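/- Write $X=(x,y)\in\mathbb R^2$, $B_r(X_0)$ for Euclidean balls, $B_r=B_r(0)$, $y^+=\max(y,0)$. Let $\Omega$ be a connected, relatively open subset of the closed half-plane $\{x\ge 0\}$, let $f:\mathbb R\to\mathbb R$ be continuous with primitive $F(z)=\int_0^z f(s)\,ds$, and assume that $|f(z)|\le Cz$ for all $z\in(0,z_0)$, for some constants $C<\infty$ and $z_0>0$. Let $\psi$ be a variational solution of $$\operatorname{div}\Big(\frac1x\nabla\psi\Big)=-xf(\psi)\ \text{ in }\Omega\cap\{\psi>0\},\qquad \frac1{x^2}|\nabla\psi|^2=y\ \text{ on }\Omega\cap\partial\{\psi>0\},$$ that is: $\psi$ and its weak gradient $\nabla\psi$ satisfy $\int_K\frac1x(\psi^2+|\nabla\psi|^2)\,dX<\infty$ for every compact $K\subset\Omega$; $\psi\in C^0(\Omega)\cap C^2(\Omega\cap\{\psi>0\})$; $\psi\ge0$ in $\Omega$; $\psi=0$ on $\Omega\cap\{x=0\}$ and on $\Omega\cap\{y\le0\}$; at each point of $\Omega\cap\{x=0\}$, as $X$ tends to that point within $\{\psi>0\}$, $\frac1x\partial_y\psi\to0$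 and $\frac1x\partial_x\psi$ has a limit; and $$\int_\Omega\Big(\tfrac1x|\nabla\psi|^2-2xF(\psi)+xy\chi_{\{\psi>0\}}\Big)\operatorname{div}\phi-\tfrac2x\nabla\psi\,D\phi\,\nabla\psi\,dX+\int_\Omega\Big(-\tfrac1{x^2}|\nabla\psi|^2-2F(\psi)+y\chi_{\{\psi>0\}}\Big)\phi_1\,dX+\int_\Omega x\chi_{\{\psi>0\}}\phi_2\,dX=0$$ for all $\phi=(\phi_1,\phi_2)\in C_0^\infty(\Omega;\mathbb R^2)$ with $\phi_1=0$ on $\{x=0\}$. Assume moreover that for every $X_1=(x_1,y_1)\in\Omega\cap\partial\{\psi>0\}$ there are $C,r>0$ with $\frac{|\nabla\psi|^2}{x^2}\le C(|y|+|x-x_1|)$ a.e. in $B_r(X_1)\cap\Omega$. For $X_0=(x_0,0)\in\Omega\cap\partial\{\psi>0\}$ with $x_0>0$ let $\delta=\frac12\min\{x_0,\operatorname{dist}(X_0,\partial\Omega)\}$ and, for $r\in(0,\delta)$, $$S(r)=\int_{\partial B_r(X_0)}\tfrac1x\psi^2\,d\mathcal H^1,\qquad \Phi(r)=r^{-3}\int_{B_r(X_0)}\Big(\tfrac1x|\nabla\psi|^2-x\psi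 f(\psi)+xy\chi_{\{\psi>0\}}\Big)dX-\tfrac32r^{-4}S(r),$$ $$I_1(r)=-\int_{B_r(X_0)}\tfrac{x-x_0}{x^2}|\nabla\psi|^2dX,\quad I_2(r)=\int_{B_r(X_0)}(x-x_0)y\chi_{\{\psi>0\}}dX,\quad J_1(r)=\int_{\partial B_r(X_0)}\tfrac{x-x_0}{x^2}\psi^2d\mathcal H^1,$$ $$D(r)=\frac{r\int_{B_r(X_0)}\big(\frac1x|\nabla\psi|^2-x\psi f(\psi)\big)dX}{S(r)},\qquad H(r)=D(r)-V(r),$$ $$V(r)=\frac{r\int_{B_r(X_0)}y^+(x_0-x\chi_{\{\psi>0\}})dX+\sum_{i=1}^2r^4\int_0^rt^{-4}I_i(t)dt+\frac32r^4\int_0^rt^{-5}J_1(t)dt}{S(r)}.$$ Suppose that $X_0\in\Sigma_\psi$, i.e. $\lim_{r\to0+}\Phi(r)=x_0\int_{B_1}y^+dX$. For a sequence $r_m\in(0,\delta)$ with $r_m\to0$ put $\phi_m(X)=\psi(X_0+r_mX)\big/\sqrt{r_m^{-1}S(r_m)}$. (Where $S(r)=0$, quotients with denominator $0$ are read as $0$;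 by the first assertion this does not happen for small $r$.) Then $S(r)>0$ for all sufficiently small $r>0$, the integrals over $(0,r)$ in the definition of $V(r)$ converge absolutely for $r\in(0,\delta)$, the limit $H(0+)=\lim_{r\to0+}H(r)$ exists and is finite, and: 1. $\lim_{r\to0+}V(r)=0$ and $\lim_{r\to0+}D(r)=H(0+)$. 2. For every sequence $r_m\in(0,\delta)$ with $r_m\to0$, the sequence $\phi_m$ is bounded in $W^{1,2}(B_1)$. 3. If $r_m\in(0,\delta)$, $r_m\to0$ and $\phi_m$ converges weakly in $W^{1,2}(B_1)$ to $\phi_0$, then (for its representative, which is continuous on $\overline{B_1}$) $\phi_0$ is homogeneous of degree $H(0+)$, i.e. $\phi_0(tX)=t^{H(0+)}\phi_0(X)$ for $X\in\overline{B_1}$, $t\in(0,1]$, and $\phi_0\ge0$ in $B_1$, $\phi_0=0$ in $B_1\cap\{y\le0\}$, and $\int_{\partial B_1}\frac1{x_0}\phi_0^2\,d\mathcal H^1=1$. -/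

import Mathlib

open Set Filter Topology MeasureTheory
open scoped ContDiff

noncomputable section

namespace StagnationFlow

/-- The plane `ℝ²` with the Euclidean norm; a point is `X = (x, y)` with `x = X 0`, `y = X 1`. -/
abbrev Plane : Type := EuclideanSpace ℝ (Fin 2)

/-- The standard basis vector `e i`. -/
def basisVec (i : Fin 2) : Plane := EuclideanSpace.single i (1 : ℝ)

/-- The partial derivative `∂ᵢ η (X)` of a (differentiable) scalar function. -/
def partialDeriv (i : Fin 2) (η : Plane → ℝ) (X : Plane) : ℝ := fderiv ℝ η X (basisVec i)

/-- The divergence of a (differentiable) vector field. -/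
def divergence (φ : Plane → Plane) (X : Plane) : ℝ :=
  ∑ i : Fin 2, (fderiv ℝ φ X (basisVec i)) i

/-- The integral of `g` over the circle `∂B_r(X₀)` with respect to arc length `ℋ¹`. -/
def circleInt (X₀ : Plane) (r : ℝ) (g : Plane → ℝ) : ℝ :=
  ∫ θ in (0 : ℝ)..(2 * Real.pi), g (X₀ + r • !₂[Real.cos θ, Real.sin θ]) * r

/-! ### Sobolev functions -/

/-- `g` is the weak gradient of `u` in the open set `U`. -/
def HasWeakGradient (u : Plane → ℝ) (g : Plane → Plane) (U : Set Plane) : Prop :=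
  LocallyIntegrableOn u U ∧ LocallyIntegrableOn g U ∧
    ∀ η : Plane → ℝ, ContDiff ℝ ∞ η → HasCompactSupport η → tsupport η ⊆ U →
      ∀ i : Fin 2, ∫ X in U, u X * partialDeriv i η X = -∫ X in U, g X i * η X

/-- `u ∈ W^{1,2}(U)` with weak gradient `g`. -/
def MemW12 (u : Plane → ℝ) (g : Plane → Plane) (U : Set Plane) : Prop :=
  MemLp u 2 (volume.restrict U) ∧ MemLp g 2 (volume.restrict U) ∧ HasWeakGradient u g U

/-- The square of the `W^{1,2}(U)`-norm of a function `u` with weak gradient `g`. -/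
def w12NormSq (u : Plane → ℝ) (g : Plane → Plane) (U : Set Plane) : ℝ :=
  (∫ X in U, u X ^ 2) + ∫ X in U, ‖g X‖ ^ 2

/-- Weak convergence in `W^{1,2}(U)` of `u m` (with weak gradients `g m`) to `u₀` (with weak
gradient `g₀`): the functions and their first derivatives converge weakly in `L²(U)`. -/
def WeakConvW12 (u : ℕ → Plane → ℝ) (g : ℕ → Plane → Plane) (u₀ : Plane → ℝ)
    (g₀ : Plane → Plane) (U : Set Plane) : Prop :=
  ∀ h : Plane → ℝ, MemLp h 2 (volume.restrict U) →
    Tendsto (fun m => ∫ X in U, u m X * h X) atTop (𝓝 (∫ X in U, u₀ X * h X)) ∧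
    ∀ i : Fin 2,
      Tendsto (fun m => ∫ X in U, g m X i * h X) atTop (𝓝 (∫ X in U, g₀ X i * h X))

/-! ### The free boundary problem -/

/-- `Ω` is a connected, relatively open subset of the closed right half-plane `{x ≥ 0}`. -/
def IsFlowDomain (Ω : Set Plane) : Prop :=
  IsConnected Ω ∧ ∃ U : Set Plane, IsOpen U ∧ Ω = U ∩ {X | 0 ≤ X 0}

/-- The primitive `F(z) = ∫₀ᶻ f(s) ds`. -/
def primitive (f : ℝ → ℝ) (z : ℝ) : ℝ := ∫ s in (0 : ℝ)..z, f s

/-- The positivity set `{ψ > 0}` in `Ω`. -/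
def posSet (Ω : Set Plane) (ψ : Plane → ℝ) : Set Plane := {X | X ∈ Ω ∧ 0 < ψ X}

/-- The characteristic function `χ_{ψ > 0}`. -/
def chiPos (ψ : Plane → ℝ) (X : Plane) : ℝ := Set.indicator {Y | 0 < ψ Y} (fun _ => (1 : ℝ)) X

/-- `ψ`, with weak gradient `G`, is a variational solution in `Ω` of
`div (∇ψ / x) = - x f(ψ)` in `{ψ > 0}`, `|∇ψ|² / x² = y` on `∂{ψ > 0}`. -/
structure IsVariationalSolution (Ω : Set Plane) (f : ℝ → ℝ) (ψ : Plane → ℝ)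
    (G : Plane → Plane) : Prop where
  nonneg : ∀ X ∈ Ω, 0 ≤ ψ X
  zero_on_axis : ∀ X ∈ Ω, X 0 = 0 → ψ X = 0
  zero_below : ∀ X ∈ Ω, X 1 ≤ 0 → ψ X = 0
  continuousOn : ContinuousOn ψ Ω
  contDiffOn : ContDiffOn ℝ 2 ψ (posSet Ω ψ)
  /-- `ψ` lies in the weighted local Sobolev space `W^{1,2}_{w,loc}(Ω)`, weight `1/x`. -/
  hasWeakGradient : HasWeakGradient ψ G (Ω ∩ {X | 0 < X 0})
  grad_meas : AEStronglyMeasurable G (volume.restrict Ω)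
  weighted_sq : ∀ K ⊆ Ω, IsCompact K → IntegrableOn (fun X => ψ X ^ 2 / X 0) K
  weighted_grad_sq : ∀ K ⊆ Ω, IsCompact K → IntegrableOn (fun X => ‖G X‖ ^ 2 / X 0) K
  axis_limit_y : ∀ X₁ ∈ Ω, X₁ 0 = 0 →
    Tendsto (fun X => partialDeriv 1 ψ X / X 0) (𝓝[posSet Ω ψ] X₁) (𝓝 0)
  axis_limit_x : ∀ X₁ ∈ Ω, X₁ 0 = 0 →
    ∃ l : ℝ, Tendsto (fun X => partialDeriv 0 ψ X / X 0) (𝓝[posSet Ω ψ] X₁) (𝓝 l)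
  /-- The first domain variation of the energy vanishes. The test fields are the smooth fields,
  up to the axis, with compact support in the relatively open set `Ω`. -/
  domain_variation : ∀ φ : Plane → Plane, ContDiff ℝ ∞ φ → HasCompactSupport φ →
    tsupport φ ∩ {X | 0 ≤ X 0} ⊆ Ω → (∀ X : Plane, X 0 = 0 → φ X 0 = 0) →
    (∫ X in Ω, ((‖G X‖ ^ 2 / X 0 - 2 * X 0 * primitive f (ψ X) + X 0 * X 1 * chiPos ψ X)
          * divergence φ X
        - 2 / X 0 * inner ℝ (G X) (fderiv ℝ φ X (G X))))
      + (∫ X in Ω, (-(‖G X‖ ^ 2 / X 0 ^ 2) - 2 * primitive f (ψ X) + X 1 * chiPos ψ X) * φ X 0)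
      + (∫ X in Ω, X 0 * chiPos ψ X * φ X 1) = 0

/-- The growth assumption `|∇ψ|² / x² ≤ C (|y| + |x - x₁|)` near each free boundary point
`X₁ = (x₁, y₁)`; the constant and the radius may depend on the point. -/
def GrowthAssumption (Ω : Set Plane) (ψ : Plane → ℝ) (G : Plane → Plane) : Prop :=
  ∀ X₁ ∈ Ω ∩ frontier (posSet Ω ψ), ∃ C : ℝ, ∃ r > 0,
    ∀ᵐ X ∂(volume.restrict (Metric.ball X₁ r ∩ Ω)),
      ‖G X‖ ^ 2 / X 0 ^ 2 ≤ C * (|X 1| + |X 0 - X₁ 0|)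

/-- `|f(z)| ≤ C z` for all small `z > 0`. -/
def VorticityGrowth (f : ℝ → ℝ) : Prop :=
  ∃ C : ℝ, ∃ z₀ > 0, ∀ z ∈ Ioo (0 : ℝ) z₀, |f z| ≤ C * z

/-- The stagnation points: free boundary points `(x₀, 0)` with `x₀ > 0`. -/
def stagnationPoints (Ω : Set Plane) (ψ : Plane → ℝ) : Set Plane :=
  {X | X ∈ Ω ∧ X ∈ frontier (posSet Ω ψ) ∧ X 1 = 0 ∧ 0 < X 0}

/-- `δ = min {x₀, dist(X₀, ∂Ω)} / 2`. Here `∂Ω` is taken in `ℝ²`; the part of it on the axis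
`{x = 0}` has distance at least `x₀` from `X₀`, so that the minimum is the same with the boundary
of `Ω` relative to the half-plane. -/
def delta (Ω : Set Plane) (X₀ : Plane) : ℝ :=
  min (X₀ 0) (Metric.infDist X₀ (frontier Ω)) / 2

/-! ### The monotonicity formula and the frequency -/

/-- `I(r)`. -/
def energyI (f : ℝ → ℝ) (ψ : Plane → ℝ) (G : Plane → Plane) (X₀ : Plane) (r : ℝ) : ℝ :=
  r ^ (-3 : ℤ) * ∫ X in Metric.ball X₀ r,
    (‖G X‖ ^ 2 / X 0 - X 0 * ψ X * f (ψ X) + X 0 * X 1 * chiPos ψ X)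

/-- The boundary mass `∫_{∂B_r(X₀)} ψ² / x dℋ¹`. -/
def bdryMass (ψ : Plane → ℝ) (X₀ : Plane) (r : ℝ) : ℝ :=
  circleInt X₀ r (fun X => ψ X ^ 2 / X 0)

/-- `J(r)`. -/
def energyJ (ψ : Plane → ℝ) (X₀ : Plane) (r : ℝ) : ℝ := r ^ (-4 : ℤ) * bdryMass ψ X₀ r

/-- The boundary adjusted energy `Φ(r) = I(r) - (3/2) J(r)`. -/
def weissEnergy (f : ℝ → ℝ) (ψ : Plane → ℝ) (G : Plane → Plane) (X₀ : Plane) (r : ℝ) : ℝ :=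
  energyI f ψ G X₀ r - 3 / 2 * energyJ ψ X₀ r

/-- `I₁(r)`. -/
def termI₁ (G : Plane → Plane) (X₀ : Plane) (r : ℝ) : ℝ :=
  ∫ X in Metric.ball X₀ r, -((X 0 - X₀ 0) / X 0 ^ 2) * ‖G X‖ ^ 2

/-- `I₂(r)`. -/
def termI₂ (ψ : Plane → ℝ) (X₀ : Plane) (r : ℝ) : ℝ :=
  ∫ X in Metric.ball X₀ r, (X 0 - X₀ 0) * X 1 * chiPos ψ X

/-- `J₁(r)`. -/
def termJ₁ (ψ : Plane → ℝ) (X₀ : Plane) (r : ℝ) : ℝ :=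
  circleInt X₀ r (fun X => (X 0 - X₀ 0) / X 0 ^ 2 * ψ X ^ 2)

/-- The degenerate points `Σ_ψ`: the stagnation points with `Φ(0+) = x₀ ∫_{B₁} y⁺ dX`. -/
def degeneratePoints (Ω : Set Plane) (f : ℝ → ℝ) (ψ : Plane → ℝ) (G : Plane → Plane) :
    Set Plane :=
  {X₀ | X₀ ∈ stagnationPoints Ω ψ ∧
    Tendsto (weissEnergy f ψ G X₀) (𝓝[>] 0)
      (𝓝 (X₀ 0 * ∫ X in Metric.ball (0 : Plane) 1, max (X 1) 0))}

/-- `D(r)`. -/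
def freqD (f : ℝ → ℝ) (ψ : Plane → ℝ) (G : Plane → Plane) (X₀ : Plane) (r : ℝ) : ℝ :=
  (r * ∫ X in Metric.ball X₀ r, (‖G X‖ ^ 2 / X 0 - X 0 * ψ X * f (ψ X))) / bdryMass ψ X₀ r

/-- `V(r)`. -/
def freqV (ψ : Plane → ℝ) (G : Plane → Plane) (X₀ : Plane) (r : ℝ) : ℝ :=
  (r * (∫ X in Metric.ball X₀ r, max (X 1) 0 * (X₀ 0 - X 0 * chiPos ψ X))
    + (r ^ 4 * (∫ t in (0 : ℝ)..r, t ^ (-4 : ℤ) * termI₁ G X₀ t)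
      + r ^ 4 * (∫ t in (0 : ℝ)..r, t ^ (-4 : ℤ) * termI₂ ψ X₀ t))
    + 3 / 2 * r ^ 4 * (∫ t in (0 : ℝ)..r, t ^ (-5 : ℤ) * termJ₁ ψ X₀ t)) / bdryMass ψ X₀ r

/-- The frequency `H(r) = D(r) - V(r)`. -/
def freqH (f : ℝ → ℝ) (ψ : Plane → ℝ) (G : Plane → Plane) (X₀ : Plane) (r : ℝ) : ℝ :=
  freqD f ψ G X₀ r - freqV ψ G X₀ r

/-! ### Blow-ups -/

/-- The normalized blow-up of `ψ` at `X₀` at scale `r`. -/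
def blowUp (ψ : Plane → ℝ) (X₀ : Plane) (r : ℝ) (X : Plane) : ℝ :=
  ψ (X₀ + r • X) / Real.sqrt (r⁻¹ * bdryMass ψ X₀ r)

/-- The gradient of the normalized blow-up, in terms of the gradient `G` of `ψ`. -/
def blowUpGrad (ψ : Plane → ℝ) (G : Plane → Plane) (X₀ : Plane) (r : ℝ) (X : Plane) : Plane :=
  (r / Real.sqrt (r⁻¹ * bdryMass ψ X₀ r)) • G (X₀ + r • X)

end StagnationFlow

end

open StagnationFlow

/-! Write J(r) = r⁻⁴S(r), let L(r) be r⁻³∫_{∂B_r} ψ ∂_νψ/x minus (3/2)J(r), and let n(r) =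
2r⁻⁵∫_{∂B_r} (r∂_νψ − (3/2)ψ)²/x be the square in the Weiss monotonicity formula. The equation
tested with ψ times a radial cutoff gives D = 3/2 + L/J, and the domain variation with the field X −
X₀ gives Φ' = n + errors. Because Φ(0+) = x₀∫y⁺, integrating from 0 gives L = Q + v + κ, where Q(r)
= ∫₀ʳ n ≥ 0, v = r⁻⁴ S V, and κ collects the terms with f. So H − 3/2 is Q/J up to κ/J.

All that is needed of ψ is then recorded in `FrequencySystem`, a set of inequalities between
functions of one variable. There p = x₀r⁻³∫y⁺(1 − χ) ≥ 0 is the main part of v, α = r⁻³∫|∇ψ|²/x, and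
j is the part of J' that comes from the variable weight. The errors I₁, I₂, J₁ and κ are bounded by
∫₀ʳ(α + p + J), which is O(rJ) by `integral_le`. Hence v + κ is bounded below by −40CrJ. With q =
Q/J, e = (v + κ)/J and W the defect in the Cauchy–Schwarz inequality for L, one finds q' = (2/t)(W +
qe + e²) − q j/J, and the lower bound on e turns this into (q exp(81Ct))' ≥ (2/t)(W + e²): this is
`key_monotone`. Consequently q has a limit and (2/t)(W + e²) is integrable at 0. Integrability of
e²/t together with the doubling of J and the monotonicity of t³p forces p/J → 0 (`tendsto_p_div`),
hence V → 0 and D, H → 3/2 + lim q. As α ≤ 2L + 4J, the blow-ups are bounded in W^{1,2}.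

For the limits, the deviation of a blow-up from homogeneity of degree H(0+) is controlled by
∫₀ʳ(2/t)(W + e²)dt and the oscillation of L/J, both of which vanish in the limit. Thus t^{−H} times
the blow-up is L²-close on each circle to a function of the angle, its radial average
(`integral_sq_sub_profile_le`). The averages are equi-Hölder with exponent 1/2 by the angular energy
bound, so they converge uniformly to some k along an ultrafilter (`exists_profile_limit`). The weak
limit must be t^H k(θ), and convergence on the circle t = 1 itself preserves the normalization.

The analytic input is obtained without regularity of the free boundary. Integrations by parts are
done with the C¹ truncation (ψ − ε)₊²/ψ, which vanishes near {ψ = 0}, followed by ε → 0. The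
differential equation is derived from the domain variation: translations give ∇ψ times the equation,
and connectedness of Ω rules out regions where ∇ψ = 0 but the equation fails (`pdeDefect_eq_zero`).
The growth assumption gives |∇ψ|² ≤ C|X − X₀| near X₀; integration along rays, which can cross the
free boundary, then gives ψ² ≤ C|X − X₀|³. -/

namespace StagnationFlow

/-! ### A system of differential inequalities for the frequency -/

/-- The almost everywhere derivative of an indefinite integral times a differentiable function. -/
theorem integral_primitive_mul {n h h' : ℝ → ℝ} {c a b : ℝ}
    (hca : c ≤ a) (hab : a ≤ b) (hn : IntervalIntegrable n volume c b)
    (hh : ∀ x ∈ Icc a b, HasDerivAt h (h' x) x) (hh' : IntervalIntegrable h' volume a b) :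
    IntervalIntegrable (fun x => n x * h x + (∫ t in c..x, n t) * h' x) volume a b ∧
    ∫ x in a..b, (n x * h x + (∫ t in c..x, n t) * h' x)
      = (∫ t in c..b, n t) * h b - (∫ t in c..a, n t) * h a := by
  have hu : uIcc a b = Icc a b := uIcc_of_le hab
  have hQ : AbsolutelyContinuousOnInterval (fun x => ∫ t in c..x, n t) a b :=
    (hn.absolutelyContinuousOnInterval_intervalIntegral left_mem_uIcc).mono
      (by rw [uIcc_of_le hab, uIcc_of_le (hca.trans hab)]; exact Icc_subset_Icc_left hca)
  -- As the integral of its integrable derivative plus a constant, h is absolutely continuous; the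
  -- definition only sees the values of h in the interval.
  have hh2 : AbsolutelyContinuousOnInterval h a b := by
    have h1 := (hh'.absolutelyContinuousOnInterval_intervalIntegral left_mem_uIcc)
    have h2 : AbsolutelyContinuousOnInterval (fun _ : ℝ => h a) a b := by
      exact (LipschitzWith.const (h a)).lipschitzOnWith.absolutelyContinuousOnInterval
    have h3 := h1.add h2
    have heq : ∀ x ∈ uIcc a b, (∫ v in a..x, h' v) + h a = h x := by
      intro x hx
      rw [hu] at hx
      rw [intervalIntegral.integral_eq_sub_of_hasDerivAt (f := h)]
      · ring
      · intro y hy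
        rw [uIcc_of_le hx.1] at hy
        exact hh y ⟨hy.1, hy.2.trans hx.2⟩
      · exact hh'.mono_set (by rw [hu, uIcc_of_le hx.1]; exact Icc_subset_Icc_right hx.2)
    rw [absolutelyContinuousOnInterval_iff] at h3 ⊢
    intro ε hε
    obtain ⟨d, hd, H⟩ := h3 ε hε
    refine ⟨d, hd, fun E hE hE2 => ?_⟩
    have := H E hE hE2
    convert this using 2
    rename_i i hi
    have hi' := (hE.1 i (by simpa using hi))
    simp only [Pi.add_apply]
    rw [heq _ hi'.1, heq _ hi'.2]
  have key := AbsolutelyContinuousOnInterval.integral_deriv_mul_eq_sub hQ hh2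
  have hae : ∀ᵐ x, x ∈ uIcc a b → deriv (fun x => ∫ t in c..x, n t) x * h x +
      (∫ t in c..x, n t) * deriv h x = n x * h x + (∫ t in c..x, n t) * h' x := by
    filter_upwards [hn.ae_hasDerivAt_integral] with x hx hx2
    rw [hu] at hx2
    have h1 := hx (by rw [uIcc_of_le (hca.trans hab)]; exact ⟨hca.trans hx2.1, hx2.2⟩) c left_mem_uIcc
    rw [h1.deriv, (hh x hx2).deriv]
  constructor
  · have hn' : IntervalIntegrable n volume a b := hn.mono_set (by
      rw [hu, uIcc_of_le (hca.trans hab)]; exact Icc_subset_Icc_left hca)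
    exact (hn'.mul_continuousOn (fun x hx => (hh x (hu ▸ hx)).continuousAt.continuousWithinAt)).add
      (hh'.continuousOn_mul hQ.continuousOn)
  · rw [← key]
    refine intervalIntegral.integral_congr_ae ?_
    filter_upwards [hae] with x hx hx2
    exact (hx (uIoc_subset_uIcc hx2)).symm

/-- The inequalities satisfied by the (rescaled) energy quantities at a degenerate point. -/
structure FrequencySystem (R C : ℝ) (J L j n p α v κ : ℝ → ℝ) : Prop where
  R_pos : 0 < R
  R_le : R ≤ 1
  C_ge : 1 ≤ C
  small : C * R ≤ 1 / 100
  J_nonneg : ∀ r ∈ Ioo 0 R, 0 ≤ J r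
  J_le : ∀ r ∈ Ioo 0 R, J r ≤ C
  J_deriv : ∀ r ∈ Ioo 0 R, HasDerivAt J (2 * L r / r + j r) r
  L_cont : ContinuousOn L (Ioo 0 R)
  j_cont : ContinuousOn j (Ioo 0 R)
  j_le : ∀ r ∈ Ioo 0 R, |j r| ≤ C * J r
  n_nonneg : ∀ r ∈ Ioo 0 R, 0 ≤ n r
  n_int : IntegrableOn n (Ioo 0 R)
  cs : ∀ r ∈ Ioo 0 R, L r ^ 2 ≤ J r * (r * n r / 2)
  split : ∀ r ∈ Ioo 0 R, L r = (∫ t in (0 : ℝ)..r, n t) + v r + κ r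
  p_nonneg : ∀ r ∈ Ioo 0 R, 0 ≤ p r
  p_int : IntegrableOn p (Ioo 0 R)
  p_mono : ∀ r ∈ Ioo 0 R, ∀ s ∈ Ioo 0 R, s ≤ r → s ^ 3 * p s ≤ r ^ 3 * p r
  α_nonneg : ∀ r ∈ Ioo 0 R, 0 ≤ α r
  α_int : IntegrableOn α (Ioo 0 R)
  α_le : ∀ r ∈ Ioo 0 R, α r ≤ 2 * L r + 4 * J r
  v_le : ∀ r ∈ Ioo 0 R, |v r - p r| ≤ C * (r * p r + ∫ t in (0 : ℝ)..r, (α t + p t + J t))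
  κ_le : ∀ r ∈ Ioo 0 R, |κ r| ≤ C * ∫ t in (0 : ℝ)..r, (α t + p t + J t)
  J_ne : ∀ ε > 0, ∃ r ∈ Ioo 0 ε, J r ≠ 0

namespace FrequencySystem

variable {R C : ℝ} {J L j n p α v κ : ℝ → ℝ}

theorem J_contOn (h : FrequencySystem R C J L j n p α v κ) : ContinuousOn J (Ioo 0 R) :=
  fun r hr => (h.J_deriv r hr).continuousAt.continuousWithinAt

theorem J_int (h : FrequencySystem R C J L j n p α v κ) : IntegrableOn J (Ioo 0 R) := by
  refine Integrable.mono' (integrableOn_const (C := C) (by simp))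
    (h.J_contOn.aestronglyMeasurable measurableSet_Ioo) ?_
  filter_upwards [ae_restrict_mem measurableSet_Ioo] with r hr
  rw [Real.norm_of_nonneg (h.J_nonneg r hr)]; exact h.J_le r hr

theorem intervalIntegrable_of_integrableOn_Ioo {g : ℝ → ℝ} {R : ℝ} (hg : IntegrableOn g (Ioo 0 R))
    {a b : ℝ} (ha : 0 ≤ a) (hab : a ≤ b) (hb : b < R) : IntervalIntegrable g volume a b := by
  rw [intervalIntegrable_iff_integrableOn_Ioc_of_le hab]
  exact hg.mono_set fun x hx => ⟨ha.trans_lt hx.1, hx.2.trans_lt hb⟩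

theorem integral_mono_Ioo {g h : ℝ → ℝ} {R : ℝ} (hg : IntegrableOn g (Ioo 0 R))
    (hh : IntegrableOn h (Ioo 0 R)) {a b : ℝ} (ha : 0 ≤ a) (hab : a ≤ b) (hb : b < R)
    (hle : ∀ t ∈ Ioc a b, g t ≤ h t) : ∫ t in a..b, g t ≤ ∫ t in a..b, h t := by
  rw [intervalIntegral.integral_of_le hab, intervalIntegral.integral_of_le hab]
  refine setIntegral_mono_on ?_ ?_ measurableSet_Ioc hle
  · exact hg.mono_set fun x hx => ⟨ha.trans_lt hx.1, hx.2.trans_lt hb⟩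
  · exact hh.mono_set fun x hx => ⟨ha.trans_lt hx.1, hx.2.trans_lt hb⟩

theorem integral_mono_right_Ioo {g : ℝ → ℝ} {R : ℝ} (hg : IntegrableOn g (Ioo 0 R))
    (h0 : ∀ t ∈ Ioo 0 R, 0 ≤ g t) {a b : ℝ} (ha : 0 ≤ a) (hab : a ≤ b) (hb : b < R) :
    ∫ t in (0 : ℝ)..a, g t ≤ ∫ t in (0 : ℝ)..b, g t := by
  rw [← intervalIntegral.integral_add_adjacent_intervals
    (intervalIntegrable_of_integrableOn_Ioo hg le_rfl ha (hab.trans_lt hb))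
    (intervalIntegrable_of_integrableOn_Ioo hg ha hab hb)]
  have : 0 ≤ ∫ t in a..b, g t := by
    rw [intervalIntegral.integral_of_le hab]
    exact setIntegral_nonneg measurableSet_Ioc fun x hx =>
      h0 x ⟨ha.trans_lt hx.1, hx.2.trans_lt hb⟩
  linarith

theorem integral_nonneg_Ioo {g : ℝ → ℝ} {R : ℝ}
    (h0 : ∀ t ∈ Ioo 0 R, 0 ≤ g t) {b : ℝ} (hb0 : 0 ≤ b) (hb : b < R) :
    0 ≤ ∫ t in (0 : ℝ)..b, g t := by
  rw [intervalIntegral.integral_of_le hb0]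
  exact setIntegral_nonneg measurableSet_Ioc fun x hx => h0 x ⟨hx.1, hx.2.trans_lt hb⟩

theorem Q_nonneg (h : FrequencySystem R C J L j n p α v κ) {r : ℝ} (hr : r ∈ Ioo 0 R) :
    0 ≤ ∫ t in (0 : ℝ)..r, n t := integral_nonneg_Ioo h.n_nonneg hr.1.le hr.2

theorem Q_int (h : FrequencySystem R C J L j n p α v κ) :
    IntegrableOn (fun r => ∫ t in (0 : ℝ)..r, n t) (Ioo 0 R) := by
  have h1 : ContinuousOn (fun r => ∫ t in (0 : ℝ)..r, n t) (uIcc 0 R) := by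
    apply intervalIntegral.continuousOn_primitive_interval
    rw [uIcc_of_le h.R_pos.le, integrableOn_Icc_iff_integrableOn_Ioo]
    exact h.n_int
  rw [uIcc_of_le h.R_pos.le] at h1
  exact (h1.integrableOn_compact isCompact_Icc).mono_set Ioo_subset_Icc_self

/-- The integral of all error terms is controlled by the boundary mass. -/
theorem integral_le (h : FrequencySystem R C J L j n p α v κ) {r : ℝ} (hr : r ∈ Ioo 0 R) :
    ∫ t in (0 : ℝ)..r, (α t + p t + J t) ≤ 20 * (r * J r) := by
  have hC := h.C_ge
  have hs := h.small
  have hσi : IntegrableOn (fun t => α t + p t + J t) (Ioo 0 R) :=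
    (h.α_int.add h.p_int).add h.J_int
  have hσ0 : ∀ t ∈ Ioo 0 R, 0 ≤ α t + p t + J t := fun t ht =>
    add_nonneg (add_nonneg (h.α_nonneg t ht) (h.p_nonneg t ht)) (h.J_nonneg t ht)
  set σ : ℝ → ℝ := fun r => ∫ t in (0 : ℝ)..r, (α t + p t + J t) with hσ
  set Q : ℝ → ℝ := fun r => ∫ t in (0 : ℝ)..r, n t with hQ
  have hτi : IntegrableOn (fun t => Q t + p t + J t) (Ioo 0 R) :=
    (h.Q_int.add h.p_int).add h.J_int
  set τ : ℝ → ℝ := fun r => ∫ t in (0 : ℝ)..r, (Q t + p t + J t) with hτ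
  have hσn : ∀ t ∈ Ioo 0 R, 0 ≤ σ t := fun t ht => integral_nonneg_Ioo hσ0 ht.1.le ht.2
  -- Smallness of CR lets the relative error in v ≈ p be absorbed into p.
  have hpm : ∀ t ∈ Ioo 0 R, C * (t * p t) ≤ p t / 100 := fun t ht => by
    have h1 : C * t ≤ 1 / 100 := le_trans (by gcongr; exact ht.2.le) hs
    nlinarith [h.p_nonneg t ht]
  have hLb : ∀ t ∈ Ioo 0 R, |L t - Q t - p t| ≤ p t / 100 + 2 * C * σ t := fun t ht => by
    have h1 := abs_le.1 (h.v_le t ht)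
    have h2 := abs_le.1 (h.κ_le t ht)
    have h3 := h.split t ht
    have h4 := hpm t ht
    simp only [hσ, hQ]
    rw [abs_le]; constructor <;> nlinarith [h1.1, h1.2, h2.1, h2.2]
  have hσC : ∀ t ∈ Ioo 0 R, ∀ s ∈ Ioc 0 t, σ s ≤ σ t := fun t ht s hs =>
    integral_mono_right_Ioo hσi hσ0 hs.1.le hs.2 ht.2
  -- Inserting L ≈ Q + p into α ≤ 2L + 4J bounds the integrand of σ by 5(Q + p + J) + 4Cσ. After
  -- integration the feedback term is at most 4Ctσ ≤ σ/25 and is absorbed.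
  have hστ : ∀ t ∈ Ioo 0 R, σ t ≤ 10 * τ t := fun t ht => by
    have h1 : σ t ≤ ∫ s in (0 : ℝ)..t, (5 * (Q s + p s + J s) + 4 * C * σ t) := by
      refine integral_mono_Ioo hσi ((hτi.const_mul 5).add (integrableOn_const (by simp)))
        le_rfl ht.1.le ht.2 fun s hs => ?_
      have hsR : s ∈ Ioo 0 R := ⟨hs.1, hs.2.trans_lt ht.2⟩
      have h2 := (abs_le.1 (hLb s hsR)).2
      have h3 := h.α_le s hsR
      have h4 := hσC t ht s hs
      have h5 := h.p_nonneg s hsR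
      have h6 := h.Q_nonneg hsR
      have h7 : C * σ s ≤ C * σ t := by gcongr
      have h8 : Q s = ∫ t in (0 : ℝ)..s, n t := rfl
      show α s + p s + J s ≤ 5 * (Q s + p s + J s) + 4 * C * σ t
      linarith
    rw [intervalIntegral.integral_add, intervalIntegral.integral_const_mul,
      intervalIntegral.integral_const, smul_eq_mul] at h1
    · have h2 : C * t ≤ 1 / 100 := le_trans (by gcongr; exact ht.2.le) hs
      have h3 := hσn t ht
      have h4 : (t - 0) * (4 * C * σ t) ≤ σ t / 25 := by nlinarith
      have h5 : τ t = ∫ s in (0 : ℝ)..t, (Q s + p s + J s) := rfl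
      rw [← h5] at h1
      have : 0 ≤ τ t := integral_nonneg_Ioo (R := R) (fun s hs =>
        add_nonneg (add_nonneg (h.Q_nonneg hs) (h.p_nonneg s hs)) (h.J_nonneg s hs)) ht.1.le ht.2
      linarith
    · exact (intervalIntegrable_of_integrableOn_Ioo hτi le_rfl ht.1.le ht.2).const_mul 5
    · exact intervalIntegrable_const
  have hτ0 : 0 ≤ τ r := integral_nonneg_Ioo (R := R) (fun s hs =>
        add_nonneg (add_nonneg (h.Q_nonneg hs) (h.p_nonneg s hs)) (h.J_nonneg s hs)) hr.1.le hr.2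
  -- the derivative of `t J(t)`
  have hd : ∀ s ∈ Ioo 0 r, (∫ t in s..r, (Q t + p t + J t)) - 41 * C * r * τ r ≤ r * J r := by
    intro s hs'
    have hsub : ∀ t ∈ Icc s r, t ∈ Ioo 0 R := fun t ht => ⟨hs'.1.trans_le ht.1, ht.2.trans_lt hr.2⟩
    have hder : ∀ t ∈ uIcc s r, HasDerivAt (fun t => t * J t)
        (1 * J t + t * (2 * L t / t + j t)) t := fun t ht => by
      rw [uIcc_of_le hs'.2.le] at ht
      exact (hasDerivAt_id t).mul (h.J_deriv t (hsub t ht))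
    have hint : IntervalIntegrable (fun t => 1 * J t + t * (2 * L t / t + j t)) volume s r := by
      apply ContinuousOn.intervalIntegrable
      rw [uIcc_of_le hs'.2.le]
      have c1 := h.J_contOn.mono hsub
      have c2 := h.L_cont.mono hsub
      have c3 := h.j_cont.mono hsub
      refine (continuousOn_const.mul c1).add (continuousOn_id.mul
        (((continuousOn_const.mul c2).div continuousOn_id fun t ht => ?_).add c3))
      exact (hsub t ht).1.ne'
    have hftc := intervalIntegral.integral_eq_sub_of_hasDerivAt hder hint
    -- Here (tJ)' = J + 2L + tj. The constant 40 comes from the error 2·2Cσ in 2L combined with σ ≤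
    -- 10τ, and −CrJ is the bound on tj.
    have hle : ∫ t in s..r, ((Q t + p t + J t) + (-(40 * C * τ r) + - (C * r) * J t))
        ≤ ∫ t in s..r, (1 * J t + t * (2 * L t / t + j t)) := by
      refine intervalIntegral.integral_mono_on hs'.2.le ?_ hint fun t ht => ?_
      · refine (intervalIntegrable_of_integrableOn_Ioo hτi hs'.1.le hs'.2.le hr.2).add
          (intervalIntegrable_const.add
          ((intervalIntegrable_of_integrableOn_Ioo h.J_int hs'.1.le hs'.2.le hr.2).const_mul _))
      · have htR := hsub t ht
        have ht0 := htR.1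
        have e1 : t * (2 * L t / t + j t) = 2 * L t + t * j t := by field_simp
        rw [e1]
        have h1 := (abs_le.1 (hLb t htR)).1
        have h2 := (abs_le.1 (h.j_le t htR)).1
        have h3 : C * σ t ≤ C * (10 * τ r) := by
          gcongr
          exact (hσC r hr t ⟨ht0, ht.2⟩).trans (hστ r hr)
        have h4 : t * (-(C * J t)) ≤ t * j t := by gcongr
        have h5 : t * (C * J t) ≤ r * (C * J t) := by
          have := h.J_nonneg t htR
          gcongr; exact ht.2
        have h6 := h.Q_nonneg htR
        have h7 := h.p_nonneg t htR
        have h8 : Q t = ∫ s in (0 : ℝ)..t, n s := rfl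
        linarith
    rw [hftc, intervalIntegral.integral_add (f := fun t => Q t + p t + J t),
      intervalIntegral.integral_add (f := fun _ => -(40 * C * τ r)),
      intervalIntegral.integral_const_mul, intervalIntegral.integral_const, smul_eq_mul] at hle
    · have h1 : ∫ t in s..r, J t ≤ τ r := by
        have : ∫ t in s..r, J t ≤ ∫ t in s..r, (Q t + p t + J t) :=
          integral_mono_Ioo h.J_int hτi hs'.1.le hs'.2.le hr.2 fun t ht => by
            have htR := hsub t (Ioc_subset_Icc_self ht)
            have h6 := h.Q_nonneg htR
            have h7 := h.p_nonneg t htR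
            have h8 : Q t = ∫ s in (0 : ℝ)..t, n s := rfl
            linarith
        refine this.trans ?_
        have h2 := intervalIntegral.integral_add_adjacent_intervals (a := 0) (b := s) (c := r)
          (intervalIntegrable_of_integrableOn_Ioo hτi le_rfl hs'.1.le (hs'.2.trans hr.2))
          (intervalIntegrable_of_integrableOn_Ioo hτi hs'.1.le hs'.2.le hr.2)
        have h3 : 0 ≤ ∫ t in (0 : ℝ)..s, (Q t + p t + J t) :=
          integral_nonneg_Ioo (R := R) (fun s hs => add_nonneg (add_nonneg (h.Q_nonneg hs)
            (h.p_nonneg s hs)) (h.J_nonneg s hs)) hs'.1.le (hs'.2.trans hr.2)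
        simp only [hτ]
        linarith
      have h2 : 0 ≤ s * J s := mul_nonneg hs'.1.le (h.J_nonneg s ⟨hs'.1, hs'.2.trans hr.2⟩)
      have h3 : C * r * ∫ t in s..r, J t ≤ C * r * τ r := by
        have := hr.1; gcongr
      have h4 : (r - s) * (40 * C * τ r) ≤ r * (40 * C * τ r) := by
        gcongr; linarith [hs'.1]
      nlinarith
    · exact intervalIntegrable_const
    · exact (intervalIntegrable_of_integrableOn_Ioo h.J_int hs'.1.le hs'.2.le hr.2).const_mul _
    · exact intervalIntegrable_of_integrableOn_Ioo hτi hs'.1.le hs'.2.le hr.2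
    · exact (intervalIntegrable_const.add
          ((intervalIntegrable_of_integrableOn_Ioo h.J_int hs'.1.le hs'.2.le hr.2).const_mul _))
  -- The boundary term sJ(s) was dropped by its sign, so only the integral has to be followed as s →
  -- 0.
  have hlim : Tendsto (fun s => (∫ t in s..r, (Q t + p t + J t)) - 41 * C * r * τ r)
      (𝓝[>] 0) (𝓝 (τ r - 41 * C * r * τ r)) := by
    refine Tendsto.sub_const ?_ _
    have hc := intervalIntegral.continuousOn_primitive_interval_left (a := 0) (b := r)
      (f := fun t => Q t + p t + J t) (μ := volume) (by
        rw [uIcc_of_le hr.1.le, integrableOn_Icc_iff_integrableOn_Ioc]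
        exact hτi.mono_set fun t ht => ⟨ht.1, ht.2.trans_lt hr.2⟩)
    rw [uIcc_of_le hr.1.le] at hc
    have := (hc 0 ⟨le_rfl, hr.1.le⟩)
    exact this.mono_left (nhdsWithin_le_of_mem (mem_of_superset (Ioo_mem_nhdsGT hr.1)
      Ioo_subset_Icc_self))
  have hfin : τ r - 41 * C * r * τ r ≤ r * J r :=
    le_of_tendsto hlim (by filter_upwards [Ioo_mem_nhdsGT hr.1] with s hs using hd s hs)
  -- Now (1 − 0.41)τ ≤ rJ and σ ≤ 10τ, which leaves room below the factor 20.
  have h2 : C * r ≤ 1 / 100 := le_trans (by gcongr; exact hr.2.le) hs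
  have h3 := hστ r hr
  show σ r ≤ _
  nlinarith

end FrequencySystem
end StagnationFlow

/-! ### Almost monotonicity of the mass and of the frequency -/

namespace StagnationFlow
namespace FrequencySystem

variable {R C : ℝ} {J L j n p α v κ : ℝ → ℝ}

theorem C_mul_le (h : FrequencySystem R C J L j n p α v κ) {r : ℝ} (hr : r ∈ Ioo 0 R) :
    C * r ≤ 1 / 100 := by
  have := h.C_ge
  exact le_trans (by gcongr; exact hr.2.le) h.small

theorem κ_abs_le (h : FrequencySystem R C J L j n p α v κ) {r : ℝ} (hr : r ∈ Ioo 0 R) :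
    |κ r| ≤ 20 * C * r * J r := by
  have := h.C_ge
  nlinarith [h.κ_le r hr, h.integral_le hr]

theorem v_abs_le (h : FrequencySystem R C J L j n p α v κ) {r : ℝ} (hr : r ∈ Ioo 0 R) :
    |v r - p r| ≤ C * r * p r + 20 * C * r * J r := by
  have := h.C_ge
  nlinarith [h.v_le r hr, h.integral_le hr]

/-- The only part of v + κ that is not O(rJ) is (1 ± Cr)p, and it is nonnegative. This one-sided
bound is the sole sign information used in the monotonicity below. -/
theorem v_add_κ_ge (h : FrequencySystem R C J L j n p α v κ) {r : ℝ} (hr : r ∈ Ioo 0 R) :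
    -(40 * C * r * J r) ≤ v r + κ r := by
  have h1 := abs_le.1 (h.κ_abs_le hr)
  have h2 := abs_le.1 (h.v_abs_le hr)
  have h3 := h.C_mul_le hr
  have h4 := h.p_nonneg r hr
  nlinarith [h1.1, h2.1]

/-- Since Q ≥ 0, L ≥ v + κ ≥ −40CrJ, so 2L/r contributes at least −80CJ to J' and j at least −CJ. -/
theorem monotoneOn_J_mul_exp (h : FrequencySystem R C J L j n p α v κ) :
    MonotoneOn (fun r => J r * Real.exp (81 * C * r)) (Ioo 0 R) := by
  have hd : ∀ r ∈ Ioo 0 R, HasDerivAt (fun r => J r * Real.exp (81 * C * r))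
      ((2 * L r / r + j r) * Real.exp (81 * C * r) +
        J r * (Real.exp (81 * C * r) * (81 * C * 1))) r := fun r hr =>
    (h.J_deriv r hr).mul (((hasDerivAt_id r).const_mul (81 * C)).exp)
  refine monotoneOn_of_deriv_nonneg (convex_Ioo 0 R)
    (fun r hr => (hd r hr).continuousAt.continuousWithinAt)
    (fun r hr => ?_) (fun r hr => ?_)
  · rw [interior_Ioo] at hr; exact (hd r hr).differentiableAt.differentiableWithinAt
  · rw [interior_Ioo] at hr
    rw [(hd r hr).deriv]
    have h1 : -(80 * C * J r) ≤ 2 * L r / r := by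
      rw [le_div_iff₀ hr.1]
      have := h.v_add_κ_ge hr
      have := h.Q_nonneg hr
      have := h.split r hr
      linarith
    have h2 := (abs_le.1 (h.j_le r hr)).1
    have h3 : (2 * L r / r + j r) * Real.exp (81 * C * r) +
        J r * (Real.exp (81 * C * r) * (81 * C * 1)) =
        (2 * L r / r + j r + 81 * C * J r) * Real.exp (81 * C * r) := by ring
    rw [h3]
    exact mul_nonneg (by linarith) (Real.exp_pos _).le

/-- Almost monotonicity carries a nonzero value to every larger radius, and `J_ne` supplies nonzero
values at arbitrarily small radii. -/
theorem J_pos (h : FrequencySystem R C J L j n p α v κ) {r : ℝ} (hr : r ∈ Ioo 0 R) : 0 < J r := by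
  obtain ⟨s, hs, hs'⟩ := h.J_ne r hr.1
  have hsR : s ∈ Ioo 0 R := ⟨hs.1, hs.2.trans hr.2⟩
  have h1 := h.monotoneOn_J_mul_exp hsR hr hs.2.le
  have h2 : 0 < J s := lt_of_le_of_ne (h.J_nonneg s hsR) (Ne.symm hs')
  have h3 : 0 < J s * Real.exp (81 * C * s) := by positivity
  exact pos_of_mul_pos_left (h3.trans_le h1) (Real.exp_pos _).le

theorem J_le_mul (h : FrequencySystem R C J L j n p α v κ) {s r : ℝ} (hs : s ∈ Ioo 0 R)
    (hr : r ∈ Ioo 0 R) (hsr : s ≤ r) : J s ≤ Real.exp 1 * J r := by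
  have h1 := h.monotoneOn_J_mul_exp hs hr hsr
  have h2 : (1 : ℝ) ≤ Real.exp (81 * C * s) := by
    apply Real.one_le_exp
    have := h.C_ge; have := hs.1; positivity
  have h3 : Real.exp (81 * C * r) ≤ Real.exp 1 := by
    apply Real.exp_le_exp.2
    have := h.C_mul_le hr; linarith
  have h4 := (h.J_pos hs).le
  have h5 := (h.J_pos hr).le
  calc J s ≤ J s * Real.exp (81 * C * s) := by nlinarith
    _ ≤ J r * Real.exp (81 * C * r) := h1
    _ ≤ Real.exp 1 * J r := by nlinarith

/-- The defect in the Cauchy–Schwarz inequality. -/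
noncomputable def defect (J L n : ℝ → ℝ) (t : ℝ) : ℝ := (t * n t / 2) / J t - (L t / J t) ^ 2

theorem defect_nonneg (h : FrequencySystem R C J L j n p α v κ) {r : ℝ} (hr : r ∈ Ioo 0 R) :
    0 ≤ defect J L n r := by
  have h1 := h.cs r hr
  have h2 := h.J_pos hr
  rw [defect, div_pow, sub_nonneg, div_le_div_iff₀ (by positivity) h2]
  nlinarith

/-- The part of the frequency with a sign. -/
noncomputable def qfun (J n : ℝ → ℝ) (r : ℝ) : ℝ := (∫ t in (0 : ℝ)..r, n t) / J r

theorem qfun_nonneg (h : FrequencySystem R C J L j n p α v κ) {r : ℝ} (hr : r ∈ Ioo 0 R) :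
    0 ≤ qfun J n r := div_nonneg (h.Q_nonneg hr) (h.J_pos hr).le

theorem L_div (h : FrequencySystem R C J L j n p α v κ) {r : ℝ} (hr : r ∈ Ioo 0 R) :
    L r / J r = qfun J n r + (v r + κ r) / J r := by
  rw [h.split r hr, qfun]; ring

theorem e_ge (h : FrequencySystem R C J L j n p α v κ) {r : ℝ} (hr : r ∈ Ioo 0 R) :
    -(40 * C * r) ≤ (v r + κ r) / J r := by
  rw [le_div_iff₀ (h.J_pos hr)]
  have := h.v_add_κ_ge hr
  linarith

/-- The system assumes no measurability of v or κ separately; their sum is measurable because it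
equals L − Q. -/
theorem aestronglyMeasurable_defect (h : FrequencySystem R C J L j n p α v κ) :
    AEStronglyMeasurable (fun t => 2 / t * (defect J L n t + ((v t + κ t) / J t) ^ 2))
      (volume.restrict (Ioo 0 R)) := by
  have hJm := h.J_contOn.aestronglyMeasurable (μ := volume) measurableSet_Ioo
  have hLm := h.L_cont.aestronglyMeasurable (μ := volume) measurableSet_Ioo
  have hQm := h.Q_int.aestronglyMeasurable
  have hnm := h.n_int.aestronglyMeasurable
  have hid : AEStronglyMeasurable (fun t : ℝ => t) (volume.restrict (Ioo 0 R)) :=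
    continuous_id.aestronglyMeasurable
  have h1 : AEStronglyMeasurable (fun t => 2 / t * (((t * n t / 2) / J t - (L t / J t) ^ 2) +
      ((L t - ∫ s in (0 : ℝ)..t, n s) / J t) ^ 2)) (volume.restrict (Ioo 0 R)) := by
    have a1 : AEStronglyMeasurable (fun t : ℝ => 2 / t) (volume.restrict (Ioo 0 R)) := by
      simpa [div_eq_mul_inv] using (hid.aemeasurable.inv.aestronglyMeasurable).const_mul 2
    have a2 : AEStronglyMeasurable (fun t => (t * n t / 2) / J t) (volume.restrict (Ioo 0 R)) := by
      exact (((hid.aemeasurable.mul hnm.aemeasurable).div_const 2).div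
        hJm.aemeasurable).aestronglyMeasurable
    have a3 : AEStronglyMeasurable (fun t => (L t / J t) ^ 2) (volume.restrict (Ioo 0 R)) :=
      ((hLm.aemeasurable.div hJm.aemeasurable).pow_const 2).aestronglyMeasurable
    have a4 : AEStronglyMeasurable (fun t => ((L t - ∫ s in (0 : ℝ)..t, n s) / J t) ^ 2)
        (volume.restrict (Ioo 0 R)) :=
      (((hLm.aemeasurable.sub hQm.aemeasurable).div
        hJm.aemeasurable).pow_const 2).aestronglyMeasurable
    exact a1.mul ((a2.sub a3).add a4)
  refine h1.congr ?_
  filter_upwards [ae_restrict_mem measurableSet_Ioo] with t ht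
  rw [defect, h.split t ht]
  ring_nf

/-- By definition of the defect W, n = (2/t)(W + (q + e)²)J, while J' = 2(q + e)J/t + j. Hence q' =
(2/t)(W + e²) + q(2e/t − j/J), and the last bracket is at least −81C because e ≥ −40Ct and |j| ≤ CJ.
The exponential compensates it, and as it is at least 1 it may be dropped from the remaining
nonnegative term. -/
theorem key_monotone (h : FrequencySystem R C J L j n p α v κ) {s r : ℝ} (hs : s ∈ Ioo 0 R)
    (hr : r ∈ Ioo 0 R) (hsr : s ≤ r) :
    IntervalIntegrable (fun t => 2 / t * (defect J L n t + ((v t + κ t) / J t) ^ 2)) volume s r ∧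
    ∫ t in s..r, 2 / t * (defect J L n t + ((v t + κ t) / J t) ^ 2) ≤
      qfun J n r * Real.exp (81 * C * r) - qfun J n s * Real.exp (81 * C * s) := by
  have hsub : ∀ t ∈ Icc s r, t ∈ Ioo 0 R := fun t ht => ⟨hs.1.trans_le ht.1, ht.2.trans_lt hr.2⟩
  -- The weighted frequency is Q times this differentiable factor, so the product rule for
  -- indefinite integrals applies although n is only integrable.
  set hf : ℝ → ℝ := fun t => Real.exp (81 * C * t) / J t
  set hf' : ℝ → ℝ := fun t => (Real.exp (81 * C * t) * (81 * C * 1) * J t -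
    Real.exp (81 * C * t) * (2 * L t / t + j t)) / J t ^ 2
  have hder : ∀ t ∈ Icc s r, HasDerivAt hf (hf' t) t := fun t ht =>
    (((hasDerivAt_id t).const_mul (81 * C)).exp).div (h.J_deriv t (hsub t ht))
      (h.J_pos (hsub t ht)).ne'
  have hint : IntervalIntegrable hf' volume s r := by
    apply ContinuousOn.intervalIntegrable
    rw [uIcc_of_le hsr]
    have c1 := h.J_contOn.mono hsub
    have c2 := h.L_cont.mono hsub
    have c3 := h.j_cont.mono hsub
    have c4 : ContinuousOn (fun t => Real.exp (81 * C * t)) (Icc s r) := by fun_prop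
    refine ContinuousOn.div (((c4.mul continuousOn_const).mul c1).sub (c4.mul
        (((continuousOn_const.mul c2).div continuousOn_id fun t ht => (hsub t ht).1.ne').add c3)))
        (c1.pow 2) fun t ht => pow_ne_zero _ (h.J_pos (hsub t ht)).ne'
  obtain ⟨hi, heq⟩ := integral_primitive_mul (c := 0) hs.1.le hsr
    (intervalIntegrable_of_integrableOn_Ioo h.n_int le_rfl hr.1.le hr.2) hder hint
  have hpt : ∀ t ∈ Icc s r, 2 / t * (defect J L n t + ((v t + κ t) / J t) ^ 2) ≤
      n t * hf t + (∫ t in (0 : ℝ)..t, n t) * hf' t := fun t ht => by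
    have htR := hsub t ht
    have ht0 := htR.1
    have hJ := h.J_pos htR
    have hL := h.L_div htR
    have he := h.e_ge htR
    have hq := h.qfun_nonneg htR
    set e := (v t + κ t) / J t
    set q := qfun J n t with hqdef
    have hQ : (∫ t in (0 : ℝ)..t, n t) = q * J t := by rw [hqdef, qfun]; field_simp
    have hL' : L t = (q + e) * J t := by rw [← hL]; field_simp
    have hn : n t = 2 / t * (defect J L n t + (q + e) ^ 2) * J t := by
      rw [defect, hL]; field_simp; ring
    have hjb : |j t / J t| ≤ C := by
      rw [abs_div, abs_of_pos hJ, div_le_iff₀ hJ]; exact h.j_le t htR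
    have hexp : (1 : ℝ) ≤ Real.exp (81 * C * t) := by
      apply Real.one_le_exp
      have := h.C_ge; positivity
    have hW := h.defect_nonneg htR
    set W := defect J L n t
    have e1 : n t * hf t + (∫ t in (0 : ℝ)..t, n t) * hf' t =
        Real.exp (81 * C * t) * (2 / t * (W + e ^ 2) + (q * (2 / t * e) + q * (81 * C - j t / J t)))
        := by
      simp only [hf, hf']
      rw [hQ, hn, hL']; field_simp; ring
    rw [e1]
    have h2 : -(80 * C) ≤ 2 / t * e := by
      have : 2 / t * (-(40 * C * t)) ≤ 2 / t * e := by gcongr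
      have h3 : 2 / t * (-(40 * C * t)) = -(80 * C) := by field_simp; ring
      linarith
    have h3 := (abs_le.1 hjb).2
    have h4 : 0 ≤ q * (2 / t * e) + q * (81 * C - j t / J t) := by
      rw [← mul_add]; exact mul_nonneg hq (by linarith)
    have h5 : 0 ≤ 2 / t * (W + e ^ 2) := by positivity
    nlinarith
  have hmeas : IntervalIntegrable
      (fun t => 2 / t * (defect J L n t + ((v t + κ t) / J t) ^ 2)) volume s r := by
    refine hi.mono_fun' ?_ ?_
    · rw [uIoc_of_le hsr]
      exact h.aestronglyMeasurable_defect.mono_set fun t ht => hsub t (Ioc_subset_Icc_self ht)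
    · rw [uIoc_of_le hsr]
      filter_upwards [ae_restrict_mem measurableSet_Ioc] with t ht
      have ht' := Ioc_subset_Icc_self ht
      have := h.defect_nonneg (hsub t ht')
      have := (hsub t ht').1
      rw [Real.norm_of_nonneg (by positivity)]
      exact hpt t ht'
  refine ⟨hmeas, ?_⟩
  calc _ ≤ ∫ x in s..r, (n x * hf x + (∫ t in (0 : ℝ)..x, n t) * hf' x) :=
        intervalIntegral.integral_mono_on hsr hmeas hi hpt
    _ = _ := by rw [heq]; simp only [qfun, hf]; ring

/-- The integrals over [r/(i+1), r] are bounded by the value of the weighted frequency at r, because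
q ≥ 0 at the lower end and the integrand is nonnegative. -/
theorem integrableOn_defect (h : FrequencySystem R C J L j n p α v κ) {r : ℝ} (hr : r ∈ Ioo 0 R) :
    IntegrableOn (fun t => 2 / t * (defect J L n t + ((v t + κ t) / J t) ^ 2)) (Ioc 0 r) := by
  have hu : Tendsto (fun i : ℕ => r / (i + 1 : ℝ)) atTop (𝓝 0) := by
    have := tendsto_one_div_add_atTop_nhds_zero_nat (𝕜 := ℝ)
    simpa [div_eq_mul_inv] using this.const_mul r
  have hmem : ∀ i : ℕ, r / (i + 1 : ℝ) ∈ Ioo 0 R ∧ r / (i + 1 : ℝ) ≤ r := fun i => by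
    have h1 : r / (i + 1 : ℝ) ≤ r := div_le_self hr.1.le (by linarith [Nat.cast_nonneg (α := ℝ) i])
    exact ⟨⟨by have := hr.1; positivity, h1.trans_lt hr.2⟩, h1⟩
  refine integrableOn_Ioc_of_intervalIntegral_norm_bounded_left
    (I := qfun J n r * Real.exp (81 * C * r)) (l := atTop) (a := fun i : ℕ => r / (i + 1 : ℝ))
    (fun i => ?_) hu (Eventually.of_forall fun i => ?_)
  · exact (intervalIntegrable_iff_integrableOn_Ioc_of_le (hmem i).2).1
      (h.key_monotone (hmem i).1 hr (hmem i).2).1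
  · have h1 := (h.key_monotone (hmem i).1 hr (hmem i).2).2
    rw [intervalIntegral.integral_of_le (hmem i).2] at h1
    have h2 : 0 ≤ qfun J n (r / (i + 1 : ℝ)) * Real.exp (81 * C * (r / (i + 1 : ℝ))) :=
      mul_nonneg (h.qfun_nonneg (hmem i).1) (Real.exp_pos _).le
    calc _ = ∫ t in Ioc (r / (i + 1 : ℝ)) r,
          2 / t * (defect J L n t + ((v t + κ t) / J t) ^ 2) := by
          refine setIntegral_congr_fun measurableSet_Ioc fun t ht => ?_
          have htR : t ∈ Ioo 0 R := ⟨(hmem i).1.1.trans ht.1, ht.2.trans_lt hr.2⟩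
          have := h.defect_nonneg htR
          have := htR.1
          exact Real.norm_of_nonneg (by positivity)
      _ ≤ _ := by linarith

/-- The weighted frequency is monotone and nonnegative, and its exponential weight tends to 1. -/
theorem exists_tendsto_qfun (h : FrequencySystem R C J L j n p α v κ) :
    ∃ q₀ : ℝ, 0 ≤ q₀ ∧ Tendsto (qfun J n) (𝓝[>] 0) (𝓝 q₀) := by
  have hmono : MonotoneOn (fun r => qfun J n r * Real.exp (81 * C * r)) (Ioo 0 R) := by
    intro s hs r hr hsr
    have h1 := (h.key_monotone hs hr hsr).2
    have h2 : 0 ≤ ∫ t in s..r, 2 / t * (defect J L n t + ((v t + κ t) / J t) ^ 2) := by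
      rw [intervalIntegral.integral_of_le hsr]
      refine setIntegral_nonneg measurableSet_Ioc fun t ht => ?_
      have htR : t ∈ Ioo 0 R := ⟨hs.1.trans ht.1, ht.2.trans_lt hr.2⟩
      have := h.defect_nonneg htR
      have := htR.1
      positivity
    simp only
    linarith
  have hbdd : BddBelow ((fun r => qfun J n r * Real.exp (81 * C * r)) '' Ioo 0 R) := by
    refine ⟨0, ?_⟩
    rintro _ ⟨r, hr, rfl⟩
    exact mul_nonneg (h.qfun_nonneg hr) (Real.exp_pos _).le
  have hne : (Ioo 0 R).Nonempty := nonempty_Ioo.2 h.R_pos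
  have ht := hmono.tendsto_nhdsWithin_Ioo_right hne hbdd
  set q₀ := sInf ((fun r => qfun J n r * Real.exp (81 * C * r)) '' Ioo 0 R)
  have he : Tendsto (fun r : ℝ => Real.exp (-(81 * C * r))) (𝓝[>] 0) (𝓝 1) := by
    have : Continuous fun r : ℝ => Real.exp (-(81 * C * r)) := by fun_prop
    have h1 := this.tendsto 0
    simp only [mul_zero, neg_zero, Real.exp_zero] at h1
    exact h1.mono_left nhdsWithin_le_nhds
  refine ⟨q₀, Real.sInf_nonneg ?_, ?_⟩
  · rintro _ ⟨r, hr, rfl⟩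
    exact mul_nonneg (h.qfun_nonneg hr) (Real.exp_pos _).le
  · have := ht.mul he
    rw [mul_one] at this
    refine this.congr fun r => ?_
    rw [mul_assoc, ← Real.exp_add]; simp

theorem tendsto_integral_defect (h : FrequencySystem R C J L j n p α v κ) :
    Tendsto (fun r => ∫ t in (0 : ℝ)..r, 2 / t * (defect J L n t + ((v t + κ t) / J t) ^ 2))
      (𝓝[>] 0) (𝓝 0) := by
  have hm : R / 2 ∈ Ioo 0 R := ⟨by have := h.R_pos; positivity, by have := h.R_pos; linarith⟩
  have hc := intervalIntegral.continuousOn_primitive_interval (a := 0) (b := R / 2)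
    (f := fun t => 2 / t * (defect J L n t + ((v t + κ t) / J t) ^ 2)) (μ := volume) (by
        rw [uIcc_of_le hm.1.le, integrableOn_Icc_iff_integrableOn_Ioc]
        exact h.integrableOn_defect hm)
  rw [uIcc_of_le hm.1.le] at hc
  have := (hc 0 ⟨le_rfl, hm.1.le⟩)
  simp only [ContinuousWithinAt, intervalIntegral.integral_same] at this
  exact this.mono_left (nhdsWithin_le_of_mem (mem_of_superset (Ioo_mem_nhdsGT hm.1)
      Ioo_subset_Icc_self))

end FrequencySystem
end StagnationFlow

/-! ### Doubling of the mass and vanishing of the volume terms -/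

namespace StagnationFlow
namespace FrequencySystem

variable {R C : ℝ} {J L j n p α v κ : ℝ → ℝ}

/-- The logarithmic derivative of J is (2/t)(q + e) + j/J. The first part is bounded through the
monotone weighted frequency; there is no pointwise upper bound on e at this stage, but e ≤ 1 + e²
and (2/t)e² has bounded integral. -/
theorem exists_doubling (h : FrequencySystem R C J L j n p α v κ) :
    ∃ M : ℝ, 0 < M ∧ ∀ r ∈ Ioo 0 (R / 4), J (2 * r) ≤ M * J r := by
  have hR := h.R_pos
  have hm : R / 2 ∈ Ioo 0 R := ⟨by positivity, by linarith⟩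
  -- By `key_monotone` this one number bounds both q on (0, R/2) and the integral of (2/t)(W + e²)
  -- over any subinterval ending at most at R/2.
  set B := qfun J n (R / 2) * Real.exp (81 * C * (R / 2)) with hB
  refine ⟨Real.exp (3 * B + 3), Real.exp_pos _, fun r hr => ?_⟩
  have hr0 := hr.1
  have hrR : r ∈ Ioo 0 R := ⟨hr0, by linarith [hr.2]⟩
  have h2r : 2 * r ∈ Ioo 0 R := ⟨by positivity, by linarith [hr.2]⟩
  have hle : r ≤ 2 * r := by linarith
  have hsub : ∀ t ∈ Icc r (2 * r), t ∈ Ioo 0 R :=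
    fun t ht => ⟨hr0.trans_le ht.1, ht.2.trans_lt h2r.2⟩
  have hgn : ∀ t ∈ Ioo 0 R, 0 ≤ 2 / t * (defect J L n t + ((v t + κ t) / J t) ^ 2) :=
    fun t ht => by
      have := h.defect_nonneg ht
      have := ht.1
      positivity
  have hq : ∀ t ∈ Ioo 0 (R / 2), qfun J n t ≤ B := fun t ht => by
    have htR : t ∈ Ioo 0 R := ⟨ht.1, ht.2.trans hm.2⟩
    have h1 := (h.key_monotone htR hm ht.2.le).2
    have h2 : 0 ≤ ∫ s in t..(R / 2), 2 / s * (defect J L n s + ((v s + κ s) / J s) ^ 2) := by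
      rw [intervalIntegral.integral_of_le ht.2.le]
      exact setIntegral_nonneg measurableSet_Ioc fun s hs =>
        hgn s ⟨ht.1.trans hs.1, hs.2.trans_lt hm.2⟩
    have h3 : (1 : ℝ) ≤ Real.exp (81 * C * t) := by
      apply Real.one_le_exp
      have := h.C_ge; have := ht.1; positivity
    have h4 := h.qfun_nonneg htR
    nlinarith
  have hgB : ∫ t in r..(2 * r), 2 / t * (defect J L n t + ((v t + κ t) / J t) ^ 2) ≤ B := by
    have h1 := (h.key_monotone hrR hm (by linarith [hr.2])).2
    have h4 := mul_nonneg (h.qfun_nonneg hrR) (Real.exp_pos (81 * C * r)).le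
    have h5 := intervalIntegral.integral_add_adjacent_intervals
      (h.key_monotone hrR h2r hle).1 (h.key_monotone h2r hm (by linarith [hr.2])).1
    have h2 : 0 ≤ ∫ s in (2 * r)..(R / 2), 2 / s * (defect J L n s + ((v s + κ s) / J s) ^ 2) := by
      rw [intervalIntegral.integral_of_le (by linarith [hr.2])]
      exact setIntegral_nonneg measurableSet_Ioc fun s hs =>
        hgn s ⟨h2r.1.trans hs.1, hs.2.trans_lt hm.2⟩
    linarith
  have hder : ∀ t ∈ uIcc r (2 * r), HasDerivAt (fun t => Real.log (J t))
      ((2 * L t / t + j t) / J t) t := fun t ht => by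
    rw [uIcc_of_le hle] at ht
    exact (h.J_deriv t (hsub t ht)).log (h.J_pos (hsub t ht)).ne'
  have hint : IntervalIntegrable (fun t => (2 * L t / t + j t) / J t) volume r (2 * r) := by
    apply ContinuousOn.intervalIntegrable
    rw [uIcc_of_le hle]
    have c1 := h.J_contOn.mono hsub
    have c2 := h.L_cont.mono hsub
    have c3 := h.j_cont.mono hsub
    exact (((continuousOn_const.mul c2).div continuousOn_id
      fun t ht => (hsub t ht).1.ne').add c3).div c1 fun t ht => (h.J_pos (hsub t ht)).ne'
  have hftc := intervalIntegral.integral_eq_sub_of_hasDerivAt hder hint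
  have hmono : ∫ t in r..(2 * r), (2 * L t / t + j t) / J t ≤
      ∫ t in r..(2 * r), ((2 / r * (B + 1) + C) +
        2 / t * (defect J L n t + ((v t + κ t) / J t) ^ 2)) := by
    refine intervalIntegral.integral_mono_on_of_le_Ioo hle hint
      (intervalIntegrable_const.add (h.key_monotone hrR h2r hle).1) fun t ht => ?_
    have htR := hsub t (Ioo_subset_Icc_self ht)
    have ht0 := htR.1
    have hJ := h.J_pos htR
    have e1 : (2 * L t / t + j t) / J t = 2 / t * (L t / J t) + j t / J t := by field_simp
    have hjb : |j t / J t| ≤ C := by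
      rw [abs_div, abs_of_pos hJ, div_le_iff₀ hJ]; exact h.j_le t htR
    have h1 := (abs_le.1 hjb).2
    rw [e1, h.L_div htR]
    have hW := h.defect_nonneg htR
    set e := (v t + κ t) / J t
    have h2 : qfun J n t ≤ B := hq t ⟨ht0, by linarith [ht.2, hr.2]⟩
    have h3 : e ≤ 1 + (defect J L n t + e ^ 2) := by nlinarith [sq_nonneg (e - 1)]
    have hB0 : 0 ≤ B := (h.qfun_nonneg htR).trans h2
    have h4 : 2 / t * (qfun J n t + e) ≤ 2 / t * (B + (1 + (defect J L n t + e ^ 2))) := by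
      gcongr
    have h5 : 2 / t * (B + 1) ≤ 2 / r * (B + 1) := by
      gcongr; exact ht.1.le
    linarith
  rw [hftc, intervalIntegral.integral_add intervalIntegrable_const (h.key_monotone hrR h2r hle).1,
    intervalIntegral.integral_const, smul_eq_mul] at hmono
  have h6 : (2 * r - r) * (2 / r * (B + 1) + C) = 2 * (B + 1) + C * r := by
    field_simp; ring
  rw [h6] at hmono
  have h7 := h.C_mul_le hrR
  -- The exponent collects 2(B + 1) + Cr from the constant part and B from the integral of (2/t)(W +
  -- e²).
  have h8 : Real.log (J (2 * r)) ≤ (3 * B + 3) + Real.log (J r) := by linarith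
  calc J (2 * r) = Real.exp (Real.log (J (2 * r))) := (Real.exp_log (h.J_pos h2r)).symm
    _ ≤ Real.exp ((3 * B + 3) + Real.log (J r)) := Real.exp_le_exp.2 h8
    _ = _ := by rw [Real.exp_add, Real.exp_log (h.J_pos hrR)]

/-- As e ≥ p/(2J) − O(t), integrability of e²/t controls p/J in an averaged sense. Monotonicity of
t³p and doubling of J compare p(r)/J(r) with p(t)/J(t) for every t in [r, 2r], so the average over
that interval gives a pointwise bound by the tail of a convergent integral. -/
theorem tendsto_p_div (h : FrequencySystem R C J L j n p α v κ) :
    Tendsto (fun r => p r / J r) (𝓝[>] 0) (𝓝 0) := by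
  obtain ⟨M, hM, hdb⟩ := h.exists_doubling
  have hR := h.R_pos
  have hC := h.C_ge
  set g : ℝ → ℝ := fun t => 2 / t * (defect J L n t + ((v t + κ t) / J t) ^ 2) with hg
  -- The factor is 8 from (2r)³/r³, 2 from p/J ≤ 2(e + 40Ct), and exp(1)·M from comparing J(t) with
  -- J(2r) and J(2r) with J(r).
  set N := 16 * Real.exp 1 * M with hN
  have hN0 : 0 < N := by positivity
  have hbound : ∀ r ∈ Ioo 0 (R / 4), (p r / J r) ^ 2 ≤
      2 * N ^ 2 * ((∫ t in (0 : ℝ)..(2 * r), g t) + (80 * C * r) ^ 2) := by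
    intro r hr
    have hr0 := hr.1
    have hrR : r ∈ Ioo 0 R := ⟨hr0, by linarith [hr.2]⟩
    have h2r : 2 * r ∈ Ioo 0 R := ⟨by positivity, by linarith [hr.2]⟩
    have hle : r ≤ 2 * r := by linarith
    have hsub : ∀ t ∈ Icc r (2 * r), t ∈ Ioo 0 R :=
      fun t ht => ⟨hr0.trans_le ht.1, ht.2.trans_lt h2r.2⟩
    have hJr := h.J_pos hrR
    -- The weight 1/r has integral one over [r, 2r] and is dominated there by the weight 2/t of the
    -- integrable quantity.
    have hpt : ∀ t ∈ Icc r (2 * r), 1 / r * (p r / J r) ^ 2 ≤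
        2 * N ^ 2 * (g t + 1 / r * (80 * C * r) ^ 2) := fun t ht => by
      have htR := hsub t ht
      have ht0 := htR.1
      have hJ := h.J_pos htR
      have h1 : J t ≤ Real.exp 1 * (M * J r) :=
        (h.J_le_mul htR h2r ht.2).trans (by gcongr; exact hdb r hr)
      have h2 : p r ≤ 8 * p t := by
        have := h.p_mono t htR r hrR ht.1
        have h3 : t ^ 3 * p t ≤ (2 * r) ^ 3 * p t := by
          have := h.p_nonneg t htR
          gcongr; exact ht.2
        have h4 : r ^ 3 * p r ≤ r ^ 3 * (8 * p t) := by nlinarith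
        exact le_of_mul_le_mul_left h4 (by positivity)
      have h3 : p t / J t ≤ 2 * ((v t + κ t) / J t + 40 * C * t) := by
        have a1 := abs_le.1 (h.κ_abs_le htR)
        have a2 := abs_le.1 (h.v_abs_le htR)
        have a3 := h.C_mul_le htR
        have a4 := h.p_nonneg t htR
        rw [div_add' _ _ _ hJ.ne', ← mul_div_assoc]
        apply div_le_div_of_nonneg_right _ hJ.le
        nlinarith [a1.1, a2.1]
      have h4 : p r / J r ≤ 8 * Real.exp 1 * M * (p t / J t) := by
        have a4 := h.p_nonneg t htR
        rw [div_le_iff₀ hJr]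
        calc p r ≤ 8 * p t := h2
          _ = 8 * (p t / J t) * J t := by field_simp
          _ ≤ 8 * (p t / J t) * (Real.exp 1 * (M * J r)) := by gcongr
          _ = _ := by ring
      set e := (v t + κ t) / J t with he
      have h5 : p r / J r ≤ N * (e + 80 * C * r) := by
        have : (0:ℝ) < 8 * Real.exp 1 * M := by positivity
        calc p r / J r ≤ 8 * Real.exp 1 * M * (2 * (e + 40 * C * t)) := h4.trans (by gcongr)
          _ = N * (e + 40 * C * t) := by rw [hN]; ring
          _ ≤ N * (e + 80 * C * r) := by
            have : 40 * C * t ≤ 80 * C * r := by nlinarith [ht.2]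
            gcongr
      have h6 : 0 ≤ p r / J r := div_nonneg (h.p_nonneg r hrR) hJr.le
      have h7 : (p r / J r) ^ 2 ≤ 2 * N ^ 2 * (e ^ 2 + (80 * C * r) ^ 2) := by
        calc (p r / J r) ^ 2 ≤ (N * (e + 80 * C * r)) ^ 2 := by gcongr
          _ ≤ _ := by nlinarith [mul_nonneg (sq_nonneg N) (sq_nonneg (e - 80 * C * r))]
      have h8 : 1 / r * e ^ 2 ≤ g t := by
        have hW := h.defect_nonneg htR
        simp only [hg]
        rw [← he]
        have : 1 / r ≤ 2 / t := by rw [div_le_div_iff₀ hr0 ht0]; linarith [ht.2]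
        calc 1 / r * e ^ 2 ≤ 2 / t * e ^ 2 := by gcongr
          _ ≤ _ := by gcongr; linarith
      calc 1 / r * (p r / J r) ^ 2 ≤ 1 / r * (2 * N ^ 2 * (e ^ 2 + (80 * C * r) ^ 2)) := by gcongr
        _ = 2 * N ^ 2 * (1 / r * e ^ 2 + 1 / r * (80 * C * r) ^ 2) := by ring
        _ ≤ _ := by gcongr
    have hgi : IntervalIntegrable g volume r (2 * r) := (h.key_monotone hrR h2r hle).1
    have h1 := intervalIntegral.integral_mono_on hle intervalIntegrable_const
      ((hgi.add intervalIntegrable_const).const_mul _) hpt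
    rw [intervalIntegral.integral_const, intervalIntegral.integral_const_mul,
      intervalIntegral.integral_add hgi intervalIntegrable_const, intervalIntegral.integral_const,
      smul_eq_mul, smul_eq_mul] at h1
    have e1 : (2 * r - r) * (1 / r * (p r / J r) ^ 2) = (p r / J r) ^ 2 := by field_simp; ring
    have e2 : (2 * r - r) * (1 / r * (80 * C * r) ^ 2) = (80 * C * r) ^ 2 := by field_simp; ring
    rw [e1, e2] at h1
    refine h1.trans ?_
    have h0r : IntervalIntegrable g volume 0 r :=
      (intervalIntegrable_iff_integrableOn_Ioc_of_le hr0.le).2 (h.integrableOn_defect hrR)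
    have h2 := intervalIntegral.integral_add_adjacent_intervals h0r hgi
    have h3 : 0 ≤ ∫ t in (0 : ℝ)..r, g t := integral_nonneg_Ioo (R := R) (fun t ht => by
      have := h.defect_nonneg ht
      have := ht.1
      simp only [hg]
      positivity) hr0.le hrR.2
    gcongr
    linarith
  have h2 : Tendsto (fun r : ℝ => 2 * r) (𝓝[>] 0) (𝓝[>] 0) := by
    refine tendsto_nhdsWithin_iff.2 ⟨?_, ?_⟩
    · have : Continuous fun r : ℝ => 2 * r := by fun_prop
      have h1 := this.tendsto 0
      simp only [mul_zero] at h1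
      exact h1.mono_left nhdsWithin_le_nhds
    · filter_upwards [self_mem_nhdsWithin] with r hr
      have : (0 : ℝ) < r := hr
      simp only [mem_Ioi]; positivity
  have h3 := h.tendsto_integral_defect.comp h2
  have h4 : Tendsto (fun r : ℝ => (80 * C * r) ^ 2) (𝓝[>] 0) (𝓝 0) := by
    have : Continuous fun r : ℝ => (80 * C * r) ^ 2 := by fun_prop
    have h1 := this.tendsto 0
    norm_num at h1
    exact h1.mono_left nhdsWithin_le_nhds
  have h5 := (h3.add h4).const_mul (2 * N ^ 2)
  simp only [Function.comp_def, add_zero, mul_zero] at h5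
  have h6 : Tendsto (fun r => (p r / J r) ^ 2) (𝓝[>] 0) (𝓝 0) := by
    refine squeeze_zero' (Eventually.of_forall fun r => sq_nonneg _) ?_ h5
    filter_upwards [Ioo_mem_nhdsGT (show (0 : ℝ) < R / 4 by positivity)] with r hr
    exact hbound r hr
  have h7 := h6.sqrt
  simp only [Real.sqrt_zero, Real.sqrt_sq_eq_abs] at h7
  exact (tendsto_zero_iff_abs_tendsto_zero _).2 h7

theorem tendsto_κ_div (h : FrequencySystem R C J L j n p α v κ) :
    Tendsto (fun r => κ r / J r) (𝓝[>] 0) (𝓝 0) := by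
  have h4 : Tendsto (fun r : ℝ => 20 * C * r) (𝓝[>] 0) (𝓝 0) := by
    have : Continuous fun r : ℝ => 20 * C * r := by fun_prop
    have h1 := this.tendsto 0
    norm_num at h1
    exact h1.mono_left nhdsWithin_le_nhds
  refine squeeze_zero_norm' ?_ h4
  filter_upwards [Ioo_mem_nhdsGT h.R_pos] with r hr
  have hJ := h.J_pos hr
  rw [Real.norm_eq_abs, abs_div, abs_of_pos hJ, div_le_iff₀ hJ]
  exact h.κ_abs_le hr

theorem tendsto_v_div (h : FrequencySystem R C J L j n p α v κ) :
    Tendsto (fun r => v r / J r) (𝓝[>] 0) (𝓝 0) := by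
  have hC := h.C_ge
  have h4 : Tendsto (fun r : ℝ => 20 * C * r) (𝓝[>] 0) (𝓝 0) := by
    have : Continuous fun r : ℝ => 20 * C * r := by fun_prop
    have h1 := this.tendsto 0
    norm_num at h1
    exact h1.mono_left nhdsWithin_le_nhds
  have h5 := (h.tendsto_p_div.const_mul 2).add h4
  simp only [mul_zero, add_zero] at h5
  refine squeeze_zero_norm' ?_ h5
  filter_upwards [Ioo_mem_nhdsGT h.R_pos] with r hr
  have hJ := h.J_pos hr
  rw [Real.norm_eq_abs, abs_div, abs_of_pos hJ, div_le_iff₀ hJ]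
  have h1 := h.v_abs_le hr
  have h2 := h.p_nonneg r hr
  have h3 := h.C_mul_le hr
  have h6 : |v r| ≤ |v r - p r| + p r := by
    have := abs_add_le (v r - p r) (p r)
    rw [sub_add_cancel, abs_of_nonneg h2] at this
    exact this
  have e1 : (2 * (p r / J r) + 20 * C * r) * J r = 2 * p r + 20 * C * r * J r := by field_simp
  rw [e1]
  nlinarith

/-- Now L/J converges, so α ≤ 2L + 4J becomes a bound by J alone. This is the gradient bound for the
blow-ups. -/
theorem exists_α_le (h : FrequencySystem R C J L j n p α v κ) :
    ∃ M : ℝ, ∀ᶠ r in 𝓝[>] 0, α r ≤ M * J r := by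
  obtain ⟨q₀, -, hq⟩ := h.exists_tendsto_qfun
  have h1 := (hq.add h.tendsto_v_div).add h.tendsto_κ_div
  refine ⟨2 * (q₀ + 0 + 0 + 1) + 4, ?_⟩
  filter_upwards [h1.eventually_lt_const (show q₀ + 0 + 0 < q₀ + 0 + 0 + 1 by linarith),
    Ioo_mem_nhdsGT h.R_pos] with r hr hrR
  have hJ := h.J_pos hrR
  have h2 := h.L_div hrR
  rw [add_div, ← add_assoc] at h2
  rw [← h2, div_lt_iff₀ hJ] at hr
  have := h.α_le r hrR
  linarith

end FrequencySystem
end StagnationFlow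

namespace StagnationFlow

/-! ### A truncation that is differentiable -/

/-- The truncation `(s - ε)₊² / s`. -/
noncomputable def trunc (ε s : ℝ) : ℝ := max (s - ε) 0 ^ 2 / s

/-- The derivative of `trunc ε`. -/
noncomputable def truncDeriv (ε s : ℝ) : ℝ :=
  2 * (max (s - ε) 0 / s) - (max (s - ε) 0 / s) ^ 2

theorem hasDerivAt_max_sq (x : ℝ) :
    HasDerivAt (fun x : ℝ => max x 0 ^ 2) (2 * max x 0) x := by
  rcases lt_trichotomy x 0 with h | h | h
  · have h1 : (fun x : ℝ => max x 0 ^ 2) =ᶠ[𝓝 x] fun _ => 0 := by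
      filter_upwards [Iio_mem_nhds h] with y hy
      rw [max_eq_right (le_of_lt hy)]; simp
    rw [max_eq_right h.le, mul_zero]
    exact (hasDerivAt_const x (0 : ℝ)).congr_of_eventuallyEq h1
  · subst h
    simp only [max_self, mul_zero]
    rw [hasDerivAt_iff_isLittleO]
    simp only [max_self, sub_zero, smul_zero]
    refine Asymptotics.IsBigO.trans_isLittleO (g := fun x : ℝ => x ^ 2) ?_ ?_
    · refine Asymptotics.IsBigO.of_bound 1 (Eventually.of_forall fun y => ?_)
      have h1 : max y 0 ≤ |y| := max_le (le_abs_self y) (abs_nonneg y)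
      have h2 : 0 ≤ max y 0 := le_max_right y 0
      rw [one_mul, Real.norm_eq_abs, Real.norm_eq_abs, zero_pow two_ne_zero, sub_zero, abs_pow,
        abs_pow, abs_of_nonneg h2]
      exact pow_le_pow_left₀ h2 h1 2
    · simpa using Asymptotics.isLittleO_pow_id (𝕜 := ℝ) (n := 2) (by norm_num)
  · have h1 : (fun x : ℝ => max x 0 ^ 2) =ᶠ[𝓝 x] fun x => x ^ 2 := by
      filter_upwards [Ioi_mem_nhds h] with y hy
      rw [max_eq_left (le_of_lt hy)]
    rw [max_eq_left h.le]
    have := (hasDerivAt_pow 2 x).congr_of_eventuallyEq h1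
    simpa using this

theorem trunc_eq_zero {ε s : ℝ} (h : s ≤ ε) : trunc ε s = 0 := by
  simp [trunc, max_eq_right (sub_nonpos.2 h)]

theorem truncDeriv_eq_zero {ε s : ℝ} (h : s ≤ ε) : truncDeriv ε s = 0 := by
  simp [truncDeriv, max_eq_right (sub_nonpos.2 h)]

/-- With ρ = (s − ε)₊/s the truncation is ρ²s and its derivative 2ρ − ρ². Both are continuous; the
derivative lies in [0, 1] and tends to 1 for s > 0 and stays 0 at s = 0, which is what dominated
convergence needs. -/
theorem hasDerivAt_trunc {ε : ℝ} (hε : 0 < ε) (s : ℝ) :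
    HasDerivAt (trunc ε) (truncDeriv ε s) s := by
  rcases lt_or_ge s ε with h | h
  · have h1 : trunc ε =ᶠ[𝓝 s] fun _ => 0 := by
      filter_upwards [Iio_mem_nhds h] with y hy using trunc_eq_zero (le_of_lt hy)
    rw [truncDeriv_eq_zero h.le]
    exact (hasDerivAt_const s (0 : ℝ)).congr_of_eventuallyEq h1
  · have hs : s ≠ 0 := (hε.trans_le h).ne'
    have h1 := (hasDerivAt_max_sq (s - ε)).comp s ((hasDerivAt_id s).sub_const ε)
    have h2 := h1.div (hasDerivAt_id s) hs
    convert! h2 using 1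
    simp only [truncDeriv, Function.comp, id]
    field_simp

theorem ratio_mem {ε s : ℝ} (hε : 0 < ε) : 0 ≤ max (s - ε) 0 / s ∧ max (s - ε) 0 / s ≤ 1 := by
  rcases lt_or_ge s ε with h | h
  · rw [max_eq_right (by linarith)]; simp
  · have hs : 0 < s := hε.trans_le h
    rw [max_eq_left (by linarith)]
    exact ⟨div_nonneg (by linarith) hs.le, (div_le_one hs).2 (by linarith)⟩

theorem truncDeriv_mem {ε s : ℝ} (hε : 0 < ε) : 0 ≤ truncDeriv ε s ∧ truncDeriv ε s ≤ 1 := by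
  obtain ⟨h1, h2⟩ := ratio_mem (s := s) hε
  simp only [truncDeriv]
  constructor <;> nlinarith

theorem trunc_mem {ε s : ℝ} (hε : 0 < ε) (hs : 0 ≤ s) : 0 ≤ trunc ε s ∧ trunc ε s ≤ s := by
  obtain ⟨h1, h2⟩ := ratio_mem (s := s) hε
  have e : trunc ε s = (max (s - ε) 0 / s) ^ 2 * s := by
    simp only [trunc]
    rcases eq_or_ne s 0 with rfl | h
    · simp
    · field_simp
  rw [e]
  constructor
  · positivity
  · nlinarith [sq_nonneg (max (s - ε) 0 / s), mul_le_one₀ h2 h1 h2]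

theorem continuous_trunc {ε : ℝ} (hε : 0 < ε) : Continuous (trunc ε) :=
  continuous_iff_continuousAt.2 fun s => (hasDerivAt_trunc hε s).continuousAt

theorem measurable_truncDeriv (ε : ℝ) : Measurable (truncDeriv ε) := by
  unfold truncDeriv; fun_prop

/-- The sequence of truncation levels. -/
noncomputable def level (m : ℕ) : ℝ := 1 / (m + 1 : ℝ)

theorem level_pos (m : ℕ) : 0 < level m := by unfold level; positivity

theorem tendsto_level : Tendsto level atTop (𝓝 0) := tendsto_one_div_add_atTop_nhds_zero_nat

theorem tendsto_ratio {s : ℝ} (hs : 0 < s) :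
    Tendsto (fun m => max (s - level m) 0 / s) atTop (𝓝 1) := by
  have h1 : Continuous fun e : ℝ => max (s - e) 0 / s := by fun_prop
  have h2 := (h1.tendsto 0).comp tendsto_level
  simp only [sub_zero, max_eq_left hs.le, div_self hs.ne'] at h2
  exact h2

theorem tendsto_truncDeriv {s : ℝ} (hs : 0 < s) :
    Tendsto (fun m => truncDeriv (level m) s) atTop (𝓝 1) := by
  have := ((tendsto_ratio hs).const_mul 2).sub ((tendsto_ratio hs).pow 2)
  norm_num at this
  exact this

theorem tendsto_trunc {s : ℝ} (hs : 0 ≤ s) :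
    Tendsto (fun m => trunc (level m) s) atTop (𝓝 s) := by
  rcases hs.eq_or_lt with rfl | hs
  · simp [trunc]
  · have := ((tendsto_ratio hs).pow 2).mul_const s
    norm_num at this
    refine this.congr fun m => ?_
    simp only [trunc]; field_simp

/-- The fundamental theorem of calculus for a nonnegative function that is differentiable only
where it is positive. -/
theorem integral_eq_sub_of_hasDerivAt_of_pos {u v : ℝ → ℝ} {a b : ℝ} (hab : a ≤ b)
    (hu : ContinuousOn u (Icc a b)) (hu0 : ∀ t ∈ Icc a b, 0 ≤ u t)
    (hd : ∀ t ∈ Ioo a b, 0 < u t → HasDerivAt u (v t) t)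
    (hv0 : ∀ t ∈ Icc a b, u t = 0 → v t = 0) (hv : IntervalIntegrable v volume a b) :
    ∫ t in a..b, v t = u b - u a := by
  have hmeas : ∀ m, AEStronglyMeasurable (fun t => truncDeriv (level m) (u t) * v t)
      (volume.restrict (uIoc a b)) := fun m => by
    rw [uIoc_of_le hab]
    refine AEStronglyMeasurable.mul ?_ hv.1.aestronglyMeasurable
    exact ((measurable_truncDeriv _).comp_aemeasurable ((hu.mono Ioc_subset_Icc_self).aemeasurable
      measurableSet_Ioc)).aestronglyMeasurable
  have hb : ∀ m t, ‖truncDeriv (level m) (u t) * v t‖ ≤ ‖v t‖ := fun m t => by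
    obtain ⟨h1, h2⟩ := truncDeriv_mem (s := u t) (level_pos m)
    rw [norm_mul, Real.norm_of_nonneg h1]
    exact mul_le_of_le_one_left (norm_nonneg _) h2
  -- The truncated function is differentiable everywhere: at a zero of u it vanishes in a
  -- neighbourhood by continuity.
  have key : ∀ m, ∫ t in a..b, truncDeriv (level m) (u t) * v t =
      trunc (level m) (u b) - trunc (level m) (u a) := fun m => by
    refine intervalIntegral.integral_eq_sub_of_hasDerivAt_of_le (f := fun t => trunc (level m) (u t))
      hab ((continuous_trunc (level_pos m)).comp_continuousOn hu) (fun t ht => ?_)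
      (hv.norm.mono_fun (hmeas m) (Eventually.of_forall fun t => by simpa using hb m t))
    rcases (hu0 t (Ioo_subset_Icc_self ht)).eq_or_lt with h | h
    · rw [← h, truncDeriv_eq_zero (level_pos m).le, zero_mul]
      refine (hasDerivAt_const t (0 : ℝ)).congr_of_eventuallyEq ?_
      have hc : ContinuousAt u t := hu.continuousAt (Icc_mem_nhds ht.1 ht.2)
      filter_upwards [hc.eventually_lt_const (by rw [← h]; exact level_pos m)] with s hs
      exact trunc_eq_zero hs.le
    · exact (hasDerivAt_trunc (level_pos m) (u t)).comp t (hd t ht h)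
  -- On {u = 0} the truncated derivatives converge to 0 rather than to v; they agree because v
  -- vanishes there.
  have h1 : Tendsto (fun m => ∫ t in a..b, truncDeriv (level m) (u t) * v t) atTop
      (𝓝 (∫ t in a..b, v t)) := by
    refine intervalIntegral.tendsto_integral_filter_of_dominated_convergence (fun t => ‖v t‖)
      (Eventually.of_forall hmeas) (Eventually.of_forall fun m => Eventually.of_forall fun t _ => hb m t)
      hv.norm (Eventually.of_forall fun t ht => ?_)
    rw [uIoc_of_le hab] at ht
    have ht' := Ioc_subset_Icc_self ht
    rcases (hu0 t ht').eq_or_lt with h | h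
    · simp [hv0 t ht' h.symm]
    · simpa using (tendsto_truncDeriv h).mul_const (v t)
  have h2 : Tendsto (fun m => trunc (level m) (u b) - trunc (level m) (u a)) atTop
      (𝓝 (u b - u a)) :=
    (tendsto_trunc (hu0 b (right_mem_Icc.2 hab))).sub (tendsto_trunc (hu0 a (left_mem_Icc.2 hab)))
  exact tendsto_nhds_unique h1 (h2.congr fun m => (key m).symm)

/-! ### Integration by parts in the plane -/

/-- Integration by parts against the constant function 1; differentiability along a single direction
and integrability suffice. -/
theorem integral_hasLineDerivAt_eq_zero {h h' : Plane → ℝ} {v : Plane} (hi : Integrable h)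
    (hi' : Integrable h') (hd : ∀ X, HasLineDerivAt ℝ h (h' X) X v) : ∫ X, h' X = 0 := by
  have := integral_bilinear_hasLineDerivAt_right_eq_neg_left_of_integrable (μ := volume)
    (f := fun _ : Plane => (1 : ℝ)) (f' := fun _ => 0) (g := h) (g' := h') (v := v)
    (B := ContinuousLinearMap.mul ℝ ℝ) (by simp) (by simpa using hi') (by simpa using hi)
    (fun X _ => by
      simpa using (hasFDerivAt_const (1 : ℝ) X).hasLineDerivAt v) (fun X _ => hd X)
  simpa using this

theorem continuous_mul_of_tsupport_subset {U : Set Plane} {a g : Plane → ℝ} (hU : IsOpen U)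
    (ha : ContinuousOn a U) (hg : Continuous g) (hs : tsupport g ⊆ U) :
    Continuous fun X => a X * g X := by
  refine continuous_iff_continuousAt.2 fun X => ?_
  by_cases hX : X ∈ tsupport g
  · exact (ha.continuousAt (hU.mem_nhds (hs hX))).mul hg.continuousAt
  · have h1 : (fun X => a X * g X) =ᶠ[𝓝 X] fun _ => 0 := by
      filter_upwards [(isClosed_tsupport g).isOpen_compl.mem_nhds hX] with Y hY
      rw [image_eq_zero_of_notMem_tsupport hY, mul_zero]
    exact continuousAt_const.congr h1.symm

theorem integrable_mul_of_tsupport_subset {U : Set Plane} {a g : Plane → ℝ} (hU : IsOpen U)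
    (ha : ContinuousOn a U) (hg : Continuous g) (hc : HasCompactSupport g) (hs : tsupport g ⊆ U) :
    Integrable fun X => a X * g X :=
  (continuous_mul_of_tsupport_subset hU ha hg hs).integrable_of_hasCompactSupport hc.mul_left

theorem tsupport_fderiv_apply_subset {η : Plane → ℝ} (v : Plane) :
    tsupport (fun X => fderiv ℝ η X v) ⊆ tsupport η :=
  (closure_mono (fun X hX => by
    simp only [Function.mem_support] at hX ⊢
    intro h; rw [h] at hX; simp at hX)).trans (tsupport_fderiv_subset ℝ)

/-- The coefficient need only be defined well in U: the product with η is globally differentiable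
since it vanishes near every point outside the support of η. -/
theorem integral_mul_add_eq_zero {U : Set Plane} {a a' η : Plane → ℝ} {v : Plane} (hU : IsOpen U)
    (ha : ContinuousOn a U) (ha' : ContinuousOn a' U)
    (hd : ∀ X ∈ U, HasLineDerivAt ℝ a (a' X) X v)
    (hη : ContDiff ℝ ∞ η) (hc : HasCompactSupport η) (hs : tsupport η ⊆ U) :
    Integrable (fun X => a' X * η X) ∧ Integrable (fun X => a X * fderiv ℝ η X v) ∧
    (∫ X, a' X * η X) + ∫ X, a X * fderiv ℝ η X v = 0 := by
  have hηv : Continuous fun X => fderiv ℝ η X v :=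
    (hη.continuous_fderiv (by simp)).clm_apply continuous_const
  have h1 := integrable_mul_of_tsupport_subset hU ha' hη.continuous hc hs
  have h2 := integrable_mul_of_tsupport_subset hU ha hηv (hc.fderiv_apply ℝ v)
    ((tsupport_fderiv_apply_subset v).trans hs)
  refine ⟨h1, h2, ?_⟩
  rw [← integral_add h1 h2]
  refine integral_hasLineDerivAt_eq_zero (h := fun X => a X * η X) (v := v)
    (integrable_mul_of_tsupport_subset hU ha hη.continuous hc hs) (h1.add h2) fun X => ?_
  by_cases hX : X ∈ tsupport η
  · have e1 := hd X (hs hX)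
    have e2 := (hη.differentiable (by simp) X).hasFDerivAt.hasLineDerivAt v
    have := HasDerivAt.mul e1 e2
    simp only [zero_smul, add_zero] at this
    exact this
  · have h0 : (fun X => a X * η X) =ᶠ[𝓝 X] fun _ => 0 := by
      filter_upwards [(isClosed_tsupport η).isOpen_compl.mem_nhds hX] with Y hY
      rw [image_eq_zero_of_notMem_tsupport hY, mul_zero]
    have e1 : η X = 0 := image_eq_zero_of_notMem_tsupport hX
    have e2 : fderiv ℝ η X v = 0 := image_eq_zero_of_notMem_tsupport
      (f := fun X => fderiv ℝ η X v) (fun h => hX (tsupport_fderiv_apply_subset v h))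
    simp only [e1, e2, mul_zero, add_zero]
    exact (by simpa using (hasFDerivAt_const (0 : ℝ) X).hasLineDerivAt v :
      HasLineDerivAt ℝ (fun _ : Plane => (0 : ℝ)) 0 X v).congr_of_eventuallyEq h0

/-! ### Regularity in the positivity set -/

variable {Ω : Set Plane} {f : ℝ → ℝ} {ψ : Plane → ℝ} {G : Plane → Plane}

@[simp] theorem basisVec_apply (i k : Fin 2) : basisVec i k = if k = i then 1 else 0 := by
  simp [basisVec]

theorem eq_sum_basisVec (v : Plane) : v = v 0 • basisVec 0 + v 1 • basisVec 1 := by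
  ext i; fin_cases i <;> simp

theorem clm_apply_eq (L : Plane →L[ℝ] ℝ) (v : Plane) :
    L v = v 0 * L (basisVec 0) + v 1 * L (basisVec 1) := by
  conv_lhs => rw [eq_sum_basisVec v]
  simp

theorem inner_eq (v w : Plane) : inner ℝ v w = v 0 * w 0 + v 1 * w 1 := by
  simp [PiLp.inner_apply, Fin.sum_univ_two, mul_comm]

theorem norm_sq_eq (v : Plane) : ‖v‖ ^ 2 = v 0 ^ 2 + v 1 ^ 2 := by
  rw [← real_inner_self_eq_norm_sq, inner_eq]; ring

theorem isOpen_inter_right (hΩ : IsFlowDomain Ω) : IsOpen (Ω ∩ {X | 0 < X 0}) := by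
  obtain ⟨-, U, hU, rfl⟩ := hΩ
  have : U ∩ {X : Plane | 0 ≤ X 0} ∩ {X | 0 < X 0} = U ∩ {X | 0 < X 0} := by
    ext X; simp only [mem_inter_iff, mem_ofPred_eq]
    exact ⟨fun h => ⟨h.1.1, h.2⟩, fun h => ⟨⟨h.1, h.2.le⟩, h.2⟩⟩
  rw [this]
  exact hU.inter (isOpen_lt continuous_const (by fun_prop))

theorem measurableSet_domain (hΩ : IsFlowDomain Ω) : MeasurableSet Ω := by
  obtain ⟨-, U, hU, rfl⟩ := hΩ
  exact hU.measurableSet.inter (isClosed_le continuous_const (by fun_prop)).measurableSet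

namespace IsVariationalSolution

theorem pos_fst (hψ : IsVariationalSolution Ω f ψ G) (hΩ : IsFlowDomain Ω) {X : Plane}
    (hX : X ∈ posSet Ω ψ) : 0 < X 0 := by
  have h0 : 0 ≤ X 0 := by
    obtain ⟨-, U, hU, rfl⟩ := hΩ; exact hX.1.2
  rcases h0.eq_or_lt with h | h
  · exact absurd (hψ.zero_on_axis X hX.1 h.symm) hX.2.ne'
  · exact h

theorem posSet_subset (hψ : IsVariationalSolution Ω f ψ G) (hΩ : IsFlowDomain Ω) :
    posSet Ω ψ ⊆ Ω ∩ {X | 0 < X 0} := fun _ hX => ⟨hX.1, hψ.pos_fst hΩ hX⟩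

theorem isOpen_posSet (hψ : IsVariationalSolution Ω f ψ G) (hΩ : IsFlowDomain Ω) :
    IsOpen (posSet Ω ψ) := by
  have h1 := (hψ.continuousOn.mono (inter_subset_left (t := {X | 0 < X 0}))).isOpen_inter_preimage
    (isOpen_inter_right hΩ) (isOpen_Ioi (a := (0 : ℝ)))
  convert h1 using 1
  ext X
  exact ⟨fun h => ⟨hψ.posSet_subset hΩ h, h.2⟩, fun h => ⟨h.1.1, h.2⟩⟩

theorem contDiffOn_partialDeriv (hψ : IsVariationalSolution Ω f ψ G) (hΩ : IsFlowDomain Ω)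
    (i : Fin 2) : ContDiffOn ℝ 1 (partialDeriv i ψ) (posSet Ω ψ) :=
  (hψ.contDiffOn.fderiv_of_isOpen (hψ.isOpen_posSet hΩ) (by norm_num)).clm_apply contDiffOn_const

theorem continuousOn_partialDeriv (hψ : IsVariationalSolution Ω f ψ G) (hΩ : IsFlowDomain Ω)
    (i : Fin 2) : ContinuousOn (partialDeriv i ψ) (posSet Ω ψ) :=
  (hψ.contDiffOn_partialDeriv hΩ i).continuousOn

theorem continuousOn_partialDeriv₂ (hψ : IsVariationalSolution Ω f ψ G) (hΩ : IsFlowDomain Ω)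
    (i k : Fin 2) : ContinuousOn (partialDeriv k (partialDeriv i ψ)) (posSet Ω ψ) :=
  ((hψ.contDiffOn_partialDeriv hΩ i).continuousOn_fderiv_of_isOpen (hψ.isOpen_posSet hΩ)
    le_rfl).clm_apply continuousOn_const

theorem hasLineDerivAt (hψ : IsVariationalSolution Ω f ψ G) (hΩ : IsFlowDomain Ω) {X : Plane}
    (hX : X ∈ posSet Ω ψ) (k : Fin 2) :
    HasLineDerivAt ℝ ψ (partialDeriv k ψ X) X (basisVec k) :=
  ((hψ.contDiffOn.contDiffAt ((hψ.isOpen_posSet hΩ).mem_nhds hX)).differentiableAt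
    (by norm_num)).hasFDerivAt.hasLineDerivAt _

theorem hasLineDerivAt_partialDeriv (hψ : IsVariationalSolution Ω f ψ G) (hΩ : IsFlowDomain Ω)
    {X : Plane} (hX : X ∈ posSet Ω ψ) (i k : Fin 2) :
    HasLineDerivAt ℝ (partialDeriv i ψ) (partialDeriv k (partialDeriv i ψ) X) X (basisVec k) :=
  (((hψ.contDiffOn_partialDeriv hΩ i).contDiffAt ((hψ.isOpen_posSet hΩ).mem_nhds
    hX)).differentiableAt (by norm_num)).hasFDerivAt.hasLineDerivAt _

theorem partialDeriv_comm (hψ : IsVariationalSolution Ω f ψ G) (hΩ : IsFlowDomain Ω)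
    {X : Plane} (hX : X ∈ posSet Ω ψ) :
    partialDeriv 1 (partialDeriv 0 ψ) X = partialDeriv 0 (partialDeriv 1 ψ) X := by
  have hc := hψ.contDiffOn.contDiffAt ((hψ.isOpen_posSet hΩ).mem_nhds hX)
  have hs := hc.isSymmSndFDerivAt (by simp)
  have hd : DifferentiableAt ℝ (fderiv ℝ ψ) X :=
    (hc.fderiv_right (m := 1) (by norm_num)).differentiableAt (by norm_num)
  have h1 : ∀ i k, partialDeriv k (partialDeriv i ψ) X =
      fderiv ℝ (fderiv ℝ ψ) X (basisVec k) (basisVec i) := fun i k => by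
    have := (hd.hasFDerivAt.clm_apply (hasFDerivAt_const (basisVec i) X)).fderiv
    have e : partialDeriv i ψ = fun Y => fderiv ℝ ψ Y (basisVec i) := rfl
    rw [partialDeriv, e, this]; simp
  rw [h1, h1, hs.eq]

end IsVariationalSolution

/-! ### The energy-momentum tensor and its divergence -/

theorem hasLineDerivAt_coord (i : Fin 2) (X v : Plane) :
    HasLineDerivAt ℝ (fun Y : Plane => Y i) (v i) X v := by
  have h : HasDerivAt (fun t : ℝ => X i + t * v i) (1 * v i) 0 :=
    ((hasDerivAt_id (0 : ℝ)).mul_const (v i)).const_add (X i)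
  rw [one_mul] at h
  exact h

theorem hasDerivAt_primitive (hf : Continuous f) (z : ℝ) :
    HasDerivAt (primitive f) (f z) z :=
  (hf.integral_hasStrictDerivAt 0 z).hasDerivAt

theorem continuous_primitive (hf : Continuous f) : Continuous (primitive f) :=
  continuous_iff_continuousAt.2 fun z => (hasDerivAt_primitive hf z).continuousAt

/-- The defect `div (∇ψ / x) + x f(ψ)` in the equation. -/
noncomputable def pdeDefect (f : ℝ → ℝ) (ψ : Plane → ℝ) (X : Plane) : ℝ :=
  (partialDeriv 0 (partialDeriv 0 ψ) X + partialDeriv 1 (partialDeriv 1 ψ) X) / X 0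
    - partialDeriv 0 ψ X / X 0 ^ 2 + X 0 * f (ψ X)

/-- The derivative of `ψ` in direction `e`, in coordinates. -/
noncomputable def dirDeriv (e : Plane) (ψ : Plane → ℝ) (X : Plane) : ℝ :=
  e 0 * partialDeriv 0 ψ X + e 1 * partialDeriv 1 ψ X

/-- The energy density in the positivity set. -/
noncomputable def energyDensity (f : ℝ → ℝ) (ψ : Plane → ℝ) (X : Plane) : ℝ :=
  (partialDeriv 0 ψ X ^ 2 + partialDeriv 1 ψ X ^ 2) / X 0 - 2 * X 0 * primitive f (ψ X)
    + X 0 * X 1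

/-- The components of the energy-momentum tensor, applied to `e`. -/
noncomputable def stressFlux (f : ℝ → ℝ) (ψ : Plane → ℝ) (e : Plane) (k : Fin 2) (X : Plane) : ℝ :=
  e k * energyDensity f ψ X - 2 * dirDeriv e ψ X * partialDeriv k ψ X / X 0

/-- The derivative of the `k`-th component of the energy-momentum tensor in direction `k`. -/
noncomputable def stressFluxDeriv (f : ℝ → ℝ) (ψ : Plane → ℝ) (e : Plane) (k : Fin 2)
    (X : Plane) : ℝ :=
  e k * ((2 * partialDeriv 0 ψ X * partialDeriv k (partialDeriv 0 ψ) X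
      + 2 * partialDeriv 1 ψ X * partialDeriv k (partialDeriv 1 ψ) X) / X 0
      - basisVec k 0 * (partialDeriv 0 ψ X ^ 2 + partialDeriv 1 ψ X ^ 2) / X 0 ^ 2
      - 2 * basisVec k 0 * primitive f (ψ X) - 2 * X 0 * (f (ψ X) * partialDeriv k ψ X)
      + (basisVec k 0 * X 1 + X 0 * basisVec k 1))
  - (2 * (e 0 * partialDeriv k (partialDeriv 0 ψ) X + e 1 * partialDeriv k (partialDeriv 1 ψ) X)
      * partialDeriv k ψ X / X 0
     + 2 * dirDeriv e ψ X * partialDeriv k (partialDeriv k ψ) X / X 0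
     - 2 * dirDeriv e ψ X * partialDeriv k ψ X * basisVec k 0 / X 0 ^ 2)

theorem IsVariationalSolution.hasLineDerivAt_stressFlux (hψ : IsVariationalSolution Ω f ψ G)
    (hΩ : IsFlowDomain Ω) (hf : Continuous f) (e : Plane) (k : Fin 2) {X : Plane}
    (hX : X ∈ posSet Ω ψ) :
    HasLineDerivAt ℝ (stressFlux f ψ e k) (stressFluxDeriv f ψ e k X) X (basisVec k) := by
  have hx0 := (hψ.pos_fst hΩ hX).ne'
  have e0 : X + (0 : ℝ) • basisVec k = X := by simp
  have hx : HasDerivAt (fun t : ℝ => (X + t • basisVec k) 0) (basisVec k 0) 0 :=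
    hasLineDerivAt_coord 0 X _
  have hy : HasDerivAt (fun t : ℝ => (X + t • basisVec k) 1) (basisVec k 1) 0 :=
    hasLineDerivAt_coord 1 X _
  have hp0 : HasDerivAt (fun t : ℝ => partialDeriv 0 ψ (X + t • basisVec k)) _ 0 :=
    hψ.hasLineDerivAt_partialDeriv hΩ hX 0 k
  have hp1 : HasDerivAt (fun t : ℝ => partialDeriv 1 ψ (X + t • basisVec k)) _ 0 :=
    hψ.hasLineDerivAt_partialDeriv hΩ hX 1 k
  have hpk : HasDerivAt (fun t : ℝ => partialDeriv k ψ (X + t • basisVec k)) _ 0 :=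
    hψ.hasLineDerivAt_partialDeriv hΩ hX k k
  have hu : HasDerivAt (fun t : ℝ => ψ (X + t • basisVec k)) _ 0 := hψ.hasLineDerivAt hΩ hX k
  have hF : HasDerivAt (fun t : ℝ => primitive f (ψ (X + t • basisVec k)))
      (f (ψ (X + (0 : ℝ) • basisVec k)) * partialDeriv k ψ X) 0 :=
    HasDerivAt.comp (h₂ := primitive f) (h := fun t : ℝ => ψ (X + t • basisVec k)) (0 : ℝ)
      (hasDerivAt_primitive hf (ψ (X + (0 : ℝ) • basisVec k))) hu
  have hne : (X + (0 : ℝ) • basisVec k) 0 ≠ 0 := by rw [e0]; exact hx0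
  have hE := ((((hp0.fun_pow 2).fun_add (hp1.fun_pow 2)).fun_div hx hne).fun_sub
    ((hx.const_mul 2).fun_mul hF)).fun_add (hx.fun_mul hy)
  have hD := (hp0.const_mul (e 0)).fun_add (hp1.const_mul (e 1))
  have hT := (hE.const_mul (e k)).fun_sub ((((hD.const_mul 2).fun_mul hpk)).fun_div hx hne)
  simp only [e0] at hT
  have goal : HasDerivAt (fun t : ℝ => stressFlux f ψ e k (X + t • basisVec k))
      (stressFluxDeriv f ψ e k X) 0 := by
    refine HasDerivAt.congr_deriv hT ?_
    simp only [stressFluxDeriv, dirDeriv]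
    field_simp
    push_cast
    ring
  exact goal

/-- Noether's identity: the divergence of the energy-momentum tensor in direction e differs from the
explicit X-derivative of the Lagrangian exactly by the Euler–Lagrange expression times the
derivative of ψ along e. Symmetry of the second derivatives is what makes the mixed terms cancel. -/
theorem IsVariationalSolution.sum_stressFluxDeriv (hψ : IsVariationalSolution Ω f ψ G)
    (hΩ : IsFlowDomain Ω) (e : Plane) {X : Plane} (hX : X ∈ posSet Ω ψ) :
    e 0 * (-((partialDeriv 0 ψ X ^ 2 + partialDeriv 1 ψ X ^ 2) / X 0 ^ 2)
        - 2 * primitive f (ψ X) + X 1) + e 1 * X 0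
      - stressFluxDeriv f ψ e 0 X - stressFluxDeriv f ψ e 1 X
      = 2 * dirDeriv e ψ X * pdeDefect f ψ X := by
  have hx0 := (hψ.pos_fst hΩ hX).ne'
  simp only [stressFluxDeriv, dirDeriv, pdeDefect, hψ.partialDeriv_comm hΩ hX, basisVec_apply]
  norm_num
  field_simp
  ring

/-! ### Classical and weak gradient in the positivity set; translations as domain variations -/

variable {Ω : Set Plane} {f : ℝ → ℝ} {ψ : Plane → ℝ} {G : Plane → Plane}

theorem setIntegral_eq_of_tsupport_subset {U : Set Plane} {a η : Plane → ℝ} (hs : tsupport η ⊆ U) :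
    ∫ X in U, a X * η X = ∫ X, a X * η X :=
  setIntegral_eq_integral_of_forall_compl_eq_zero fun X hX => by
    rw [image_eq_zero_of_notMem_tsupport fun h => hX (hs h), mul_zero]

theorem setIntegral_eq_of_tsupport_subset' {U : Set Plane} {a η : Plane → ℝ} (v : Plane)
    (hs : tsupport η ⊆ U) :
    ∫ X in U, a X * fderiv ℝ η X v = ∫ X, a X * fderiv ℝ η X v :=
  setIntegral_eq_of_tsupport_subset (η := fun X => fderiv ℝ η X v)
    ((tsupport_fderiv_apply_subset v).trans hs)

theorem _root_.MeasureTheory.LocallyIntegrableOn.coord {g : Plane → Plane} {U : Set Plane}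
    (h : LocallyIntegrableOn g U) (i : Fin 2) : LocallyIntegrableOn (fun X => g X i) U := by
  intro X hX
  obtain ⟨s, hs, hi⟩ := h X hX
  exact ⟨s, hs, (ContinuousLinearMap.integrable_comp (EuclideanSpace.proj (𝕜 := ℝ) i) hi)⟩

theorem integrable_mul_of_locallyIntegrableOn {a η : Plane → ℝ} {U : Set Plane} (hU : IsOpen U)
    (ha : LocallyIntegrableOn a U) (hη : Continuous η) (hc : HasCompactSupport η)
    (hs : tsupport η ⊆ U) : Integrable fun X => a X * η X := by
  have h1 : IntegrableOn a (tsupport η) :=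
    (locallyIntegrableOn_iff hU.isLocallyClosed).1 ha _ hs hc
  have h2 : IntegrableOn (fun X => a X * η X) (tsupport η) :=
    h1.mul_continuousOn hη.continuousOn hc
  rwa [integrableOn_iff_integrable_of_support_subset] at h2
  exact fun X hX => subset_tsupport η fun h => hX (by simp [h])

/-- Uniqueness of weak derivatives. -/
theorem ae_eq_of_forall_test {a b : Plane → ℝ} {U : Set Plane} (hU : IsOpen U)
    (ha : LocallyIntegrableOn a U) (hb : LocallyIntegrableOn b U)
    (h : ∀ η : Plane → ℝ, ContDiff ℝ ∞ η → HasCompactSupport η → tsupport η ⊆ U →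
      ∫ X, a X * η X = ∫ X, b X * η X) : ∀ᵐ X, X ∈ U → a X = b X := by
  have := hU.ae_eq_zero_of_integral_contDiff_smul_eq_zero (f := fun X => a X - b X) (μ := volume)
    (ha.sub hb) fun η hη hc hs => by
      have h1 := h η hη hc hs
      have i1 := integrable_mul_of_locallyIntegrableOn hU ha hη.continuous hc hs
      have i2 := integrable_mul_of_locallyIntegrableOn hU hb hη.continuous hc hs
      calc ∫ X, η X • (a X - b X) = ∫ X, (a X * η X - b X * η X) := by
            congr 1; ext X; simp only [smul_eq_mul]; ring
        _ = 0 := by rw [integral_sub i1 i2, h1, sub_self]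
  filter_upwards [this] with X hX hXU using sub_eq_zero.1 (hX hXU)

/-- The gradient of `ψ` in the positivity set, extended by `0`. -/
noncomputable def gradPos (Ω : Set Plane) (ψ : Plane → ℝ) (X : Plane) : Plane :=
  (posSet Ω ψ).indicator (fun X => !₂[partialDeriv 0 ψ X, partialDeriv 1 ψ X]) X

theorem gradPos_of_mem {X : Plane} (hX : X ∈ posSet Ω ψ) (i : Fin 2) :
    gradPos Ω ψ X i = partialDeriv i ψ X := by
  rw [gradPos, indicator_of_mem hX]; fin_cases i <;> rfl

theorem gradPos_of_notMem {X : Plane} (hX : X ∉ posSet Ω ψ) : gradPos Ω ψ X = 0 := by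
  rw [gradPos, indicator_of_notMem hX]

namespace IsVariationalSolution

theorem continuousOn_gradPos (hψ : IsVariationalSolution Ω f ψ G) (hΩ : IsFlowDomain Ω) :
    ContinuousOn (gradPos Ω ψ) (posSet Ω ψ) := by
  have h : ContinuousOn (fun X => !₂[partialDeriv 0 ψ X, partialDeriv 1 ψ X]) (posSet Ω ψ) := by
    apply (PiLp.continuous_toLp 2 (fun _ : Fin 2 => ℝ)).comp_continuousOn
    refine continuousOn_pi.2 fun i => ?_
    fin_cases i
    · exact hψ.continuousOn_partialDeriv hΩ 0
    · exact hψ.continuousOn_partialDeriv hΩ 1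
  exact h.congr fun X hX => by rw [gradPos, indicator_of_mem hX]

theorem measurable_gradPos (hψ : IsVariationalSolution Ω f ψ G) (hΩ : IsFlowDomain Ω) :
    Measurable (gradPos Ω ψ) := by
  have hP := (hψ.isOpen_posSet hΩ).measurableSet
  refine measurable_of_restrict_of_restrict_compl hP ?_ ?_
  · exact (continuousOn_iff_continuous_domRestrict.1 (hψ.continuousOn_gradPos hΩ)).measurable
  · have : (posSet Ω ψ)ᶜ.domRestrict (gradPos Ω ψ) = fun _ => 0 := by
      ext1 X; exact gradPos_of_notMem X.2
    rw [this]; exact measurable_const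

/-- In the open set {ψ > 0} the function is C², so its classical derivatives are weak derivatives,
and weak derivatives are unique. -/
theorem ae_grad_eq_of_mem (hψ : IsVariationalSolution Ω f ψ G) (hΩ : IsFlowDomain Ω) :
    ∀ᵐ X, X ∈ posSet Ω ψ → G X = gradPos Ω ψ X := by
  have hP := hψ.isOpen_posSet hΩ
  have hsub := hψ.posSet_subset hΩ
  have key : ∀ i : Fin 2, ∀ᵐ X, X ∈ posSet Ω ψ → G X i = partialDeriv i ψ X := fun i => by
    have hG := (hψ.hasWeakGradient.2.1.coord i).mono_set hsub
    refine ae_eq_of_forall_test hP hG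
      ((hψ.continuousOn_partialDeriv hΩ i).locallyIntegrableOn hP.measurableSet)
      fun η hη hc hs => ?_
    have h1 := hψ.hasWeakGradient.2.2 η hη hc (hs.trans hsub) i
    rw [setIntegral_eq_of_tsupport_subset (a := fun X => G X i) (hs.trans hsub)] at h1
    simp only [partialDeriv] at h1
    rw [setIntegral_eq_of_tsupport_subset' _ (hs.trans hsub)] at h1
    obtain ⟨-, -, h2⟩ := integral_mul_add_eq_zero hP (hψ.continuousOn.mono fun X hX => hX.1)
      (hψ.continuousOn_partialDeriv hΩ i) (fun X hX => hψ.hasLineDerivAt hΩ hX i) hη hc hs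
    linarith
  filter_upwards [key 0, key 1] with X h0 h1 hX
  ext i
  rw [gradPos_of_mem hX]
  fin_cases i
  · exact h0 hX
  · exact h1 hX

theorem continuousOn_comp (hψ : IsVariationalSolution Ω f ψ G) {g : ℝ → ℝ} (hg : Continuous g) :
    ContinuousOn (fun X => g (ψ X)) (posSet Ω ψ) :=
  hg.comp_continuousOn (hψ.continuousOn.mono fun _ hX => hX.1)

theorem continuousOn_dirDeriv (hψ : IsVariationalSolution Ω f ψ G) (hΩ : IsFlowDomain Ω)
    (e : Plane) : ContinuousOn (dirDeriv e ψ) (posSet Ω ψ) :=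
  (continuousOn_const.mul (hψ.continuousOn_partialDeriv hΩ 0)).add
    (continuousOn_const.mul (hψ.continuousOn_partialDeriv hΩ 1))

theorem continuousOn_coord (i : Fin 2) (s : Set Plane) : ContinuousOn (fun X : Plane => X i) s := by
  fun_prop

theorem continuousOn_pdeDefect (hψ : IsVariationalSolution Ω f ψ G) (hΩ : IsFlowDomain Ω)
    (hf : Continuous f) : ContinuousOn (pdeDefect f ψ) (posSet Ω ψ) := by
  have hx := continuousOn_coord 0 (posSet Ω ψ)
  have hx0 : ∀ X ∈ posSet Ω ψ, X 0 ≠ 0 := fun X hX => (hψ.pos_fst hΩ hX).ne'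
  exact ((((hψ.continuousOn_partialDeriv₂ hΩ 0 0).add (hψ.continuousOn_partialDeriv₂ hΩ 1 1)).div
    hx hx0).sub ((hψ.continuousOn_partialDeriv hΩ 0).div (hx.pow 2)
    fun X hX => pow_ne_zero 2 (hx0 X hX))).add (hx.mul (hψ.continuousOn_comp hf))

theorem continuousOn_stressFlux (hψ : IsVariationalSolution Ω f ψ G) (hΩ : IsFlowDomain Ω)
    (hf : Continuous f) (e : Plane) (k : Fin 2) :
    ContinuousOn (stressFlux f ψ e k) (posSet Ω ψ) := by
  have hx := continuousOn_coord 0 (posSet Ω ψ)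
  have hy := continuousOn_coord 1 (posSet Ω ψ)
  have hx0 : ∀ X ∈ posSet Ω ψ, X 0 ≠ 0 := fun X hX => (hψ.pos_fst hΩ hX).ne'
  have hp := fun i => hψ.continuousOn_partialDeriv hΩ i
  have hF := hψ.continuousOn_comp (continuous_primitive hf)
  exact (continuousOn_const.mul ((((((hp 0).pow 2).add ((hp 1).pow 2)).div hx hx0).sub
    ((continuousOn_const.mul hx).mul hF)).add (hx.mul hy))).sub
    (((continuousOn_const.mul (hψ.continuousOn_dirDeriv hΩ e)).mul (hp k)).div hx hx0)

theorem continuousOn_stressFluxDeriv (hψ : IsVariationalSolution Ω f ψ G) (hΩ : IsFlowDomain Ω)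
    (hf : Continuous f) (e : Plane) (k : Fin 2) :
    ContinuousOn (stressFluxDeriv f ψ e k) (posSet Ω ψ) := by
  have hx := continuousOn_coord 0 (posSet Ω ψ)
  have hy := continuousOn_coord 1 (posSet Ω ψ)
  have hx0 : ∀ X ∈ posSet Ω ψ, X 0 ≠ 0 := fun X hX => (hψ.pos_fst hΩ hX).ne'
  have hx2 : ∀ X ∈ posSet Ω ψ, X 0 ^ 2 ≠ 0 := fun X hX => pow_ne_zero 2 (hx0 X hX)
  have hp := fun i => hψ.continuousOn_partialDeriv hΩ i
  have hq := fun i k => hψ.continuousOn_partialDeriv₂ hΩ i k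
  have hF := hψ.continuousOn_comp (continuous_primitive hf)
  have hfc := hψ.continuousOn_comp hf
  have hD := hψ.continuousOn_dirDeriv hΩ e
  have c : ∀ r : ℝ, ContinuousOn (fun _ : Plane => r) (posSet Ω ψ) := fun r => continuousOn_const
  unfold stressFluxDeriv
  exact ((c (e k)).mul
    (((((((((c 2).mul (hp 0)).mul (hq 0 k)).add (((c 2).mul (hp 1)).mul (hq 1 k))).div hx hx0).sub
    (((c _).mul (((hp 0).pow 2).add ((hp 1).pow 2))).div (hx.pow 2) hx2)).sub
    ((c _).mul hF)).sub (((c 2).mul hx).mul (hfc.mul (hp k)))).add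
    (((c _).mul hy).add (hx.mul (c _))))).sub
    ((((((c 2).mul (((c _).mul (hq 0 k)).add ((c _).mul (hq 1 k)))).mul (hp k)).div hx hx0).add
    ((((c 2).mul hD).mul (hq k k)).div hx hx0)).sub
    (((((c 2).mul hD).mul (hp k)).mul (c _)).div (hx.pow 2) hx2))

/-- The domain variation is tested with η e, η supported in {ψ > 0}, and integrated by parts. Only
the product with the gradient comes out: an inner variation sees nothing where ∇ψ = 0, and that case
needs a separate argument. -/
theorem dirDeriv_mul_pdeDefect (hψ : IsVariationalSolution Ω f ψ G) (hΩ : IsFlowDomain Ω)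
    (hf : Continuous f) (e : Plane) {X : Plane} (hX : X ∈ posSet Ω ψ) :
    dirDeriv e ψ X * pdeDefect f ψ X = 0 := by
  have hP := hψ.isOpen_posSet hΩ
  have hPΩ : posSet Ω ψ ⊆ Ω := fun X hX => hX.1
  have hx := continuousOn_coord 0 (posSet Ω ψ)
  have hy := continuousOn_coord 1 (posSet Ω ψ)
  have hx0 : ∀ X ∈ posSet Ω ψ, X 0 ≠ 0 := fun X hX => (hψ.pos_fst hΩ hX).ne'
  have hx2 : ∀ X ∈ posSet Ω ψ, X 0 ^ 2 ≠ 0 := fun X hX => pow_ne_zero 2 (hx0 X hX)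
  have hp := fun i => hψ.continuousOn_partialDeriv hΩ i
  have hF := hψ.continuousOn_comp (continuous_primitive hf)
  have hcont : ContinuousOn (fun X => dirDeriv e ψ X * pdeDefect f ψ X) (posSet Ω ψ) :=
    (hψ.continuousOn_dirDeriv hΩ e).mul (hψ.continuousOn_pdeDefect hΩ hf)
  have hae : ∀ᵐ X, X ∈ posSet Ω ψ → dirDeriv e ψ X * pdeDefect f ψ X = 0 := by
    refine ae_eq_of_forall_test hP (hcont.locallyIntegrableOn hP.measurableSet)
      (b := fun _ => 0) (locallyIntegrableOn_const _) fun η hη hc hs => ?_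
    simp only [zero_mul, integral_zero]
    have hφ : ContDiff ℝ ∞ fun X => η X • e := hη.smul contDiff_const
    have hsupp : tsupport (fun X => η X • e) ⊆ tsupport η := tsupport_smul_subset_left η _
    have hvar := hψ.domain_variation (fun X => η X • e) hφ
      (hc.smul_right (f' := fun _ => e))
      (fun X hX => hPΩ (hs (hsupp hX.1)))
      (fun X hX => by
        have : X ∉ tsupport η := fun h => (hx0 X (hs h)) hX
        rw [image_eq_zero_of_notMem_tsupport this]; simp)
    have hfd : ∀ X v, fderiv ℝ (fun X => η X • e) X v = fderiv ℝ η X v • e := fun X v => by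
      have := ((hη.differentiable (by simp) X).hasFDerivAt.smul_const e).fderiv
      rw [this]; simp
    set b₀ : Plane → ℝ := fun X => -((partialDeriv 0 ψ X ^ 2 + partialDeriv 1 ψ X ^ 2) / X 0 ^ 2)
        - 2 * primitive f (ψ X) + X 1 with hb₀
    have hb₀c : ContinuousOn b₀ (posSet Ω ψ) :=
      (((((hp 0).pow 2).add ((hp 1).pow 2)).div (hx.pow 2) hx2).neg.sub
        (continuousOn_const.mul hF)).add hy
    have hη0 : ∀ X, X ∉ posSet Ω ψ → η X = 0 := fun X hX =>
      image_eq_zero_of_notMem_tsupport fun h => hX (hs h)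
    have hηd : ∀ X v, X ∉ posSet Ω ψ → fderiv ℝ η X v = 0 := fun X v hX =>
      image_eq_zero_of_notMem_tsupport (f := fun X => fderiv ℝ η X v)
        fun h => hX (hs (tsupport_fderiv_apply_subset v h))
    have hχ : ∀ X ∈ posSet Ω ψ, chiPos ψ X = 1 := fun X hX => by simp [chiPos, hX.2]
    have hG := hψ.ae_grad_eq_of_mem hΩ
    have e1 : (∫ X in Ω, ((‖G X‖ ^ 2 / X 0 - 2 * X 0 * primitive f (ψ X) + X 0 * X 1 * chiPos ψ X)
          * divergence (fun X => η X • e) X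
        - 2 / X 0 * inner ℝ (G X) (fderiv ℝ (fun X => η X • e) X (G X)))) =
        (∫ X, stressFlux f ψ e 0 X * fderiv ℝ η X (basisVec 0)) +
        ∫ X, stressFlux f ψ e 1 X * fderiv ℝ η X (basisVec 1) := by
      have i := fun k => (integral_mul_add_eq_zero hP (hψ.continuousOn_stressFlux hΩ hf e k)
        (hψ.continuousOn_stressFluxDeriv hΩ hf e k)
        (fun X hX => hψ.hasLineDerivAt_stressFlux hΩ hf e k hX) hη hc hs).2.1
      rw [← integral_add (i 0) (i 1)]
      refine Eq.trans ?_ (setIntegral_eq_integral_of_forall_compl_eq_zero (s := Ω)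
        fun X hX => by rw [hηd X _ fun h => hX (hPΩ h), hηd X _ fun h => hX (hPΩ h)]; simp)
      refine integral_congr_ae (ae_restrict_of_ae ?_)
      filter_upwards [hG] with X hGX
      simp only [divergence, hfd, inner_smul_right, Fin.sum_univ_two, PiLp.smul_apply, smul_eq_mul]
      by_cases hXP : X ∈ posSet Ω ψ
      · rw [hGX hXP, hχ X hXP, clm_apply_eq (fderiv ℝ η X) (gradPos Ω ψ X), norm_sq_eq, inner_eq]
        simp only [gradPos_of_mem hXP, stressFlux, dirDeriv, energyDensity]
        ring
      · rw [hηd X _ hXP, hηd X _ hXP, hηd X _ hXP]; simp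
    have e2 : (∫ X in Ω, (-(‖G X‖ ^ 2 / X 0 ^ 2) - 2 * primitive f (ψ X) + X 1 * chiPos ψ X)
        * (η X • e) 0) = ∫ X, e 0 * b₀ X * η X := by
      refine Eq.trans ?_ (setIntegral_eq_integral_of_forall_compl_eq_zero (s := Ω)
        fun X hX => by rw [hη0 X fun h => hX (hPΩ h)]; simp)
      refine integral_congr_ae (ae_restrict_of_ae ?_)
      filter_upwards [hG] with X hGX
      by_cases hXP : X ∈ posSet Ω ψ
      · rw [hGX hXP, hχ X hXP, norm_sq_eq]
        simp only [gradPos_of_mem hXP, hb₀, PiLp.smul_apply, smul_eq_mul]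
        ring
      · rw [hη0 X hXP]; simp
    have e3 : (∫ X in Ω, X 0 * chiPos ψ X * (η X • e) 1) = ∫ X : Plane, e 1 * X 0 * η X := by
      refine Eq.trans ?_ (setIntegral_eq_integral_of_forall_compl_eq_zero (s := Ω)
        fun X hX => by rw [hη0 X fun h => hX (hPΩ h)]; simp)
      refine integral_congr_ae (ae_restrict_of_ae (Eventually.of_forall fun X => ?_))
      by_cases hXP : X ∈ posSet Ω ψ
      · simp only [hχ X hXP, PiLp.smul_apply, smul_eq_mul]; ring
      · simp [hη0 X hXP]
    rw [e1, e2, e3] at hvar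
    have J := fun k => integral_mul_add_eq_zero hP (hψ.continuousOn_stressFlux hΩ hf e k)
        (hψ.continuousOn_stressFluxDeriv hΩ hf e k)
        (fun X hX => hψ.hasLineDerivAt_stressFlux hΩ hf e k hX) hη hc hs
    have i1 : Integrable fun X => e 0 * b₀ X * η X :=
      integrable_mul_of_tsupport_subset hP (continuousOn_const.mul hb₀c) hη.continuous hc hs
    have i2 : Integrable fun X : Plane => e 1 * X 0 * η X :=
      integrable_mul_of_tsupport_subset hP (continuousOn_const.mul hx) hη.continuous hc hs
    have hfin : ∫ X, 2 * (dirDeriv e ψ X * pdeDefect f ψ X * η X) =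
        ((∫ X, e 0 * b₀ X * η X) + ∫ X : Plane, e 1 * X 0 * η X) -
        (∫ X, stressFluxDeriv f ψ e 0 X * η X) - ∫ X, stressFluxDeriv f ψ e 1 X * η X := by
      have i3 : Integrable fun X : Plane => e 0 * b₀ X * η X + e 1 * X 0 * η X := i1.add i2
      have i4 : Integrable fun X : Plane => e 0 * b₀ X * η X + e 1 * X 0 * η X -
        stressFluxDeriv f ψ e 0 X * η X := i3.sub (J 0).1
      rw [← integral_add i1 i2, ← integral_sub i3 (J 0).1, ← integral_sub i4 (J 1).1]
      congr 1; ext X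
      by_cases hXP : X ∈ posSet Ω ψ
      · have := hψ.sum_stressFluxDeriv hΩ e hXP
        simp only [hb₀]
        linear_combination (-η X) * this
      · simp [hη0 X hXP]
    rw [integral_const_mul] at hfin
    have := (J 0).2.2
    have := (J 1).2.2
    linarith
  -- Both sides are continuous in the open positivity set, so the almost everywhere identity holds
  -- everywhere.
  exact Measure.eqOn_open_of_ae_eq (μ := volume) ((ae_restrict_iff' hP.measurableSet).2 hae) hP hcont
    continuousOn_const hX

end IsVariationalSolution

/-! ### The equation in the positivity set and integration by parts up to the free boundary -/

variable {Ω : Set Plane} {f : ℝ → ℝ} {ψ : Plane → ℝ} {G : Plane → Plane}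

theorem continuous_truncDeriv {ε : ℝ} (hε : 0 < ε) : Continuous (truncDeriv ε) := by
  refine continuous_iff_continuousAt.2 fun s => ?_
  rcases lt_or_ge s ε with h | h
  · have h1 : truncDeriv ε =ᶠ[𝓝 s] fun _ => 0 := by
      filter_upwards [Iio_mem_nhds h] with y hy using truncDeriv_eq_zero (le_of_lt hy)
    exact continuousAt_const.congr h1.symm
  · have hs : s ≠ 0 := (hε.trans_le h).ne'
    unfold truncDeriv
    have h1 : ContinuousAt (fun s : ℝ => max (s - ε) 0 / s) s :=
      ContinuousAt.div (by fun_prop) continuousAt_id hs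
    exact (continuousAt_const.mul h1).sub (h1.pow 2)

namespace IsVariationalSolution

/-- The equation holds in the whole positivity set. -/
theorem pdeDefect_eq_zero (hψ : IsVariationalSolution Ω f ψ G) (hΩ : IsFlowDomain Ω)
    (hf : Continuous f) {X₀ : Plane} (hX₀ : X₀ ∈ Ω) (h0 : ψ X₀ = 0) {X₁ : Plane}
    (hX₁ : X₁ ∈ posSet Ω ψ) : pdeDefect f ψ X₁ = 0 := by
  by_contra hN
  have hP := hψ.isOpen_posSet hΩ
  have hNc := hψ.continuousOn_pdeDefect hΩ hf
  -- Where the equation fails the gradient vanishes on an open set, so ψ is locally constant there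
  -- and the defect reduces to x f(ψ).
  set Z : Set Plane := {X | X ∈ posSet Ω ψ ∧ pdeDefect f ψ X ≠ 0} with hZ
  have hZo : IsOpen Z := hNc.isOpen_inter_preimage hP isOpen_compl_singleton
  have hp : ∀ i, ∀ X ∈ Z, partialDeriv i ψ X = 0 := fun i X hX => by
    have := hψ.dirDeriv_mul_pdeDefect hΩ hf (basisVec i) hX.1
    have h1 := (mul_eq_zero.1 this).resolve_right hX.2
    fin_cases i <;> simpa [dirDeriv] using h1
  have hNf : ∀ X ∈ Z, pdeDefect f ψ X = X 0 * f (ψ X) := fun X hX => by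
    have h1 : ∀ i k, partialDeriv k (partialDeriv i ψ) X = 0 := fun i k => by
      have : partialDeriv i ψ =ᶠ[𝓝 X] fun _ => 0 := by
        filter_upwards [hZo.mem_nhds hX] with Y hY using hp i Y hY
      rw [partialDeriv, this.fderiv_eq]; simp
    rw [pdeDefect, h1, h1, hp 0 X hX]; simp
  set c := ψ X₁ with hc
  have hc0 : 0 < c := hX₁.2
  have : PreconnectedSpace Ω := isPreconnected_iff_preconnectedSpace.1 hΩ.1.isPreconnected
  -- This set is relatively open because ψ is locally constant on Z. It is closed because at a limit
  -- point ψ = c > 0 and the defect, being continuous, still equals x f(c), which is nonzero.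
  set A : Set Ω := {X | ψ X = c ∧ (X : Plane) ∈ Z} with hA
  have hfc : X₁ 0 * f c ≠ 0 := by rw [hc, ← hNf X₁ ⟨hX₁, hN⟩]; exact hN
  have hopen : IsOpen A := by
    rw [isOpen_iff_mem_nhds]
    rintro X ⟨hXc, hXZ⟩
    obtain ⟨ε, hε, hball⟩ := Metric.isOpen_iff.1 hZo X hXZ
    have hconst : ∀ Y ∈ Metric.ball (X : Plane) ε, ψ Y = ψ X := fun Y hY => by
      refine Metric.isOpen_ball.is_const_of_fderiv_eq_zero (𝕜 := ℝ)
        (convex_ball (X : Plane) ε).isPreconnected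
        ((hψ.contDiffOn.differentiableOn (by norm_num)).mono fun W hW => (hball hW).1)
        (fun W hW => ?_) hY (Metric.mem_ball_self hε)
      ext v
      rw [clm_apply_eq (fderiv ℝ ψ W) v]
      have h0 := hp 0 W (hball hW)
      have h1 := hp 1 W (hball hW)
      simp only [partialDeriv] at h0 h1
      rw [h0, h1]; simp
    have : Subtype.val ⁻¹' Metric.ball (X : Plane) ε ∈ 𝓝 X :=
      continuous_subtype_val.continuousAt.preimage_mem_nhds (Metric.ball_mem_nhds _ hε)
    filter_upwards [this] with Y hY
    exact ⟨(hconst Y hY).trans hXc, hball hY⟩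
  have hclosed : IsClosed A := by
    rw [← closure_subset_iff_isClosed]
    intro X hX
    have hψc : Continuous fun X : Ω => ψ X := continuousOn_iff_continuous_domRestrict.1 hψ.continuousOn
    have h1 : ψ X = c :=
      closure_minimal (fun Y hY => hY.1) (isClosed_eq hψc continuous_const) hX
    have hXP : (X : Plane) ∈ posSet Ω ψ := ⟨X.2, by rw [h1]; exact hc0⟩
    refine ⟨h1, hXP, ?_⟩
    have h2 : ContinuousAt (fun Y : Ω => pdeDefect f ψ Y - (Y : Plane) 0 * f c) X := by
      have a1 : ContinuousAt (fun Y : Plane => pdeDefect f ψ Y - Y 0 * f c) X :=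
        (hNc.continuousAt (hP.mem_nhds hXP)).sub (by fun_prop)
      exact a1.comp continuous_subtype_val.continuousAt
    have h3 : pdeDefect f ψ X - (X : Plane) 0 * f c = 0 := by
      by_contra hne
      have h4 := h2.eventually_ne hne
      have h5 := mem_closure_iff_frequently.1 hX
      obtain ⟨Y, hY1, hY2⟩ := (h5.and_eventually h4).exists
      exact hY2 (by rw [hNf Y hY1.2, hY1.1, sub_self])
    rw [sub_eq_zero.1 h3]
    exact mul_ne_zero (hψ.pos_fst hΩ hXP).ne' (right_ne_zero_of_mul hfc)
  -- Connectedness of Ω would make ψ identically c > 0, against the zero at X₀.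
  have huniv : A = univ := IsClopen.eq_univ ⟨hclosed, hopen⟩ ⟨⟨X₁, hX₁.1⟩, rfl, hX₁, hN⟩
  have : (⟨X₀, hX₀⟩ : Ω) ∈ A := huniv ▸ mem_univ _
  have h2 : ψ X₀ = c := this.1
  linarith

/-- The product lives on {ψ ≥ ε} ∩ supp η, which is closed; taking the closure of the support
therefore does not reach the free boundary. -/
theorem tsupport_trunc_subset (hψ : IsVariationalSolution Ω f ψ G)
    {b : ℝ → ℝ} {ε : ℝ} (hε : 0 < ε) (hb : ∀ s ≤ ε, b s = 0)
    {η : Plane → ℝ} (hs : tsupport η ⊆ Ω ∩ {X | 0 < X 0}) :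
    tsupport (fun X => b (ψ X) * η X) ⊆ posSet Ω ψ ∩ tsupport η := by
  have hK : IsClosed (tsupport η ∩ ψ ⁻¹' Ici ε) :=
    (hψ.continuousOn.mono (hs.trans inter_subset_left)).preimage_isClosed_of_isClosed
      (isClosed_tsupport η) isClosed_Ici
  have h1 : tsupport (fun X => b (ψ X) * η X) ⊆ tsupport η ∩ ψ ⁻¹' Ici ε := by
    refine closure_minimal (fun X hX => ?_) hK
    have hX' : b (ψ X) * η X ≠ 0 := hX
    refine ⟨subset_tsupport η (right_ne_zero_of_mul hX'), ?_⟩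
    by_contra h
    exact left_ne_zero_of_mul hX' (hb _ (not_le.1 h).le)
  exact fun X hX => ⟨⟨(hs (h1 hX).1).1, hε.trans_le (h1 hX).2⟩, (h1 hX).1⟩

theorem continuous_trunc_mul (hψ : IsVariationalSolution Ω f ψ G) (hΩ : IsFlowDomain Ω)
    {b : ℝ → ℝ} (hbc : Continuous b)
    {η : Plane → ℝ} (hη : Continuous η) (hs : tsupport η ⊆ Ω ∩ {X | 0 < X 0}) :
    Continuous (fun X => b (ψ X) * η X) :=
  continuous_mul_of_tsupport_subset (isOpen_inter_right hΩ)
    (hbc.comp_continuousOn (hψ.continuousOn.mono inter_subset_left)) hη hs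

/-- Integration by parts with a truncation that vanishes near the free boundary. -/
theorem integral_trunc_mul (hψ : IsVariationalSolution Ω f ψ G) (hΩ : IsFlowDomain Ω)
    {a a' : Plane → ℝ} {k : Fin 2} (ha : ContinuousOn a (posSet Ω ψ))
    (ha' : ContinuousOn a' (posSet Ω ψ))
    (hd : ∀ X ∈ posSet Ω ψ, HasLineDerivAt ℝ a (a' X) X (basisVec k)) {ε : ℝ} (hε : 0 < ε)
    {η : Plane → ℝ} (hη : ContDiff ℝ ∞ η) (hc : HasCompactSupport η)
    (hs : tsupport η ⊆ Ω ∩ {X | 0 < X 0}) :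
    Integrable (fun X => partialDeriv k ψ X * a X * (truncDeriv ε (ψ X) * η X)) ∧
    Integrable (fun X => a' X * (trunc ε (ψ X) * η X)) ∧
    Integrable (fun X => a X * (trunc ε (ψ X) * partialDeriv k η X)) ∧
    (∫ X, partialDeriv k ψ X * a X * (truncDeriv ε (ψ X) * η X)) +
      (∫ X, a' X * (trunc ε (ψ X) * η X)) +
      ∫ X, a X * (trunc ε (ψ X) * partialDeriv k η X) = 0 := by
  have hP := hψ.isOpen_posSet hΩ
  have hη1 : Continuous (partialDeriv k η) :=
    (hη.continuous_fderiv (by simp)).clm_apply continuous_const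
  have hc1 : HasCompactSupport (partialDeriv k η) := hc.fderiv_apply ℝ (basisVec k)
  have hs1 : tsupport (partialDeriv k η) ⊆ Ω ∩ {X | 0 < X 0} :=
    (tsupport_fderiv_apply_subset _).trans hs
  have hb1 : ∀ s ≤ ε, trunc ε s = 0 := fun s h => trunc_eq_zero h
  have hb2 : ∀ s ≤ ε, truncDeriv ε s = 0 := fun s h => truncDeriv_eq_zero h
  have i1 : Integrable (fun X => partialDeriv k ψ X * a X * (truncDeriv ε (ψ X) * η X)) :=
    integrable_mul_of_tsupport_subset hP ((hψ.continuousOn_partialDeriv hΩ k).mul ha)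
    (hψ.continuous_trunc_mul hΩ (continuous_truncDeriv hε) hη.continuous hs) hc.mul_left
    ((hψ.tsupport_trunc_subset hε hb2 hs).trans inter_subset_left)
  have i2 := integrable_mul_of_tsupport_subset hP ha'
    (hψ.continuous_trunc_mul hΩ (continuous_trunc hε) hη.continuous hs) hc.mul_left
    ((hψ.tsupport_trunc_subset hε hb1 hs).trans inter_subset_left)
  have i3 := integrable_mul_of_tsupport_subset hP ha
    (hψ.continuous_trunc_mul hΩ (continuous_trunc hε) hη1 hs1) hc1.mul_left
    ((hψ.tsupport_trunc_subset hε hb1 hs1).trans inter_subset_left)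
  have i0 := integrable_mul_of_tsupport_subset hP ha
    (hψ.continuous_trunc_mul hΩ (continuous_trunc hε) hη.continuous hs) hc.mul_left
    ((hψ.tsupport_trunc_subset hε hb1 hs).trans inter_subset_left)
  refine ⟨i1, i2, i3, ?_⟩
  have i12 : Integrable fun X => partialDeriv k ψ X * a X * (truncDeriv ε (ψ X) * η X) +
    a' X * (trunc ε (ψ X) * η X) := i1.add i2
  rw [← integral_add i1 i2, ← integral_add i12 i3]
  refine integral_hasLineDerivAt_eq_zero i0 (i12.add i3) (v := basisVec k) fun X => ?_
  by_cases hX : X ∈ tsupport fun X => trunc ε (ψ X) * η X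
  · have hXP := ((hψ.tsupport_trunc_subset hε hb1 hs) hX).1
    have e0 : X + (0 : ℝ) • basisVec k = X := by simp
    have d1 : HasDerivAt (fun t : ℝ => a (X + t • basisVec k)) (a' X) 0 := hd X hXP
    have d2 : HasDerivAt (fun t : ℝ => ψ (X + t • basisVec k)) (partialDeriv k ψ X) 0 :=
      hψ.hasLineDerivAt hΩ hXP k
    have d3 : HasDerivAt (fun t : ℝ => trunc ε (ψ (X + t • basisVec k)))
        (truncDeriv ε (ψ (X + (0 : ℝ) • basisVec k)) * partialDeriv k ψ X) 0 :=
      HasDerivAt.comp (h₂ := trunc ε) (h := fun t : ℝ => ψ (X + t • basisVec k)) (0 : ℝ)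
        (hasDerivAt_trunc hε _) d2
    have d4 : HasDerivAt (fun t : ℝ => η (X + t • basisVec k)) (partialDeriv k η X) 0 :=
      (hη.differentiable (by simp) X).hasFDerivAt.hasLineDerivAt (basisVec k)
    have d5 := d1.fun_mul (d3.fun_mul d4)
    simp only [e0] at d5
    refine HasDerivAt.congr_deriv (f := fun t : ℝ => a (X + t • basisVec k) *
      (trunc ε (ψ (X + t • basisVec k)) * η (X + t • basisVec k))) d5 ?_
    ring
  · have h0 : (fun X => a X * (trunc ε (ψ X) * η X)) =ᶠ[𝓝 X] fun _ => 0 := by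
      filter_upwards [(isClosed_tsupport _).isOpen_compl.mem_nhds hX] with Y hY
      rw [image_eq_zero_of_notMem_tsupport hY, mul_zero]
    have hz : (partialDeriv k ψ X * a X * (truncDeriv ε (ψ X) * η X) +
        a' X * (trunc ε (ψ X) * η X)) + a X * (trunc ε (ψ X) * partialDeriv k η X) = 0 := by
      rw [image_eq_zero_of_notMem_tsupport hX]
      by_cases hXη : X ∈ tsupport η
      · have hψc : ContinuousAt ψ X :=
          (hψ.continuousOn.mono inter_subset_left).continuousAt
            ((isOpen_inter_right hΩ).mem_nhds (hs hXη))
        -- If ψ exceeded ε at this point of supp η, the product would be nonzero at points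
        -- arbitrarily close to it, contrary to X lying outside its support.
        have hle : ψ X ≤ ε := by
          by_contra hlt
          push Not at hlt
          apply hX
          have hfr := mem_closure_iff_frequently.1 hXη
          refine mem_closure_iff_frequently.2 ((hfr.and_eventually
            (hψc.eventually_const_lt hlt)).mono fun Y hY => ?_)
          have h1 : 0 < trunc ε (ψ Y) := by
            have h2 : ε < ψ Y := hY.2
            have h3 : 0 < ψ Y := hε.trans h2
            simp only [trunc]
            rw [max_eq_left (by linarith)]
            have : 0 < ψ Y - ε := by linarith
            positivity
          exact mul_ne_zero h1.ne' hY.1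
        rw [hb1 _ hle, hb2 _ hle]; simp
      · have e1 : η X = 0 := image_eq_zero_of_notMem_tsupport hXη
        have e2 : partialDeriv k η X = 0 := image_eq_zero_of_notMem_tsupport
          (f := partialDeriv k η) (fun h => hXη (tsupport_fderiv_apply_subset _ h))
        rw [e1, e2]; simp
    rw [hz]
    exact (by simpa using (hasFDerivAt_const (0 : ℝ) X).hasLineDerivAt (basisVec k) :
      HasLineDerivAt ℝ (fun _ : Plane => (0 : ℝ)) 0 X (basisVec k)).congr_of_eventuallyEq h0

/-- Dominated convergence. The density must vanish on {ψ = 0}, since `truncDeriv` tends to 0 there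
and to 1 on {ψ > 0}. -/
theorem tendsto_integral_truncDeriv (hψ : IsVariationalSolution Ω f ψ G)
    {b : Plane → ℝ} {U : Set Plane} (hU : U ⊆ Ω) (hm : ∀ m, AEStronglyMeasurable
      (fun X => b X * truncDeriv (level m) (ψ X)))
    (hb : Integrable b) (hb0 : ∀ X, X ∉ U → b X = 0) (hb1 : ∀ X ∈ U, ψ X = 0 → b X = 0) :
    Tendsto (fun m => ∫ X, b X * truncDeriv (level m) (ψ X)) atTop (𝓝 (∫ X, b X)) := by
  refine tendsto_integral_filter_of_dominated_convergence (fun X => ‖b X‖)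
    (Eventually.of_forall hm) (Eventually.of_forall fun m => Eventually.of_forall fun X => ?_)
    hb.norm (Eventually.of_forall fun X => ?_)
  · obtain ⟨h1, h2⟩ := truncDeriv_mem (s := ψ X) (level_pos m)
    rw [norm_mul, Real.norm_of_nonneg h1]
    exact mul_le_of_le_one_right (norm_nonneg _) h2
  · by_cases hX : X ∈ U
    · rcases (hψ.nonneg X (hU hX)).eq_or_lt with h | h
      · simp [hb1 X hX h.symm]
      · simpa using (tendsto_truncDeriv h).const_mul (b X)
    · simp [hb0 X hX]

theorem tendsto_integral_trunc (hψ : IsVariationalSolution Ω f ψ G)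
    {b : Plane → ℝ} {U : Set Plane} (hU : U ⊆ Ω)
    (hm : ∀ m, AEStronglyMeasurable (fun X => b X * trunc (level m) (ψ X)))
    (hb : Integrable fun X => b X * ψ X) (hb0 : ∀ X, X ∉ U → b X = 0) :
    Tendsto (fun m => ∫ X, b X * trunc (level m) (ψ X)) atTop (𝓝 (∫ X, b X * ψ X)) := by
  refine tendsto_integral_filter_of_dominated_convergence (fun X => ‖b X * ψ X‖)
    (Eventually.of_forall hm) (Eventually.of_forall fun m => Eventually.of_forall fun X => ?_)
    hb.norm (Eventually.of_forall fun X => ?_)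
  · by_cases hX : X ∈ U
    · obtain ⟨h1, h2⟩ := trunc_mem (level_pos m) (hψ.nonneg X (hU hX))
      rw [norm_mul, norm_mul, Real.norm_of_nonneg h1, Real.norm_of_nonneg (hψ.nonneg X (hU hX))]
      gcongr
    · simp [hb0 X hX]
  · by_cases hX : X ∈ U
    · exact (tendsto_trunc (hψ.nonneg X (hU hX))).const_mul (b X)
    · simp [hb0 X hX]

theorem aestronglyMeasurable_gradPos_coord (hψ : IsVariationalSolution Ω f ψ G)
    (hΩ : IsFlowDomain Ω) (i : Fin 2) (μ : Measure Plane) :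
    AEStronglyMeasurable (fun X => gradPos Ω ψ X i) μ := by
  have h : Measurable fun X => gradPos Ω ψ X i :=
    (by fun_prop : Measurable fun X : Plane => X i).comp (hψ.measurable_gradPos hΩ)
  exact h.aestronglyMeasurable

/-- The weak gradient of `ψ` is the classical one in `{ψ > 0}` and vanishes elsewhere. -/
theorem ae_grad_eq (hψ : IsVariationalSolution Ω f ψ G) (hΩ : IsFlowDomain Ω) :
    ∀ᵐ X, X ∈ Ω ∩ {X | 0 < X 0} → G X = gradPos Ω ψ X := by
  have hO := isOpen_inter_right hΩ
  have hG := hψ.ae_grad_eq_of_mem hΩ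
  -- The extension by zero is dominated by G, which provides its local integrability without any
  -- knowledge of G on {ψ = 0}.
  have hle : ∀ᵐ X, ∀ i, ‖gradPos Ω ψ X i‖ ≤ ‖G X i‖ := by
    filter_upwards [hG] with X hX i
    by_cases h : X ∈ posSet Ω ψ
    · rw [hX h]
    · rw [gradPos_of_notMem h]; simp
  have key : ∀ i : Fin 2, ∀ᵐ X, X ∈ Ω ∩ {X | 0 < X 0} → G X i = gradPos Ω ψ X i := fun i => by
    have hGi := hψ.hasWeakGradient.2.1.coord i
    refine ae_eq_of_forall_test hO hGi ?_ fun η hη hc hs => ?_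
    · intro X hX
      obtain ⟨s, hs, hi⟩ := hGi X hX
      exact ⟨s, hs, Integrable.mono hi (hψ.aestronglyMeasurable_gradPos_coord hΩ i _)
        (ae_restrict_of_ae (hle.mono fun X hX => hX i))⟩
    · have h1 := hψ.hasWeakGradient.2.2 η hη hc hs i
      rw [setIntegral_eq_of_tsupport_subset (a := fun X => G X i) hs] at h1
      simp only [partialDeriv] at h1
      rw [setIntegral_eq_of_tsupport_subset' _ hs] at h1
      have hI : Integrable fun X => gradPos Ω ψ X i * η X :=
        (integrable_mul_of_locallyIntegrableOn hO hGi hη.continuous hc hs).mono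
        ((hψ.aestronglyMeasurable_gradPos_coord hΩ i _).mul hη.continuous.aestronglyMeasurable)
        (hle.mono fun X hX => by rw [norm_mul, norm_mul]; gcongr; exact hX i)
      have hηi : Continuous (partialDeriv i η) :=
        (hη.continuous_fderiv (by simp)).clm_apply continuous_const
      have hsi : tsupport (partialDeriv i η) ⊆ Ω ∩ {X | 0 < X 0} :=
        (tsupport_fderiv_apply_subset _).trans hs
      have hI2 : Integrable fun X => partialDeriv i η X * ψ X := by
        have := integrable_mul_of_tsupport_subset hO (hψ.continuousOn.mono inter_subset_left)
          hηi (hc.fderiv_apply ℝ (basisVec i)) hsi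
        exact this.congr (Eventually.of_forall fun X => mul_comm _ _)
      -- With coefficient 1 the truncated identity says that `truncDeriv` times the classical
      -- gradient is the weak gradient of the truncation of ψ; the limit identifies the weak
      -- gradient of ψ itself.
      have hk := fun m => hψ.integral_trunc_mul hΩ (a := fun _ => 1) (a' := fun _ => 0) (k := i)
        continuousOn_const continuousOn_const (fun X _ => by
          simpa using (hasFDerivAt_const (1 : ℝ) X).hasLineDerivAt (basisVec i))
        (level_pos m) hη hc hs
      have e1 : ∀ m, (fun X => partialDeriv i ψ X * 1 * (truncDeriv (level m) (ψ X) * η X)) =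
          fun X => gradPos Ω ψ X i * η X * truncDeriv (level m) (ψ X) := fun m => by
        ext X
        by_cases hX : X ∈ posSet Ω ψ
        · rw [gradPos_of_mem hX]; ring
        · rw [gradPos_of_notMem hX]
          by_cases hη0 : X ∈ tsupport η
          · have : ψ X = 0 := le_antisymm (not_lt.1 fun h => hX ⟨(hs hη0).1, h⟩)
              (hψ.nonneg X (hs hη0).1)
            rw [this, truncDeriv_eq_zero (level_pos m).le]; simp
          · rw [image_eq_zero_of_notMem_tsupport hη0]; simp
      have e2 : ∀ m, (fun X => 1 * (trunc (level m) (ψ X) * partialDeriv i η X)) =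
          fun X => partialDeriv i η X * trunc (level m) (ψ X) := fun m => by
        ext X; ring
      have t1 := hψ.tendsto_integral_truncDeriv (U := Ω ∩ {X | 0 < X 0}) inter_subset_left
        (fun m => by rw [← e1]; exact (hk m).1.aestronglyMeasurable) hI
        (fun X hX => by rw [image_eq_zero_of_notMem_tsupport fun h => hX (hs h), mul_zero])
        (fun X hX h => by rw [gradPos_of_notMem fun h' => h'.2.ne' h]; simp)
      have t2 := hψ.tendsto_integral_trunc (U := Ω ∩ {X | 0 < X 0}) inter_subset_left
        (fun m => by rw [← e2]; exact (hk m).2.2.1.aestronglyMeasurable) hI2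
        (fun X hX => image_eq_zero_of_notMem_tsupport fun h => hX (hsi h))
      have t3 := t1.add t2
      have hz : ∀ m, (∫ X, gradPos Ω ψ X i * η X * truncDeriv (level m) (ψ X)) +
          (∫ X, partialDeriv i η X * trunc (level m) (ψ X)) = 0 := fun m => by
        have := (hk m).2.2.2
        rw [e1, e2] at this
        simpa using this
      have h2 := tendsto_nhds_unique t3 (tendsto_const_nhds.congr fun m => (hz m).symm)
      have h3 : ∫ X, partialDeriv i η X * ψ X = ∫ X, ψ X * fderiv ℝ η X (basisVec i) := by
        congr 1; ext X; rw [partialDeriv, mul_comm]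
      linarith
  filter_upwards [key 0, key 1] with X h0 h1 hX
  ext i
  fin_cases i
  · exact h0 hX
  · exact h1 hX

end IsVariationalSolution

/-! ### Local solutions near a stagnation point: gradient growth and the weak equation -/

variable {Ω : Set Plane} {f : ℝ → ℝ} {ψ : Plane → ℝ} {G : Plane → Plane}

/-- The continuous functions max(a, b) and b agree almost everywhere in an open set, hence
everywhere. -/
theorem le_of_ae_le_of_isOpen {U : Set Plane} (hU : IsOpen U) {a b : Plane → ℝ}
    (ha : ContinuousOn a U) (hb : ContinuousOn b U) (h : ∀ᵐ X, X ∈ U → a X ≤ b X) {X : Plane}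
    (hX : X ∈ U) : a X ≤ b X := by
  have h1 : (fun X => max (a X) (b X)) =ᵐ[volume.restrict U] b := by
    refine (ae_restrict_iff' hU.measurableSet).2 ?_
    filter_upwards [h] with Y hY hYU using max_eq_right (hY hYU)
  have := Measure.eqOn_open_of_ae_eq h1 hU (ha.sup hb) hb hX
  exact max_eq_right_iff.1 this

/-- What is needed of a variational solution in a small ball around a stagnation point. -/
structure LocalSolution (X₀ : Plane) (R C : ℝ) (f : ℝ → ℝ) (ψ : Plane → ℝ) (g : Plane → Plane) :
    Prop where
  R_pos : 0 < R
  R_le_one : R ≤ 1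
  R_le : R ≤ X₀ 0 / 4
  C_nonneg : 0 ≤ C
  center : X₀ 1 = 0
  zero_center : ψ X₀ = 0
  f_cont : Continuous f
  contOn : ContinuousOn ψ (Metric.ball X₀ R)
  nonneg : ∀ X ∈ Metric.ball X₀ R, 0 ≤ ψ X
  zero_below : ∀ X ∈ Metric.ball X₀ R, X 1 ≤ 0 → ψ X = 0
  hasFDerivAt : ∀ X ∈ Metric.ball X₀ R, 0 < ψ X → HasFDerivAt ψ (innerSL ℝ (g X)) X
  grad_zero : ∀ X ∈ Metric.ball X₀ R, ψ X = 0 → g X = 0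
  grad_meas : Measurable g
  grad_cont : ContinuousOn g (Metric.ball X₀ R ∩ {X | 0 < ψ X})
  grad_le : ∀ X ∈ Metric.ball X₀ R, ‖g X‖ ^ 2 ≤ C * ‖X - X₀‖
  f_le : ∀ X ∈ Metric.ball X₀ R, |f (ψ X)| ≤ C * ψ X
  F_le : ∀ X ∈ Metric.ball X₀ R, |primitive f (ψ X)| ≤ C * ψ X ^ 2
  euler : ∀ η : Plane → ℝ, ContDiff ℝ ∞ η → HasCompactSupport η →
    tsupport η ⊆ Metric.ball X₀ R →
      ∫ X, (‖g X‖ ^ 2 / X 0 - X 0 * ψ X * f (ψ X)) * η X =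
        -∫ X, ψ X * (fderiv ℝ η X (g X)) / X 0
  variation : ∀ φ : Plane → Plane, ContDiff ℝ ∞ φ → HasCompactSupport φ →
    tsupport φ ⊆ Metric.ball X₀ R →
    (∫ X,
        ((‖g X‖ ^ 2 / X 0 - 2 * X 0 * primitive f (ψ X) + X 0 * X 1 * chiPos ψ X)
          * divergence φ X
        - 2 / X 0 * inner ℝ (g X) (fderiv ℝ φ X (g X))))
      + (∫ X,
        (-(‖g X‖ ^ 2 / X 0 ^ 2) - 2 * primitive f (ψ X) + X 1 * chiPos ψ X) * φ X 0)
      + (∫ X, X 0 * chiPos ψ X * φ X 1) = 0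
  nontrivial : ∀ ε > 0, ∃ X ∈ Metric.ball X₀ ε, ψ X ≠ 0

theorem abs_coord_le (X : Plane) (i : Fin 2) : |X i| ≤ ‖X‖ := by
  have := PiLp.norm_apply_le X i
  simpa using this

theorem abs_sub_coord_le (X Y : Plane) (i : Fin 2) : |X i - Y i| ≤ ‖X - Y‖ := by
  have := abs_coord_le (X - Y) i
  simpa using this

/-- The ball is connected and misses the frontier, so it cannot leave the interior of Ω once its
centre lies there. -/
theorem ball_subset_of_lt_infDist {Ω : Set Plane} {X₀ : Plane} (hX₀ : X₀ ∈ Ω) {r : ℝ}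
    (hr : r ≤ Metric.infDist X₀ (frontier Ω)) : Metric.ball X₀ r ⊆ Ω := by
  rcases le_or_gt r 0 with h | h
  · rw [Metric.ball_eq_empty.2 h]; exact empty_subset _
  have hpre : IsPreconnected (Metric.ball X₀ r) := (convex_ball X₀ r).isPreconnected
  have hf : ∀ Z ∈ Metric.ball X₀ r, Z ∉ frontier Ω := fun Z hZ hZf => by
    have h1 := Metric.infDist_le_dist_of_mem (x := X₀) hZf
    rw [Metric.mem_ball'] at hZ
    linarith
  have h0 : X₀ ∈ Metric.ball X₀ r := Metric.mem_ball_self h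
  have hint : ∀ Z ∈ Metric.ball X₀ r, Z ∈ closure Ω → Z ∈ interior Ω := fun Z hZ hZc => by
    by_contra h'; exact hf Z hZ ⟨hZc, h'⟩
  exact (hpre.subset_of_closure_inter_subset isOpen_interior
    ⟨X₀, h0, hint X₀ h0 (subset_closure hX₀)⟩ fun Z hZ =>
      hint Z hZ.2 (closure_mono interior_subset hZ.1)).trans interior_subset

namespace IsVariationalSolution

theorem hasFDerivAt_of_mem (hψ : IsVariationalSolution Ω f ψ G) (hΩ : IsFlowDomain Ω) {X : Plane}
    (hX : X ∈ posSet Ω ψ) : HasFDerivAt ψ (innerSL ℝ (gradPos Ω ψ X)) X := by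
  have h := ((hψ.contDiffOn.contDiffAt ((hψ.isOpen_posSet hΩ).mem_nhds hX)).differentiableAt
    (by norm_num)).hasFDerivAt
  convert! h using 1
  ext v
  rw [clm_apply_eq (fderiv ℝ ψ X) v]
  simp only [innerSL_apply_apply, inner_eq, gradPos_of_mem hX, partialDeriv]
  ring

/-- Continuity of the classical gradient in {ψ > 0} upgrades the growth assumption from almost every
point to every point. At a stagnation point y vanishes, so |y| + |x − x₀| ≤ 2|X − X₀|, and the
weight x² is bounded in the ball. -/
theorem exists_growth (hψ : IsVariationalSolution Ω f ψ G) (hΩ : IsFlowDomain Ω)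
    (hg : GrowthAssumption Ω ψ G) {X₀ : Plane} (hX₀ : X₀ ∈ stagnationPoints Ω ψ) :
    ∃ C ≥ 0, ∃ r > 0, ∀ X ∈ Metric.ball X₀ r, X ∈ Ω ∩ {X | 0 < X 0} →
      ‖gradPos Ω ψ X‖ ^ 2 ≤ C * ‖X - X₀‖ := by
  obtain ⟨C, r, hr, hC⟩ := hg X₀ ⟨hX₀.1, hX₀.2.1⟩
  have hP := hψ.isOpen_posSet hΩ
  have hU : IsOpen (posSet Ω ψ ∩ Metric.ball X₀ r) := hP.inter Metric.isOpen_ball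
  have hx := continuousOn_coord 0 (posSet Ω ψ ∩ Metric.ball X₀ r)
  have hae : ∀ᵐ X, X ∈ posSet Ω ψ ∩ Metric.ball X₀ r →
      ‖gradPos Ω ψ X‖ ^ 2 / X 0 ^ 2 ≤ C * (|X 1| + |X 0 - X₀ 0|) := by
    have h1 := (ae_restrict_iff' (Metric.isOpen_ball.measurableSet.inter
      (measurableSet_domain hΩ))).1 hC
    filter_upwards [h1, hψ.ae_grad_eq_of_mem hΩ] with X hX1 hX2 hX
    rw [← hX2 hX.1]
    exact hX1 ⟨hX.2, hX.1.1⟩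
  have hle : ∀ X ∈ posSet Ω ψ ∩ Metric.ball X₀ r,
      ‖gradPos Ω ψ X‖ ^ 2 / X 0 ^ 2 ≤ C * (|X 1| + |X 0 - X₀ 0|) := fun X hX =>
    le_of_ae_le_of_isOpen hU
      (((((hψ.continuousOn_gradPos hΩ).mono inter_subset_left).norm).pow 2).div (hx.pow 2)
        fun Y hY => pow_ne_zero 2 (hψ.pos_fst hΩ hY.1).ne')
      (by fun_prop) hae hX
  refine ⟨2 * |C| * (X₀ 0 + r) ^ 2, by positivity, r, hr, fun X hX hXO => ?_⟩
  by_cases hXP : X ∈ posSet Ω ψ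
  · have h1 := hle X ⟨hXP, hX⟩
    have hx0 : 0 < X 0 := hXO.2
    rw [div_le_iff₀ (by positivity)] at h1
    have h2 := abs_sub_coord_le X X₀ 0
    have h3 := abs_sub_coord_le X X₀ 1
    rw [hX₀.2.2.1, sub_zero] at h3
    have h4 : X 0 ≤ X₀ 0 + r := by
      have := (abs_le.1 h2).2
      have h5 : ‖X - X₀‖ < r := by rwa [← dist_eq_norm]
      linarith
    calc ‖gradPos Ω ψ X‖ ^ 2 ≤ C * (|X 1| + |X 0 - X₀ 0|) * X 0 ^ 2 := h1
      _ ≤ |C| * (‖X - X₀‖ + ‖X - X₀‖) * (X₀ 0 + r) ^ 2 := by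
        gcongr
        exact le_abs_self C
      _ = _ := by ring
  · rw [gradPos_of_notMem hXP, norm_zero, zero_pow two_ne_zero]
    positivity

/-- The weak form of the equation, tested with `ψ η`. -/
theorem euler_weak (hψ : IsVariationalSolution Ω f ψ G) (hΩ : IsFlowDomain Ω)
    (hf : Continuous f) {X₀ : Plane} (hX₀ : X₀ ∈ Ω) (h0 : ψ X₀ = 0) {R M d : ℝ}
    (hsub : Metric.ball X₀ R ⊆ Ω) (hd : 0 < d) (hxd : ∀ X ∈ Metric.ball X₀ R, d ≤ X 0)
    (hM : ∀ X ∈ Metric.ball X₀ R, ‖gradPos Ω ψ X‖ ≤ M)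
    {η : Plane → ℝ} (hη : ContDiff ℝ ∞ η) (hc : HasCompactSupport η)
    (hs : tsupport η ⊆ Metric.ball X₀ R) :
      ∫ X, (‖gradPos Ω ψ X‖ ^ 2 / X 0 - X 0 * ψ X * f (ψ X)) * η X =
        -∫ X, ψ X * (fderiv ℝ η X (gradPos Ω ψ X)) / X 0 := by
  set g := gradPos Ω ψ with hg
  have hgm : Measurable g := hψ.measurable_gradPos hΩ
  have hgi : ∀ i, Measurable fun X => g X i := fun i =>
    (by fun_prop : Measurable fun X : Plane => X i).comp hgm
  have hxm : Measurable fun X : Plane => X 0 := by fun_prop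
  have hBO : Metric.ball X₀ R ⊆ Ω ∩ {X | 0 < X 0} := fun X hX => ⟨hsub hX, hd.trans_le (hxd X hX)⟩
  have hηk : ∀ k, Continuous (partialDeriv k η) := fun k =>
    (hη.continuous_fderiv (by simp)).clm_apply continuous_const
  have hck : ∀ k, HasCompactSupport (partialDeriv k η) := fun k => hc.fderiv_apply ℝ (basisVec k)
  have hsk : ∀ k, tsupport (partialDeriv k η) ⊆ Metric.ball X₀ R := fun k =>
    (tsupport_fderiv_apply_subset _).trans hs
  have hψB : ContinuousOn ψ (Metric.ball X₀ R) := hψ.continuousOn.mono hsub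
  have hgP : ∀ X ∈ Metric.ball X₀ R, ψ X = 0 → g X = 0 := fun X hX h =>
    gradPos_of_notMem fun h' => h'.2.ne' h
  have hp0 : ∀ X ∈ Metric.ball X₀ R, X ∉ posSet Ω ψ → ψ X = 0 := fun X hX h =>
    le_antisymm (not_lt.1 fun h' => h ⟨hsub hX, h'⟩) (hψ.nonneg X (hsub hX))
  have hx := continuousOn_coord 0 (posSet Ω ψ)
  have hx0 : ∀ X ∈ posSet Ω ψ, X 0 ≠ 0 := fun X hX => (hψ.pos_fst hΩ hX).ne'
  -- the truncated identities
  have hk := fun m k => hψ.integral_trunc_mul hΩ (a := fun X => partialDeriv k ψ X / X 0)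
    (a' := fun X => partialDeriv k (partialDeriv k ψ) X / X 0
      - partialDeriv k ψ X * basisVec k 0 / X 0 ^ 2) (k := k)
    ((hψ.continuousOn_partialDeriv hΩ k).div hx hx0)
    (((hψ.continuousOn_partialDeriv₂ hΩ k k).div hx hx0).sub
      (((hψ.continuousOn_partialDeriv hΩ k).mul continuousOn_const).div (hx.pow 2)
        fun X hX => pow_ne_zero 2 (hx0 X hX)))
    (fun X hX => by
      have d1 : HasDerivAt (fun t : ℝ => partialDeriv k ψ (X + t • basisVec k)) _ 0 :=
        hψ.hasLineDerivAt_partialDeriv hΩ hX k k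
      have d2 : HasDerivAt (fun t : ℝ => (X + t • basisVec k) 0) (basisVec k 0) 0 :=
        hasLineDerivAt_coord 0 X _
      have e0 : X + (0 : ℝ) • basisVec k = X := by simp
      have d3 := d1.fun_div d2 (by rw [e0]; exact hx0 X hX)
      simp only [e0] at d3
      refine HasDerivAt.congr_deriv (f := fun t : ℝ => partialDeriv k ψ (X + t • basisVec k) /
        (X + t • basisVec k) 0) d3 ?_
      have := hx0 X hX
      field_simp)
    (level_pos m) hη hc (hs.trans hBO)
  have hI1 : Integrable fun X => ‖g X‖ ^ 2 / X 0 * η X := by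
    refine Integrable.mono' (g := fun X => M ^ 2 / d * |η X|)
      ((hη.continuous.abs.integrable_of_hasCompactSupport hc.norm).const_mul _)
      (((hgm.norm.pow_const 2).div hxm).mul hη.continuous.measurable).aestronglyMeasurable
      (Eventually.of_forall fun X => ?_)
    by_cases hX : X ∈ tsupport η
    · have hXB := hs hX
      have hX0 := hd.trans_le (hxd X hXB)
      rw [norm_mul, Real.norm_eq_abs, Real.norm_eq_abs, abs_of_nonneg (by positivity)]
      gcongr
      · exact hM X hXB
      · exact hxd X hXB
    · rw [image_eq_zero_of_notMem_tsupport hX]; simp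
  have hI2 : Integrable fun X => X 0 * f (ψ X) * η X * ψ X := by
    have : ContinuousOn (fun X => X 0 * f (ψ X) * ψ X) (Metric.ball X₀ R) :=
      ((continuousOn_coord 0 _).mul (hf.comp_continuousOn hψB)).mul hψB
    exact (integrable_mul_of_tsupport_subset Metric.isOpen_ball this hη.continuous hc hs).congr
      (Eventually.of_forall fun X => by ring)
  have hI3 : ∀ k, Integrable fun X => g X k / X 0 * partialDeriv k η X * ψ X := fun k => by
    have hcψ : Continuous fun X => ψ X * partialDeriv k η X :=
      continuous_mul_of_tsupport_subset Metric.isOpen_ball hψB (hηk k) (hsk k)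
    refine Integrable.mono' (g := fun X => M / d * |ψ X * partialDeriv k η X|)
      ((hcψ.abs.integrable_of_hasCompactSupport (hck k).mul_left.norm).const_mul _)
      ((((hgi k).div hxm).mul hcψ.measurable).aestronglyMeasurable.congr
        (Eventually.of_forall fun X => by simp only [Pi.mul_apply, Pi.div_apply]; ring)) (Eventually.of_forall fun X => ?_)
    by_cases hX : X ∈ tsupport (partialDeriv k η)
    · have hXB := hsk k hX
      have hX0 := hd.trans_le (hxd X hXB)
      have e : g X k / X 0 * partialDeriv k η X * ψ X =
        (g X k / X 0) * (ψ X * partialDeriv k η X) := by ring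
      rw [e, norm_mul, Real.norm_eq_abs, Real.norm_eq_abs, abs_div, abs_of_pos hX0]
      have h1 : |g X k| ≤ M := (abs_coord_le _ k).trans (hM X hXB)
      have hM0 : 0 ≤ M := (abs_nonneg _).trans h1
      gcongr
      exact hxd X hXB
    · rw [image_eq_zero_of_notMem_tsupport hX]; simp
  have e1 : ∀ m, (fun X => ‖g X‖ ^ 2 / X 0 * η X * truncDeriv (level m) (ψ X)) = fun X =>
      partialDeriv 0 ψ X * (partialDeriv 0 ψ X / X 0) * (truncDeriv (level m) (ψ X) * η X) +
      partialDeriv 1 ψ X * (partialDeriv 1 ψ X / X 0) * (truncDeriv (level m) (ψ X) * η X) :=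
    fun m => by
      ext X
      by_cases hX : X ∈ posSet Ω ψ
      · rw [norm_sq_eq, hg, gradPos_of_mem hX, gradPos_of_mem hX]; ring
      · by_cases hXη : X ∈ tsupport η
        · rw [hp0 X (hs hXη) hX, truncDeriv_eq_zero (level_pos m).le]; simp
        · rw [image_eq_zero_of_notMem_tsupport hXη]; simp
  have e2 : ∀ m, (fun X => X 0 * f (ψ X) * η X * trunc (level m) (ψ X)) = fun X =>
      -((partialDeriv 0 (partialDeriv 0 ψ) X / X 0
      - partialDeriv 0 ψ X * basisVec 0 0 / X 0 ^ 2) * (trunc (level m) (ψ X) * η X) +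
      (partialDeriv 1 (partialDeriv 1 ψ) X / X 0
      - partialDeriv 1 ψ X * basisVec 1 0 / X 0 ^ 2) * (trunc (level m) (ψ X) * η X)) :=
    fun m => by
      ext X
      by_cases hX : X ∈ posSet Ω ψ
      · have h1 := hψ.pdeDefect_eq_zero hΩ hf hX₀ h0 hX
        have h2 := hx0 X hX
        rw [pdeDefect] at h1
        simp only [basisVec_apply, if_true, zero_ne_one, if_false]
        linear_combination (trunc (level m) (ψ X) * η X) * h1
      · by_cases hXη : X ∈ tsupport η
        · rw [hp0 X (hs hXη) hX, trunc_eq_zero (level_pos m).le]; simp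
        · rw [image_eq_zero_of_notMem_tsupport hXη]; simp
  have e3 : ∀ m k, (fun X => g X k / X 0 * partialDeriv k η X * trunc (level m) (ψ X)) = fun X =>
      partialDeriv k ψ X / X 0 * (trunc (level m) (ψ X) * partialDeriv k η X) := fun m k => by
      ext X
      by_cases hX : X ∈ posSet Ω ψ
      · rw [hg, gradPos_of_mem hX]; ring
      · by_cases hXη : X ∈ tsupport (partialDeriv k η)
        · rw [hp0 X (hsk k hXη) hX, trunc_eq_zero (level_pos m).le]; simp
        · rw [image_eq_zero_of_notMem_tsupport hXη]; simp
  have t1 := hψ.tendsto_integral_truncDeriv (U := Metric.ball X₀ R) hsub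
    (b := fun X => ‖g X‖ ^ 2 / X 0 * η X)
    (fun m => by
      rw [e1 m]; exact ((hk m 0).1.add (hk m 1).1).aestronglyMeasurable) hI1
    (fun X hX => by rw [image_eq_zero_of_notMem_tsupport fun h => hX (hs h), mul_zero])
    (fun X hX h => by rw [hgP X hX h]; simp)
  have t2 := hψ.tendsto_integral_trunc (U := Metric.ball X₀ R) hsub
    (b := fun X => X 0 * f (ψ X) * η X)
    (fun m => by
      rw [e2 m]; exact ((hk m 0).2.1.add (hk m 1).2.1).neg.aestronglyMeasurable) hI2
    (fun X hX => by rw [image_eq_zero_of_notMem_tsupport fun h => hX (hs h), mul_zero])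
  have t3 := fun k => hψ.tendsto_integral_trunc (U := Metric.ball X₀ R) hsub
    (b := fun X => g X k / X 0 * partialDeriv k η X)
    (fun m => by rw [e3 m k]; exact (hk m k).2.2.1.aestronglyMeasurable) (hI3 k)
    (fun X hX => by rw [image_eq_zero_of_notMem_tsupport fun h => hX (hsk k h), mul_zero])
  have hz : ∀ m, (∫ X, ‖g X‖ ^ 2 / X 0 * η X * truncDeriv (level m) (ψ X)) -
      (∫ X, X 0 * f (ψ X) * η X * trunc (level m) (ψ X)) +
      ((∫ X, g X 0 / X 0 * partialDeriv 0 η X * trunc (level m) (ψ X)) +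
      ∫ X, g X 1 / X 0 * partialDeriv 1 η X * trunc (level m) (ψ X)) = 0 := fun m => by
    rw [e1 m, e2 m, e3 m 0, e3 m 1, integral_add (hk m 0).1 (hk m 1).1, integral_neg,
      integral_add (hk m 0).2.1 (hk m 1).2.1]
    have h1 := (hk m 0).2.2.2
    have h2 := (hk m 1).2.2.2
    linarith
  -- The gradient term carries `truncDeriv`, whose limit is harmless because ∇ψ was set to 0 on {ψ =
  -- 0}; the other terms carry the truncation of ψ itself, which tends to ψ.
  have t := (t1.sub t2).add ((t3 0).add (t3 1))
  have hlim := tendsto_nhds_unique t (tendsto_const_nhds.congr fun m => (hz m).symm)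
  have f1 : ∫ X, (‖g X‖ ^ 2 / X 0 - X 0 * ψ X * f (ψ X)) * η X =
      (∫ X, ‖g X‖ ^ 2 / X 0 * η X) - ∫ X, X 0 * f (ψ X) * η X * ψ X := by
    rw [← integral_sub hI1 hI2]; congr 1; ext X; ring
  have f2 : ∫ X, ψ X * (fderiv ℝ η X (g X)) / X 0 =
      (∫ X, g X 0 / X 0 * partialDeriv 0 η X * ψ X) +
      ∫ X, g X 1 / X 0 * partialDeriv 1 η X * ψ X := by
    rw [← integral_add (hI3 0) (hI3 1)]; congr 1; ext X
    rw [clm_apply_eq (fderiv ℝ η X) (g X)]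
    simp only [partialDeriv]; ring
  rw [f1, f2]
  linarith

end IsVariationalSolution

/-! ### Choice of the radius and construction of the local solution -/

variable {Ω : Set Plane} {f : ℝ → ℝ} {ψ : Plane → ℝ} {G : Plane → Plane}

/-- Continuity forces f(0) = 0, so the linear bound extends to z = 0; integrating it gives the
quadratic bound on the primitive. -/
theorem VorticityGrowth.exists_bound (hf : Continuous f) (hg : VorticityGrowth f) :
    ∃ C ≥ 0, ∃ z₀ > 0, ∀ z, 0 ≤ z → z < z₀ → |f z| ≤ C * z ∧ |primitive f z| ≤ C * z ^ 2 := by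
  obtain ⟨C, z₀, hz₀, h⟩ := hg
  have h0 : f 0 = 0 := by
    have t1 : Tendsto f (𝓝[>] 0) (𝓝 (f 0)) := hf.continuousAt.mono_left nhdsWithin_le_nhds
    have t2 : Tendsto (fun z : ℝ => C * z) (𝓝[>] 0) (𝓝 0) := by
      have : Continuous fun z : ℝ => C * z := by fun_prop
      have h1 := this.tendsto 0
      rw [mul_zero] at h1
      exact h1.mono_left nhdsWithin_le_nhds
    have t3 : Tendsto f (𝓝[>] 0) (𝓝 0) := by
      refine squeeze_zero_norm' ?_ t2
      filter_upwards [Ioo_mem_nhdsGT hz₀] with z hz using h z hz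
    exact tendsto_nhds_unique t1 t3
  have hb : ∀ z, 0 ≤ z → z < z₀ → |f z| ≤ |C| * z := fun z hz hz' => by
    rcases hz.eq_or_lt with rfl | hz
    · simp [h0]
    · exact (h z ⟨hz, hz'⟩).trans (by gcongr; exact le_abs_self C)
  refine ⟨|C|, abs_nonneg C, z₀, hz₀, fun z hz hz' => ⟨hb z hz hz', ?_⟩⟩
  have := intervalIntegral.norm_integral_le_of_norm_le_const (a := 0) (b := z) (f := f)
    (C := |C| * z) fun s hs => by
      rw [uIoc_of_le hz] at hs
      exact (hb s hs.1.le (hs.2.trans_lt hz')).trans (by gcongr; exact hs.2)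
  rw [Real.norm_eq_abs, sub_zero, abs_of_nonneg hz] at this
  calc |primitive f z| ≤ |C| * z * z := this
    _ = _ := by ring

/-- The frontier must be shown nonempty, as the infimum distance to the empty set is 0; it is
nonempty because Ω misses the left half-plane. -/
theorem delta_pos {X₀ : Plane} (hΩ : IsFlowDomain Ω) (hX₀ : X₀ ∈ Ω) (hx : 0 < X₀ 0) :
    0 < delta Ω X₀ := by
  have hO := isOpen_inter_right hΩ
  have hint : X₀ ∈ interior Ω :=
    interior_maximal inter_subset_left hO (⟨hX₀, hx⟩ : X₀ ∈ Ω ∩ {X | 0 < X 0})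
  have hne : (frontier Ω).Nonempty := by
    refine nonempty_frontier_iff.2 ⟨⟨X₀, hX₀⟩, fun h => ?_⟩
    obtain ⟨-, U, -, hU⟩ := hΩ
    have : (EuclideanSpace.single 0 (-1) : Plane) ∈ Ω := h ▸ mem_univ _
    rw [hU] at this
    have := this.2
    norm_num at this
  have h1 : 0 < Metric.infDist X₀ (frontier Ω) :=
    (isClosed_frontier.notMem_iff_infDist_pos hne).1 fun h => h.2 hint
  unfold delta
  have := lt_min hx h1
  positivity

theorem ball_delta_subset {X₀ : Plane} (hX₀ : X₀ ∈ Ω) {r : ℝ} (hr : r ≤ 2 * delta Ω X₀) :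
    Metric.ball X₀ r ⊆ Ω := by
  refine ball_subset_of_lt_infDist hX₀ (hr.trans ?_)
  have := min_le_right (X₀ 0) (Metric.infDist X₀ (frontier Ω))
  unfold delta; linarith

theorem IsVariationalSolution.exists_localSolution (hψ : IsVariationalSolution Ω f ψ G)
    (hΩ : IsFlowDomain Ω) (hf : Continuous f) (hfg : VorticityGrowth f)
    (hg : GrowthAssumption Ω ψ G) {X₀ : Plane} (hX₀ : X₀ ∈ stagnationPoints Ω ψ) :
    ∃ R C, LocalSolution X₀ R C f ψ (gradPos Ω ψ) ∧ R ≤ delta Ω X₀ := by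
  obtain ⟨C₁, hC₁, r₁, hr₁, hgr⟩ := hψ.exists_growth hΩ hg hX₀
  obtain ⟨C₂, hC₂, z₀, hz₀, hfb⟩ := hfg.exists_bound hf
  obtain ⟨hXΩ, hXf, hX1, hX0⟩ := hX₀
  have hzero : ψ X₀ = 0 := hψ.zero_below X₀ hXΩ hX1.le
  have hO := isOpen_inter_right hΩ
  have hcont : ContinuousAt ψ X₀ :=
    (hψ.continuousOn.mono inter_subset_left).continuousAt (hO.mem_nhds ⟨hXΩ, hX0⟩)
  obtain ⟨r₂, hr₂, hsmall⟩ := Metric.eventually_nhds_iff_ball.1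
    (hcont.eventually_lt_const (by rw [hzero]; exact hz₀))
  have hδ := delta_pos hΩ hXΩ hX0
  -- The radius keeps the ball inside the growth neighbourhood, makes ψ small enough for the bounds
  -- on f, allows powers of R to be dropped, keeps x comparable to x₀, and stays inside Ω.
  set R := min (min (min r₁ r₂) (min 1 (X₀ 0 / 4))) (delta Ω X₀) with hR
  have hRpos : 0 < R := by positivity
  have hR1 : R ≤ r₁ := (min_le_left _ _).trans ((min_le_left _ _).trans (min_le_left _ _))
  have hR2 : R ≤ r₂ := (min_le_left _ _).trans ((min_le_left _ _).trans (min_le_right _ _))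
  have hR3 : R ≤ 1 := (min_le_left _ _).trans ((min_le_right _ _).trans (min_le_left _ _))
  have hR4 : R ≤ X₀ 0 / 4 := (min_le_left _ _).trans ((min_le_right _ _).trans (min_le_right _ _))
  have hRδ : R ≤ delta Ω X₀ := min_le_right _ _
  have hsub : Metric.ball X₀ R ⊆ Ω := ball_delta_subset hXΩ (by linarith)
  have hx : ∀ X ∈ Metric.ball X₀ R, X₀ 0 / 2 ≤ X 0 := fun X hX => by
    have h1 := (abs_le.1 (abs_sub_coord_le X X₀ 0)).1
    rw [Metric.mem_ball, dist_eq_norm] at hX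
    linarith
  have hsubO : Metric.ball X₀ R ⊆ Ω ∩ {X | 0 < X 0} := fun X hX =>
    ⟨hsub hX, lt_of_lt_of_le (by positivity) (hx X hX)⟩
  have hgle : ∀ X ∈ Metric.ball X₀ R, ‖gradPos Ω ψ X‖ ^ 2 ≤ C₁ * ‖X - X₀‖ := fun X hX =>
    hgr X (Metric.ball_subset_ball hR1 hX) (hsubO hX)
  have hψs : ∀ X ∈ Metric.ball X₀ R, ψ X < z₀ := fun X hX =>
    hsmall X (Metric.ball_subset_ball hR2 hX)
  refine ⟨R, C₁ + C₂, ?_, hRδ⟩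
  refine
  { R_pos := hRpos
    R_le_one := hR3
    R_le := hR4
    C_nonneg := by positivity
    center := hX1
    zero_center := hzero
    f_cont := hf
    contOn := hψ.continuousOn.mono hsub
    nonneg := fun X hX => hψ.nonneg X (hsub hX)
    zero_below := fun X hX => hψ.zero_below X (hsub hX)
    hasFDerivAt := fun X hX h => hψ.hasFDerivAt_of_mem hΩ ⟨hsub hX, h⟩
    grad_zero := fun X _ h => gradPos_of_notMem fun h' => h'.2.ne' h
    grad_meas := hψ.measurable_gradPos hΩ
    grad_cont := (hψ.continuousOn_gradPos hΩ).mono fun X hX => ⟨hsub hX.1, hX.2⟩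
    grad_le := fun X hX => (hgle X hX).trans (by gcongr; linarith)
    f_le := fun X hX => ((hfb _ (hψ.nonneg X (hsub hX)) (hψs X hX)).1).trans (by
      have := hψ.nonneg X (hsub hX)
      gcongr; linarith)
    F_le := fun X hX => ((hfb _ (hψ.nonneg X (hsub hX)) (hψs X hX)).2).trans (by
      gcongr; linarith)
    euler := fun η hη hc hs => by
      refine hψ.euler_weak hΩ hf hXΩ hzero hsub (d := X₀ 0 / 2) (by positivity) hx
        (M := Real.sqrt (C₁ * R)) (fun X hX => ?_) hη hc hs
      refine Real.le_sqrt_of_sq_le ((hgle X hX).trans ?_)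
      rw [Metric.mem_ball, dist_eq_norm] at hX
      gcongr
    variation := fun φ hφ hc hs => ?_
    nontrivial := fun ε hε => ?_ }
  · have hφ0 : ∀ X, X ∉ Metric.ball X₀ R → φ X = 0 := fun X hX =>
      image_eq_zero_of_notMem_tsupport fun h => hX (hs h)
    have hφ1 : ∀ X, X ∉ Metric.ball X₀ R → fderiv ℝ φ X = 0 := fun X hX =>
      image_eq_zero_of_notMem_tsupport fun h => hX (hs (tsupport_fderiv_subset ℝ h))
    have hvar := hψ.domain_variation φ hφ hc (fun X hX => hsub (hs hX.1)) (fun X hX => by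
      rw [hφ0 X fun h => ?_]; · rfl
      have := (hsubO h).2
      simp only [mem_ofPred_eq] at this
      linarith)
    -- On the support of the field the weak gradient may be replaced by its representative that
    -- vanishes on {ψ = 0}; outside the ball both φ and its derivative vanish.
    have hae := hψ.ae_grad_eq hΩ
    rw [← hvar]
    refine congrArg₂ _ (congrArg₂ _ ?_ ?_) ?_
    · refine (setIntegral_eq_integral_of_forall_compl_eq_zero (s := Ω) fun X hX => ?_).symm.trans
        (integral_congr_ae (ae_restrict_of_ae ?_))
      · rw [divergence, hφ1 X fun h => hX (hsub h)]; simp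
      · filter_upwards [hae] with X hX
        by_cases hXB : X ∈ Metric.ball X₀ R
        · rw [hX (hsubO hXB)]
        · rw [divergence, hφ1 X hXB]; simp
    · refine (setIntegral_eq_integral_of_forall_compl_eq_zero (s := Ω) fun X hX => ?_).symm.trans
        (integral_congr_ae (ae_restrict_of_ae ?_))
      · rw [hφ0 X fun h => hX (hsub h)]; simp
      · filter_upwards [hae] with X hX
        by_cases hXB : X ∈ Metric.ball X₀ R
        · rw [hX (hsubO hXB)]
        · rw [hφ0 X hXB]; simp
    · refine (setIntegral_eq_integral_of_forall_compl_eq_zero (s := Ω) fun X hX => ?_).symm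
      rw [hφ0 X fun h => hX (hsub h)]; simp
  · have h1 := frontier_subset_closure hXf
    obtain ⟨Y, hY, hY'⟩ := Metric.mem_closure_iff.1 h1 ε hε
    exact ⟨Y, by rwa [Metric.mem_ball'], hY.2.ne'⟩

/-! ### Polar coordinates -/

/-- The unit vector with polar angle `θ`. -/
noncomputable def dir (θ : ℝ) : Plane := !₂[Real.cos θ, Real.sin θ]

@[simp] theorem dir_zero (θ : ℝ) : dir θ 0 = Real.cos θ := rfl
@[simp] theorem dir_one (θ : ℝ) : dir θ 1 = Real.sin θ := rfl

@[simp] theorem norm_dir (θ : ℝ) : ‖dir θ‖ = 1 := by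
  have h := norm_sq_eq (dir θ)
  rw [dir_zero, dir_one, Real.cos_sq_add_sin_sq] at h
  have h0 := norm_nonneg (dir θ)
  nlinarith

theorem continuous_dir : Continuous dir := by
  apply (PiLp.continuous_toLp 2 (fun _ : Fin 2 => ℝ)).comp
  refine continuous_pi fun i => ?_
  fin_cases i
  · exact Real.continuous_cos
  · exact Real.continuous_sin

theorem dir_periodic : Function.Periodic dir (2 * Real.pi) := fun θ => by
  simp [dir]

theorem circleInt_eq (X₀ : Plane) (r : ℝ) (h : Plane → ℝ) :
    circleInt X₀ r h = ∫ θ in (0 : ℝ)..(2 * Real.pi), h (X₀ + r • dir θ) * r := rfl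

/-- Periodicity shifts the angle to (−π, π), the range used by `polarCoord`. -/
theorem circleInt_eq_Ioo (X₀ : Plane) (r : ℝ) (h : Plane → ℝ) :
    circleInt X₀ r h = ∫ θ in Ioo (-Real.pi) Real.pi, r * h (X₀ + r • dir θ) := by
  have hp : Function.Periodic (fun θ => h (X₀ + r • dir θ) * r) (2 * Real.pi) := fun θ => by
    simp only [dir_periodic θ]
  have := hp.intervalIntegral_add_eq 0 (-Real.pi)
  rw [zero_add, show -Real.pi + 2 * Real.pi = Real.pi by ring] at this
  rw [circleInt_eq, this, intervalIntegral.integral_of_le (by linarith [Real.pi_pos]),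
    integral_Ioc_eq_integral_Ioo]
  simp only [mul_comm]

/-- The measure preserving identification of `ℝ × ℝ` with the plane, centred at `X₀`. -/
noncomputable def planeEquiv (X₀ : Plane) : ℝ × ℝ ≃ᵐ Plane :=
  ((MeasurableEquiv.finTwoArrow (α := ℝ)).symm.trans (MeasurableEquiv.toLp 2 (Fin 2 → ℝ))).trans
    (MeasurableEquiv.addLeft X₀)

theorem planeEquiv_apply (X₀ : Plane) (p : ℝ × ℝ) : planeEquiv X₀ p = X₀ + !₂[p.1, p.2] := by
  simp only [planeEquiv, MeasurableEquiv.trans_apply]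
  rfl

theorem measurePreserving_planeEquiv (X₀ : Plane) : MeasurePreserving (planeEquiv X₀) :=
  (measurePreserving_add_left volume X₀).comp ((PiLp.volume_preserving_toLp (Fin 2)).comp
    (volume_preserving_finTwoArrow ℝ).symm)

theorem planeEquiv_polar (X₀ : Plane) (p : ℝ × ℝ) :
    planeEquiv X₀ (polarCoord.symm p) = X₀ + p.1 • dir p.2 := by
  rw [planeEquiv_apply]
  congr 1
  ext i; fin_cases i <;> simp

theorem mem_ball_polar {X₀ : Plane} {t r θ : ℝ} (ht : 0 ≤ t) :
    X₀ + t • dir θ ∈ Metric.ball X₀ r ↔ t < r := by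
  simp [norm_smul, abs_of_nonneg ht]

theorem measurable_polar (X₀ : Plane) : Measurable fun p : ℝ × ℝ => X₀ + p.1 • dir p.2 := by
  have : Continuous fun p : ℝ × ℝ => X₀ + p.1 • dir p.2 := by
    have := continuous_dir; fun_prop
  exact this.measurable

theorem integrableOn_polar {X₀ : Plane} {r : ℝ} {h : Plane → ℝ} (hm : Measurable h)
    (hi : IntegrableOn h (Metric.ball X₀ r)) :
    IntegrableOn (fun p : ℝ × ℝ => p.1 * h (X₀ + p.1 • dir p.2))
      (Ioo 0 r ×ˢ Ioo (-Real.pi) Real.pi) := by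
  set H := (Metric.ball X₀ r).indicator h with hH
  have hHm : Measurable H := hm.indicator Metric.isOpen_ball.measurableSet
  have hHi : Integrable H := (integrable_indicator_iff Metric.isOpen_ball.measurableSet).2 hi
  have h1 : IntegrableOn (fun p : ℝ × ℝ => p.1 * H (X₀ + p.1 • dir p.2)) polarCoord.target := by
    refine ⟨(measurable_fst.mul (hHm.comp (measurable_polar X₀))).aestronglyMeasurable, ?_⟩
    have e := lintegral_comp_polarCoord_symm (fun p => ‖H (planeEquiv X₀ p)‖ₑ)
    rw [(measurePreserving_planeEquiv X₀).lintegral_comp (f := fun X => ‖H X‖ₑ)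
      hHm.enorm] at e
    rw [hasFiniteIntegral_iff_enorm]
    have h2 := hHi.2
    rw [hasFiniteIntegral_iff_enorm, ← e] at h2
    refine lt_of_le_of_lt (le_of_eq ?_) h2
    refine setLIntegral_congr_fun polarCoord.open_target.measurableSet fun p hp => ?_
    have hp1 : 0 < p.1 := hp.1
    simp only [planeEquiv_polar, enorm_mul, smul_eq_mul]
    rw [Real.enorm_of_nonneg hp1.le]
  have hsub : Ioo 0 r ×ˢ Ioo (-Real.pi) Real.pi ⊆ polarCoord.target := fun p hp =>
    ⟨hp.1.1, hp.2⟩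
  refine (h1.mono_set hsub).congr_fun (fun p hp => ?_) (measurableSet_Ioo.prod measurableSet_Ioo)
  simp only [hH]
  rw [indicator_of_mem ((mem_ball_polar hp.1.1.le).2 hp.1.2)]

theorem intervalIntegrable_circleInt {X₀ : Plane} {r : ℝ} (hr : 0 ≤ r) {h : Plane → ℝ}
    (hm : Measurable h) (hi : IntegrableOn h (Metric.ball X₀ r)) :
    IntervalIntegrable (fun t => circleInt X₀ t h) volume 0 r := by
  have h1 := integrableOn_polar hm hi
  rw [IntegrableOn, Measure.volume_eq_prod, ← Measure.prod_restrict] at h1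
  rw [intervalIntegrable_iff_integrableOn_Ioo_of_le hr]
  exact h1.integral_prod_left.congr (Eventually.of_forall fun t => (circleInt_eq_Ioo X₀ t h).symm)

theorem integral_ball_eq {X₀ : Plane} {r : ℝ} (hr : 0 ≤ r) {h : Plane → ℝ}
    (hm : Measurable h) (hi : IntegrableOn h (Metric.ball X₀ r)) :
    ∫ X in Metric.ball X₀ r, h X = ∫ t in (0 : ℝ)..r, circleInt X₀ t h := by
  have h1 := integrableOn_polar hm hi
  set H := (Metric.ball X₀ r).indicator h with hH
  have e1 : ∫ X in Metric.ball X₀ r, h X = ∫ X, H X :=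
    (integral_indicator Metric.isOpen_ball.measurableSet).symm
  rw [e1, ← (measurePreserving_planeEquiv X₀).integral_comp' H,
    ← integral_comp_polarCoord_symm]
  have hsub : Ioo 0 r ×ˢ Ioo (-Real.pi) Real.pi ⊆ polarCoord.target := fun p hp =>
    ⟨hp.1.1, hp.2⟩
  have e2 : ∫ p in polarCoord.target, p.1 • H (planeEquiv X₀ (polarCoord.symm p)) =
      ∫ p in Ioo 0 r ×ˢ Ioo (-Real.pi) Real.pi, p.1 * h (X₀ + p.1 • dir p.2) := by
    refine (setIntegral_eq_of_subset_of_forall_sdiff_eq_zero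
      polarCoord.open_target.measurableSet hsub ?_).trans ?_
    rotate_left
    · refine setIntegral_congr_fun (measurableSet_Ioo.prod measurableSet_Ioo) fun p hp => ?_
      simp only [planeEquiv_polar, smul_eq_mul, hH]
      rw [indicator_of_mem ((mem_ball_polar hp.1.1.le).2 hp.1.2)]
    · intro p hp
      have hp1 : 0 < p.1 := hp.1.1
      have : X₀ + p.1 • dir p.2 ∉ Metric.ball X₀ r := fun h' =>
        hp.2 ⟨⟨hp1, (mem_ball_polar hp1.le).1 h'⟩, hp.1.2⟩
      simp only [planeEquiv_polar, hH]
      rw [indicator_of_notMem this, smul_zero]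
  rw [e2, Measure.volume_eq_prod, setIntegral_prod _ (by rwa [Measure.volume_eq_prod] at h1),
    intervalIntegral.integral_of_le hr, integral_Ioc_eq_integral_Ioo]
  exact setIntegral_congr_fun measurableSet_Ioo fun t _ => (circleInt_eq_Ioo X₀ t h).symm

theorem circleInt_congr {X₀ : Plane} {r R : ℝ} (hr : 0 ≤ r) (hR : r < R) {h k : Plane → ℝ}
    (e : ∀ X ∈ Metric.ball X₀ R, h X = k X) : circleInt X₀ r h = circleInt X₀ r k := by
  simp only [circleInt_eq]
  congr 1; ext θ
  rw [e _ ((mem_ball_polar hr).2 hR)]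

theorem circleInt_intervalIntegrable {X₀ : Plane} {r R B : ℝ} (hr : 0 ≤ r) (hR : r < R)
    {h : Plane → ℝ} (hm : Measurable h) (hb : ∀ X ∈ Metric.ball X₀ R, |h X| ≤ B) :
    IntervalIntegrable (fun θ => h (X₀ + r • dir θ) * r) volume 0 (2 * Real.pi) := by
  have hmeas : Measurable fun θ => h (X₀ + r • dir θ) * r := by
    have : Measurable fun θ => X₀ + r • dir θ := by
      have : Continuous fun θ => X₀ + r • dir θ := by
        have := continuous_dir; fun_prop
      exact this.measurable
    exact (hm.comp this).mul_const r
  refine (intervalIntegrable_const (c := B * r)).mono_fun' hmeas.aestronglyMeasurable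
    (Eventually.of_forall fun θ => ?_)
  show ‖h (X₀ + r • dir θ) * r‖ ≤ B * r
  rw [norm_mul, Real.norm_eq_abs, Real.norm_of_nonneg hr]
  gcongr
  exact hb _ ((mem_ball_polar hr).2 hR)

theorem circleInt_mono {X₀ : Plane} {r R B B' : ℝ} (hr : 0 ≤ r) (hR : r < R)
    {h k : Plane → ℝ} (hm : Measurable h) (hb : ∀ X ∈ Metric.ball X₀ R, |h X| ≤ B)
    (km : Measurable k) (kb : ∀ X ∈ Metric.ball X₀ R, |k X| ≤ B')
    (hle : ∀ X ∈ Metric.ball X₀ R, ‖X - X₀‖ = r → h X ≤ k X) :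
    circleInt X₀ r h ≤ circleInt X₀ r k := by
  simp only [circleInt_eq]
  refine intervalIntegral.integral_mono_on (by positivity)
    (circleInt_intervalIntegrable hr hR hm hb) (circleInt_intervalIntegrable hr hR km kb)
    fun θ _ => ?_
  gcongr
  refine hle _ ((mem_ball_polar hr).2 hR) ?_
  simp [norm_smul, abs_of_nonneg hr]

theorem circleInt_add {X₀ : Plane} {r R B B' : ℝ} (hr : 0 ≤ r) (hR : r < R)
    {h k : Plane → ℝ} (hm : Measurable h) (hb : ∀ X ∈ Metric.ball X₀ R, |h X| ≤ B)
    (km : Measurable k) (kb : ∀ X ∈ Metric.ball X₀ R, |k X| ≤ B') :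
    circleInt X₀ r (fun X => h X + k X) = circleInt X₀ r h + circleInt X₀ r k := by
  simp only [circleInt_eq]
  rw [← intervalIntegral.integral_add
    (circleInt_intervalIntegrable hr hR hm hb) (circleInt_intervalIntegrable hr hR km kb)]
  congr 1; ext θ; ring

theorem circleInt_const_mul (X₀ : Plane) (r c : ℝ) (h : Plane → ℝ) :
    circleInt X₀ r (fun X => c * h X) = c * circleInt X₀ r h := by
  simp only [circleInt_eq]
  rw [← intervalIntegral.integral_const_mul]
  congr 1; ext θ; ring

theorem circleInt_mul_radial {X₀ : Plane} {r : ℝ} (hr : 0 ≤ r) (h : Plane → ℝ) (γ : ℝ → ℝ) :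
    circleInt X₀ r (fun X => h X * γ ‖X - X₀‖) = circleInt X₀ r h * γ r := by
  simp only [circleInt_eq]
  rw [← intervalIntegral.integral_mul_const]
  congr 1; ext θ
  simp only [add_sub_cancel_left, norm_smul, norm_dir, Real.norm_eq_abs, abs_of_nonneg hr, mul_one]
  ring

theorem circleInt_nonneg {X₀ : Plane} {r R : ℝ} (hr : 0 ≤ r) (hR : r < R)
    {h : Plane → ℝ} (hb : ∀ X ∈ Metric.ball X₀ R, 0 ≤ h X) : 0 ≤ circleInt X₀ r h := by
  rw [circleInt_eq]
  refine intervalIntegral.integral_nonneg (by positivity) fun θ _ => ?_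
  exact mul_nonneg (hb _ ((mem_ball_polar hr).2 hR)) hr

theorem abs_circleInt_le {X₀ : Plane} {r R B : ℝ} (hr : 0 ≤ r) (hR : r < R)
    {h : Plane → ℝ} (hb : ∀ X ∈ Metric.ball X₀ R, ‖X - X₀‖ = r → |h X| ≤ B) :
    |circleInt X₀ r h| ≤ 2 * Real.pi * B * r := by
  have := intervalIntegral.norm_integral_le_of_norm_le_const (a := 0) (b := 2 * Real.pi)
    (f := fun θ => h (X₀ + r • dir θ) * r) (C := B * r) fun θ _ => by
      rw [norm_mul, Real.norm_eq_abs, Real.norm_of_nonneg hr]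
      gcongr
      refine hb _ ((mem_ball_polar hr).2 hR) ?_
      simp [norm_smul, abs_of_nonneg hr]
  rw [circleInt_eq, ← Real.norm_eq_abs]
  refine this.trans (le_of_eq ?_)
  rw [sub_zero, abs_of_nonneg (by positivity)]; ring

/-! ### Integrals over circles and balls -/

theorem integrableOn_ball_of_le {X₀ : Plane} {r B : ℝ} {h : Plane → ℝ} (hm : Measurable h)
    (hb : ∀ X ∈ Metric.ball X₀ r, |h X| ≤ B) : IntegrableOn h (Metric.ball X₀ r) := by
  refine Measure.integrableOn_of_bounded (M := B) measure_ball_lt_top.ne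
    hm.aestronglyMeasurable ?_
  exact (ae_restrict_iff' Metric.isOpen_ball.measurableSet).2 (Eventually.of_forall hb)

theorem intervalIntegrable_circleInt_of_le {X₀ : Plane} {a b R B : ℝ} (ha : 0 ≤ a) (hab : a ≤ b)
    (hb : b ≤ R) {h : Plane → ℝ} (hm : Measurable h) (hB : ∀ X ∈ Metric.ball X₀ R, |h X| ≤ B) :
    IntervalIntegrable (fun t => circleInt X₀ t h) volume a b :=
  (intervalIntegrable_circleInt (ha.trans (hab.trans hb)) hm
    (integrableOn_ball_of_le hm hB)).mono_set (by
      rw [uIcc_of_le hab, uIcc_of_le (ha.trans (hab.trans hb))]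
      exact Icc_subset_Icc ha hb)

theorem integral_ball_eq_of_le {X₀ : Plane} {r R B : ℝ} (hr : 0 ≤ r) (hrR : r ≤ R)
    {h : Plane → ℝ} (hm : Measurable h) (hB : ∀ X ∈ Metric.ball X₀ R, |h X| ≤ B) :
    ∫ X in Metric.ball X₀ r, h X = ∫ t in (0 : ℝ)..r, circleInt X₀ t h :=
  integral_ball_eq hr hm (integrableOn_ball_of_le hm fun X hX =>
    hB X (Metric.ball_subset_ball hrR hX))

theorem continuousOn_circleInt {X₀ : Plane} {R B : ℝ} {h : Plane → ℝ}
    (hc : ContinuousOn h (Metric.ball X₀ R)) (hB : ∀ X ∈ Metric.ball X₀ R, |h X| ≤ B) :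
    ContinuousOn (fun r => circleInt X₀ r h) (Ioo 0 R) := by
  intro r hr
  refine ContinuousAt.continuousWithinAt ?_
  have hmem : ∀ s ∈ Ioo 0 R, ∀ θ, X₀ + s • dir θ ∈ Metric.ball X₀ R := fun s hs θ =>
    (mem_ball_polar hs.1.le).2 hs.2
  have hcd := continuous_dir
  refine intervalIntegral.continuousAt_of_dominated_interval (bound := fun _ => B * R)
    (F := fun s θ => h (X₀ + s • dir θ) * s) ?_ ?_ intervalIntegrable_const ?_
  · filter_upwards [isOpen_Ioo.mem_nhds hr] with s hs
    have : Continuous fun θ => h (X₀ + s • dir θ) := by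
      rw [← continuousOn_univ]
      exact hc.comp (by fun_prop) fun θ _ => hmem s hs θ
    exact (this.mul continuous_const).aestronglyMeasurable
  · filter_upwards [isOpen_Ioo.mem_nhds hr] with s hs
    refine Eventually.of_forall fun θ _ => ?_
    rw [norm_mul, Real.norm_eq_abs, Real.norm_of_nonneg hs.1.le]
    have h1 := hB _ (hmem s hs θ)
    have h2 := (abs_nonneg _).trans h1
    exact mul_le_mul h1 hs.2.le hs.1.le h2
  · refine Eventually.of_forall fun θ _ => ?_
    have h1 : ContinuousAt h (X₀ + r • dir θ) :=
      hc.continuousAt (Metric.isOpen_ball.mem_nhds (hmem r hr θ))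
    have h2 : ContinuousAt (fun s : ℝ => X₀ + s • dir θ) r := by fun_prop
    exact (ContinuousAt.comp (f := fun s : ℝ => X₀ + s • dir θ) (g := h) h1 h2).mul continuousAt_id

/-- The function `t ↦ ∫ₜ^R γ`. -/
noncomputable def tailInt (γ : ℝ → ℝ) (R t : ℝ) : ℝ := ∫ s in t..R, γ s

theorem hasDerivAt_tailInt {γ : ℝ → ℝ} (hγ : Continuous γ) (R t : ℝ) :
    HasDerivAt (tailInt γ R) (-γ t) t :=
  intervalIntegral.integral_hasDerivAt_left (hγ.intervalIntegrable _ _)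
    (hγ.stronglyMeasurableAtFilter _ _) hγ.continuousAt

theorem contDiff_tailInt {γ : ℝ → ℝ} (hγ : ContDiff ℝ ∞ γ) (R : ℝ) :
    ContDiff ℝ ∞ (tailInt γ R) := by
  rw [contDiff_infty_iff_deriv]
  refine ⟨fun t => (hasDerivAt_tailInt hγ.continuous R t).differentiableAt, ?_⟩
  have : deriv (tailInt γ R) = fun t => -γ t := by
    ext t; exact (hasDerivAt_tailInt hγ.continuous R t).deriv
  rw [this]; exact hγ.neg

/-- The margin at 0 makes the radial test function constant near the centre, hence smooth there; the
margin at R gives it compact support in the open ball. -/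
theorem exists_tailInt_eq {γ : ℝ → ℝ} {R : ℝ} (hc : HasCompactSupport γ)
    (hs : tsupport γ ⊆ Ioo 0 R) (hR : 0 < R) :
    ∃ a b, 0 < a ∧ a < b ∧ b < R ∧ (∀ t, t ≤ a → γ t = 0) ∧ (∀ t, b ≤ t → γ t = 0) := by
  rcases (tsupport γ).eq_empty_or_nonempty with he | hne
  · have h0 : ∀ t, γ t = 0 := fun t => image_eq_zero_of_notMem_tsupport (by rw [he]; simp)
    exact ⟨R / 3, R / 2, by positivity, by linarith, by linarith, fun t _ => h0 t, fun t _ => h0 t⟩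
  · have hK : IsCompact (tsupport γ) := hc
    obtain ⟨a, ha, hamin⟩ := hK.exists_isLeast hne
    obtain ⟨b, hb, hbmax⟩ := hK.exists_isGreatest hne
    have h1 := hs ha
    have h2 := hs hb
    have hab := hamin hb
    have h3 := h1.1
    have h4 := h2.2
    refine ⟨a / 2, (b + R) / 2, by linarith, by linarith, by linarith, fun t ht => ?_, fun t ht => ?_⟩
    · refine image_eq_zero_of_notMem_tsupport fun h => ?_
      have := hamin h; linarith
    · refine image_eq_zero_of_notMem_tsupport fun h => ?_
      have := hbmax h; linarith

/-- A radial test function with profile `tailInt γ R`. -/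
noncomputable def radialTest (γ : ℝ → ℝ) (R : ℝ) (X₀ X : Plane) : ℝ := tailInt γ R ‖X - X₀‖

/-- The unit normal of the circles around `X₀`. -/
noncomputable def normal (X₀ X : Plane) : Plane := ‖X - X₀‖⁻¹ • (X - X₀)

theorem norm_normal_le (X₀ X : Plane) : ‖normal X₀ X‖ ≤ 1 := by
  rw [normal, norm_smul, norm_inv, norm_norm]
  exact inv_mul_le_one

theorem normal_polar {X₀ : Plane} {t : ℝ} (ht : 0 < t) (θ : ℝ) :
    normal X₀ (X₀ + t • dir θ) = dir θ := by
  simp [normal, norm_smul, abs_of_pos ht, smul_smul, ht.ne']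

theorem measurable_normal (X₀ : Plane) : Measurable (normal X₀) := by
  have : Measurable fun X : Plane => X - X₀ := by fun_prop
  exact this.norm.inv.smul this

section radialTest

variable {γ : ℝ → ℝ} {R : ℝ} {X₀ : Plane}

theorem tailInt_eq_zero {b : ℝ} (hb : ∀ t, b ≤ t → γ t = 0) (hbR : b ≤ R) {t : ℝ} (ht : b ≤ t) :
    tailInt γ R t = 0 := by
  rw [tailInt, intervalIntegral.integral_congr (g := fun _ => (0 : ℝ)) fun s hs => ?_]
  · simp
  · exact hb s ((le_min ht hbR).trans hs.1)

theorem tsupport_radialTest_subset (hc : HasCompactSupport γ) (hs : tsupport γ ⊆ Ioo 0 R)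
    (hR : 0 < R) : ∃ b < R, tsupport (radialTest γ R X₀) ⊆ Metric.closedBall X₀ b := by
  obtain ⟨a, b, ha, hab, hbR, ha0, hb0⟩ := exists_tailInt_eq hc hs hR
  refine ⟨b, hbR, closure_minimal (fun X hX => ?_) Metric.isClosed_closedBall⟩
  by_contra h
  rw [Metric.mem_closedBall, dist_eq_norm, not_le] at h
  exact hX (tailInt_eq_zero hb0 hbR.le h.le)

/-- Away from the centre this is the chain rule for |X − X₀|. At the centre the test function is
locally constant and γ(0) = 0, so the value of `normal` there is irrelevant. -/
theorem hasFDerivAt_radialTest (hγ : ContDiff ℝ ∞ γ) (hc : HasCompactSupport γ)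
    (hs : tsupport γ ⊆ Ioo 0 R) (hR : 0 < R) (X : Plane) :
    HasFDerivAt (radialTest γ R X₀) (-(γ ‖X - X₀‖ • innerSL ℝ (normal X₀ X))) X := by
  obtain ⟨a, b, ha, hab, hbR, ha0, hb0⟩ := exists_tailInt_eq hc hs hR
  by_cases hX : X = X₀
  · have h1 : radialTest γ R X₀ =ᶠ[𝓝 X] fun _ => tailInt γ R 0 := by
      filter_upwards [Metric.ball_mem_nhds X ha] with Y hY
      rw [hX, Metric.mem_ball, dist_eq_norm] at hY
      have h2 : ∀ t ∈ uIcc 0 ‖Y - X₀‖, γ t = 0 := fun t ht => by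
        rw [uIcc_of_le (norm_nonneg _)] at ht
        exact ha0 t (ht.2.trans hY.le)
      have h3 := intervalIntegral.integral_add_adjacent_intervals (μ := volume) (a := 0)
        (b := ‖Y - X₀‖) (c := R) (f := γ) (hγ.continuous.intervalIntegrable _ _)
        (hγ.continuous.intervalIntegrable _ _)
      rw [intervalIntegral.integral_congr (g := fun _ => (0 : ℝ)) h2] at h3
      simpa [radialTest, tailInt] using h3
    have h0 : γ ‖X - X₀‖ = 0 := ha0 _ (by rw [hX, sub_self, norm_zero]; exact ha.le)
    rw [h0, zero_smul, neg_zero]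
    exact (hasFDerivAt_const _ _).congr_of_eventuallyEq h1
  · have hne : X - X₀ ≠ 0 := sub_ne_zero.2 hX
    have h1 : HasFDerivAt (fun Y : Plane => ‖Y - X₀‖) (innerSL ℝ (normal X₀ X)) X := by
      have h2 : HasFDerivAt (fun Y : Plane => ‖Y - X₀‖ ^ 2) _ X :=
        ((hasFDerivAt_id X).sub_const X₀).norm_sq
      have hp : 0 < ‖X - X₀‖ := norm_pos_iff.2 hne
      have h3 := h2.sqrt (by simpa using hne)
      simp only [Real.sqrt_sq (norm_nonneg _)] at h3
      refine h3.congr_fderiv ?_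
      ext v
      simp [normal]
      field_simp
    have h4 := (hasDerivAt_tailInt hγ.continuous R ‖X - X₀‖).comp_hasFDerivAt X h1
    refine h4.congr_fderiv ?_
    rw [neg_smul]

theorem fderiv_radialTest (hγ : ContDiff ℝ ∞ γ) (hc : HasCompactSupport γ)
    (hs : tsupport γ ⊆ Ioo 0 R) (hR : 0 < R) (X v : Plane) :
    fderiv ℝ (radialTest γ R X₀) X v = -(γ ‖X - X₀‖ * inner ℝ (normal X₀ X) v) := by
  rw [(hasFDerivAt_radialTest hγ hc hs hR X).fderiv]
  simp

theorem contDiff_radialTest (hγ : ContDiff ℝ ∞ γ) (hc : HasCompactSupport γ)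
    (hs : tsupport γ ⊆ Ioo 0 R) (hR : 0 < R) : ContDiff ℝ ∞ (radialTest γ R X₀) := by
  obtain ⟨a, b, ha, hab, hbR, ha0, hb0⟩ := exists_tailInt_eq hc hs hR
  rw [contDiff_iff_contDiffAt]
  intro X
  by_cases hX : X = X₀
  · have h1 : radialTest γ R X₀ =ᶠ[𝓝 X] fun _ => tailInt γ R 0 := by
      filter_upwards [Metric.ball_mem_nhds X ha] with Y hY
      have hd : ∀ Z ∈ Metric.ball X a, fderiv ℝ (radialTest γ R X₀) Z = 0 := fun Z hZ => by
        rw [(hasFDerivAt_radialTest hγ hc hs hR Z).fderiv, ha0, zero_smul, neg_zero]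
        rw [hX, Metric.mem_ball, dist_eq_norm] at hZ
        exact hZ.le
      have h2 := (convex_ball X a).is_const_of_fderivWithin_eq_zero (𝕜 := ℝ)
        (f := radialTest γ R X₀)
        (fun Z _ => (hasFDerivAt_radialTest hγ hc hs hR Z).differentiableAt.differentiableWithinAt)
        (fun Z hZ => by rw [fderivWithin_of_isOpen Metric.isOpen_ball hZ, hd Z hZ]) hY
        (Metric.mem_ball_self ha)
      rw [h2, hX]; simp [radialTest]
    exact contDiffAt_const.congr_of_eventuallyEq h1
  · have : ContDiffAt ℝ ∞ (fun Y : Plane => ‖Y - X₀‖) X :=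
      (contDiffAt_id.sub contDiffAt_const).norm ℝ (sub_ne_zero.2 hX)
    exact (contDiff_tailInt hγ R).contDiffAt.comp X this

/-- A function whose weighted averages against radial profiles are circle integrals. -/
theorem ae_integral_ball_eq_circleInt {B : ℝ} {U T : Plane → ℝ} (hR : 0 < R) (hU : Measurable U)
    (hUB : ∀ X ∈ Metric.ball X₀ R, |U X| ≤ B) (hT : Measurable T)
    (hTB : ∀ X ∈ Metric.ball X₀ R, |T X| ≤ B)
    (h : ∀ γ : ℝ → ℝ, ContDiff ℝ ∞ γ → HasCompactSupport γ → tsupport γ ⊆ Ioo 0 R →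
      ∫ X in Metric.ball X₀ R, U X * radialTest γ R X₀ X =
        ∫ X in Metric.ball X₀ R, T X * γ ‖X - X₀‖) :
    ∀ᵐ s, s ∈ Ioo 0 R → ∫ X in Metric.ball X₀ s, U X = circleInt X₀ s T := by
  have hUi := intervalIntegrable_circleInt_of_le le_rfl hR.le le_rfl hU hUB
  have hTi := intervalIntegrable_circleInt_of_le le_rfl hR.le le_rfl hT hTB
  have hQc : ContinuousOn (fun s => ∫ t in (0 : ℝ)..s, circleInt X₀ t U) (uIcc 0 R) :=
    intervalIntegral.continuousOn_primitive_interval' hUi left_mem_uIcc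
  -- The fundamental lemma of the calculus of variations in the radius: it suffices to test the
  -- difference of the two sides with smooth γ.
  have hmain := isOpen_Ioo.ae_eq_zero_of_integral_contDiff_smul_eq_zero (μ := volume)
    (f := fun s => (∫ t in (0 : ℝ)..s, circleInt X₀ t U) - circleInt X₀ s T) (U := Ioo 0 R) ?_ ?_
  · filter_upwards [hmain] with s hs hsI
    rw [integral_ball_eq_of_le hsI.1.le hsI.2.le hU hUB]
    linarith [hs hsI]
  · refine IntegrableOn.locallyIntegrableOn ?_
    refine Integrable.sub ?_ ?_
    · exact (hQc.intervalIntegrable.1).mono_set Ioo_subset_Ioc_self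
    · exact hTi.1.mono_set Ioo_subset_Ioc_self
  · intro γ hγ hc hs
    have hη : Continuous (radialTest γ R X₀) := (contDiff_radialTest hγ hc hs hR).continuous
    have hηc : HasCompactSupport (radialTest γ R X₀) := by
      obtain ⟨b, -, hb⟩ := tsupport_radialTest_subset (X₀ := X₀) hc hs hR
      exact (isCompact_closedBall X₀ b).of_isClosed_subset (isClosed_tsupport _) hb
    obtain ⟨M, hM⟩ := hη.bounded_above_of_compact_support hηc
    obtain ⟨N, hN⟩ := hγ.continuous.bounded_above_of_compact_support hc
    have hB0 : 0 ≤ B := (abs_nonneg _).trans (hUB X₀ (Metric.mem_ball_self hR))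
    have hγn : Measurable fun X : Plane => γ ‖X - X₀‖ :=
      hγ.continuous.measurable.comp (by fun_prop)
    have e1 := integral_ball_eq_of_le (B := B * M) hR.le le_rfl (hU.mul hη.measurable)
      fun X hX => by
        rw [Pi.mul_apply, abs_mul]
        exact mul_le_mul (hUB X hX) (hM X) (abs_nonneg _) hB0
    have e2 := integral_ball_eq_of_le (B := B * N) hR.le le_rfl (hT.mul hγn)
      fun X hX => by
        rw [Pi.mul_apply, abs_mul]
        exact mul_le_mul (hTB X hX) (hN _) (abs_nonneg _) hB0
    have e3 := h γ hγ hc hs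
    simp only [Pi.mul_def] at e1 e2
    rw [e1, e2] at e3
    have e4 : ∫ t in (0 : ℝ)..R, circleInt X₀ t (fun X => U X * radialTest γ R X₀ X) =
        ∫ t in (0 : ℝ)..R, circleInt X₀ t U * tailInt γ R t :=
      intervalIntegral.integral_congr fun t ht => by
        rw [uIcc_of_le hR.le] at ht
        exact circleInt_mul_radial ht.1 U (tailInt γ R)
    have e5 : ∫ t in (0 : ℝ)..R, circleInt X₀ t (fun X => T X * γ ‖X - X₀‖) =
        ∫ t in (0 : ℝ)..R, circleInt X₀ t T * γ t :=
      intervalIntegral.integral_congr fun t ht => by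
        rw [uIcc_of_le hR.le] at ht
        exact circleInt_mul_radial ht.1 T γ
    rw [e4, e5] at e3
    -- Integration by parts in the radius exchanges the tail integral of γ for γ itself. Both
    -- boundary terms vanish: the tail at R and the primitive at 0.
    obtain ⟨-, e6⟩ := integral_primitive_mul le_rfl hR.le hUi
      (fun x _ => hasDerivAt_tailInt hγ.continuous R x) (hγ.continuous.neg.intervalIntegrable _ _)
    have hcU : IntervalIntegrable (fun t => circleInt X₀ t U * tailInt γ R t) volume 0 R :=
      hUi.mul_continuousOn (contDiff_tailInt hγ R).continuous.continuousOn
    have hcQ : IntervalIntegrable (fun t => (∫ s in (0 : ℝ)..t, circleInt X₀ s U) * γ t)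
        volume 0 R := (hQc.mul hγ.continuous.continuousOn).intervalIntegrable
    have hcT : IntervalIntegrable (fun t => circleInt X₀ t T * γ t) volume 0 R :=
      hTi.mul_continuousOn hγ.continuous.continuousOn
    have e7 : tailInt γ R R = 0 := by simp [tailInt]
    rw [e7, intervalIntegral.integral_same] at e6
    have e8 : (∫ x in (0 : ℝ)..R, (circleInt X₀ x U * tailInt γ R x +
        (∫ s in (0 : ℝ)..x, circleInt X₀ s U) * -γ x)) =
        (∫ t in (0 : ℝ)..R, circleInt X₀ t U * tailInt γ R t) -
          ∫ t in (0 : ℝ)..R, (∫ s in (0 : ℝ)..t, circleInt X₀ s U) * γ t := by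
      rw [← intervalIntegral.integral_sub hcU hcQ]
      congr 1; ext t; ring
    have e9 : ∫ x, γ x • ((∫ t in (0 : ℝ)..x, circleInt X₀ t U) - circleInt X₀ x T) =
        (∫ t in (0 : ℝ)..R, (∫ s in (0 : ℝ)..t, circleInt X₀ s U) * γ t) -
          ∫ t in (0 : ℝ)..R, circleInt X₀ t T * γ t := by
      rw [← intervalIntegral.integral_sub hcQ hcT, intervalIntegral.integral_of_le hR.le]
      rw [setIntegral_eq_integral_of_forall_compl_eq_zero fun x hx => ?_]
      · congr 1; ext x; rw [smul_eq_mul]; ring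
      · have : γ x = 0 := image_eq_zero_of_notMem_tsupport fun h' =>
          hx (Ioo_subset_Ioc_self (hs h'))
        rw [this]; ring
    rw [e9]
    linarith

end radialTest

/-! ### Bounded measurable densities -/

/-- `h` is measurable, and bounded on the ball `B_R(X₀)`. -/
def MeasBdd (X₀ : Plane) (R : ℝ) (h : Plane → ℝ) : Prop :=
  Measurable h ∧ ∃ B, ∀ X ∈ Metric.ball X₀ R, |h X| ≤ B

namespace MeasBdd

variable {X₀ : Plane} {R r : ℝ} {h k : Plane → ℝ}

theorem add (hh : MeasBdd X₀ R h) (hk : MeasBdd X₀ R k) : MeasBdd X₀ R fun X => h X + k X := by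
  obtain ⟨m, B, b⟩ := hh
  obtain ⟨m', B', b'⟩ := hk
  exact ⟨m.add m', B + B', fun X hX => (abs_add_le _ _).trans (add_le_add (b X hX) (b' X hX))⟩

theorem mul (hh : MeasBdd X₀ R h) (hk : MeasBdd X₀ R k) : MeasBdd X₀ R fun X => h X * k X := by
  obtain ⟨m, B, b⟩ := hh
  obtain ⟨m', B', b'⟩ := hk
  refine ⟨m.mul m', B * B', fun X hX => ?_⟩
  rw [abs_mul]
  exact mul_le_mul (b X hX) (b' X hX) (abs_nonneg _) ((abs_nonneg _).trans (b X hX))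

theorem const (c : ℝ) : MeasBdd X₀ R fun _ => c := ⟨measurable_const, |c|, fun _ _ => le_rfl⟩

theorem const_mul (hh : MeasBdd X₀ R h) (c : ℝ) : MeasBdd X₀ R fun X => c * h X := (const c).mul hh

theorem neg (hh : MeasBdd X₀ R h) : MeasBdd X₀ R fun X => -h X :=
  ⟨hh.1.neg, hh.2.imp fun B b X hX => by rw [abs_neg]; exact b X hX⟩

theorem sub (hh : MeasBdd X₀ R h) (hk : MeasBdd X₀ R k) : MeasBdd X₀ R fun X => h X - k X := by
  simpa only [sub_eq_add_neg] using hh.add hk.neg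

theorem pow (hh : MeasBdd X₀ R h) (n : ℕ) : MeasBdd X₀ R fun X => h X ^ n := by
  obtain ⟨m, B, b⟩ := hh
  refine ⟨m.pow_const n, B ^ n, fun X hX => ?_⟩
  rw [abs_pow]
  exact pow_le_pow_left₀ (abs_nonneg _) (b X hX) n

theorem mono (hh : MeasBdd X₀ R h) (hr : r ≤ R) : MeasBdd X₀ r h :=
  ⟨hh.1, hh.2.imp fun _ b X hX => b X (Metric.ball_subset_ball hr hX)⟩

theorem integrableOn (hh : MeasBdd X₀ R h) : IntegrableOn h (Metric.ball X₀ R) := by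
  obtain ⟨m, B, b⟩ := hh
  exact integrableOn_ball_of_le m b

theorem intervalIntegrable (hh : MeasBdd X₀ R h) {a b : ℝ} (ha : 0 ≤ a) (hab : a ≤ b)
    (hb : b ≤ R) : IntervalIntegrable (fun t => circleInt X₀ t h) volume a b := by
  obtain ⟨m, B, b'⟩ := hh
  exact intervalIntegrable_circleInt_of_le ha hab hb m b'

theorem integral_ball (hh : MeasBdd X₀ R h) (hr : 0 ≤ r) (hrR : r ≤ R) :
    ∫ X in Metric.ball X₀ r, h X = ∫ t in (0 : ℝ)..r, circleInt X₀ t h := by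
  obtain ⟨m, B, b'⟩ := hh
  exact integral_ball_eq_of_le hr hrR m b'

theorem intervalIntegrable_circle (hh : MeasBdd X₀ R h) (hr : 0 ≤ r) (hrR : r < R) :
    IntervalIntegrable (fun θ => h (X₀ + r • dir θ) * r) volume 0 (2 * Real.pi) := by
  obtain ⟨m, B, b'⟩ := hh
  exact circleInt_intervalIntegrable hr hrR m b'

theorem circleInt_add (hh : MeasBdd X₀ R h) (hk : MeasBdd X₀ R k) (hr : 0 ≤ r) (hrR : r < R) :
    circleInt X₀ r (fun X => h X + k X) = circleInt X₀ r h + circleInt X₀ r k := by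
  obtain ⟨m, B, b⟩ := hh
  obtain ⟨m', B', b'⟩ := hk
  exact StagnationFlow.circleInt_add hr hrR m b m' b'

theorem circleInt_sub (hh : MeasBdd X₀ R h) (hk : MeasBdd X₀ R k) (hr : 0 ≤ r) (hrR : r < R) :
    circleInt X₀ r (fun X => h X - k X) = circleInt X₀ r h - circleInt X₀ r k := by
  have e := hh.circleInt_add (hk.const_mul (-1)) hr hrR
  rw [circleInt_const_mul] at e
  simpa only [neg_mul, one_mul, ← sub_eq_add_neg] using e

theorem circleInt_mono (hh : MeasBdd X₀ R h) (hk : MeasBdd X₀ R k) (hr : 0 ≤ r) (hrR : r < R)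
    (hle : ∀ X ∈ Metric.ball X₀ R, ‖X - X₀‖ = r → h X ≤ k X) :
    circleInt X₀ r h ≤ circleInt X₀ r k := by
  obtain ⟨m, B, b⟩ := hh
  obtain ⟨m', B', b'⟩ := hk
  exact StagnationFlow.circleInt_mono hr hrR m b m' b' hle

theorem abs_circleInt_le (hh : MeasBdd X₀ R h) (hk : MeasBdd X₀ R k) (hr : 0 ≤ r) (hrR : r < R)
    (hle : ∀ X ∈ Metric.ball X₀ R, ‖X - X₀‖ = r → |h X| ≤ k X) :
    |circleInt X₀ r h| ≤ circleInt X₀ r k := by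
  rw [abs_le]
  refine ⟨?_, hh.circleInt_mono hk hr hrR fun X hX e => (abs_le.1 (hle X hX e)).2⟩
  have := (hk.const_mul (-1)).circleInt_mono hh hr hrR fun X hX e => by
    linarith [(abs_le.1 (hle X hX e)).1]
  rw [circleInt_const_mul] at this
  linarith

theorem integral_mono (hh : MeasBdd X₀ R h) (hk : MeasBdd X₀ R k) (hrR : r ≤ R)
    (hle : ∀ X ∈ Metric.ball X₀ r, h X ≤ k X) :
    ∫ X in Metric.ball X₀ r, h X ≤ ∫ X in Metric.ball X₀ r, k X :=
  setIntegral_mono_on (hh.mono hrR).integrableOn (hk.mono hrR).integrableOn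
    Metric.isOpen_ball.measurableSet hle

theorem abs_integral_le (hh : MeasBdd X₀ R h) (hk : MeasBdd X₀ R k) (hrR : r ≤ R)
    (hle : ∀ X ∈ Metric.ball X₀ r, |h X| ≤ k X) :
    |∫ X in Metric.ball X₀ r, h X| ≤ ∫ X in Metric.ball X₀ r, k X := by
  rw [abs_le, ← integral_neg]
  exact ⟨hk.neg.integral_mono hh hrR fun X hX => (abs_le.1 (hle X hX)).1,
    hh.integral_mono hk hrR fun X hX => (abs_le.1 (hle X hX)).2⟩

theorem integral_add (hh : MeasBdd X₀ R h) (hk : MeasBdd X₀ R k) (hrR : r ≤ R) :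
    ∫ X in Metric.ball X₀ r, (h X + k X) =
      (∫ X in Metric.ball X₀ r, h X) + ∫ X in Metric.ball X₀ r, k X :=
  MeasureTheory.integral_add (hh.mono hrR).integrableOn (hk.mono hrR).integrableOn

theorem integral_sub (hh : MeasBdd X₀ R h) (hk : MeasBdd X₀ R k) (hrR : r ≤ R) :
    ∫ X in Metric.ball X₀ r, (h X - k X) =
      (∫ X in Metric.ball X₀ r, h X) - ∫ X in Metric.ball X₀ r, k X :=
  MeasureTheory.integral_sub (hh.mono hrR).integrableOn (hk.mono hrR).integrableOn

end MeasBdd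

theorem volume_ball (X₀ : Plane) {r : ℝ} (hr : 0 ≤ r) :
    volume.real (Metric.ball X₀ r) = Real.pi * r ^ 2 := by
  rw [Measure.real, EuclideanSpace.volume_ball_fin_two, ENNReal.toReal_mul, ENNReal.toReal_pow,
    ENNReal.toReal_ofReal hr]
  simp [mul_comm, Real.pi_pos.le]

theorem chiPos_of_pos {ψ : Plane → ℝ} {X : Plane} (h : 0 < ψ X) : chiPos ψ X = 1 :=
  indicator_of_mem (s := {Y | 0 < ψ Y}) h _

theorem chiPos_of_not_pos {ψ : Plane → ℝ} {X : Plane} (h : ¬0 < ψ X) : chiPos ψ X = 0 :=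
  indicator_of_notMem (s := {Y | 0 < ψ Y}) h _

theorem chiPos_mem (ψ : Plane → ℝ) (X : Plane) : 0 ≤ chiPos ψ X ∧ chiPos ψ X ≤ 1 := by
  by_cases h : 0 < ψ X
  · rw [chiPos_of_pos h]; norm_num
  · rw [chiPos_of_not_pos h]; norm_num

theorem measurable_chiPos {ψ : Plane → ℝ} (h : Measurable ψ) : Measurable (chiPos ψ) :=
  measurable_const.indicator (measurableSet_lt measurable_const h)

/-- A bound for integrals over small balls. -/
theorem abs_integral_ball_le {X₀ : Plane} {r B : ℝ} (hr : 0 ≤ r) {h : Plane → ℝ}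
    (hB : ∀ X ∈ Metric.ball X₀ r, |h X| ≤ B) :
    |∫ X in Metric.ball X₀ r, h X| ≤ B * (Real.pi * r ^ 2) := by
  have := norm_setIntegral_le_of_norm_le_const (μ := volume) (C := B) (f := h)
    (measure_ball_lt_top (x := X₀) (r := r)) hB
  rwa [volume_ball X₀ hr] at this

/-! ### Behaviour of the solution along rays from the centre -/

namespace LocalSolution

variable {X₀ : Plane} {R C : ℝ} {f : ℝ → ℝ} {ψ : Plane → ℝ} {g : Plane → Plane}

/-- Restricting `ψ` to the ball makes it measurable. -/
theorem localize (h : LocalSolution X₀ R C f ψ g) :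
    LocalSolution X₀ R C f ((Metric.ball X₀ R).indicator ψ) g ∧
      Measurable ((Metric.ball X₀ R).indicator ψ) := by
  have e : ∀ X ∈ Metric.ball X₀ R, (Metric.ball X₀ R).indicator ψ X = ψ X := fun X hX =>
    indicator_of_mem hX ψ
  have eχ : ∀ X ∈ Metric.ball X₀ R, chiPos ((Metric.ball X₀ R).indicator ψ) X = chiPos ψ X :=
    fun X hX => by
      by_cases hp : 0 < ψ X
      · rw [chiPos_of_pos hp, chiPos_of_pos (by rwa [e X hX])]
      · rw [chiPos_of_not_pos hp, chiPos_of_not_pos (by rwa [e X hX])]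
  constructor
  · exact
    { R_pos := h.R_pos
      R_le_one := h.R_le_one
      R_le := h.R_le
      C_nonneg := h.C_nonneg
      center := h.center
      zero_center := by rw [e X₀ (Metric.mem_ball_self h.R_pos), h.zero_center]
      f_cont := h.f_cont
      contOn := h.contOn.congr e
      nonneg := fun X hX => by rw [e X hX]; exact h.nonneg X hX
      zero_below := fun X hX => by rw [e X hX]; exact h.zero_below X hX
      hasFDerivAt := fun X hX h' => by
        rw [e X hX] at h'
        exact (h.hasFDerivAt X hX h').congr_of_eventuallyEq
          (eventually_of_mem (Metric.isOpen_ball.mem_nhds hX) e)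
      grad_zero := fun X hX => by rw [e X hX]; exact h.grad_zero X hX
      grad_meas := h.grad_meas
      grad_cont := h.grad_cont.mono fun X hX => ⟨hX.1, by
        have := hX.2
        simp only [mem_ofPred_eq] at this ⊢
        rwa [e X hX.1] at this⟩
      grad_le := h.grad_le
      f_le := fun X hX => by rw [e X hX]; exact h.f_le X hX
      F_le := fun X hX => by rw [e X hX]; exact h.F_le X hX
      euler := fun η hη hc hs => by
        have h0 : ∀ X, X ∉ Metric.ball X₀ R → η X = 0 := fun X hX =>
          image_eq_zero_of_notMem_tsupport fun h => hX (hs h)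
        have h1 : ∀ X, X ∉ Metric.ball X₀ R → fderiv ℝ η X = 0 := fun X hX =>
          image_eq_zero_of_notMem_tsupport fun h => hX (hs (tsupport_fderiv_subset ℝ h))
        refine Eq.trans ?_ ((h.euler η hη hc hs).trans (congrArg _ ?_))
        · congr 1; ext X
          by_cases hX : X ∈ Metric.ball X₀ R
          · rw [e X hX]
          · rw [h0 X hX]; simp
        · congr 1; ext X
          by_cases hX : X ∈ Metric.ball X₀ R
          · rw [e X hX]
          · rw [h1 X hX]; simp
      variation := fun φ hφ hc hs => by
        have h0 : ∀ X, X ∉ Metric.ball X₀ R → φ X = 0 := fun X hX =>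
          image_eq_zero_of_notMem_tsupport fun h => hX (hs h)
        have h1 : ∀ X, X ∉ Metric.ball X₀ R → fderiv ℝ φ X = 0 := fun X hX =>
          image_eq_zero_of_notMem_tsupport fun h => hX (hs (tsupport_fderiv_subset ℝ h))
        refine Eq.trans ?_ (h.variation φ hφ hc hs)
        refine congrArg₂ _ (congrArg₂ _ ?_ ?_) ?_ <;> congr 1 <;> ext X <;>
          by_cases hX : X ∈ Metric.ball X₀ R
        · rw [e X hX, eχ X hX]
        · simp [divergence, h1 X hX]
        · rw [e X hX, eχ X hX]
        · simp [h0 X hX]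
        · rw [eχ X hX]
        · simp [h0 X hX]
      nontrivial := fun ε hε => by
        obtain ⟨X, hX, hX'⟩ := h.nontrivial (min ε R) (lt_min hε h.R_pos)
        refine ⟨X, Metric.ball_subset_ball (min_le_left _ _) hX, ?_⟩
        rwa [e X (Metric.ball_subset_ball (min_le_right _ _) hX)] }
  · refine measurable_of_restrict_of_restrict_compl (s := Metric.ball X₀ R)
      Metric.isOpen_ball.measurableSet ?_ ?_
    · exact (continuousOn_iff_continuous_domRestrict.1 (h.contOn.congr e)).measurable
    · have : (Metric.ball X₀ R)ᶜ.domRestrict ((Metric.ball X₀ R).indicator ψ) = fun _ => 0 := by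
        ext1 X; exact indicator_of_notMem X.2 _
      rw [this]; exact measurable_const

theorem fst_mem (h : LocalSolution X₀ R C f ψ g) {X : Plane} (hX : X ∈ Metric.ball X₀ R) :
    X₀ 0 / 2 ≤ X 0 ∧ X 0 ≤ 2 * X₀ 0 := by
  have h1 := abs_le.1 (abs_sub_coord_le X X₀ 0)
  have := h.R_le
  have := h.R_pos
  rw [Metric.mem_ball, dist_eq_norm] at hX
  constructor <;> linarith

theorem center_pos (h : LocalSolution X₀ R C f ψ g) : 0 < X₀ 0 := by
  have := h.R_le
  have := h.R_pos
  linarith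

theorem fst_pos (h : LocalSolution X₀ R C f ψ g) {X : Plane} (hX : X ∈ Metric.ball X₀ R) :
    0 < X 0 := by
  have := h.center_pos
  have := (h.fst_mem hX).1
  linarith

theorem hasDerivAt_ray (h : LocalSolution X₀ R C f ψ g) (θ : ℝ) {t : ℝ} (ht : t ∈ Ico 0 R)
    (hp : 0 < ψ (X₀ + t • dir θ)) :
    HasDerivAt (fun s => ψ (X₀ + s • dir θ)) (inner ℝ (dir θ) (g (X₀ + t • dir θ))) t := by
  have h1 := h.hasFDerivAt _ ((mem_ball_polar ht.1).2 ht.2) hp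
  have h2 : HasDerivAt (fun s : ℝ => X₀ + s • dir θ) (dir θ) t := by
    simpa using ((hasDerivAt_id t).smul_const (dir θ)).const_add X₀
  have h3 := HasFDerivAt.comp_hasDerivAt (f := fun s : ℝ => X₀ + s • dir θ) t h1 h2
  rw [innerSL_apply_apply, real_inner_comm] at h3
  exact h3

theorem continuousOn_ray (h : LocalSolution X₀ R C f ψ g) (θ : ℝ) :
    ContinuousOn (fun s => ψ (X₀ + s • dir θ)) (Ico 0 R) :=
  h.contOn.comp (by fun_prop) fun _ hs => (mem_ball_polar hs.1).2 hs.2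

theorem measurable_ray (h : LocalSolution X₀ R C f ψ g) (θ : ℝ) :
    Measurable fun s : ℝ => inner ℝ (dir θ) (g (X₀ + s • dir θ)) :=
  measurable_const.inner (h.grad_meas.comp (by fun_prop))

theorem sq_inner_ray_le (h : LocalSolution X₀ R C f ψ g) (θ : ℝ) {t : ℝ} (ht : t ∈ Ico 0 R) :
    inner ℝ (dir θ) (g (X₀ + t • dir θ)) ^ 2 ≤ C * t := by
  have h1 := h.grad_le _ ((mem_ball_polar (X₀ := X₀) (θ := θ) ht.1).2 ht.2)
  simp only [add_sub_cancel_left, norm_smul, norm_dir, Real.norm_eq_abs, abs_of_nonneg ht.1,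
    mul_one] at h1
  have h2 := abs_real_inner_le_norm (dir θ) (g (X₀ + t • dir θ))
  rw [norm_dir, one_mul] at h2
  refine le_trans ?_ h1
  rw [← sq_abs]
  exact pow_le_pow_left₀ (abs_nonneg _) h2 2

theorem abs_inner_ray_le (h : LocalSolution X₀ R C f ψ g) (θ : ℝ) {t b : ℝ} (ht : t ∈ Ico 0 R)
    (hb : t ≤ b) : |inner ℝ (dir θ) (g (X₀ + t • dir θ))| ≤ Real.sqrt (C * b) := by
  refine Real.abs_le_sqrt ((h.sq_inner_ray_le θ ht).trans ?_)
  have := h.C_nonneg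
  gcongr

theorem intervalIntegrable_ray (h : LocalSolution X₀ R C f ψ g) (θ : ℝ) {a b : ℝ} (ha : 0 ≤ a)
    (hab : a ≤ b) (hb : b < R) :
    IntervalIntegrable (fun s => inner ℝ (dir θ) (g (X₀ + s • dir θ))) volume a b := by
  refine (intervalIntegrable_const (c := Real.sqrt (C * b))).mono_fun'
    (h.measurable_ray θ).aestronglyMeasurable ?_
  refine (ae_restrict_iff' measurableSet_uIoc).2 (Eventually.of_forall fun t ht => ?_)
  rw [uIoc_of_le hab] at ht
  exact h.abs_inner_ray_le θ ⟨ha.trans ht.1.le, ht.2.trans_lt hb⟩ ht.2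

/-- The ray may cross the free boundary any number of times: ψ is nonnegative, differentiable where
positive, and its gradient is set to 0 where it vanishes, so the truncated fundamental theorem of
calculus applies. -/
theorem integral_ray (h : LocalSolution X₀ R C f ψ g) (θ : ℝ) {a b : ℝ} (ha : 0 ≤ a)
    (hab : a ≤ b) (hb : b < R) :
    ∫ s in a..b, inner ℝ (dir θ) (g (X₀ + s • dir θ)) =
      ψ (X₀ + b • dir θ) - ψ (X₀ + a • dir θ) := by
  have hmem : ∀ t ∈ Icc a b, t ∈ Ico 0 R := fun t ht => ⟨ha.trans ht.1, ht.2.trans_lt hb⟩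
  have hm : ∀ t ∈ Icc a b, X₀ + t • dir θ ∈ Metric.ball X₀ R := fun t ht =>
    (mem_ball_polar (hmem t ht).1).2 (hmem t ht).2
  exact integral_eq_sub_of_hasDerivAt_of_pos hab ((h.continuousOn_ray θ).mono hmem)
    (fun t ht => h.nonneg _ (hm t ht))
    (fun t ht hp => h.hasDerivAt_ray θ (hmem t (Ioo_subset_Icc_self ht)) hp)
    (fun t ht h0 => by rw [h.grad_zero _ (hm t ht) h0, inner_zero_right])
    (h.intervalIntegrable_ray θ ha hab hb)

theorem abs_ray_sub_le (h : LocalSolution X₀ R C f ψ g) (θ : ℝ) {a b : ℝ} (ha : 0 ≤ a)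
    (hab : a ≤ b) (hb : b < R) :
    |ψ (X₀ + b • dir θ) - ψ (X₀ + a • dir θ)| ≤ Real.sqrt (C * b) * (b - a) := by
  rw [← h.integral_ray θ ha hab hb, ← Real.norm_eq_abs]
  have := intervalIntegral.norm_integral_le_of_norm_le_const (a := a) (b := b)
    (f := fun s => inner ℝ (dir θ) (g (X₀ + s • dir θ))) (C := Real.sqrt (C * b)) fun t ht => by
      rw [uIoc_of_le hab] at ht
      exact h.abs_inner_ray_le θ ⟨ha.trans ht.1.le, ht.2.trans_lt hb⟩ ht.2
  rwa [abs_of_nonneg (sub_nonneg.2 hab)] at this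

theorem exists_polar {X₀ X : Plane} : ∃ θ, X = X₀ + ‖X - X₀‖ • dir θ := by
  have h1 := norm_sq_eq (X - X₀)
  set z : ℂ := ⟨(X - X₀) 0, (X - X₀) 1⟩ with hz
  have h2 : ‖z‖ = ‖X - X₀‖ := by
    rw [Complex.norm_def, Complex.normSq_apply, hz, ← Real.sqrt_sq (norm_nonneg (X - X₀)), h1]
    congr 1; ring
  refine ⟨Complex.arg z, ?_⟩
  rw [← sub_eq_iff_eq_add', ← h2]
  ext i
  fin_cases i
  · simp [hz]
  · simp [hz]

/-- The gradient is at most the square root of C times the distance; integrating it along the ray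
from X₀, where ψ = 0, gives growth of order 3/2. -/
theorem sq_le (h : LocalSolution X₀ R C f ψ g) {X : Plane} (hX : X ∈ Metric.ball X₀ R) :
    ψ X ^ 2 ≤ C * ‖X - X₀‖ ^ 3 := by
  obtain ⟨θ, hθ⟩ := exists_polar (X₀ := X₀) (X := X)
  have hC := h.C_nonneg
  have hb : ‖X - X₀‖ < R := by rwa [Metric.mem_ball, dist_eq_norm] at hX
  have h1 := h.abs_ray_sub_le θ le_rfl (norm_nonneg (X - X₀)) hb
  rw [← hθ, zero_smul, add_zero, h.zero_center, sub_zero, sub_zero] at h1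
  calc ψ X ^ 2 = |ψ X| ^ 2 := (sq_abs _).symm
    _ ≤ (Real.sqrt (C * ‖X - X₀‖) * ‖X - X₀‖) ^ 2 := by gcongr
    _ = C * ‖X - X₀‖ ^ 3 := by rw [mul_pow, Real.sq_sqrt (by positivity)]; ring

/-- The square of the solution is differentiable along rays, also on the free boundary. -/
theorem hasDerivAt_sq_ray (h : LocalSolution X₀ R C f ψ g) (θ : ℝ) {t : ℝ} (ht : t ∈ Ioo 0 R) :
    HasDerivAt (fun s => ψ (X₀ + s • dir θ) ^ 2)
      (2 * ψ (X₀ + t • dir θ) * inner ℝ (dir θ) (g (X₀ + t • dir θ))) t := by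
  have htm : t ∈ Ico 0 R := Ioo_subset_Ico_self ht
  have hm := (mem_ball_polar (X₀ := X₀) (θ := θ) htm.1).2 htm.2
  rcases (h.nonneg _ hm).eq_or_lt with h0 | hp
  · rw [← h0, mul_zero, zero_mul]
    -- At a zero, ψ is Lipschitz along the ray although perhaps not differentiable; its square is
    -- then quadratically small.
    have hO : (fun s => ψ (X₀ + s • dir θ) ^ 2) =O[𝓝 t] fun s => ‖s - t‖ ^ 2 := by
      refine Asymptotics.IsBigO.of_bound (C * R) ?_
      filter_upwards [isOpen_Ioo.mem_nhds ht] with s hs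
      have h1 : |ψ (X₀ + s • dir θ)| ≤ Real.sqrt (C * R) * |s - t| := by
        have hC := h.C_nonneg
        rcases le_total t s with hts | hts
        · have h2 := h.abs_ray_sub_le θ ht.1.le hts hs.2
          rw [← h0, sub_zero] at h2
          rw [abs_of_nonneg (sub_nonneg.2 hts)]
          refine h2.trans ?_
          have := hs.2.le
          have := sub_nonneg.2 hts
          gcongr
        · have h2 := h.abs_ray_sub_le θ hs.1.le hts ht.2
          rw [← h0, zero_sub, abs_neg] at h2
          rw [abs_sub_comm, abs_of_nonneg (sub_nonneg.2 hts)]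
          refine h2.trans ?_
          have := ht.2.le
          have := sub_nonneg.2 hts
          gcongr
      rw [norm_pow, norm_pow, norm_norm, Real.norm_eq_abs, Real.norm_eq_abs]
      calc |ψ (X₀ + s • dir θ)| ^ 2 ≤ (Real.sqrt (C * R) * |s - t|) ^ 2 := by gcongr
        _ = C * R * |s - t| ^ 2 := by
          rw [mul_pow, Real.sq_sqrt (mul_nonneg h.C_nonneg h.R_pos.le)]
    have := (hO.hasFDerivAt one_lt_two).hasDerivAt
    simpa using this
  · have := (h.hasDerivAt_ray θ htm hp).fun_pow 2
    simpa using this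

end LocalSolution

namespace LocalSolution

variable {X₀ : Plane} {R C : ℝ} {f : ℝ → ℝ} {ψ : Plane → ℝ} {g : Plane → Plane}

/-! ### Boundedness of the densities -/

theorem measBdd_fst (h : LocalSolution X₀ R C f ψ g) : MeasBdd X₀ R fun X => X 0 :=
  ⟨by fun_prop, 2 * X₀ 0, fun X hX => by
    rw [abs_of_pos (h.fst_pos hX)]; exact (h.fst_mem hX).2⟩

theorem measBdd_snd (h : LocalSolution X₀ R C f ψ g) : MeasBdd X₀ R fun X => X 1 :=
  ⟨by fun_prop, R, fun X hX => by
    have := abs_sub_coord_le X X₀ 1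
    rw [h.center, sub_zero] at this
    rw [Metric.mem_ball, dist_eq_norm] at hX
    exact this.trans hX.le⟩

theorem measBdd_inv (h : LocalSolution X₀ R C f ψ g) : MeasBdd X₀ R fun X => (X 0)⁻¹ :=
  ⟨by fun_prop, (X₀ 0 / 2)⁻¹, fun X hX => by
    have h1 := (h.fst_mem hX).1
    have h2 := h.center_pos
    rw [abs_of_pos (inv_pos.2 (h.fst_pos hX))]
    exact inv_anti₀ (by positivity) h1⟩

theorem measBdd_div (h : LocalSolution X₀ R C f ψ g) {k : Plane → ℝ} (hk : MeasBdd X₀ R k) :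
    MeasBdd X₀ R fun X => k X / X 0 := by
  simpa only [div_eq_mul_inv] using hk.mul h.measBdd_inv

theorem norm_sub_lt {X : Plane} (hX : X ∈ Metric.ball X₀ R) : ‖X - X₀‖ < R := by
  rwa [Metric.mem_ball, dist_eq_norm] at hX

theorem measBdd_psi (h : LocalSolution X₀ R C f ψ g) (hm : Measurable ψ) : MeasBdd X₀ R ψ :=
  ⟨hm, Real.sqrt C, fun X hX => Real.abs_le_sqrt <| by
    have h1 := h.sq_le hX
    have h2 : ‖X - X₀‖ ≤ 1 := (norm_sub_lt hX).le.trans h.R_le_one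
    have h3 : ‖X - X₀‖ ^ 3 ≤ 1 := pow_le_one₀ (norm_nonneg _) h2
    have := h.C_nonneg
    nlinarith⟩

theorem measBdd_grad_sq (h : LocalSolution X₀ R C f ψ g) : MeasBdd X₀ R fun X => ‖g X‖ ^ 2 :=
  ⟨h.grad_meas.norm.pow_const 2, C, fun X hX => by
    have h1 := h.grad_le X hX
    have h2 : ‖X - X₀‖ ≤ 1 := (norm_sub_lt hX).le.trans h.R_le_one
    have := h.C_nonneg
    rw [abs_of_nonneg (by positivity)]
    nlinarith⟩

/-- The normal derivative on the circles around `X₀`. -/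
noncomputable def _root_.StagnationFlow.normalDeriv (X₀ : Plane) (g : Plane → Plane) (X : Plane) :
    ℝ := inner ℝ (normal X₀ X) (g X)

theorem _root_.StagnationFlow.sq_normalDeriv_le (X₀ : Plane) (g : Plane → Plane) (X : Plane) :
    normalDeriv X₀ g X ^ 2 ≤ ‖g X‖ ^ 2 := by
  have h1 := abs_real_inner_le_norm (normal X₀ X) (g X)
  have h2 := norm_normal_le X₀ X
  rw [← sq_abs]
  refine pow_le_pow_left₀ (abs_nonneg _) (h1.trans ?_) 2
  exact mul_le_of_le_one_left (norm_nonneg _) h2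

theorem measBdd_normalDeriv (h : LocalSolution X₀ R C f ψ g) :
    MeasBdd X₀ R (normalDeriv X₀ g) := by
  obtain ⟨-, B, hB⟩ := h.measBdd_grad_sq
  refine ⟨(measurable_normal X₀).inner h.grad_meas, Real.sqrt B, fun X hX => ?_⟩
  exact Real.abs_le_sqrt ((sq_normalDeriv_le X₀ g X).trans ((le_abs_self _).trans (hB X hX)))

theorem measBdd_f (h : LocalSolution X₀ R C f ψ g) (hm : Measurable ψ) :
    MeasBdd X₀ R fun X => f (ψ X) := by
  obtain ⟨-, B, hB⟩ := h.measBdd_psi hm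
  refine ⟨h.f_cont.measurable.comp hm, C * B, fun X hX => (h.f_le X hX).trans ?_⟩
  have := h.C_nonneg
  have := (le_abs_self _).trans (hB X hX)
  gcongr

theorem measBdd_F (h : LocalSolution X₀ R C f ψ g) (hm : Measurable ψ) :
    MeasBdd X₀ R fun X => primitive f (ψ X) := by
  obtain ⟨-, B, hB⟩ := (h.measBdd_psi hm).pow 2
  refine ⟨(continuous_primitive h.f_cont).measurable.comp hm, C * B, fun X hX =>
    (h.F_le X hX).trans ?_⟩
  have := h.C_nonneg
  have := (le_abs_self _).trans (hB X hX)
  gcongr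

theorem measBdd_chi (_ : LocalSolution X₀ R C f ψ g) (hm : Measurable ψ) :
    MeasBdd X₀ R (chiPos ψ) :=
  ⟨measurable_chiPos hm, 1, fun X _ => by
    rw [abs_of_nonneg (chiPos_mem ψ X).1]; exact (chiPos_mem ψ X).2⟩

theorem measBdd_mass (h : LocalSolution X₀ R C f ψ g) (hm : Measurable ψ) :
    MeasBdd X₀ R fun X => ψ X ^ 2 / X 0 := h.measBdd_div ((h.measBdd_psi hm).pow 2)

theorem measBdd_flux (h : LocalSolution X₀ R C f ψ g) (hm : Measurable ψ) :
    MeasBdd X₀ R fun X => ψ X * normalDeriv X₀ g X / X 0 :=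
  h.measBdd_div ((h.measBdd_psi hm).mul h.measBdd_normalDeriv)

theorem measBdd_termJ (h : LocalSolution X₀ R C f ψ g) (hm : Measurable ψ) :
    MeasBdd X₀ R fun X => (X 0 - X₀ 0) / X 0 ^ 2 * ψ X ^ 2 := by
  simpa only [inv_pow, ← div_eq_mul_inv] using ((h.measBdd_fst.sub (MeasBdd.const (X₀ 0))).mul
    (h.measBdd_inv.pow 2)).mul ((h.measBdd_psi hm).pow 2)

theorem measBdd_termI₁ (h : LocalSolution X₀ R C f ψ g) :
    MeasBdd X₀ R fun X => -((X 0 - X₀ 0) / X 0 ^ 2) * ‖g X‖ ^ 2 := by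
  simpa only [inv_pow, ← div_eq_mul_inv] using ((h.measBdd_fst.sub (MeasBdd.const (X₀ 0))).mul
    (h.measBdd_inv.pow 2)).neg.mul h.measBdd_grad_sq

theorem measBdd_termI₂ (h : LocalSolution X₀ R C f ψ g) (hm : Measurable ψ) :
    MeasBdd X₀ R fun X => (X 0 - X₀ 0) * X 1 * chiPos ψ X :=
  ((h.measBdd_fst.sub (MeasBdd.const (X₀ 0))).mul h.measBdd_snd).mul (h.measBdd_chi hm)

theorem measBdd_energy (h : LocalSolution X₀ R C f ψ g) (hm : Measurable ψ) :
    MeasBdd X₀ R fun X => ‖g X‖ ^ 2 / X 0 - X 0 * ψ X * f (ψ X) :=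
  (h.measBdd_div h.measBdd_grad_sq).sub
    ((h.measBdd_fst.mul (h.measBdd_psi hm)).mul (h.measBdd_f hm))

theorem measBdd_chiPart (h : LocalSolution X₀ R C f ψ g) (hm : Measurable ψ) :
    MeasBdd X₀ R fun X => X 0 * X 1 * chiPos ψ X :=
  (h.measBdd_fst.mul h.measBdd_snd).mul (h.measBdd_chi hm)

theorem measBdd_lagrangian (h : LocalSolution X₀ R C f ψ g) (hm : Measurable ψ) :
    MeasBdd X₀ R fun X =>
      ‖g X‖ ^ 2 / X 0 - 2 * X 0 * primitive f (ψ X) + X 0 * X 1 * chiPos ψ X :=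
  ((h.measBdd_div h.measBdd_grad_sq).sub
    ((h.measBdd_fst.const_mul 2).mul (h.measBdd_F hm))).add (h.measBdd_chiPart hm)

/-! ### The derivative of the boundary mass -/

/-- In polar coordinates differentiation passes under the angular integral. The arc length factor
contributes S/r, the square of ψ contributes the flux, and the radial derivative of the weight 1/x
is what produces J₁. -/
theorem hasDerivAt_bdryMass (h : LocalSolution X₀ R C f ψ g) (hm : Measurable ψ) {r : ℝ}
    (hr : r ∈ Ioo 0 R) :
    HasDerivAt (bdryMass ψ X₀) (bdryMass ψ X₀ r / r
      + 2 * circleInt X₀ r (fun X => ψ X * normalDeriv X₀ g X / X 0)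
      - termJ₁ ψ X₀ r / r) r := by
  have b1 := h.measBdd_flux hm
  have b2 := h.measBdd_div (h.measBdd_mass hm)
  have b3 := h.measBdd_mass hm
  have hmem : ∀ s ∈ Ioo 0 R, ∀ θ, X₀ + s • dir θ ∈ Metric.ball X₀ R := fun s hs θ =>
    (mem_ball_polar hs.1.le).2 hs.2
  have hcoord : ∀ s θ : ℝ, (X₀ + s • dir θ) 0 = X₀ 0 + s * Real.cos θ := fun s θ => by simp
  -- The derivative is bounded uniformly in s and θ by the bounds on the flux and mass densities, as
  -- required for differentiation under the integral.
  set F' : ℝ → ℝ → ℝ := fun s θ =>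
    (2 * (ψ (X₀ + s • dir θ) * normalDeriv X₀ g (X₀ + s • dir θ) / (X₀ + s • dir θ) 0) -
      ψ (X₀ + s • dir θ) ^ 2 / (X₀ + s • dir θ) 0 / (X₀ + s • dir θ) 0 * Real.cos θ) * s +
      ψ (X₀ + s • dir θ) ^ 2 / (X₀ + s • dir θ) 0 with hF'
  have hpm : ∀ s : ℝ, Measurable fun θ => X₀ + s • dir θ := fun s => by
    have := continuous_dir.measurable; fun_prop
  obtain ⟨m1, B1, hB1⟩ := b1
  obtain ⟨m2, B2, hB2⟩ := b2
  obtain ⟨m3, B3, hB3⟩ := b3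
  have key := intervalIntegral.hasDerivAt_integral_of_dominated_loc_of_deriv_le
    (μ := volume) (a := 0) (b := 2 * Real.pi)
    (F := fun s θ => ψ (X₀ + s • dir θ) ^ 2 / (X₀ + s • dir θ) 0 * s) (F' := F')
    (x₀ := r) (s := Ioo 0 R) (bound := fun _ => (2 * B1 + B2) * R + B3)
    (isOpen_Ioo.mem_nhds hr)
    (Eventually.of_forall fun s => ((m3.comp (hpm s)).mul_const s).aestronglyMeasurable)
    ((h.measBdd_mass hm).intervalIntegrable_circle hr.1.le hr.2)
    ((((((m1.comp (hpm r)).const_mul 2).sub ((m2.comp (hpm r)).mul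
      Real.continuous_cos.measurable)).mul_const r).add (m3.comp (hpm r))).aestronglyMeasurable)
    (Eventually.of_forall fun θ _ s hs => by
      have h1 := hB1 _ (hmem s hs θ)
      have h2 := hB2 _ (hmem s hs θ)
      have h3 := hB3 _ (hmem s hs θ)
      have h4 := (abs_nonneg _).trans h1
      have h5 := (abs_nonneg _).trans h2
      rw [hF', Real.norm_eq_abs]
      refine (abs_add_le _ _).trans (add_le_add ?_ h3)
      rw [abs_mul, abs_of_pos hs.1]
      refine mul_le_mul ((abs_sub _ _).trans (add_le_add ?_ ?_)) hs.2.le hs.1.le (by positivity)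
      · rw [abs_mul, abs_two]; gcongr
      · rw [abs_mul]
        exact (mul_le_of_le_one_right (abs_nonneg _) (Real.abs_cos_le_one θ)).trans h2)
    intervalIntegrable_const
    (Eventually.of_forall fun θ _ s hs => by
      have hx := (h.fst_pos (hmem s hs θ)).ne'
      have d1 := h.hasDerivAt_sq_ray θ hs
      have d2 : HasDerivAt (fun s : ℝ => (X₀ + s • dir θ) 0) (Real.cos θ) s := by
        simp only [hcoord]
        simpa using ((hasDerivAt_id s).mul_const (Real.cos θ)).const_add (X₀ 0)
      have d3 := (d1.fun_div d2 hx).fun_mul (hasDerivAt_id' s)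
      refine d3.congr_deriv ?_
      rw [hF']
      simp only [normalDeriv, normal_polar hs.1]
      field_simp)
  refine HasDerivAt.congr_deriv (f := bdryMass ψ X₀) key.2 ?_
  have i1 := (h.measBdd_flux hm).intervalIntegrable_circle hr.1.le hr.2
  have i2 := (h.measBdd_termJ hm).intervalIntegrable_circle hr.1.le hr.2
  have i3 := (h.measBdd_mass hm).intervalIntegrable_circle hr.1.le hr.2
  rw [bdryMass, termJ₁, circleInt_eq, circleInt_eq, circleInt_eq,
    ← intervalIntegral.integral_const_mul, ← intervalIntegral.integral_div,
    ← intervalIntegral.integral_div, ← intervalIntegral.integral_add (i3.div_const r) (i1.const_mul 2),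
    ← intervalIntegral.integral_sub ((i3.div_const r).add (i1.const_mul 2)) (i2.div_const r)]
  refine intervalIntegral.integral_congr fun θ _ => ?_
  have hx := (h.fst_pos (hmem r hr θ)).ne'
  have hc : (X₀ + r • dir θ) 0 - X₀ 0 = r * Real.cos θ := by rw [hcoord]; ring
  have hr0 := hr.1.ne'
  simp only [hF', hc]
  field_simp
  ring

/-! ### The weak equation on balls -/

/-- The normal derivative may jump on the free boundary and the normal is singular at X₀, but at all
such points ψ = 0 and the other factor is bounded. -/
theorem continuousOn_flux (h : LocalSolution X₀ R C f ψ g) :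
    ContinuousOn (fun X => ψ X * normalDeriv X₀ g X / X 0) (Metric.ball X₀ R) := by
  intro X hX
  refine ContinuousAt.continuousWithinAt ?_
  have hnb := Metric.isOpen_ball.mem_nhds hX
  have hψ : ContinuousAt ψ X := h.contOn.continuousAt hnb
  rcases (h.nonneg X hX).eq_or_lt with h0 | hp
  · obtain ⟨-, B, hB⟩ := h.measBdd_div h.measBdd_normalDeriv
    rw [ContinuousAt, ← h0, zero_mul, zero_div]
    have hz : Tendsto (fun Y => B * ψ Y) (𝓝 X) (𝓝 0) := by
      have := hψ.tendsto.const_mul B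
      rwa [← h0, mul_zero] at this
    refine squeeze_zero_norm' ?_ hz
    filter_upwards [hnb] with Y hY
    rw [mul_div_assoc, norm_mul, Real.norm_eq_abs, Real.norm_eq_abs, abs_of_nonneg (h.nonneg Y hY),
      mul_comm]
    exact mul_le_mul_of_nonneg_right (hB Y hY) (h.nonneg Y hY)
  · have hne : X - X₀ ≠ 0 := fun h' => by
      rw [sub_eq_zero.1 h', h.zero_center] at hp; exact lt_irrefl _ hp
    have hg : ContinuousAt g X := by
      refine h.grad_cont.continuousAt ?_
      exact inter_mem hnb (hψ.tendsto.eventually_const_lt hp)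
    have hn : ContinuousAt (normal X₀) X := by
      unfold normal
      have : ‖X - X₀‖ ≠ 0 := norm_ne_zero_iff.2 hne
      fun_prop (disch := assumption)
    have hx : ContinuousAt (fun Y : Plane => Y 0) X := by fun_prop
    exact (hψ.mul (hn.inner hg)).div hx (h.fst_pos hX).ne'

/-- The weak equation tested with ψ times a radial cutoff gives this for almost every radius;
continuity of both sides in r gives it for every radius. -/
theorem integral_energy_eq (h : LocalSolution X₀ R C f ψ g) (hm : Measurable ψ) {r : ℝ}
    (hr : r ∈ Ioo 0 R) :
    ∫ X in Metric.ball X₀ r, (‖g X‖ ^ 2 / X 0 - X 0 * ψ X * f (ψ X)) =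
      circleInt X₀ r (fun X => ψ X * normalDeriv X₀ g X / X 0) := by
  obtain ⟨m1, B1, hB1⟩ := h.measBdd_energy hm
  obtain ⟨m2, B2, hB2⟩ := h.measBdd_flux hm
  have hae := ae_integral_ball_eq_circleInt (B := max B1 B2) h.R_pos m1
    (fun X hX => (hB1 X hX).trans (le_max_left _ _)) m2
    (fun X hX => (hB2 X hX).trans (le_max_right _ _)) fun γ hγ hc hs => by
      have hη := contDiff_radialTest (X₀ := X₀) hγ hc hs h.R_pos
      obtain ⟨b, hb, hbs⟩ := tsupport_radialTest_subset (X₀ := X₀) hc hs h.R_pos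
      have hηc : HasCompactSupport (radialTest γ R X₀) :=
        (isCompact_closedBall X₀ b).of_isClosed_subset (isClosed_tsupport _) hbs
      have hηs : tsupport (radialTest γ R X₀) ⊆ Metric.ball X₀ R :=
        hbs.trans (Metric.closedBall_subset_ball hb)
      have e := h.euler _ hη hηc hηs
      have hγ0 : ∀ X, X ∉ Metric.ball X₀ R → γ ‖X - X₀‖ = 0 := fun X hX =>
        image_eq_zero_of_notMem_tsupport fun h' => hX (by
          rw [Metric.mem_ball, dist_eq_norm]; exact (hs h').2)
      rw [setIntegral_eq_integral_of_forall_compl_eq_zero fun X hX => ?_,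
        setIntegral_eq_integral_of_forall_compl_eq_zero fun X hX => ?_, e, ← integral_neg]
      · congr 1; ext X
        rw [fderiv_radialTest hγ hc hs h.R_pos, normalDeriv]
        ring
      · rw [hγ0 X hX, mul_zero]
      · rw [image_eq_zero_of_notMem_tsupport fun h' => hX (hηs h'), mul_zero]
  have hc1 : ContinuousOn (fun s => ∫ X in Metric.ball X₀ s,
      (‖g X‖ ^ 2 / X 0 - X 0 * ψ X * f (ψ X))) (Ioo 0 R) := by
    have i1 := (h.measBdd_energy hm).intervalIntegrable le_rfl h.R_pos.le le_rfl
    have c1 := intervalIntegral.continuousOn_primitive_interval' i1 left_mem_uIcc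
    rw [uIcc_of_le h.R_pos.le] at c1
    exact (c1.mono Ioo_subset_Icc_self).congr fun s hs =>
      (h.measBdd_energy hm).integral_ball hs.1.le hs.2.le
  have hc2 := continuousOn_circleInt h.continuousOn_flux hB2
  exact Measure.eqOn_open_of_ae_eq ((ae_restrict_iff' measurableSet_Ioo).2 hae) isOpen_Ioo hc1 hc2 hr

/-! ### The Pohozaev identity -/

/-- The density of the domain variation with the field `X - X₀`. -/
noncomputable def _root_.StagnationFlow.pohozaevDensity (f : ℝ → ℝ) (ψ : Plane → ℝ)
    (g : Plane → Plane) (X₀ X : Plane) : ℝ :=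
  3 * (X 0 * X 1 * chiPos ψ X) - (6 * X 0 - 2 * X₀ 0) * primitive f (ψ X)
    + -((X 0 - X₀ 0) / X 0 ^ 2) * ‖g X‖ ^ 2 + (X 0 - X₀ 0) * X 1 * chiPos ψ X

theorem measBdd_pohozaevDensity (h : LocalSolution X₀ R C f ψ g) (hm : Measurable ψ) :
    MeasBdd X₀ R (pohozaevDensity f ψ g X₀) :=
  (((h.measBdd_chiPart hm).const_mul 3).sub
    (((h.measBdd_fst.const_mul 6).sub (MeasBdd.const (2 * X₀ 0))).mul (h.measBdd_F hm))).add
      h.measBdd_termI₁ |>.add (h.measBdd_termI₂ hm)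

/-- The domain variation is tested with a radial cutoff times X − X₀. In two dimensions the interior
Dirichlet terms 2|∇ψ|²/x cancel; the divergence 2 and the explicit factors x and y turn the
remaining terms into those of `pohozaevDensity`. The derivative of the cutoff gives the circle
integral. It contains |∇ψ|², for which no continuity in the radius is available, so the identity
remains an almost everywhere one. -/
theorem ae_pohozaev (h : LocalSolution X₀ R C f ψ g) (hm : Measurable ψ) :
    ∀ᵐ r, r ∈ Ioo 0 R → ∫ X in Metric.ball X₀ r, pohozaevDensity f ψ g X₀ X =
      r * circleInt X₀ r (fun X =>
        (‖g X‖ ^ 2 / X 0 - 2 * X 0 * primitive f (ψ X) + X 0 * X 1 * chiPos ψ X)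
          - 2 * (normalDeriv X₀ g X ^ 2 / X 0)) := by
  have bE := h.measBdd_lagrangian hm
  have bT := bE.sub ((h.measBdd_div (h.measBdd_normalDeriv.pow 2)).const_mul 2)
  have bρ : MeasBdd X₀ R fun X => ‖X - X₀‖ := ⟨by fun_prop, R, fun X hX => by
    rw [abs_of_nonneg (norm_nonneg _)]; exact (norm_sub_lt hX).le⟩
  obtain ⟨m1, B1, hB1⟩ := h.measBdd_pohozaevDensity hm
  obtain ⟨m2, B2, hB2⟩ := bT.mul bρ
  have hae := ae_integral_ball_eq_circleInt (B := max B1 B2) h.R_pos m1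
    (fun X hX => (hB1 X hX).trans (le_max_left _ _)) m2
    (fun X hX => (hB2 X hX).trans (le_max_right _ _)) fun γ hγ hc hs => by
      set η := radialTest γ R X₀ with hηdef
      have hη : ContDiff ℝ ∞ η := contDiff_radialTest (X₀ := X₀) hγ hc hs h.R_pos
      obtain ⟨b, hb, hbs⟩ := tsupport_radialTest_subset (X₀ := X₀) hc hs h.R_pos
      have hηc : HasCompactSupport η :=
        (isCompact_closedBall X₀ b).of_isClosed_subset (isClosed_tsupport _) hbs
      have hηs : tsupport η ⊆ Metric.ball X₀ R :=
        hbs.trans (Metric.closedBall_subset_ball hb)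
      have hγ0 : ∀ X, X ∉ Metric.ball X₀ R → γ ‖X - X₀‖ = 0 := fun X hX =>
        image_eq_zero_of_notMem_tsupport fun h' => hX (by
          rw [Metric.mem_ball, dist_eq_norm]; exact (hs h').2)
      have hη0 : ∀ X, X ∉ Metric.ball X₀ R → η X = 0 := fun X hX =>
        image_eq_zero_of_notMem_tsupport fun h' => hX (hηs h')
      have e := h.variation (fun X => η X • (X - X₀)) (hη.smul (contDiff_id.sub contDiff_const))
        hηc.smul_right ((tsupport_smul_subset_left _ _).trans hηs)
      have hd : ∀ X v, fderiv ℝ (fun X => η X • (X - X₀)) X v =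
          η X • v - (γ ‖X - X₀‖ * inner ℝ (normal X₀ X) v) • (X - X₀) := fun X v => by
        have h1 := hasFDerivAt_radialTest (X₀ := X₀) hγ hc hs h.R_pos X
        have h2 : HasFDerivAt (fun X => η X • (X - X₀)) _ X :=
          h1.fun_smul ((hasFDerivAt_id X).sub_const X₀)
        rw [h2.fderiv]
        show η X • v + (-(γ ‖X - X₀‖ * inner ℝ (normal X₀ X) v)) • (X - X₀) = _
        rw [neg_smul, ← sub_eq_add_neg]
      have hn : ∀ X, inner ℝ (normal X₀ X) (X - X₀) = ‖X - X₀‖ := fun X => by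
        rw [normal, real_inner_smul_left, real_inner_self_eq_norm_sq]
        rcases eq_or_ne ‖X - X₀‖ 0 with h' | h'
        · rw [h']; simp
        · field_simp
      -- The derivative of the cutoff is −γ in the normal direction, and the normal component of X −
      -- X₀ is |X − X₀|.
      have hdiv : ∀ X, divergence (fun X => η X • (X - X₀)) X =
          2 * η X - γ ‖X - X₀‖ * ‖X - X₀‖ := fun X => by
        have h1 := hn X
        rw [inner_eq] at h1
        rw [divergence, Fin.sum_univ_two, hd, hd]
        simp only [inner_eq, PiLp.sub_apply, PiLp.smul_apply, basisVec_apply, smul_eq_mul] at h1 ⊢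
        simp only [if_true, zero_ne_one, one_ne_zero, if_false]
        linear_combination (-γ ‖X - X₀‖) * h1
      have hin : ∀ X, inner ℝ (g X) (fderiv ℝ (fun X => η X • (X - X₀)) X (g X)) =
          η X * ‖g X‖ ^ 2 - γ ‖X - X₀‖ * ‖X - X₀‖ * normalDeriv X₀ g X ^ 2 := fun X => by
        rw [hd, inner_sub_right, real_inner_smul_right, real_inner_smul_right,
          real_inner_self_eq_norm_sq]
        have h1 : inner ℝ (g X) (X - X₀) = ‖X - X₀‖ * normalDeriv X₀ g X := by
          rw [normalDeriv, normal, real_inner_smul_left, real_inner_comm]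
          rcases eq_or_ne ‖X - X₀‖ 0 with h' | h'
          · rw [norm_eq_zero.1 h']; simp
          · field_simp
        rw [h1, normalDeriv]
        ring
      have bη : MeasBdd X₀ R η := by
        obtain ⟨M, hM⟩ := hη.continuous.bounded_above_of_compact_support hηc
        exact ⟨hη.continuous.measurable, M, fun X _ => hM X⟩
      have bγ : MeasBdd X₀ R fun X => γ ‖X - X₀‖ := by
        obtain ⟨M, hM⟩ := hγ.continuous.bounded_above_of_compact_support hc
        exact ⟨hγ.continuous.measurable.comp (by fun_prop), M, fun X _ => hM _⟩
      have bx := h.measBdd_fst.sub (MeasBdd.const (X₀ 0))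
      have bW : MeasBdd X₀ R fun X => (-(‖g X‖ ^ 2 / X 0 ^ 2) - 2 * primitive f (ψ X)
          + X 1 * chiPos ψ X) * (η X * (X 0 - X₀ 0)) := by
        have := (((h.measBdd_grad_sq.mul (h.measBdd_inv.pow 2)).neg.sub
          ((h.measBdd_F hm).const_mul 2)).add (h.measBdd_snd.mul (h.measBdd_chi hm))).mul
            (bη.mul bx)
        simpa only [inv_pow, ← div_eq_mul_inv] using this
      have bZ : MeasBdd X₀ R fun X => X 0 * chiPos ψ X * (η X * X 1) :=
        (h.measBdd_fst.mul (h.measBdd_chi hm)).mul (bη.mul h.measBdd_snd)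
      have bP : MeasBdd X₀ R fun X =>
          (‖g X‖ ^ 2 / X 0 - 2 * X 0 * primitive f (ψ X) + X 0 * X 1 * chiPos ψ X)
          * (2 * η X - γ ‖X - X₀‖ * ‖X - X₀‖)
          - 2 / X 0 * (η X * ‖g X‖ ^ 2 - γ ‖X - X₀‖ * ‖X - X₀‖ * normalDeriv X₀ g X ^ 2) := by
        have := (bE.mul ((bη.const_mul 2).sub (bγ.mul bρ))).sub ((h.measBdd_inv.const_mul 2).mul
          ((bη.mul h.measBdd_grad_sq).sub ((bγ.mul bρ).mul (h.measBdd_normalDeriv.pow 2))))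
        simpa only [← div_eq_mul_inv] using this
      simp only [hdiv, hin, PiLp.smul_apply, PiLp.sub_apply, smul_eq_mul, h.center, sub_zero] at e
      have q : ∀ k : Plane → ℝ, (∀ X, X ∉ Metric.ball X₀ R → k X = 0) →
          ∫ X, k X = ∫ X in Metric.ball X₀ R, k X := fun k hk =>
        (setIntegral_eq_integral_of_forall_compl_eq_zero hk).symm
      rw [q (fun X =>
          (‖g X‖ ^ 2 / X 0 - 2 * X 0 * primitive f (ψ X) + X 0 * X 1 * chiPos ψ X)
          * (2 * η X - γ ‖X - X₀‖ * ‖X - X₀‖)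
          - 2 / X 0 * (η X * ‖g X‖ ^ 2 - γ ‖X - X₀‖ * ‖X - X₀‖ * normalDeriv X₀ g X ^ 2))
          fun X hX => by rw [hγ0 X hX, hη0 X hX]; ring,
        q (fun X => (-(‖g X‖ ^ 2 / X 0 ^ 2) - 2 * primitive f (ψ X)
          + X 1 * chiPos ψ X) * (η X * (X 0 - X₀ 0))) fun X hX => by rw [hη0 X hX]; ring,
        q (fun X => X 0 * chiPos ψ X * (η X * X 1)) fun X hX => by rw [hη0 X hX]; ring,
        ← bP.integral_add bW le_rfl, ← (bP.add bW).integral_add bZ le_rfl] at e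
      have bU := (h.measBdd_pohozaevDensity hm).mul bη
      have bV := (bT.mul bρ).mul bγ
      have e2 := bU.integral_sub bV le_rfl
      rw [← sub_eq_zero, ← e2, ← e]
      refine setIntegral_congr_fun Metric.isOpen_ball.measurableSet fun X hX => ?_
      have hx := (h.fst_pos hX).ne'
      simp only [pohozaevDensity]
      field_simp
      ring
  filter_upwards [hae] with r hr hrI
  rw [hr hrI, mul_comm]
  exact circleInt_mul_radial hrI.1.le _ fun t => t

end LocalSolution

/-- The error density of the Weiss formula that comes from the vorticity function. -/
noncomputable def vortexTerm (f : ℝ → ℝ) (ψ : Plane → ℝ) (X₀ : Plane) (t : ℝ) : ℝ :=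
  t * circleInt X₀ t (fun X => X 0 * (2 * primitive f (ψ X) - ψ X * f (ψ X)))
    - ∫ X in Metric.ball X₀ t, (6 * X 0 - 2 * X₀ 0) * primitive f (ψ X)

/-- The flux `∫_{∂B_r} ψ ∂_ν ψ / x`. -/
noncomputable def fluxInt (ψ : Plane → ℝ) (g : Plane → Plane) (X₀ : Plane) (r : ℝ) : ℝ :=
  circleInt X₀ r fun X => ψ X * normalDeriv X₀ g X / X 0

/-- The deviation from homogeneity of degree `3/2`. -/
noncomputable def weissDefect (ψ : Plane → ℝ) (g : Plane → Plane) (X₀ : Plane) (t : ℝ) : ℝ :=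
  2 / t ^ 5 * circleInt X₀ t fun X => (t * normalDeriv X₀ g X - 3 / 2 * ψ X) ^ 2 / X 0

/-- The quotient `J(r) = r⁻⁴ S(r)`. -/
noncomputable def massRatio (ψ : Plane → ℝ) (X₀ : Plane) (r : ℝ) : ℝ := bdryMass ψ X₀ r / r ^ 4

theorem MeasBdd.continuousOn_integral {X₀ : Plane} {R : ℝ} {k : Plane → ℝ} (hk : MeasBdd X₀ R k) :
    ContinuousOn (fun s => ∫ X in Metric.ball X₀ s, k X) (Ioo 0 R) := by
  rcases le_or_gt R 0 with hR | hR
  · rw [Ioo_eq_empty (not_lt.2 hR)]; exact continuousOn_empty _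
  have i1 := hk.intervalIntegrable le_rfl hR.le le_rfl
  have c1 := intervalIntegral.continuousOn_primitive_interval' i1 left_mem_uIcc
  rw [uIcc_of_le hR.le] at c1
  exact (c1.mono Ioo_subset_Icc_self).congr fun s hs => hk.integral_ball hs.1.le hs.2.le

theorem integrableOn_Ioo_of_continuousOn {k : ℝ → ℝ} {R B : ℝ} (hk : ContinuousOn k (Ioo 0 R))
    (hB : ∀ t ∈ Ioo 0 R, |k t| ≤ B) : IntegrableOn k (Ioo 0 R) :=
  Integrable.mono' (g := fun _ => B) (integrableOn_const measure_Ioo_lt_top.ne)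
    (hk.aestronglyMeasurable measurableSet_Ioo)
    ((ae_restrict_iff' measurableSet_Ioo).2 (Eventually.of_forall hB))

theorem continuousOn_div_pow {k : ℝ → ℝ} {R : ℝ} (hk : ContinuousOn k (Ioo 0 R)) (n : ℕ) :
    ContinuousOn (fun t => k t / t ^ n) (Ioo 0 R) :=
  hk.div (continuousOn_pow n) fun _ ht => pow_ne_zero n ht.1.ne'

/-! ### The Weiss monotonicity formula -/

namespace LocalSolution

variable {X₀ : Plane} {R C : ℝ} {f : ℝ → ℝ} {ψ : Plane → ℝ} {g : Plane → Plane}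

theorem continuousOn_fst (_ : LocalSolution X₀ R C f ψ g) :
    ContinuousOn (fun X : Plane => X 0) (Metric.ball X₀ R) := by fun_prop

theorem continuousOn_bdryMass (h : LocalSolution X₀ R C f ψ g) (hm : Measurable ψ) :
    ContinuousOn (bdryMass ψ X₀) (Ioo 0 R) := fun _ hr =>
  (h.hasDerivAt_bdryMass hm hr).continuousAt.continuousWithinAt

theorem continuousOn_fluxInt (h : LocalSolution X₀ R C f ψ g) (hm : Measurable ψ) :
    ContinuousOn (fluxInt ψ g X₀) (Ioo 0 R) := by
  obtain ⟨-, B, hB⟩ := h.measBdd_flux hm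
  exact continuousOn_circleInt h.continuousOn_flux hB

theorem continuousOn_termJ₁ (h : LocalSolution X₀ R C f ψ g) (hm : Measurable ψ) :
    ContinuousOn (termJ₁ ψ X₀) (Ioo 0 R) := by
  obtain ⟨-, B, hB⟩ := h.measBdd_termJ hm
  refine continuousOn_circleInt ?_ hB
  exact ((h.continuousOn_fst.sub continuousOn_const).div (h.continuousOn_fst.pow 2)
    fun X hX => pow_ne_zero 2 (h.fst_pos hX).ne').mul (h.contOn.pow 2)

theorem measBdd_vortex (h : LocalSolution X₀ R C f ψ g) (hm : Measurable ψ) :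
    MeasBdd X₀ R fun X => X 0 * (2 * primitive f (ψ X) - ψ X * f (ψ X)) :=
  h.measBdd_fst.mul (((h.measBdd_F hm).const_mul 2).sub ((h.measBdd_psi hm).mul (h.measBdd_f hm)))

theorem measBdd_vortex' (h : LocalSolution X₀ R C f ψ g) (hm : Measurable ψ) :
    MeasBdd X₀ R fun X => (6 * X 0 - 2 * X₀ 0) * primitive f (ψ X) :=
  ((h.measBdd_fst.const_mul 6).sub (MeasBdd.const (2 * X₀ 0))).mul (h.measBdd_F hm)

theorem continuousOn_vortexTerm (h : LocalSolution X₀ R C f ψ g) (hm : Measurable ψ) :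
    ContinuousOn (vortexTerm f ψ X₀) (Ioo 0 R) := by
  obtain ⟨-, B, hB⟩ := h.measBdd_vortex hm
  refine ContinuousOn.sub (continuousOn_id.mul (continuousOn_circleInt ?_ hB))
    (h.measBdd_vortex' hm).continuousOn_integral
  exact h.continuousOn_fst.mul (((continuousOn_const).mul
    ((continuous_primitive h.f_cont).comp_continuousOn h.contOn)).sub
      (h.contOn.mul (h.f_cont.comp_continuousOn h.contOn)))

theorem hasDerivAt_massRatio (h : LocalSolution X₀ R C f ψ g) (hm : Measurable ψ) {r : ℝ}
    (hr : r ∈ Ioo 0 R) :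
    HasDerivAt (massRatio ψ X₀)
      (2 * (fluxInt ψ g X₀ r / r ^ 3 - 3 / 2 * massRatio ψ X₀ r) / r + -(termJ₁ ψ X₀ r / r ^ 5)) r := by
  have hr0 := hr.1.ne'
  have h1 := (h.hasDerivAt_bdryMass hm hr).fun_div (hasDerivAt_pow 4 r) (pow_ne_zero 4 hr0)
  refine h1.congr_deriv ?_
  rw [massRatio, fluxInt]
  field_simp
  push_cast
  ring

theorem circleInt_sq_eq (h : LocalSolution X₀ R C f ψ g) (hm : Measurable ψ) {r : ℝ}
    (hr : r ∈ Ioo 0 R) (a b : ℝ) :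
    circleInt X₀ r (fun X => (a * normalDeriv X₀ g X - b * ψ X) ^ 2 / X 0) =
      a ^ 2 * circleInt X₀ r (fun X => normalDeriv X₀ g X ^ 2 / X 0)
        - 2 * a * b * fluxInt ψ g X₀ r + b ^ 2 * bdryMass ψ X₀ r := by
  have b1 := h.measBdd_div (h.measBdd_normalDeriv.pow 2)
  have b2 := h.measBdd_flux hm
  have b3 := h.measBdd_mass hm
  have e := ((b1.const_mul (a ^ 2)).sub (b2.const_mul (2 * a * b))).circleInt_add
    (b3.const_mul (b ^ 2)) hr.1.le hr.2
  rw [(b1.const_mul (a ^ 2)).circleInt_sub (b2.const_mul (2 * a * b)) hr.1.le hr.2,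
    circleInt_const_mul, circleInt_const_mul, circleInt_const_mul] at e
  rw [fluxInt, bdryMass, ← e]
  congr 1; ext X; ring

theorem weissDefect_eq (h : LocalSolution X₀ R C f ψ g) (hm : Measurable ψ) {r : ℝ}
    (hr : r ∈ Ioo 0 R) : weissDefect ψ g X₀ r = 2 / r ^ 3 *
      circleInt X₀ r (fun X => normalDeriv X₀ g X ^ 2 / X 0)
        - 6 * fluxInt ψ g X₀ r / r ^ 4 + 9 / 2 * bdryMass ψ X₀ r / r ^ 5 := by
  have hr0 := hr.1.ne'
  rw [weissDefect, h.circleInt_sq_eq hm hr]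
  field_simp
  ring

theorem measBdd_weissDensity (h : LocalSolution X₀ R C f ψ g) (hm : Measurable ψ) :
    MeasBdd X₀ R fun X =>
      ‖g X‖ ^ 2 / X 0 - X 0 * ψ X * f (ψ X) + X 0 * X 1 * chiPos ψ X :=
  (h.measBdd_energy hm).add (h.measBdd_chiPart hm)

/-- The Weiss monotonicity formula, as an almost everywhere identity. -/
theorem ae_weiss (h : LocalSolution X₀ R C f ψ g) (hm : Measurable ψ) :
    ∀ᵐ t, t ∈ Ioo 0 R →
      circleInt X₀ t (fun X =>
          ‖g X‖ ^ 2 / X 0 - X 0 * ψ X * f (ψ X) + X 0 * X 1 * chiPos ψ X) * (1 / t ^ 3)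
        + (∫ X in Metric.ball X₀ t,
          (‖g X‖ ^ 2 / X 0 - X 0 * ψ X * f (ψ X) + X 0 * X 1 * chiPos ψ X)) * (-3 / t ^ 4)
        - 3 / 2 * (2 * (fluxInt ψ g X₀ t / t ^ 3 - 3 / 2 * massRatio ψ X₀ t) / t
          + -(termJ₁ ψ X₀ t / t ^ 5)) =
      weissDefect ψ g X₀ t + (termI₁ g X₀ t / t ^ 4 + termI₂ ψ X₀ t / t ^ 4
        + vortexTerm f ψ X₀ t / t ^ 4 + 3 / 2 * (termJ₁ ψ X₀ t / t ^ 5)) := by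
  filter_upwards [h.ae_pohozaev hm] with t ht htI
  have ht0 := htI.1.ne'
  have hp := ht htI
  have b1 := (h.measBdd_chiPart hm).const_mul 3
  have b2 := h.measBdd_vortex' hm
  have b3 := h.measBdd_termI₁
  have b4 := h.measBdd_termI₂ hm
  have b5 := (h.measBdd_div (h.measBdd_normalDeriv.pow 2)).const_mul 2
  have b6 := h.measBdd_lagrangian hm
  have e1 : ∫ X in Metric.ball X₀ t, pohozaevDensity f ψ g X₀ X =
      3 * (∫ X in Metric.ball X₀ t, X 0 * X 1 * chiPos ψ X)
        - (∫ X in Metric.ball X₀ t, (6 * X 0 - 2 * X₀ 0) * primitive f (ψ X))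
        + termI₁ g X₀ t + termI₂ ψ X₀ t := by
    simp only [pohozaevDensity]
    rw [((b1.sub b2).add b3).integral_add b4 htI.2.le, (b1.sub b2).integral_add b3 htI.2.le,
      b1.integral_sub b2 htI.2.le, integral_const_mul]
    rfl
  have e2 := b6.circleInt_sub b5 htI.1.le htI.2
  rw [circleInt_const_mul] at e2
  -- The derivative of Φ contains ψf(ψ), while the domain variation contains 2F(ψ); their difference
  -- is part of the vorticity error.
  have e3 : circleInt X₀ t (fun X =>
      ‖g X‖ ^ 2 / X 0 - X 0 * ψ X * f (ψ X) + X 0 * X 1 * chiPos ψ X) =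
      circleInt X₀ t (fun X =>
        ‖g X‖ ^ 2 / X 0 - 2 * X 0 * primitive f (ψ X) + X 0 * X 1 * chiPos ψ X) +
      circleInt X₀ t (fun X => X 0 * (2 * primitive f (ψ X) - ψ X * f (ψ X))) := by
    rw [← b6.circleInt_add (h.measBdd_vortex hm) htI.1.le htI.2]
    congr 1; ext X; ring
  -- Replacing the interior energy by the flux leaves only boundary terms, which combine with the
  -- normal derivative in the Pohozaev identity to the complete square in n.
  have e4 : ∫ X in Metric.ball X₀ t,
      (‖g X‖ ^ 2 / X 0 - X 0 * ψ X * f (ψ X) + X 0 * X 1 * chiPos ψ X) =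
      fluxInt ψ g X₀ t + ∫ X in Metric.ball X₀ t, X 0 * X 1 * chiPos ψ X := by
    rw [(h.measBdd_energy hm).integral_add (h.measBdd_chiPart hm) htI.2.le,
      h.integral_energy_eq hm htI]
    rfl
  rw [e1, e2] at hp
  rw [e3, e4, h.weissDefect_eq hm htI, massRatio, vortexTerm]
  set c1 := circleInt X₀ t (fun X =>
        ‖g X‖ ^ 2 / X 0 - 2 * X 0 * primitive f (ψ X) + X 0 * X 1 * chiPos ψ X)
  field_simp
  linear_combination (-2 * t) * hp

/-- The function `Φ`, with natural powers. -/
theorem weissEnergy_eq (X₀ : Plane) (f : ℝ → ℝ) (ψ : Plane → ℝ) (g : Plane → Plane) (r : ℝ) :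
    weissEnergy f ψ g X₀ r = (∫ X in Metric.ball X₀ r,
      (‖g X‖ ^ 2 / X 0 - X 0 * ψ X * f (ψ X) + X 0 * X 1 * chiPos ψ X)) / r ^ 3
        - 3 / 2 * massRatio ψ X₀ r := by
  rw [weissEnergy, energyI, energyJ, massRatio]
  simp only [zpow_neg, div_eq_mul_inv]
  norm_cast
  ring

theorem intervalIntegrable_of_continuousOn {k : ℝ → ℝ} {s r : ℝ} (hk : ContinuousOn k (Ioo 0 R))
    (hs : 0 < s) (hsr : s ≤ r) (hr : r < R) : IntervalIntegrable k volume s r := by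
  refine ContinuousOn.intervalIntegrable (hk.mono ?_)
  rw [uIcc_of_le hsr]
  exact fun t ht => ⟨hs.trans_le ht.1, ht.2.trans_lt hr⟩

theorem continuousOn_weissError (h : LocalSolution X₀ R C f ψ g) (hm : Measurable ψ) :
    ContinuousOn (fun t => termI₁ g X₀ t / t ^ 4 + termI₂ ψ X₀ t / t ^ 4
        + vortexTerm f ψ X₀ t / t ^ 4 + 3 / 2 * (termJ₁ ψ X₀ t / t ^ 5)) (Ioo 0 R) :=
  (((continuousOn_div_pow h.measBdd_termI₁.continuousOn_integral 4).add
    (continuousOn_div_pow (h.measBdd_termI₂ hm).continuousOn_integral 4)).add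
      (continuousOn_div_pow (h.continuousOn_vortexTerm hm) 4)).add
    (continuousOn_const.mul (continuousOn_div_pow (h.continuousOn_termJ₁ hm) 5))

theorem intervalIntegrable_weissDefect (h : LocalSolution X₀ R C f ψ g) (hm : Measurable ψ)
    {s r : ℝ} (hs : 0 < s) (hsr : s ≤ r) (hr : r < R) :
    IntervalIntegrable (weissDefect ψ g X₀) volume s r := by
  have hmem : ∀ t ∈ uIcc s r, t ∈ Ioo 0 R := fun t ht => by
    rw [uIcc_of_le hsr] at ht
    exact ⟨hs.trans_le ht.1, ht.2.trans_lt hr⟩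
  have i1 := (h.measBdd_div (h.measBdd_normalDeriv.pow 2)).intervalIntegrable hs.le hsr hr.le
  have i2 : IntervalIntegrable (fun t => 2 / t ^ 3 *
      circleInt X₀ t (fun X => normalDeriv X₀ g X ^ 2 / X 0)) volume s r :=
    i1.continuousOn_mul (ContinuousOn.div continuousOn_const (continuousOn_pow 3)
      fun t ht => pow_ne_zero 3 (hmem t ht).1.ne')
  have c1 : ContinuousOn (fun t => 6 * fluxInt ψ g X₀ t / t ^ 4) (Ioo 0 R) :=
    continuousOn_div_pow (continuousOn_const.mul (h.continuousOn_fluxInt hm)) 4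
  have c2 : ContinuousOn (fun t => 9 / 2 * bdryMass ψ X₀ t / t ^ 5) (Ioo 0 R) :=
    continuousOn_div_pow (continuousOn_const.mul (h.continuousOn_bdryMass hm)) 5
  refine ((i2.sub (intervalIntegrable_of_continuousOn c1 hs hsr hr)).add
    (intervalIntegrable_of_continuousOn c2 hs hsr hr)).congr fun t ht => ?_
  exact (h.weissDefect_eq hm (hmem t (uIoc_subset_uIcc ht))).symm

/-- The integrated Weiss monotonicity formula. -/
theorem weissEnergy_sub (h : LocalSolution X₀ R C f ψ g) (hm : Measurable ψ) {s r : ℝ}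
    (hs : 0 < s) (hsr : s ≤ r) (hr : r < R) :
    weissEnergy f ψ g X₀ r - weissEnergy f ψ g X₀ s =
      (∫ t in s..r, weissDefect ψ g X₀ t) +
      ∫ t in s..r, (termI₁ g X₀ t / t ^ 4 + termI₂ ψ X₀ t / t ^ 4
        + vortexTerm f ψ X₀ t / t ^ 4 + 3 / 2 * (termJ₁ ψ X₀ t / t ^ 5)) := by
  have hmem : ∀ t ∈ Icc s r, t ∈ Ioo 0 R := fun t ht => ⟨hs.trans_le ht.1, ht.2.trans_lt hr⟩
  have bW := h.measBdd_weissDensity hm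
  have cW : ContinuousOn (fun t : ℝ => -3 / t ^ 4) (Icc s r) :=
    continuousOn_const.div (continuousOn_pow 4) fun t ht => pow_ne_zero 4 (hmem t ht).1.ne'
  -- The energy part of Φ is an indefinite integral over circles times r⁻³, hence recovered from its
  -- almost everywhere derivative; the mass part is differentiable in the classical sense.
  obtain ⟨i1, e1⟩ := integral_primitive_mul (h := fun t => 1 / t ^ 3) (h' := fun t => -3 / t ^ 4)
    hs.le hsr (bW.intervalIntegrable le_rfl (hs.le.trans hsr) hr.le) (fun t ht => by
      have ht0 := (hmem t ht).1.ne'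
      have := (hasDerivAt_pow 3 t).fun_inv (pow_ne_zero 3 ht0)
      simp only [one_div]
      refine this.congr_deriv ?_
      field_simp
      push_cast
      ring) (cW.intervalIntegrable_of_Icc hsr)
  have cJ : ContinuousOn (fun t => 2 * (fluxInt ψ g X₀ t / t ^ 3 - 3 / 2 * massRatio ψ X₀ t) / t
      + -(termJ₁ ψ X₀ t / t ^ 5)) (Ioo 0 R) := by
    refine ((continuousOn_const.mul ((continuousOn_div_pow (h.continuousOn_fluxInt hm) 3).sub
      (continuousOn_const.mul (continuousOn_div_pow (h.continuousOn_bdryMass hm) 4)))).div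
      continuousOn_id fun t ht => ht.1.ne').add (continuousOn_div_pow (h.continuousOn_termJ₁ hm) 5).neg
  have iJ := intervalIntegrable_of_continuousOn cJ hs hsr hr
  have e2 := intervalIntegral.integral_eq_sub_of_hasDerivAt (fun t ht => by
    rw [uIcc_of_le hsr] at ht
    exact h.hasDerivAt_massRatio hm (hmem t ht)) iJ
  rw [← intervalIntegral.integral_add (h.intervalIntegrable_weissDefect hm hs hsr hr)
    (intervalIntegrable_of_continuousOn (h.continuousOn_weissError hm) hs hsr hr)]
  rw [weissEnergy_eq, weissEnergy_eq, bW.integral_ball (hs.le.trans hsr) hr.le,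
    bW.integral_ball hs.le (hsr.trans hr.le)]
  have e3 : ∫ t in s..r, (weissDefect ψ g X₀ t + (termI₁ g X₀ t / t ^ 4 + termI₂ ψ X₀ t / t ^ 4
        + vortexTerm f ψ X₀ t / t ^ 4 + 3 / 2 * (termJ₁ ψ X₀ t / t ^ 5))) =
      ∫ t in s..r, (circleInt X₀ t (fun X =>
          ‖g X‖ ^ 2 / X 0 - X 0 * ψ X * f (ψ X) + X 0 * X 1 * chiPos ψ X) * (1 / t ^ 3)
        + (∫ u in (0 : ℝ)..t, circleInt X₀ u (fun X =>
          ‖g X‖ ^ 2 / X 0 - X 0 * ψ X * f (ψ X) + X 0 * X 1 * chiPos ψ X)) * (-3 / t ^ 4)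
        - 3 / 2 * (2 * (fluxInt ψ g X₀ t / t ^ 3 - 3 / 2 * massRatio ψ X₀ t) / t
          + -(termJ₁ ψ X₀ t / t ^ 5))) := by
    refine intervalIntegral.integral_congr_ae ?_
    filter_upwards [h.ae_weiss hm] with t ht htI
    rw [uIoc_of_le hsr] at htI
    have htI' := hmem t (Ioc_subset_Icc_self htI)
    rw [← ht htI', bW.integral_ball htI'.1.le htI'.2.le]
  rw [e3, intervalIntegral.integral_sub i1 (iJ.const_mul _), e1, intervalIntegral.integral_const_mul,
    e2]
  ring

/-! ### Growth near the centre -/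

theorem snd_sq_le {X : Plane} (h : LocalSolution X₀ R C f ψ g) : |X 1| ≤ ‖X - X₀‖ := by
  have := abs_sub_coord_le X X₀ 1
  rwa [h.center, sub_zero] at this

theorem bdryMass_le (h : LocalSolution X₀ R C f ψ g) {r : ℝ} (hr : r ∈ Ioo 0 R) :
    bdryMass ψ X₀ r ≤ 4 * Real.pi * C / X₀ 0 * r ^ 4 := by
  have hx := h.center_pos
  have hC := h.C_nonneg
  have h1 := abs_circleInt_le (B := 2 * C / X₀ 0 * r ^ 3) (h := fun X => ψ X ^ 2 / X 0) hr.1.le hr.2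
    fun X hX hXr => by
      have hXp := h.fst_pos hX
      have h1 := h.sq_le hX
      rw [hXr] at h1
      rw [abs_of_nonneg (by positivity), div_le_iff₀ hXp]
      refine h1.trans ?_
      have h2 := (h.fst_mem hX).1
      have hr0 := hr.1
      calc C * r ^ 3 = 2 * C / X₀ 0 * r ^ 3 * (X₀ 0 / 2) := by field_simp
        _ ≤ 2 * C / X₀ 0 * r ^ 3 * X 0 := by gcongr
  refine (le_abs_self _).trans (h1.trans (le_of_eq ?_))
  ring

theorem bdryMass_nonneg (h : LocalSolution X₀ R C f ψ g) {r : ℝ} (hr : r ∈ Ioo 0 R) :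
    0 ≤ bdryMass ψ X₀ r :=
  circleInt_nonneg hr.1.le hr.2 fun X hX => by
    have := h.fst_pos hX
    positivity

/-- Compared with the weight 1/x, the factor (x − x₀)/x² gains one power of r. This makes I₁ and J₁
integrable errors. -/
theorem abs_factor_le (h : LocalSolution X₀ R C f ψ g) {X : Plane} (hX : X ∈ Metric.ball X₀ R)
    {r : ℝ} (hXr : ‖X - X₀‖ ≤ r) : |(X 0 - X₀ 0) / X 0 ^ 2| ≤ 2 * r / X₀ 0 * (1 / X 0) := by
  have hx := h.center_pos
  have hXp := h.fst_pos hX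
  have h1 := (abs_sub_coord_le X X₀ 0).trans hXr
  have h2 := (h.fst_mem hX).1
  have hr0 := (norm_nonneg _).trans hXr
  rw [abs_div, abs_of_pos (pow_pos hXp 2), div_le_iff₀ (by positivity)]
  calc |X 0 - X₀ 0| ≤ r := h1
    _ = 2 * r / X₀ 0 * (X₀ 0 / 2) := by field_simp
    _ ≤ 2 * r / X₀ 0 * X 0 := by gcongr
    _ = 2 * r / X₀ 0 * (1 / X 0) * X 0 ^ 2 := by field_simp

theorem abs_termJ₁_le (h : LocalSolution X₀ R C f ψ g) (hm : Measurable ψ) {r : ℝ}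
    (hr : r ∈ Ioo 0 R) : |termJ₁ ψ X₀ r| ≤ 2 * r / X₀ 0 * bdryMass ψ X₀ r := by
  rw [bdryMass, ← circleInt_const_mul]
  refine (h.measBdd_termJ hm).abs_circleInt_le ((h.measBdd_mass hm).const_mul _) hr.1.le hr.2
    fun X hX hXr => ?_
  rw [abs_mul, abs_of_nonneg (sq_nonneg (ψ X))]
  refine (mul_le_mul_of_nonneg_right (h.abs_factor_le hX hXr.le) (sq_nonneg _)).trans (le_of_eq ?_)
  ring

theorem abs_termI₁_le (h : LocalSolution X₀ R C f ψ g) {r : ℝ}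
    (hr : r ∈ Ioo 0 R) :
    |termI₁ g X₀ r| ≤ 2 * r / X₀ 0 * ∫ X in Metric.ball X₀ r, ‖g X‖ ^ 2 / X 0 := by
  rw [← integral_const_mul]
  refine h.measBdd_termI₁.abs_integral_le ((h.measBdd_div h.measBdd_grad_sq).const_mul _) hr.2.le
    fun X hX => ?_
  rw [abs_mul, abs_neg, abs_of_nonneg (sq_nonneg ‖g X‖)]
  refine (mul_le_mul_of_nonneg_right (h.abs_factor_le (Metric.ball_subset_ball hr.2.le hX)
    (norm_sub_lt hX).le) (sq_nonneg _)).trans (le_of_eq ?_)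
  ring

theorem integral_grad_le (h : LocalSolution X₀ R C f ψ g) {r : ℝ} (hr : r ∈ Ioo 0 R) :
    ∫ X in Metric.ball X₀ r, ‖g X‖ ^ 2 / X 0 ≤ 2 * Real.pi * C / X₀ 0 * r ^ 3 := by
  have hx := h.center_pos
  have hC := h.C_nonneg
  have h1 := abs_integral_ball_le (X₀ := X₀) (B := 2 * C / X₀ 0 * r) (h := fun X => ‖g X‖ ^ 2 / X 0)
    hr.1.le fun X hX => by
      have hXR := Metric.ball_subset_ball hr.2.le hX
      have hXp := h.fst_pos hXR
      rw [abs_of_nonneg (by positivity), div_le_iff₀ hXp]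
      have h2 := (h.fst_mem hXR).1
      have hr0 := hr.1
      calc ‖g X‖ ^ 2 ≤ C * ‖X - X₀‖ := h.grad_le X hXR
        _ ≤ C * r := by gcongr; exact (norm_sub_lt hX).le
        _ = 2 * C / X₀ 0 * r * (X₀ 0 / 2) := by field_simp
        _ ≤ 2 * C / X₀ 0 * r * X 0 := by gcongr
  refine (le_abs_self _).trans (h1.trans (le_of_eq ?_))
  ring

theorem integral_grad_nonneg (h : LocalSolution X₀ R C f ψ g) {r : ℝ} (hr : r ∈ Ioo 0 R) :
    0 ≤ ∫ X in Metric.ball X₀ r, ‖g X‖ ^ 2 / X 0 :=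
  setIntegral_nonneg Metric.isOpen_ball.measurableSet fun X hX => by
    have := h.fst_pos (Metric.ball_subset_ball hr.2.le hX)
    positivity

/-- A Poincaré type inequality. -/
theorem integral_mass_le (h : LocalSolution X₀ R C f ψ g) (hm : Measurable ψ) {r : ℝ}
    (hr : r ∈ Ioo 0 R) :
    ∫ X in Metric.ball X₀ r, ψ X ^ 2 / X 0 ≤ r * bdryMass ψ X₀ r +
      2 * r ^ 2 * ∫ X in Metric.ball X₀ r, ‖g X‖ ^ 2 / X 0 := by
  have bS := h.measBdd_mass hm
  have ba := h.measBdd_div h.measBdd_grad_sq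
  have hx := h.center_pos
  rw [bS.integral_ball hr.1.le hr.2.le, ba.integral_ball hr.1.le hr.2.le]
  -- the inequality on `(s, r)`
  have key : ∀ s ∈ Ioo 0 r, (∫ t in s..r, bdryMass ψ X₀ t) ≤ r * bdryMass ψ X₀ r +
      2 * r ^ 2 * ∫ t in (0 : ℝ)..r, circleInt X₀ t fun X => ‖g X‖ ^ 2 / X 0 := fun s hs => by
    have hmem : ∀ t ∈ Icc s r, t ∈ Ioo 0 R := fun t ht => ⟨hs.1.trans_le ht.1, ht.2.trans_lt hr.2⟩
    have cD : ContinuousOn (fun t => 1 * bdryMass ψ X₀ t + t * (bdryMass ψ X₀ t / t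
        + 2 * fluxInt ψ g X₀ t - termJ₁ ψ X₀ t / t)) (Ioo 0 R) :=
      (continuousOn_const.mul (h.continuousOn_bdryMass hm)).add (continuousOn_id.mul
        ((((h.continuousOn_bdryMass hm).div continuousOn_id fun t ht => ht.1.ne').add
          (continuousOn_const.mul (h.continuousOn_fluxInt hm))).sub
          ((h.continuousOn_termJ₁ hm).div continuousOn_id fun t ht => ht.1.ne')))
    have iD := intervalIntegrable_of_continuousOn cD hs.1 hs.2.le hr.2
    have e := intervalIntegral.integral_eq_sub_of_hasDerivAt (f := fun t => t * bdryMass ψ X₀ t)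
      (fun t ht => by
      rw [uIcc_of_le hs.2.le] at ht
      exact (hasDerivAt_id' t).fun_mul (h.hasDerivAt_bdryMass hm (hmem t ht))) iD
    have iS := intervalIntegrable_of_continuousOn (h.continuousOn_bdryMass hm) hs.1 hs.2.le hr.2
    have ia := ba.intervalIntegrable hs.1.le hs.2.le hr.2.le
    have hle : ∫ t in s..r, (bdryMass ψ X₀ t - 2 * r ^ 2 * circleInt X₀ t fun X => ‖g X‖ ^ 2 / X 0) ≤
        ∫ t in s..r, (1 * bdryMass ψ X₀ t + t * (bdryMass ψ X₀ t / t
        + 2 * fluxInt ψ g X₀ t - termJ₁ ψ X₀ t / t)) := by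
      -- The derivative of tS is 2S + 2t·flux − J₁. The flux term costs S/2 plus a gradient term by
      -- Young's inequality and J₁ costs at most S/2, so one full S is left.
      refine intervalIntegral.integral_mono_on hs.2.le (iS.sub (ia.const_mul _)) iD fun t ht => ?_
      have htR := hmem t ht
      have ht0 := htR.1
      have hS0 := h.bdryMass_nonneg htR
      have h1 := (abs_le.1 (h.abs_termJ₁_le hm htR)).2
      have h2 : 2 * t / X₀ 0 ≤ 1 / 2 := by
        rw [div_le_iff₀ hx]; linarith [h.R_le, htR.2]
      have h3 : -(1 / 2 * bdryMass ψ X₀ t + 2 * r ^ 2 * circleInt X₀ t fun X => ‖g X‖ ^ 2 / X 0) ≤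
          2 * t * fluxInt ψ g X₀ t := by
        have := (((bS.const_mul (-(1 / 2))).sub (ba.const_mul (2 * r ^ 2))).circleInt_mono
          ((h.measBdd_flux hm).const_mul (2 * t)) htR.1.le htR.2 fun X hX _ => by
            have hXp := h.fst_pos hX
            rw [← mul_div_assoc, ← mul_div_assoc, ← mul_div_assoc, ← sub_div]
            refine div_le_div_of_nonneg_right ?_ hXp.le
            have h4 := sq_normalDeriv_le X₀ g X
            have h5 : t ^ 2 ≤ r ^ 2 := pow_le_pow_left₀ ht0.le ht.2 2
            have h6 : t ^ 2 * normalDeriv X₀ g X ^ 2 ≤ r ^ 2 * ‖g X‖ ^ 2 :=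
              mul_le_mul h5 h4 (sq_nonneg _) (sq_nonneg _)
            nlinarith [sq_nonneg (ψ X + 2 * t * normalDeriv X₀ g X)])
        rw [(bS.const_mul (-(1 / 2))).circleInt_sub (ba.const_mul (2 * r ^ 2)) htR.1.le htR.2,
          circleInt_const_mul, circleInt_const_mul, circleInt_const_mul] at this
        rw [fluxInt, bdryMass]
        linarith
      have h7 : t * (bdryMass ψ X₀ t / t + 2 * fluxInt ψ g X₀ t - termJ₁ ψ X₀ t / t) =
          bdryMass ψ X₀ t + 2 * t * fluxInt ψ g X₀ t - termJ₁ ψ X₀ t := by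
        field_simp
      rw [h7]
      nlinarith
    rw [e, intervalIntegral.integral_sub iS (ia.const_mul _),
      intervalIntegral.integral_const_mul] at hle
    have hs0 := mul_nonneg hs.1.le (h.bdryMass_nonneg ⟨hs.1, hs.2.trans hr.2⟩)
    have hmono : (∫ t in s..r, circleInt X₀ t fun X => ‖g X‖ ^ 2 / X 0) ≤
        ∫ t in (0 : ℝ)..r, circleInt X₀ t fun X => ‖g X‖ ^ 2 / X 0 := by
      rw [← intervalIntegral.integral_add_adjacent_intervals
        (ba.intervalIntegrable le_rfl hs.1.le (hs.2.le.trans hr.2.le)) ia]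
      have : 0 ≤ ∫ t in (0 : ℝ)..s, circleInt X₀ t fun X => ‖g X‖ ^ 2 / X 0 :=
        intervalIntegral.integral_nonneg hs.1.le fun t ht =>
          circleInt_nonneg ht.1 (ht.2.trans_lt (hs.2.trans hr.2)) fun X hX => by
            have := h.fst_pos hX
            positivity
      linarith
    have := mul_le_mul_of_nonneg_left hmono (by positivity : 0 ≤ 2 * r ^ 2)
    linarith
  have iS0 : IntervalIntegrable (bdryMass ψ X₀) volume 0 r :=
    bS.intervalIntegrable le_rfl hr.1.le hr.2.le
  have hlim : Tendsto (fun s => ∫ t in s..r, bdryMass ψ X₀ t) (𝓝[>] 0)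
      (𝓝 (∫ t in (0 : ℝ)..r, bdryMass ψ X₀ t)) := by
    have c := intervalIntegral.continuousOn_primitive_interval_left (μ := volume)
      (f := bdryMass ψ X₀) (a := 0) (b := r)
      (by rw [uIcc_of_le hr.1.le]
          exact (intervalIntegrable_iff_integrableOn_Icc_of_le hr.1.le).1 iS0)
    refine (c 0 left_mem_uIcc).mono_left ?_
    rw [uIcc_of_le hr.1.le]
    exact nhdsWithin_le_of_mem (Icc_mem_nhdsGT hr.1)
  exact le_of_tendsto hlim (eventually_of_mem (Ioo_mem_nhdsGT hr.1) key)

end LocalSolution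

/-! ### Two explicit integrals -/

theorem measBdd_posPart {X₀ : Plane} (h0 : X₀ 1 = 0) (R : ℝ) :
    MeasBdd X₀ R fun X => max (X 1) 0 :=
  ⟨by fun_prop, R, fun X hX => by
    have h1 := abs_sub_coord_le X X₀ 1
    rw [h0, sub_zero] at h1
    rw [Metric.mem_ball, dist_eq_norm] at hX
    rw [abs_of_nonneg (le_max_right _ _)]
    exact max_le ((le_abs_self _).trans (h1.trans hX.le)) ((norm_nonneg _).trans hX.le)⟩

theorem circleInt_posPart {X₀ : Plane} (h0 : X₀ 1 = 0) {t : ℝ} (ht : 0 ≤ t) :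
    circleInt X₀ t (fun X => max (X 1) 0) =
      t ^ 2 * ∫ θ in (0 : ℝ)..(2 * Real.pi), max (Real.sin θ) 0 := by
  rw [circleInt_eq, ← intervalIntegral.integral_const_mul]
  congr 1; ext θ
  have : max ((X₀ + t • dir θ) 1) 0 = t * max (Real.sin θ) 0 := by
    rw [mul_max_of_nonneg _ _ ht, mul_zero]
    simp [h0]
  rw [this]; ring

/-- Homogeneity of degree one of y⁺ about a centre with y = 0. It makes x₀r⁻³∫y⁺ independent of r
and equal to the degenerate density. -/
theorem integral_ball_posPart {X₀ : Plane} (h0 : X₀ 1 = 0) {r : ℝ} (hr : 0 ≤ r) :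
    ∫ X in Metric.ball X₀ r, max (X 1) 0 =
      r ^ 3 * ∫ X in Metric.ball (0 : Plane) 1, max (X 1) 0 := by
  have key : ∀ (Y : Plane) (s : ℝ), Y 1 = 0 → 0 ≤ s → ∫ X in Metric.ball Y s, max (X 1) 0 =
      s ^ 3 / 3 * ∫ θ in (0 : ℝ)..(2 * Real.pi), max (Real.sin θ) 0 := fun Y s hY hs => by
    rw [(measBdd_posPart hY s).integral_ball hs le_rfl,
      intervalIntegral.integral_congr (g := fun t => t ^ 2 *
        ∫ θ in (0 : ℝ)..(2 * Real.pi), max (Real.sin θ) 0) fun t ht => ?_,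
      intervalIntegral.integral_mul_const, integral_pow]
    · norm_num
    · rw [uIcc_of_le hs] at ht
      exact circleInt_posPart hY ht.1
  rw [key X₀ r h0 hr, key 0 1 rfl zero_le_one]
  ring

theorem integral_cos_mul_posPart_sin :
    ∫ θ in (0 : ℝ)..(2 * Real.pi), Real.cos θ * max (Real.sin θ) 0 = 0 := by
  have h := intervalIntegral.integral_eq_sub_of_hasDerivAt (a := 0) (b := 2 * Real.pi)
    (f := fun θ => max (Real.sin θ) 0 ^ 2 / 2) (f' := fun θ => Real.cos θ * max (Real.sin θ) 0)
    (fun θ _ => by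
      have h1 := HasDerivAt.comp (h₂ := fun x : ℝ => max x 0 ^ 2) (h := Real.sin) θ
        (hasDerivAt_max_sq (Real.sin θ)) (Real.hasDerivAt_sin θ)
      refine (h1.div_const 2).congr_deriv ?_
      ring)
    (Continuous.intervalIntegrable (Real.continuous_cos.mul
      (Real.continuous_sin.max continuous_const)) _ _)
  rw [h]; simp

/-- The integrand is odd under reflection in the vertical line through X₀; in polar coordinates the
angular integral is that of the exact derivative of (sin θ)₊²/2. -/
theorem integral_ball_fst_mul_posPart {X₀ : Plane} (h0 : X₀ 1 = 0) {r : ℝ} (hr : 0 ≤ r) :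
    ∫ X in Metric.ball X₀ r, (X 0 - X₀ 0) * max (X 1) 0 = 0 := by
  have b : MeasBdd X₀ r fun X => X 0 - X₀ 0 := ⟨by fun_prop, r, fun X hX => by
    have h1 := abs_sub_coord_le X X₀ 0
    rw [Metric.mem_ball, dist_eq_norm] at hX
    exact h1.trans hX.le⟩
  rw [(b.mul (measBdd_posPart h0 r)).integral_ball hr le_rfl,
    intervalIntegral.integral_congr (g := fun _ => (0 : ℝ)) fun t ht => ?_]
  · simp
  · rw [uIcc_of_le hr] at ht
    show circleInt X₀ t (fun X => (X 0 - X₀ 0) * max (X 1) 0) = 0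
    refine Eq.trans ?_ ((congrArg (t ^ 3 * ·) integral_cos_mul_posPart_sin).trans (mul_zero _))
    simp only
    rw [circleInt_eq, ← intervalIntegral.integral_const_mul]
    congr 1; ext θ
    have : max ((X₀ + t • dir θ) 1) 0 = t * max (Real.sin θ) 0 := by
      rw [mul_max_of_nonneg _ _ ht.1, mul_zero]
      simp [h0]
    rw [this]; simp; ring

theorem tendsto_intervalIntegral_left {k : ℝ → ℝ} {r : ℝ} (hr : 0 < r)
    (hk : IntervalIntegrable k volume 0 r) :
    Tendsto (fun s => ∫ t in s..r, k t) (𝓝[>] 0) (𝓝 (∫ t in (0 : ℝ)..r, k t)) := by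
  have c := intervalIntegral.continuousOn_primitive_interval_left (μ := volume)
    (f := k) (a := 0) (b := r)
    (by rw [uIcc_of_le hr.le]
        exact (intervalIntegrable_iff_integrableOn_Icc_of_le hr.le).1 hk)
  refine (c 0 left_mem_uIcc).mono_left ?_
  rw [uIcc_of_le hr.le]
  exact nhdsWithin_le_of_mem (Icc_mem_nhdsGT hr)

/-! ### The frequency system of a local solution -/

/-- The defect `∫ y⁺ (1 - χ)` of the positivity set in the upper half-plane. -/
noncomputable def waterDefect (ψ : Plane → ℝ) (X₀ : Plane) (r : ℝ) : ℝ :=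
  ∫ X in Metric.ball X₀ r, max (X 1) 0 * (1 - chiPos ψ X)

/-- The normalized Dirichlet energy. -/
noncomputable def gradRatio (g : Plane → Plane) (X₀ : Plane) (r : ℝ) : ℝ :=
  (∫ X in Metric.ball X₀ r, ‖g X‖ ^ 2 / X 0) / r ^ 3

/-- The normalized defect of the positivity set. -/
noncomputable def defectRatio (ψ : Plane → ℝ) (X₀ : Plane) (r : ℝ) : ℝ :=
  X₀ 0 * waterDefect ψ X₀ r / r ^ 3

/-- The quantity `r⁻⁴ V(r) S(r)`. -/
noncomputable def volumeTerm (ψ : Plane → ℝ) (g : Plane → Plane) (X₀ : Plane) (r : ℝ) : ℝ :=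
  (∫ X in Metric.ball X₀ r, max (X 1) 0 * (X₀ 0 - X 0 * chiPos ψ X)) / r ^ 3
    + ((∫ t in (0 : ℝ)..r, termI₁ g X₀ t / t ^ 4) + ∫ t in (0 : ℝ)..r, termI₂ ψ X₀ t / t ^ 4)
    + 3 / 2 * ∫ t in (0 : ℝ)..r, termJ₁ ψ X₀ t / t ^ 5

/-- The normalized excess `r⁻³ ∫_{∂B_r} ψ ∂_ν ψ / x - (3/2) J(r)`. -/
noncomputable def excess (ψ : Plane → ℝ) (g : Plane → Plane) (X₀ : Plane) (r : ℝ) : ℝ :=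
  fluxInt ψ g X₀ r / r ^ 3 - 3 / 2 * massRatio ψ X₀ r

/-- The integrated error from the vorticity function. -/
noncomputable def vortexError (f : ℝ → ℝ) (ψ : Plane → ℝ) (X₀ : Plane) (r : ℝ) : ℝ :=
  ∫ t in (0 : ℝ)..r, vortexTerm f ψ X₀ t / t ^ 4

namespace LocalSolution

variable {X₀ : Plane} {R C : ℝ} {f : ℝ → ℝ} {ψ : Plane → ℝ} {g : Plane → Plane}

theorem measBdd_waterDefect (h : LocalSolution X₀ R C f ψ g) (hm : Measurable ψ) :
    MeasBdd X₀ R fun X => max (X 1) 0 * (1 - chiPos ψ X) :=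
  (measBdd_posPart h.center R).mul ((MeasBdd.const 1).sub (h.measBdd_chi hm))

theorem waterDefect_density_nonneg (ψ : Plane → ℝ) (X : Plane) :
    0 ≤ max (X 1) 0 * (1 - chiPos ψ X) :=
  mul_nonneg (le_max_right _ _) (sub_nonneg.2 (chiPos_mem ψ X).2)

theorem waterDefect_nonneg (ψ : Plane → ℝ) (X₀ : Plane) (r : ℝ) : 0 ≤ waterDefect ψ X₀ r :=
  setIntegral_nonneg Metric.isOpen_ball.measurableSet fun X _ => waterDefect_density_nonneg ψ X

theorem waterDefect_mono (h : LocalSolution X₀ R C f ψ g) (hm : Measurable ψ) {s r : ℝ}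
    (hsr : s ≤ r) (hr : r ≤ R) : waterDefect ψ X₀ s ≤ waterDefect ψ X₀ r :=
  setIntegral_mono_set ((h.measBdd_waterDefect hm).mono hr).integrableOn
    (Eventually.of_forall fun X => waterDefect_density_nonneg ψ X)
    (Metric.ball_subset_ball hsr).eventuallyLE

theorem waterDefect_le (h : LocalSolution X₀ R C f ψ g) {r : ℝ} (hr : r ∈ Ioo 0 R) :
    waterDefect ψ X₀ r ≤ Real.pi * r ^ 3 := by
  have h1 := abs_integral_ball_le (X₀ := X₀) (B := r)
    (h := fun X => max (X 1) 0 * (1 - chiPos ψ X)) hr.1.le fun X hX => by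
      rw [abs_of_nonneg (waterDefect_density_nonneg ψ X)]
      have h2 := h.snd_sq_le (X := X)
      have h3 := norm_sub_lt hX
      have h4 : max (X 1) 0 ≤ r := max_le ((le_abs_self _).trans (h2.trans h3.le)) hr.1.le
      have h5 := chiPos_mem ψ X
      nlinarith [le_max_right (X 1) 0]
  refine (le_abs_self _).trans (h1.trans (le_of_eq ?_))
  ring

/-- The solution vanishes for y ≤ 0, so only the part y > 0 contributes. -/
theorem snd_mul_chiPos (h : LocalSolution X₀ R C f ψ g) {X : Plane} (hX : X ∈ Metric.ball X₀ R) :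
    X 1 * chiPos ψ X = max (X 1) 0 * chiPos ψ X := by
  rcases le_total (X 1) 0 with hy | hy
  · rw [chiPos_of_not_pos (by rw [h.zero_below X hX hy]; exact lt_irrefl _), mul_zero, mul_zero]
  · rw [max_eq_left hy]

/-- Since (x − x₀)y⁺ has zero integral, χ may be replaced by −(1 − χ). This bounds I₂ by the water
defect instead of by r⁴, which would not be comparable with J. -/
theorem abs_termI₂_le (h : LocalSolution X₀ R C f ψ g) (hm : Measurable ψ) {r : ℝ}
    (hr : r ∈ Ioo 0 R) : |termI₂ ψ X₀ r| ≤ r * waterDefect ψ X₀ r := by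
  have b1 : MeasBdd X₀ R fun X => (X 0 - X₀ 0) * max (X 1) 0 :=
    (h.measBdd_fst.sub (MeasBdd.const (X₀ 0))).mul (measBdd_posPart h.center R)
  have b2 : MeasBdd X₀ R fun X => (X 0 - X₀ 0) * (max (X 1) 0 * (1 - chiPos ψ X)) :=
    (h.measBdd_fst.sub (MeasBdd.const (X₀ 0))).mul (h.measBdd_waterDefect hm)
  have e : termI₂ ψ X₀ r =
      -∫ X in Metric.ball X₀ r, (X 0 - X₀ 0) * (max (X 1) 0 * (1 - chiPos ψ X)) := by
    have e0 := b1.integral_sub b2 hr.2.le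
    rw [integral_ball_fst_mul_posPart h.center hr.1.le, zero_sub] at e0
    rw [← e0, termI₂]
    refine setIntegral_congr_fun Metric.isOpen_ball.measurableSet fun X hX => ?_
    have := h.snd_mul_chiPos (Metric.ball_subset_ball hr.2.le hX)
    simp only
    rw [mul_assoc, this]; ring
  rw [e, abs_neg, waterDefect, ← integral_const_mul]
  refine b2.abs_integral_le ((h.measBdd_waterDefect hm).const_mul r) hr.2.le fun X hX => ?_
  rw [abs_mul, abs_of_nonneg (waterDefect_density_nonneg ψ X)]
  exact mul_le_mul_of_nonneg_right ((abs_sub_coord_le X X₀ 0).trans (norm_sub_lt hX).le)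
    (waterDefect_density_nonneg ψ X)

/-- Both ψf(ψ) and F(ψ) are quadratic in ψ, hence controlled by the weighted masses on the circle
and in the ball. The constants use x ≤ 2x₀: 12 = 3·2² on the circle and 20 = 10·2 in the ball. -/
theorem abs_vortexTerm_le (h : LocalSolution X₀ R C f ψ g) (hm : Measurable ψ) {r : ℝ}
    (hr : r ∈ Ioo 0 R) : |vortexTerm f ψ X₀ r| ≤ 12 * C * X₀ 0 ^ 2 * (r * bdryMass ψ X₀ r) +
      20 * C * X₀ 0 ^ 2 * ∫ X in Metric.ball X₀ r, ψ X ^ 2 / X 0 := by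
  have hC := h.C_nonneg
  have hx := h.center_pos
  have hr0 := hr.1
  have e1 : |circleInt X₀ r (fun X => X 0 * (2 * primitive f (ψ X) - ψ X * f (ψ X)))| ≤
      12 * C * X₀ 0 ^ 2 * bdryMass ψ X₀ r := by
    rw [bdryMass, ← circleInt_const_mul]
    refine (h.measBdd_vortex hm).abs_circleInt_le ((h.measBdd_mass hm).const_mul _) hr.1.le hr.2
      fun X hX _ => ?_
    have hXp := h.fst_pos hX
    have h1 := h.F_le X hX
    have h2 := h.f_le X hX
    have h3 := (h.fst_mem hX).2
    have h4 : |2 * primitive f (ψ X) - ψ X * f (ψ X)| ≤ 3 * C * ψ X ^ 2 := by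
      refine (abs_sub _ _).trans ?_
      rw [abs_mul, abs_mul, abs_two, abs_of_nonneg (h.nonneg X hX)]
      have := mul_le_mul_of_nonneg_left h2 (h.nonneg X hX)
      nlinarith
    rw [abs_mul, abs_of_pos hXp]
    calc X 0 * |2 * primitive f (ψ X) - ψ X * f (ψ X)| ≤ X 0 * (3 * C * ψ X ^ 2) := by gcongr
      _ = 3 * C * X 0 ^ 2 * (ψ X ^ 2 / X 0) := by field_simp
      _ ≤ 3 * C * (2 * X₀ 0) ^ 2 * (ψ X ^ 2 / X 0) := by gcongr
      _ = 12 * C * X₀ 0 ^ 2 * (ψ X ^ 2 / X 0) := by ring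
  have e2 : |∫ X in Metric.ball X₀ r, (6 * X 0 - 2 * X₀ 0) * primitive f (ψ X)| ≤
      20 * C * X₀ 0 ^ 2 * ∫ X in Metric.ball X₀ r, ψ X ^ 2 / X 0 := by
    rw [← integral_const_mul]
    refine (h.measBdd_vortex' hm).abs_integral_le ((h.measBdd_mass hm).const_mul _) hr.2.le
      fun X hX => ?_
    have hXR := Metric.ball_subset_ball hr.2.le hX
    have hXp := h.fst_pos hXR
    have h1 := h.F_le X hXR
    obtain ⟨h2, h3⟩ := h.fst_mem hXR
    have h4 : |6 * X 0 - 2 * X₀ 0| ≤ 10 * X₀ 0 := by rw [abs_le]; constructor <;> linarith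
    rw [abs_mul]
    calc |6 * X 0 - 2 * X₀ 0| * |primitive f (ψ X)| ≤ (10 * X₀ 0) * (C * ψ X ^ 2) := by gcongr
      _ = 10 * C * X₀ 0 * X 0 * (ψ X ^ 2 / X 0) := by field_simp
      _ ≤ 10 * C * X₀ 0 * (2 * X₀ 0) * (ψ X ^ 2 / X 0) := by gcongr
      _ = 20 * C * X₀ 0 ^ 2 * (ψ X ^ 2 / X 0) := by ring
  refine (abs_sub _ _).trans (add_le_add ?_ e2)
  rw [abs_mul, abs_of_pos hr0]
  calc r * _ ≤ r * (12 * C * X₀ 0 ^ 2 * bdryMass ψ X₀ r) := by gcongr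
    _ = _ := by ring

theorem gradRatio_nonneg (h : LocalSolution X₀ R C f ψ g) {r : ℝ} (hr : r ∈ Ioo 0 R) :
    0 ≤ gradRatio g X₀ r := div_nonneg (h.integral_grad_nonneg hr) (pow_nonneg hr.1.le 3)

theorem gradRatio_le (h : LocalSolution X₀ R C f ψ g) {r : ℝ} (hr : r ∈ Ioo 0 R) :
    gradRatio g X₀ r ≤ 2 * Real.pi * C / X₀ 0 := by
  rw [gradRatio, div_le_iff₀ (pow_pos hr.1 3)]
  exact h.integral_grad_le hr

theorem massRatio_nonneg (h : LocalSolution X₀ R C f ψ g) {r : ℝ} (hr : r ∈ Ioo 0 R) :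
    0 ≤ massRatio ψ X₀ r := div_nonneg (h.bdryMass_nonneg hr) (pow_nonneg hr.1.le 4)

theorem massRatio_le (h : LocalSolution X₀ R C f ψ g) {r : ℝ} (hr : r ∈ Ioo 0 R) :
    massRatio ψ X₀ r ≤ 4 * Real.pi * C / X₀ 0 := by
  rw [massRatio, div_le_iff₀ (pow_pos hr.1 4)]
  exact h.bdryMass_le hr

theorem defectRatio_nonneg (h : LocalSolution X₀ R C f ψ g) {r : ℝ} (hr : r ∈ Ioo 0 R) :
    0 ≤ defectRatio ψ X₀ r :=
  div_nonneg (mul_nonneg h.center_pos.le (waterDefect_nonneg _ _ _)) (pow_nonneg hr.1.le 3)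

theorem defectRatio_le (h : LocalSolution X₀ R C f ψ g) {r : ℝ} (hr : r ∈ Ioo 0 R) :
    defectRatio ψ X₀ r ≤ X₀ 0 * Real.pi := by
  rw [defectRatio, div_le_iff₀ (pow_pos hr.1 3), mul_assoc]
  exact mul_le_mul_of_nonneg_left (h.waterDefect_le hr) h.center_pos.le

theorem abs_termI₁_div_le (h : LocalSolution X₀ R C f ψ g) {r : ℝ} (hr : r ∈ Ioo 0 R) :
    |termI₁ g X₀ r / r ^ 4| ≤ 2 / X₀ 0 * gradRatio g X₀ r := by
  have hr0 := hr.1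
  have hx := h.center_pos
  rw [abs_div, abs_of_pos (pow_pos hr0 4), div_le_iff₀ (by positivity), gradRatio]
  refine (h.abs_termI₁_le hr).trans (le_of_eq ?_)
  field_simp

theorem abs_termI₂_div_le (h : LocalSolution X₀ R C f ψ g) (hm : Measurable ψ) {r : ℝ}
    (hr : r ∈ Ioo 0 R) : |termI₂ ψ X₀ r / r ^ 4| ≤ 1 / X₀ 0 * defectRatio ψ X₀ r := by
  have hr0 := hr.1
  have hx := h.center_pos
  rw [abs_div, abs_of_pos (pow_pos hr0 4), div_le_iff₀ (by positivity), defectRatio]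
  refine (h.abs_termI₂_le hm hr).trans (le_of_eq ?_)
  field_simp

theorem abs_termJ₁_div_le (h : LocalSolution X₀ R C f ψ g) (hm : Measurable ψ) {r : ℝ}
    (hr : r ∈ Ioo 0 R) : |termJ₁ ψ X₀ r / r ^ 5| ≤ 2 / X₀ 0 * massRatio ψ X₀ r := by
  have hr0 := hr.1
  have hx := h.center_pos
  rw [abs_div, abs_of_pos (pow_pos hr0 5), div_le_iff₀ (by positivity), massRatio]
  refine (h.abs_termJ₁_le hm hr).trans (le_of_eq ?_)
  field_simp

/-- The Poincaré inequality turns the interior mass into J and α; a spare factor r ≤ 1 is discarded.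
-/
theorem abs_vortexTerm_div_le (h : LocalSolution X₀ R C f ψ g) (hm : Measurable ψ) {r : ℝ}
    (hr : r ∈ Ioo 0 R) : |vortexTerm f ψ X₀ r / r ^ 4| ≤
      40 * C * X₀ 0 ^ 2 * (gradRatio g X₀ r + massRatio ψ X₀ r) := by
  have hr0 := hr.1
  have hx := h.center_pos
  have hC := h.C_nonneg
  have h1 := h.abs_vortexTerm_le hm hr
  have h2 := h.integral_mass_le hm hr
  have h3 : r ≤ 1 := hr.2.le.trans h.R_le_one
  have h4 := h.gradRatio_nonneg hr
  have h5 := h.massRatio_nonneg hr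
  have e1 : bdryMass ψ X₀ r = massRatio ψ X₀ r * r ^ 4 := by rw [massRatio]; field_simp
  have e2 : ∫ X in Metric.ball X₀ r, ‖g X‖ ^ 2 / X 0 = gradRatio g X₀ r * r ^ 3 := by
    rw [gradRatio]; field_simp
  rw [e1, e2] at h2
  rw [e1] at h1
  rw [abs_div, abs_of_pos (pow_pos hr0 4), div_le_iff₀ (by positivity)]
  calc |vortexTerm f ψ X₀ r| ≤ 12 * C * X₀ 0 ^ 2 * (r * (massRatio ψ X₀ r * r ^ 4)) +
      20 * C * X₀ 0 ^ 2 * (r * (massRatio ψ X₀ r * r ^ 4) +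
        2 * r ^ 2 * (gradRatio g X₀ r * r ^ 3)) := h1.trans (by gcongr)
    _ = C * X₀ 0 ^ 2 * r ^ 4 * (r * (32 * massRatio ψ X₀ r + 40 * gradRatio g X₀ r)) := by ring
    _ ≤ C * X₀ 0 ^ 2 * r ^ 4 * (1 * (40 * massRatio ψ X₀ r + 40 * gradRatio g X₀ r)) := by
      gcongr; norm_num
    _ = _ := by ring

theorem continuousOn_massRatio (h : LocalSolution X₀ R C f ψ g) (hm : Measurable ψ) :
    ContinuousOn (massRatio ψ X₀) (Ioo 0 R) := continuousOn_div_pow (h.continuousOn_bdryMass hm) 4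

theorem integrableOn_massRatio (h : LocalSolution X₀ R C f ψ g) (hm : Measurable ψ) :
    IntegrableOn (massRatio ψ X₀) (Ioo 0 R) :=
  integrableOn_Ioo_of_continuousOn (h.continuousOn_massRatio hm) fun t ht => by
    rw [abs_of_nonneg (h.massRatio_nonneg ht)]; exact h.massRatio_le ht

theorem integrableOn_gradRatio (h : LocalSolution X₀ R C f ψ g) :
    IntegrableOn (gradRatio g X₀) (Ioo 0 R) :=
  integrableOn_Ioo_of_continuousOn
    (continuousOn_div_pow (h.measBdd_div h.measBdd_grad_sq).continuousOn_integral 3) fun t ht => by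
    rw [abs_of_nonneg (h.gradRatio_nonneg ht)]; exact h.gradRatio_le ht

theorem integrableOn_defectRatio (h : LocalSolution X₀ R C f ψ g) (hm : Measurable ψ) :
    IntegrableOn (defectRatio ψ X₀) (Ioo 0 R) :=
  integrableOn_Ioo_of_continuousOn (continuousOn_div_pow
    (continuousOn_const.mul (h.measBdd_waterDefect hm).continuousOn_integral) 3) fun t ht => by
    rw [abs_of_nonneg (h.defectRatio_nonneg ht)]; exact h.defectRatio_le ht

theorem integrableOn_of_abs_le {k b : ℝ → ℝ} (hk : ContinuousOn k (Ioo 0 R))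
    (hb : IntegrableOn b (Ioo 0 R)) (hle : ∀ t ∈ Ioo 0 R, |k t| ≤ b t) :
    IntegrableOn k (Ioo 0 R) :=
  Integrable.mono' hb (hk.aestronglyMeasurable measurableSet_Ioo)
    ((ae_restrict_iff' measurableSet_Ioo).2 (Eventually.of_forall hle))

theorem integrableOn_termI₁ (h : LocalSolution X₀ R C f ψ g) :
    IntegrableOn (fun t => termI₁ g X₀ t / t ^ 4) (Ioo 0 R) :=
  integrableOn_of_abs_le (continuousOn_div_pow h.measBdd_termI₁.continuousOn_integral 4)
    (h.integrableOn_gradRatio.const_mul _) fun _ ht => h.abs_termI₁_div_le ht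

theorem integrableOn_termI₂ (h : LocalSolution X₀ R C f ψ g) (hm : Measurable ψ) :
    IntegrableOn (fun t => termI₂ ψ X₀ t / t ^ 4) (Ioo 0 R) :=
  integrableOn_of_abs_le (continuousOn_div_pow (h.measBdd_termI₂ hm).continuousOn_integral 4)
    ((h.integrableOn_defectRatio hm).const_mul _) fun _ ht => h.abs_termI₂_div_le hm ht

theorem integrableOn_termJ₁ (h : LocalSolution X₀ R C f ψ g) (hm : Measurable ψ) :
    IntegrableOn (fun t => termJ₁ ψ X₀ t / t ^ 5) (Ioo 0 R) :=
  integrableOn_of_abs_le (continuousOn_div_pow (h.continuousOn_termJ₁ hm) 5)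
    ((h.integrableOn_massRatio hm).const_mul _) fun _ ht => h.abs_termJ₁_div_le hm ht

theorem integrableOn_vortexTerm (h : LocalSolution X₀ R C f ψ g) (hm : Measurable ψ) :
    IntegrableOn (fun t => vortexTerm f ψ X₀ t / t ^ 4) (Ioo 0 R) :=
  integrableOn_of_abs_le (continuousOn_div_pow (h.continuousOn_vortexTerm hm) 4)
    ((h.integrableOn_gradRatio.add (h.integrableOn_massRatio hm)).const_mul _)
    fun _ ht => h.abs_vortexTerm_div_le hm ht

theorem weissDefect_nonneg (h : LocalSolution X₀ R C f ψ g) {r : ℝ} (hr : r ∈ Ioo 0 R) :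
    0 ≤ weissDefect ψ g X₀ r :=
  mul_nonneg (div_nonneg two_pos.le (pow_nonneg hr.1.le 5)) <|
    circleInt_nonneg hr.1.le hr.2 fun X hX => by
      have := h.fst_pos hX
      positivity

theorem intervalIntegrable_of_Ioo {k : ℝ → ℝ} (hk : IntegrableOn k (Ioo 0 R)) {s r : ℝ}
    (hs : 0 ≤ s) (hsr : s ≤ r) (hr : r ≤ R) : IntervalIntegrable k volume s r := by
  rw [intervalIntegrable_iff_integrableOn_Ioo_of_le hsr]
  exact hk.mono_set (Ioo_subset_Ioo hs hr)

/-- The quadratic form behind the Cauchy-Schwarz inequality. -/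
theorem excess_sq_le (h : LocalSolution X₀ R C f ψ g) (hm : Measurable ψ) {r : ℝ}
    (hr : r ∈ Ioo 0 R) :
    excess ψ g X₀ r ^ 2 ≤ massRatio ψ X₀ r * (r * weissDefect ψ g X₀ r / 2) := by
  have hr0 := hr.1
  have h1 : discrim (bdryMass ψ X₀ r) (-(2 * r * fluxInt ψ g X₀ r))
      (r ^ 2 * circleInt X₀ r (fun X => normalDeriv X₀ g X ^ 2 / X 0)) ≤ 0 := by
    -- The integral of (r∂_νψ − bψ)²/x is a nonnegative quadratic polynomial in b, so its
    -- discriminant is nonpositive; shifting b by 3/2 turns this into the inequality between L, J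
    -- and n.
    refine discrim_le_zero fun b => ?_
    have h2 : 0 ≤ circleInt X₀ r (fun X => (r * normalDeriv X₀ g X - b * ψ X) ^ 2 / X 0) :=
      circleInt_nonneg hr.1.le hr.2 fun X hX => by
        have := h.fst_pos hX
        positivity
    rw [h.circleInt_sq_eq hm hr] at h2
    linarith
  rw [discrim] at h1
  rw [excess, h.weissDefect_eq hm hr, massRatio]
  have e : bdryMass ψ X₀ r / r ^ 4 * (r * (2 / r ^ 3 *
      circleInt X₀ r (fun X => normalDeriv X₀ g X ^ 2 / X 0) - 6 * fluxInt ψ g X₀ r / r ^ 4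
      + 9 / 2 * bdryMass ψ X₀ r / r ^ 5) / 2) -
      (fluxInt ψ g X₀ r / r ^ 3 - 3 / 2 * (bdryMass ψ X₀ r / r ^ 4)) ^ 2 =
      (4 * bdryMass ψ X₀ r * (r ^ 2 * circleInt X₀ r (fun X => normalDeriv X₀ g X ^ 2 / X 0)) -
        (-(2 * r * fluxInt ψ g X₀ r)) ^ 2) / (4 * r ^ 8) := by
    field_simp
    ring
  have : 0 ≤ (4 * bdryMass ψ X₀ r *
      (r ^ 2 * circleInt X₀ r (fun X => normalDeriv X₀ g X ^ 2 / X 0)) -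
        (-(2 * r * fluxInt ψ g X₀ r)) ^ 2) / (4 * r ^ 8) := by
    apply div_nonneg _ (by positivity)
    linarith
  linarith

theorem integral_volume_eq (h : LocalSolution X₀ R C f ψ g) (hm : Measurable ψ) {r : ℝ}
    (hr : r ∈ Ioo 0 R) :
    ∫ X in Metric.ball X₀ r, max (X 1) 0 * (X₀ 0 - X 0 * chiPos ψ X) =
      X₀ 0 * (∫ X in Metric.ball X₀ r, max (X 1) 0) -
        ∫ X in Metric.ball X₀ r, X 0 * X 1 * chiPos ψ X := by
  rw [← integral_const_mul, ← ((measBdd_posPart h.center R).const_mul (X₀ 0)).integral_sub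
    (h.measBdd_chiPart hm) hr.2.le]
  refine setIntegral_congr_fun Metric.isOpen_ball.measurableSet fun X hX => ?_
  have := h.snd_mul_chiPos (Metric.ball_subset_ball hr.2.le hX)
  simp only
  rw [mul_assoc (X 0), this]; ring

/-- This splitting isolates p in the volume term, for the estimate of v − p; `integral_volume_eq`
instead isolates the density of Φ(0+), for the identity L = Q + v + κ. -/
theorem integral_volume_eq' (h : LocalSolution X₀ R C f ψ g) (hm : Measurable ψ) {r : ℝ}
    (hr : r ∈ Ioo 0 R) :
    ∫ X in Metric.ball X₀ r, max (X 1) 0 * (X₀ 0 - X 0 * chiPos ψ X) =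
      X₀ 0 * waterDefect ψ X₀ r - termI₂ ψ X₀ r := by
  rw [waterDefect, termI₂, ← integral_const_mul, ← ((h.measBdd_waterDefect hm).const_mul
    (X₀ 0)).integral_sub (h.measBdd_termI₂ hm) hr.2.le]
  refine setIntegral_congr_fun Metric.isOpen_ball.measurableSet fun X hX => ?_
  have := h.snd_mul_chiPos (Metric.ball_subset_ball hr.2.le hX)
  simp only
  rw [mul_assoc, this]; ring

/-- The energy identity expresses α by the flux plus a vorticity term. The latter is at most
4Cx₀²r²(J + 2α) by the Poincaré inequality, and half of α is absorbed under the smallness condition.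
-/
theorem gradRatio_le_excess (h : LocalSolution X₀ R C f ψ g) (hm : Measurable ψ) {r : ℝ}
    (hr : r ∈ Ioo 0 R) (hsmall : 16 * C * X₀ 0 ^ 2 * r ^ 2 ≤ 1) :
    gradRatio g X₀ r ≤ 2 * excess ψ g X₀ r + 4 * massRatio ψ X₀ r := by
  have hr0 := hr.1
  have hC := h.C_nonneg
  have ba := h.measBdd_div h.measBdd_grad_sq
  have bf := (h.measBdd_fst.mul (h.measBdd_psi hm)).mul (h.measBdd_f hm)
  have e1 := h.integral_energy_eq hm hr
  rw [ba.integral_sub bf hr.2.le] at e1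
  have h1 : ∫ X in Metric.ball X₀ r, X 0 * ψ X * f (ψ X) ≤
      4 * C * X₀ 0 ^ 2 * ∫ X in Metric.ball X₀ r, ψ X ^ 2 / X 0 := by
    rw [← integral_const_mul]
    refine bf.integral_mono ((h.measBdd_mass hm).const_mul _) hr.2.le fun X hX => ?_
    have hXR := Metric.ball_subset_ball hr.2.le hX
    have hXp := h.fst_pos hXR
    have h2 := (le_abs_self _).trans (h.f_le X hXR)
    have h3 := h.nonneg X hXR
    have h4 := (h.fst_mem hXR).2
    calc X 0 * ψ X * f (ψ X) ≤ X 0 * ψ X * (C * ψ X) := by gcongr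
      _ = C * X 0 ^ 2 * (ψ X ^ 2 / X 0) := by field_simp
      _ ≤ C * (2 * X₀ 0) ^ 2 * (ψ X ^ 2 / X 0) := by gcongr
      _ = _ := by ring
  have h2 := h.integral_mass_le hm hr
  have e2 : bdryMass ψ X₀ r = massRatio ψ X₀ r * r ^ 4 := by rw [massRatio]; field_simp
  have e3 : ∫ X in Metric.ball X₀ r, ‖g X‖ ^ 2 / X 0 = gradRatio g X₀ r * r ^ 3 := by
    rw [gradRatio]; field_simp
  have e4 : fluxInt ψ g X₀ r = (excess ψ g X₀ r + 3 / 2 * massRatio ψ X₀ r) * r ^ 3 := by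
    rw [excess]; field_simp; ring
  have e5 : circleInt X₀ r (fun X => ψ X * normalDeriv X₀ g X / X 0) = fluxInt ψ g X₀ r := rfl
  rw [e5, e4, e3] at e1
  rw [e2, e3] at h2
  have h3 := mul_le_mul_of_nonneg_left h2 (by positivity : 0 ≤ 4 * C * X₀ 0 ^ 2)
  have hα := h.gradRatio_nonneg hr
  have hJ := h.massRatio_nonneg hr
  have hr3 := pow_pos hr0 3
  have h4 : gradRatio g X₀ r * r ^ 3 ≤ (excess ψ g X₀ r + 3 / 2 * massRatio ψ X₀ r) * r ^ 3 +
      4 * C * X₀ 0 ^ 2 * (r * (massRatio ψ X₀ r * r ^ 4) +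
        2 * r ^ 2 * (gradRatio g X₀ r * r ^ 3)) := by linarith
  have h5 : gradRatio g X₀ r * r ^ 3 ≤ (excess ψ g X₀ r + 3 / 2 * massRatio ψ X₀ r +
      4 * C * X₀ 0 ^ 2 * r ^ 2 * (massRatio ψ X₀ r + 2 * gradRatio g X₀ r)) * r ^ 3 := by
    refine h4.trans (le_of_eq ?_); ring
  have h6 := le_of_mul_le_mul_right h5 hr3
  nlinarith

/-- On the circle through a nearby point where ψ ≠ 0 the continuous nonnegative integrand is
positive at one angle, so the integral is positive. -/
theorem exists_massRatio_ne (h : LocalSolution X₀ R C f ψ g) {ε : ℝ} (hε : 0 < ε) :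
    ∃ r ∈ Ioo 0 ε, massRatio ψ X₀ r ≠ 0 := by
  obtain ⟨X, hX, hne⟩ := h.nontrivial (min ε R) (lt_min hε h.R_pos)
  have hX' := norm_sub_lt hX
  have hXR : ‖X - X₀‖ < R := hX'.trans_le (min_le_right _ _)
  have hX0 : X ≠ X₀ := fun h' => hne (by rw [h', h.zero_center])
  have hr0 : 0 < ‖X - X₀‖ := norm_pos_iff.2 (sub_ne_zero.2 hX0)
  refine ⟨‖X - X₀‖, ⟨hr0, hX'.trans_le (min_le_left _ _)⟩, ?_⟩
  refine (div_pos ?_ (pow_pos hr0 4)).ne'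
  obtain ⟨θ, hθ⟩ := exists_polar (X₀ := X₀) (X := X)
  set r := ‖X - X₀‖
  have hmem : ∀ θ, X₀ + r • dir θ ∈ Metric.ball X₀ R := fun θ => (mem_ball_polar hr0.le).2 hXR
  obtain ⟨θ', hθ', e'⟩ := dir_periodic.exists_mem_Ico₀ Real.two_pi_pos θ
  rw [bdryMass, circleInt_eq]
  refine intervalIntegral.integral_pos Real.two_pi_pos ?_ (fun θ _ => ?_)
    ⟨θ', Ico_subset_Icc_self hθ', ?_⟩
  · have hcd := continuous_dir
    have hc : Continuous fun θ => X₀ + r • dir θ := by fun_prop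
    have hψ : Continuous fun θ => ψ (X₀ + r • dir θ) := by
      rw [← continuousOn_univ]
      exact h.contOn.comp hc.continuousOn fun θ _ => hmem θ
    have hx : Continuous fun θ => (X₀ + r • dir θ) 0 := by fun_prop
    exact (((hψ.pow 2).div hx fun θ => (h.fst_pos (hmem θ)).ne').mul continuous_const).continuousOn
  · have := h.fst_pos (hmem θ)
    positivity
  · have h1 := h.fst_pos (hmem θ')
    have h2 : ψ (X₀ + r • dir θ') ≠ 0 := by rwa [← e', ← hθ]
    positivity

/-- The frequency system of a solution with the density of a degenerate point. -/
theorem exists_frequencySystem (h : LocalSolution X₀ R C f ψ g) (hm : Measurable ψ)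
    (hΦ : Tendsto (weissEnergy f ψ g X₀) (𝓝[>] 0)
      (𝓝 (X₀ 0 * ∫ X in Metric.ball (0 : Plane) 1, max (X 1) 0))) :
    ∃ R' C', R' ≤ R ∧ FrequencySystem R' C' (massRatio ψ X₀) (excess ψ g X₀)
      (fun r => -(termJ₁ ψ X₀ r / r ^ 5)) (weissDefect ψ g X₀) (defectRatio ψ X₀) (gradRatio g X₀)
      (volumeTerm ψ g X₀) (vortexError f ψ X₀) := by
  have hx := h.center_pos
  have hC := h.C_nonneg
  have hR := h.R_pos
  -- The summands bound, in order, the normalization C' ≥ 1, the size of J, the errors from the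
  -- variable weight, and the vorticity errors.
  set C' := 1 + 4 * Real.pi * C / X₀ 0 + 3 / X₀ 0 + 40 * C * X₀ 0 ^ 2 with hC'
  have hp1 : 0 ≤ 4 * Real.pi * C / X₀ 0 := by positivity
  have hp2 : 0 ≤ 3 / X₀ 0 := by positivity
  have hp3 : 0 ≤ 40 * C * X₀ 0 ^ 2 := by positivity
  have hC'1 : 1 ≤ C' := by linarith
  set R' := min (R / 2) (1 / (100 * C')) with hR'
  have hR'R : R' < R := (min_le_left _ _).trans_lt (by linarith)
  have hR'0 : 0 < R' := by positivity
  have hR'1 : R' ≤ 1 := hR'R.le.trans h.R_le_one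
  have hsmall : C' * R' ≤ 1 / 100 := by
    have : R' ≤ 1 / (100 * C') := min_le_right _ _
    calc C' * R' ≤ C' * (1 / (100 * C')) := by gcongr
      _ = 1 / 100 := by field_simp
  have hmem : ∀ r ∈ Ioo 0 R', r ∈ Ioo 0 R := fun r hr => ⟨hr.1, hr.2.trans hR'R⟩
  have hsub : Ioo 0 R' ⊆ Ioo 0 R := hmem
  have iE1 := h.integrableOn_termI₁
  have iE2 := h.integrableOn_termI₂ hm
  have iE3 := h.integrableOn_vortexTerm hm
  have iE4 := h.integrableOn_termJ₁ hm
  have iE : IntegrableOn (fun t => termI₁ g X₀ t / t ^ 4 + termI₂ ψ X₀ t / t ^ 4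
        + vortexTerm f ψ X₀ t / t ^ 4 + 3 / 2 * (termJ₁ ψ X₀ t / t ^ 5)) (Ioo 0 R) :=
    ((iE1.add iE2).add iE3).add (iE4.const_mul _)
  -- The Weiss formula expresses the integral of n over [s, R'] by Φ(R') − Φ(s) and integrable
  -- errors; existence of Φ(0+) keeps it bounded as s → 0.
  have hn_int : IntegrableOn (weissDefect ψ g X₀) (Ioo 0 R') := by
    refine IntegrableOn.mono_set ?_ Ioo_subset_Ioc_self
    have hlim : Tendsto (fun i : ℕ => R' / (i + 1 : ℝ)) atTop (𝓝 0) := by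
      have := tendsto_one_div_add_atTop_nhds_zero_nat.const_mul R'
      rw [mul_zero] at this
      refine this.congr fun i => ?_
      rw [mul_one_div]
    have hpos : ∀ i : ℕ, 0 < R' / (i + 1 : ℝ) := fun i => by positivity
    have hle : ∀ i : ℕ, R' / (i + 1 : ℝ) ≤ R' := fun i =>
      div_le_self hR'0.le (by linarith [Nat.cast_nonneg (α := ℝ) i])
    have hlim' : Tendsto (fun i : ℕ => R' / (i + 1 : ℝ)) atTop (𝓝[>] 0) :=
      tendsto_nhdsWithin_iff.2 ⟨hlim, Eventually.of_forall hpos⟩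
    have hb := ((hΦ.comp hlim').const_sub (weissEnergy f ψ g X₀ R')).sub
      ((tendsto_intervalIntegral_left hR'0
        (intervalIntegrable_of_Ioo iE le_rfl hR'0.le hR'R.le)).comp hlim')
    refine integrableOn_Ioc_of_intervalIntegral_norm_bounded_left (l := atTop)
      (a := fun i : ℕ => R' / (i + 1 : ℝ)) (fun i => ?_) hlim
      (Tendsto.eventually_le_const (lt_add_one _) (hb.congr fun i => ?_))
    · exact (h.intervalIntegrable_weissDefect hm (hpos i) (hle i) hR'R).1
    · simp only [Function.comp_apply]
      rw [h.weissEnergy_sub hm (hpos i) (hle i) hR'R, add_sub_cancel_right,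
        intervalIntegral.integral_of_le (hle i)]
      refine setIntegral_congr_fun measurableSet_Ioc fun t ht => ?_
      exact (Real.norm_of_nonneg (h.weissDefect_nonneg
        ⟨(hpos i).trans ht.1, ht.2.trans_lt hR'R⟩)).symm
  have hbd : ∀ {k b : ℝ → ℝ}, IntegrableOn k (Ioo 0 R) → IntegrableOn b (Ioo 0 R) →
      (∀ t ∈ Ioo 0 R, |k t| ≤ b t) → ∀ r ∈ Ioo 0 R', |∫ t in (0 : ℝ)..r, k t| ≤
        ∫ t in (0 : ℝ)..r, b t := fun {k b} hk hb hle r hr => by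
    rw [← Real.norm_eq_abs]
    refine intervalIntegral.norm_integral_le_of_norm_le hr.1.le (Eventually.of_forall
      fun t ht => hle t ⟨ht.1, ht.2.trans_lt (hmem r hr).2⟩)
      (intervalIntegrable_of_Ioo hb le_rfl hr.1.le (hmem r hr).2.le)
  have iα := h.integrableOn_gradRatio
  have ip := h.integrableOn_defectRatio hm
  have iJ := h.integrableOn_massRatio hm
  have hσ : ∀ r ∈ Ioo 0 R', ∫ t in (0 : ℝ)..r,
      (gradRatio g X₀ t + defectRatio ψ X₀ t + massRatio ψ X₀ t) =
      (∫ t in (0 : ℝ)..r, gradRatio g X₀ t) + (∫ t in (0 : ℝ)..r, defectRatio ψ X₀ t) +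
        ∫ t in (0 : ℝ)..r, massRatio ψ X₀ t := fun r hr => by
    have k1 := intervalIntegrable_of_Ioo iα le_rfl hr.1.le (hmem r hr).2.le
    have k2 := intervalIntegrable_of_Ioo ip le_rfl hr.1.le (hmem r hr).2.le
    have k3 := intervalIntegrable_of_Ioo iJ le_rfl hr.1.le (hmem r hr).2.le
    rw [intervalIntegral.integral_add (k1.add k2) k3, intervalIntegral.integral_add k1 k2]
  have hnn : ∀ {k : ℝ → ℝ}, (∀ t ∈ Ioo 0 R, 0 ≤ k t) → ∀ r ∈ Ioo 0 R',
      0 ≤ ∫ t in (0 : ℝ)..r, k t := fun {k} hk r hr => by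
    rw [intervalIntegral.integral_of_le hr.1.le]
    exact setIntegral_nonneg measurableSet_Ioc fun t ht =>
      hk t ⟨ht.1, ht.2.trans_lt (hmem r hr).2⟩
  have hα0 := hnn (k := gradRatio g X₀) fun t ht => h.gradRatio_nonneg ht
  have hp0 := hnn (k := defectRatio ψ X₀) fun t ht => h.defectRatio_nonneg ht
  have hJ0 := hnn (k := massRatio ψ X₀) fun t ht => h.massRatio_nonneg ht
  refine ⟨R', C', hR'R.le, ?_⟩
  exact
  { R_pos := hR'0
    R_le := hR'1
    C_ge := hC'1
    small := hsmall
    J_nonneg := fun r hr => h.massRatio_nonneg (hmem r hr)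
    J_le := fun r hr => (h.massRatio_le (hmem r hr)).trans (by linarith)
    J_deriv := fun r hr => h.hasDerivAt_massRatio hm (hmem r hr)
    L_cont := ((continuousOn_div_pow (h.continuousOn_fluxInt hm) 3).sub
      (continuousOn_const.mul (h.continuousOn_massRatio hm))).mono hsub
    j_cont := ((continuousOn_div_pow (h.continuousOn_termJ₁ hm) 5).neg).mono hsub
    j_le := fun r hr => by
      rw [abs_neg]
      refine (h.abs_termJ₁_div_le hm (hmem r hr)).trans ?_
      have := h.massRatio_nonneg (hmem r hr)
      gcongr
      have : 2 / X₀ 0 ≤ 3 / X₀ 0 := by gcongr; norm_num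
      linarith
    n_nonneg := fun r hr => h.weissDefect_nonneg (hmem r hr)
    n_int := hn_int
    cs := fun r hr => h.excess_sq_le hm (hmem r hr)
    split := fun r hr => by
      have hrR := hmem r hr
      have hr0 := hr.1
      have k1 := intervalIntegrable_of_Ioo iE1 le_rfl hr.1.le hrR.2.le
      have k2 := intervalIntegrable_of_Ioo iE2 le_rfl hr.1.le hrR.2.le
      have k3 := intervalIntegrable_of_Ioo iE3 le_rfl hr.1.le hrR.2.le
      have k4 := intervalIntegrable_of_Ioo iE4 le_rfl hr.1.le hrR.2.le
      have kn : IntervalIntegrable (weissDefect ψ g X₀) volume 0 r := by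
        rw [intervalIntegrable_iff_integrableOn_Ioo_of_le hr.1.le]
        exact hn_int.mono_set (Ioo_subset_Ioo_right hr.2.le)
      -- Letting the lower radius tend to 0 brings in Φ(0+) = x₀∫y⁺; this is the one place where the
      -- degenerate value, and not just convergence of Φ, matters.
      have t1 := (hΦ.const_sub (weissEnergy f ψ g X₀ r)).sub
        (tendsto_intervalIntegral_left hr.1 (((k1.add k2).add k3).add (k4.const_mul (3 / 2))))
      have t2 := tendsto_intervalIntegral_left hr.1 kn
      have e := tendsto_nhds_unique t2 (t1.congr' ?_)
      · rw [intervalIntegral.integral_add ((k1.add k2).add k3) (k4.const_mul (3 / 2)),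
          intervalIntegral.integral_add (k1.add k2) k3, intervalIntegral.integral_add k1 k2,
          intervalIntegral.integral_const_mul] at e
        rw [e, volumeTerm, vortexError, h.integral_volume_eq hm hrR,
          integral_ball_posPart h.center hr0.le, weissEnergy_eq,
          (h.measBdd_energy hm).integral_add (h.measBdd_chiPart hm) hrR.2.le,
          h.integral_energy_eq hm hrR, excess, fluxInt]
        field_simp
        ring
      · filter_upwards [Ioo_mem_nhdsGT hr.1] with s hs
        rw [h.weissEnergy_sub hm hs.1 hs.2.le hrR.2]
        exact add_sub_cancel_right _ _
    p_nonneg := fun r hr => h.defectRatio_nonneg (hmem r hr)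
    p_int := ip.mono_set hsub
    p_mono := fun r hr s hs hsr => by
      have hr0 := hr.1
      have hs0 := hs.1
      have e : ∀ t : ℝ, 0 < t → t ^ 3 * defectRatio ψ X₀ t = X₀ 0 * waterDefect ψ X₀ t :=
        fun t ht => by rw [defectRatio]; field_simp
      rw [e r hr0, e s hs0]
      exact mul_le_mul_of_nonneg_left (h.waterDefect_mono hm hsr (hmem r hr).2.le) hx.le
    α_nonneg := fun r hr => h.gradRatio_nonneg (hmem r hr)
    α_int := iα.mono_set hsub
    α_le := fun r hr => by
      refine h.gradRatio_le_excess hm (hmem r hr) ?_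
      have h1 : r ^ 2 ≤ R' := by nlinarith [hr.1, hr.2]
      have h2 : 40 * C * X₀ 0 ^ 2 * R' ≤ C' * R' := by gcongr; linarith
      have h3 : 40 * C * X₀ 0 ^ 2 * r ^ 2 ≤ 40 * C * X₀ 0 ^ 2 * R' := by gcongr
      nlinarith
    v_le := fun r hr => by
      have hrR := hmem r hr
      have hr0 := hr.1
      -- What remains after removing p is I₂ at radius r, small relative to p, and the accumulated
      -- weight errors.
      have e : volumeTerm ψ g X₀ r - defectRatio ψ X₀ r = -(r * (termI₂ ψ X₀ r / r ^ 4)) +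
          ((∫ t in (0 : ℝ)..r, termI₁ g X₀ t / t ^ 4) + ∫ t in (0 : ℝ)..r, termI₂ ψ X₀ t / t ^ 4)
          + 3 / 2 * ∫ t in (0 : ℝ)..r, termJ₁ ψ X₀ t / t ^ 5 := by
        rw [volumeTerm, h.integral_volume_eq' hm hrR, defectRatio]
        field_simp
        ring
      have b1 := hbd iE1 (iα.const_mul (2 / X₀ 0)) (fun t ht => h.abs_termI₁_div_le ht) r hr
      have b2 := hbd iE2 (ip.const_mul (1 / X₀ 0)) (fun t ht => h.abs_termI₂_div_le hm ht) r hr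
      have b3 := hbd iE4 (iJ.const_mul (2 / X₀ 0)) (fun t ht => h.abs_termJ₁_div_le hm ht) r hr
      rw [intervalIntegral.integral_const_mul] at b1 b2 b3
      have b4 : |-(r * (termI₂ ψ X₀ r / r ^ 4))| ≤ 1 / X₀ 0 * (r * defectRatio ψ X₀ r) := by
        rw [abs_neg, abs_mul, abs_of_pos hr0]
        calc r * |termI₂ ψ X₀ r / r ^ 4| ≤ r * (1 / X₀ 0 * defectRatio ψ X₀ r) := by
              gcongr; exact h.abs_termI₂_div_le hm hrR
          _ = _ := by ring
      rw [e, hσ r hr]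
      have hp := mul_nonneg hr0.le (h.defectRatio_nonneg hrR)
      have a1 := hα0 r hr
      have a2 := hp0 r hr
      have a3 := hJ0 r hr
      have hy : 0 ≤ 1 / X₀ 0 := by positivity
      calc _ ≤ 3 / X₀ 0 * (r * defectRatio ψ X₀ r + ((∫ t in (0 : ℝ)..r, gradRatio g X₀ t) +
            (∫ t in (0 : ℝ)..r, defectRatio ψ X₀ t) + ∫ t in (0 : ℝ)..r, massRatio ψ X₀ t)) := by
            have e1 : 3 / X₀ 0 = 3 * (1 / X₀ 0) := by ring
            have e2 : 2 / X₀ 0 = 2 * (1 / X₀ 0) := by ring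
            rw [e2] at b1 b3
            rw [e1]
            rw [abs_le] at b1 b2 b3 b4 ⊢
            have c1 := mul_nonneg hy hp
            have c2 := mul_nonneg hy a1
            have c3 := mul_nonneg hy a2
            have c4 := mul_nonneg hy a3
            constructor <;> linarith
        _ ≤ C' * _ := by gcongr; linarith
    κ_le := fun r hr => by
      have hrR := hmem r hr
      have b1 := hbd iE3 ((iα.add iJ).const_mul (40 * C * X₀ 0 ^ 2))
        (fun t ht => h.abs_vortexTerm_div_le hm ht) r hr
      have k1 := intervalIntegrable_of_Ioo iα le_rfl hr.1.le (hmem r hr).2.le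
      have k3 := intervalIntegrable_of_Ioo iJ le_rfl hr.1.le (hmem r hr).2.le
      simp only [Pi.add_apply] at b1
      rw [intervalIntegral.integral_const_mul, intervalIntegral.integral_add k1 k3] at b1
      rw [hσ r hr]
      have a1 := hα0 r hr
      have a2 := hp0 r hr
      have a3 := hJ0 r hr
      refine b1.trans ?_
      calc _ ≤ 40 * C * X₀ 0 ^ 2 * ((∫ t in (0 : ℝ)..r, gradRatio g X₀ t) +
            (∫ t in (0 : ℝ)..r, defectRatio ψ X₀ t) + ∫ t in (0 : ℝ)..r, massRatio ψ X₀ t) := by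
            gcongr; linarith
        _ ≤ C' * _ := by gcongr; linarith
    J_ne := fun ε hε => h.exists_massRatio_ne hε }

end LocalSolution

variable {Ω : Set Plane} {f : ℝ → ℝ} {ψ : Plane → ℝ} {G g : Plane → Plane} {X₀ : Plane}

/-! ### Integrability of the terms of `V` on `(0, δ)` -/

theorem continuousOn_integral_ball {k : Plane → ℝ} {ρ : ℝ} (hk : Measurable k)
    (hi : IntegrableOn k (Metric.ball X₀ ρ)) :
    ContinuousOn (fun t => ∫ X in Metric.ball X₀ t, k X) (Ioo 0 ρ) := by
  rcases le_or_gt ρ 0 with hR | hR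
  · rw [Ioo_eq_empty (not_lt.2 hR)]; exact continuousOn_empty _
  have c1 := intervalIntegral.continuousOn_primitive_interval'
    (intervalIntegrable_circleInt hR.le hk hi) left_mem_uIcc
  rw [uIcc_of_le hR.le] at c1
  exact (c1.mono Ioo_subset_Icc_self).congr fun s hs => integral_ball_eq hs.1.le hk
    (hi.mono_set (Metric.ball_subset_ball hs.2.le))

/-- Integrability near 0 comes from the local estimates on the small interval; on the rest, up to
any r < δ, continuity is enough. -/
theorem intervalIntegrable_of_continuousOn_Ioo {k : ℝ → ℝ} {R δ : ℝ} (hR : 0 < R)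
    (hk : IntegrableOn k (Ioo 0 R)) (hc : ContinuousOn k (Ioo 0 δ)) {r : ℝ} (hr : r ∈ Ioo 0 δ) :
    IntervalIntegrable k volume 0 r := by
  set s := min r (R / 2)
  have hs0 : 0 < s := lt_min hr.1 (by positivity)
  have hsr : s ≤ r := min_le_left _ _
  have hsR : s ≤ R := (min_le_right _ _).trans (by linarith)
  refine IntervalIntegrable.trans (b := s) ?_ ?_
  · rw [intervalIntegrable_iff_integrableOn_Ioo_of_le hs0.le]
    exact hk.mono_set (Ioo_subset_Ioo_right hsR)
  · exact LocalSolution.intervalIntegrable_of_continuousOn hc hs0 hsr hr.2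

theorem closedBall_delta_subset (hΩ : IsFlowDomain Ω) (hX₀ : X₀ ∈ Ω) (hx : 0 < X₀ 0) :
    Metric.closedBall X₀ (delta Ω X₀) ⊆ Ω := by
  have h1 := delta_pos hΩ hX₀ hx
  refine (Metric.closedBall_subset_ball ?_).trans (ball_delta_subset hX₀ (r := 2 * delta Ω X₀) le_rfl)
  linarith

theorem fst_ge_of_mem_closedBall_delta {X : Plane} (hX : X ∈ Metric.closedBall X₀ (delta Ω X₀)) :
    X₀ 0 / 2 ≤ X 0 := by
  have h1 := (abs_le.1 (abs_sub_coord_le X X₀ 0)).1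
  rw [Metric.mem_closedBall, dist_eq_norm] at hX
  have h2 : delta Ω X₀ ≤ X₀ 0 / 2 := by
    rw [delta]; gcongr; exact min_le_left _ _
  linarith

namespace IsVariationalSolution

theorem ae_grad_eq_ball (hψ : IsVariationalSolution Ω f ψ G) (hΩ : IsFlowDomain Ω) (hX₀ : X₀ ∈ Ω)
    (hx : 0 < X₀ 0) :
    ∀ᵐ X, X ∈ Metric.closedBall X₀ (delta Ω X₀) → G X = gradPos Ω ψ X := by
  filter_upwards [hψ.ae_grad_eq hΩ] with X hX hXB
  refine hX ⟨closedBall_delta_subset hΩ hX₀ hx hXB, ?_⟩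
  have := fst_ge_of_mem_closedBall_delta hXB
  simp only [mem_ofPred_eq]; linarith

theorem integrableOn_grad_sq (hψ : IsVariationalSolution Ω f ψ G) (hΩ : IsFlowDomain Ω)
    (hX₀ : X₀ ∈ Ω) (hx : 0 < X₀ 0) :
    IntegrableOn (fun X => ‖gradPos Ω ψ X‖ ^ 2 / X 0) (Metric.closedBall X₀ (delta Ω X₀)) := by
  refine (hψ.weighted_grad_sq _ (closedBall_delta_subset hΩ hX₀ hx)
    (isCompact_closedBall _ _)).congr_fun_ae ?_
  refine (ae_restrict_iff' Metric.isClosed_closedBall.measurableSet).2 ?_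
  filter_upwards [hψ.ae_grad_eq_ball hΩ hX₀ hx] with X hX hXB
  rw [hX hXB]

/-- Up to the radius δ there is no pointwise gradient bound. Instead |x − x₀| ≤ x₀/2 ≤ x dominates
the density by |∇ψ|²/x, which is integrable on compact subsets of Ω. -/
theorem continuousOn_termI₁ (hψ : IsVariationalSolution Ω f ψ G) (hΩ : IsFlowDomain Ω)
    (hX₀ : X₀ ∈ Ω) (hx : 0 < X₀ 0) : ContinuousOn (termI₁ G X₀) (Ioo 0 (delta Ω X₀)) := by
  have hgm : Measurable (gradPos Ω ψ) := hψ.measurable_gradPos hΩ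
  have hkm : Measurable fun X : Plane => -((X 0 - X₀ 0) / X 0 ^ 2) * ‖gradPos Ω ψ X‖ ^ 2 := by
    fun_prop
  have hki : IntegrableOn (fun X : Plane => -((X 0 - X₀ 0) / X 0 ^ 2) * ‖gradPos Ω ψ X‖ ^ 2)
      (Metric.closedBall X₀ (delta Ω X₀)) := by
    refine Integrable.mono' (hψ.integrableOn_grad_sq hΩ hX₀ hx) hkm.aestronglyMeasurable ?_
    refine (ae_restrict_iff' Metric.isClosed_closedBall.measurableSet).2
      (Eventually.of_forall fun X hX => ?_)
    have h1 := fst_ge_of_mem_closedBall_delta hX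
    have hXp : 0 < X 0 := by linarith
    have h2 : |X 0 - X₀ 0| ≤ X 0 := by
      have h3 := abs_sub_coord_le X X₀ 0
      rw [Metric.mem_closedBall, dist_eq_norm] at hX
      have h4 : delta Ω X₀ ≤ X₀ 0 / 2 := by
        rw [delta]; gcongr; exact min_le_left _ _
      linarith
    rw [norm_mul, norm_neg, Real.norm_eq_abs, abs_div, abs_of_pos (pow_pos hXp 2), norm_pow,
      norm_norm]
    calc |X 0 - X₀ 0| / X 0 ^ 2 * ‖gradPos Ω ψ X‖ ^ 2 ≤ X 0 / X 0 ^ 2 * ‖gradPos Ω ψ X‖ ^ 2 := by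
          gcongr
      _ = _ := by field_simp
  refine (continuousOn_integral_ball hkm (hki.mono_set Metric.ball_subset_closedBall)).congr
    fun t ht => ?_
  refine setIntegral_congr_ae Metric.isOpen_ball.measurableSet ?_
  filter_upwards [hψ.ae_grad_eq_ball hΩ hX₀ hx] with X hX hXB
  rw [hX (Metric.ball_subset_closedBall (Metric.ball_subset_ball ht.2.le hXB))]

end IsVariationalSolution

theorem chiPos_indicator {R : ℝ} {X : Plane} (hX : X ∈ Metric.ball X₀ R) :
    chiPos ((Metric.ball X₀ R).indicator ψ) X = chiPos ψ X := by
  by_cases hp : 0 < ψ X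
  · rw [chiPos_of_pos hp, chiPos_of_pos (by rwa [indicator_of_mem hX])]
  · rw [chiPos_of_not_pos hp, chiPos_of_not_pos (by rwa [indicator_of_mem hX])]

theorem measurable_indicator_ball {R : ℝ} (hc : ContinuousOn ψ (Metric.ball X₀ R)) :
    Measurable ((Metric.ball X₀ R).indicator ψ) := by
  refine measurable_of_restrict_of_restrict_compl (s := Metric.ball X₀ R)
    Metric.isOpen_ball.measurableSet ?_ ?_
  · exact (continuousOn_iff_continuous_domRestrict.1
      (hc.congr fun X hX => indicator_of_mem hX ψ)).measurable
  · have : (Metric.ball X₀ R)ᶜ.domRestrict ((Metric.ball X₀ R).indicator ψ) = fun _ => 0 := by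
      ext1 X; exact indicator_of_notMem X.2 _
    rw [this]; exact measurable_const

theorem continuousOn_termI₂_of_continuousOn {ρ : ℝ} (hc : ContinuousOn ψ (Metric.ball X₀ ρ)) :
    ContinuousOn (termI₂ ψ X₀) (Ioo 0 ρ) := by
  have hχ := measurable_chiPos (measurable_indicator_ball hc)
  have hb : MeasBdd X₀ ρ fun X => (X 0 - X₀ 0) * X 1 * chiPos ((Metric.ball X₀ ρ).indicator ψ) X := by
    refine ⟨by fun_prop, ρ * (|X₀ 1| + ρ) * 1, fun X hX => ?_⟩
    have hXn : ‖X - X₀‖ ≤ ρ := (LocalSolution.norm_sub_lt hX).le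
    have h0 := (norm_nonneg _).trans hXn
    have h1 := (abs_sub_coord_le X X₀ 0).trans hXn
    have h2 := (abs_sub_coord_le X X₀ 1).trans hXn
    have h3 : |X 1| ≤ |X₀ 1| + ρ := by
      have := abs_add_le (X₀ 1) (X 1 - X₀ 1)
      rw [add_sub_cancel] at this
      linarith
    have h4 := chiPos_mem ((Metric.ball X₀ ρ).indicator ψ) X
    rw [abs_mul, abs_mul, abs_of_nonneg h4.1]
    gcongr
    · exact h4.1
    · exact h4.2
  refine hb.continuousOn_integral.congr fun t ht => ?_
  refine setIntegral_congr_fun Metric.isOpen_ball.measurableSet fun X hX => ?_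
  simp only [chiPos_indicator (Metric.ball_subset_ball ht.2.le hX)]

theorem continuousOn_termJ₁_of_continuousOn {ρ : ℝ} (hc : ContinuousOn ψ (Metric.closedBall X₀ ρ))
    (hx : ∀ X ∈ Metric.closedBall X₀ ρ, 0 < X 0) : ContinuousOn (termJ₁ ψ X₀) (Ioo 0 ρ) := by
  have hd : ContinuousOn (fun X => (X 0 - X₀ 0) / X 0 ^ 2 * ψ X ^ 2) (Metric.closedBall X₀ ρ) :=
    ((by fun_prop : ContinuousOn (fun X : Plane => X 0 - X₀ 0) _).div
      (by fun_prop) fun X hX => pow_ne_zero 2 (hx X hX).ne').mul (hc.pow 2)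
  obtain ⟨B, hB⟩ := (isCompact_closedBall X₀ ρ).exists_bound_of_continuousOn hd
  exact continuousOn_circleInt (hd.mono Metric.ball_subset_closedBall)
    fun X hX => hB X (Metric.ball_subset_closedBall hX)

/-! ### Localization of the functionals -/

section localize

variable {R : ℝ}

theorem bdryMass_indicator {r : ℝ} (hr : r ∈ Ioo 0 R) :
    bdryMass ((Metric.ball X₀ R).indicator ψ) X₀ r = bdryMass ψ X₀ r :=
  circleInt_congr hr.1.le hr.2 fun X hX => by rw [indicator_of_mem hX]

theorem termJ₁_indicator {r : ℝ} (hr : r ∈ Ioo 0 R) :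
    termJ₁ ((Metric.ball X₀ R).indicator ψ) X₀ r = termJ₁ ψ X₀ r :=
  circleInt_congr hr.1.le hr.2 fun X hX => by rw [indicator_of_mem hX]

theorem termI₂_indicator {r : ℝ} (hr : r ∈ Ioo 0 R) :
    termI₂ ((Metric.ball X₀ R).indicator ψ) X₀ r = termI₂ ψ X₀ r :=
  setIntegral_congr_fun Metric.isOpen_ball.measurableSet fun X hX => by
    simp only [chiPos_indicator (Metric.ball_subset_ball hr.2.le hX)]

theorem setIntegral_ball_congr {r : ℝ} (hr : r ∈ Ioo 0 R)
    (hG : ∀ᵐ X, X ∈ Metric.ball X₀ R → G X = g X) {k l : Plane → ℝ}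
    (h : ∀ X ∈ Metric.ball X₀ R, G X = g X → k X = l X) :
    ∫ X in Metric.ball X₀ r, k X = ∫ X in Metric.ball X₀ r, l X := by
  refine setIntegral_congr_ae Metric.isOpen_ball.measurableSet ?_
  filter_upwards [hG] with X hX hXB
  have hXR := Metric.ball_subset_ball hr.2.le hXB
  exact h X hXR (hX hXR)

theorem termI₁_congr {r : ℝ} (hr : r ∈ Ioo 0 R)
    (hG : ∀ᵐ X, X ∈ Metric.ball X₀ R → G X = g X) : termI₁ G X₀ r = termI₁ g X₀ r :=
  setIntegral_ball_congr hr hG fun X _ e => by rw [e]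

theorem weissEnergy_indicator {r : ℝ} (hr : r ∈ Ioo 0 R)
    (hG : ∀ᵐ X, X ∈ Metric.ball X₀ R → G X = g X) :
    weissEnergy f ((Metric.ball X₀ R).indicator ψ) g X₀ r = weissEnergy f ψ G X₀ r := by
  rw [weissEnergy, weissEnergy, energyI, energyI, energyJ, energyJ, bdryMass_indicator hr]
  congr 2
  refine (setIntegral_ball_congr hr hG fun X hX e => ?_).symm
  rw [e, indicator_of_mem hX, chiPos_indicator hX]

/-- By the energy identity the numerator of D is r times the flux, and the excess was defined by
subtracting 3/2 of the mass. -/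
theorem freqD_eq {C : ℝ} (h : LocalSolution X₀ R C f ((Metric.ball X₀ R).indicator ψ) g)
    (hm : Measurable ((Metric.ball X₀ R).indicator ψ)) {r : ℝ} (hr : r ∈ Ioo 0 R)
    (hG : ∀ᵐ X, X ∈ Metric.ball X₀ R → G X = g X)
    (hJ : massRatio ((Metric.ball X₀ R).indicator ψ) X₀ r ≠ 0) :
    freqD f ψ G X₀ r = 3 / 2 + excess ((Metric.ball X₀ R).indicator ψ) g X₀ r /
      massRatio ((Metric.ball X₀ R).indicator ψ) X₀ r := by
  have hr0 := hr.1
  have e : ∫ X in Metric.ball X₀ r, (‖G X‖ ^ 2 / X 0 - X 0 * ψ X * f (ψ X)) =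
      fluxInt ((Metric.ball X₀ R).indicator ψ) g X₀ r := by
    rw [fluxInt, ← h.integral_energy_eq hm hr]
    refine setIntegral_ball_congr hr hG fun X hX e => ?_
    rw [e, indicator_of_mem hX]
  have hS : bdryMass ((Metric.ball X₀ R).indicator ψ) X₀ r ≠ 0 := fun h0 => hJ (by
    rw [massRatio, h0, zero_div])
  rw [freqD, e, ← bdryMass_indicator hr, excess, massRatio]
  field_simp
  ring

theorem freqV_eq {r : ℝ} (hr : r ∈ Ioo 0 R)
    (hG : ∀ᵐ X, X ∈ Metric.ball X₀ R → G X = g X) :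
    freqV ψ G X₀ r = volumeTerm ((Metric.ball X₀ R).indicator ψ) g X₀ r /
      massRatio ((Metric.ball X₀ R).indicator ψ) X₀ r := by
  have hr0 := hr.1
  have hmem : ∀ t ∈ Ioc 0 r, t ∈ Ioo 0 R := fun t ht => ⟨ht.1, ht.2.trans_lt hr.2⟩
  have e0 : ∫ X in Metric.ball X₀ r, max (X 1) 0 * (X₀ 0 - X 0 * chiPos ψ X) =
      ∫ X in Metric.ball X₀ r, max (X 1) 0 *
        (X₀ 0 - X 0 * chiPos ((Metric.ball X₀ R).indicator ψ) X) :=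
    setIntegral_congr_fun Metric.isOpen_ball.measurableSet fun X hX => by
      simp only [chiPos_indicator (Metric.ball_subset_ball hr.2.le hX)]
  have e1 : ∫ t in (0 : ℝ)..r, t ^ (-4 : ℤ) * termI₁ G X₀ t =
      ∫ t in (0 : ℝ)..r, termI₁ g X₀ t / t ^ 4 := by
    rw [intervalIntegral.integral_of_le hr0.le, intervalIntegral.integral_of_le hr0.le]
    refine setIntegral_congr_fun measurableSet_Ioc fun t ht => ?_
    simp only [termI₁_congr (hmem t ht) hG, zpow_neg, div_eq_inv_mul]
    norm_cast
  have e2 : ∫ t in (0 : ℝ)..r, t ^ (-4 : ℤ) * termI₂ ψ X₀ t =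
      ∫ t in (0 : ℝ)..r, termI₂ ((Metric.ball X₀ R).indicator ψ) X₀ t / t ^ 4 := by
    rw [intervalIntegral.integral_of_le hr0.le, intervalIntegral.integral_of_le hr0.le]
    refine setIntegral_congr_fun measurableSet_Ioc fun t ht => ?_
    simp only [termI₂_indicator (hmem t ht), zpow_neg, div_eq_inv_mul]
    norm_cast
  have e3 : ∫ t in (0 : ℝ)..r, t ^ (-5 : ℤ) * termJ₁ ψ X₀ t =
      ∫ t in (0 : ℝ)..r, termJ₁ ((Metric.ball X₀ R).indicator ψ) X₀ t / t ^ 5 := by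
    rw [intervalIntegral.integral_of_le hr0.le, intervalIntegral.integral_of_le hr0.le]
    refine setIntegral_congr_fun measurableSet_Ioc fun t ht => ?_
    simp only [termJ₁_indicator (hmem t ht), zpow_neg, div_eq_inv_mul]
    norm_cast
  rw [freqV, e0, e1, e2, e3, volumeTerm, massRatio, ← bdryMass_indicator hr]
  -- Where the mass vanishes both sides are 0 by the convention for division by zero.
  by_cases hS : bdryMass ((Metric.ball X₀ R).indicator ψ) X₀ r = 0
  · rw [hS]; simp
  · field_simp

end localize

/-- The limits of the frequency functions. -/
theorem tendsto_freq {R C R' C' : ℝ}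
    (h : LocalSolution X₀ R C f ((Metric.ball X₀ R).indicator ψ) g)
    (hm : Measurable ((Metric.ball X₀ R).indicator ψ))
    (hG : ∀ᵐ X, X ∈ Metric.ball X₀ R → G X = g X) (hR : R' ≤ R)
    (hF : FrequencySystem R' C' (massRatio ((Metric.ball X₀ R).indicator ψ) X₀)
      (excess ((Metric.ball X₀ R).indicator ψ) g X₀)
      (fun r => -(termJ₁ ((Metric.ball X₀ R).indicator ψ) X₀ r / r ^ 5))
      (weissDefect ((Metric.ball X₀ R).indicator ψ) g X₀)
      (defectRatio ((Metric.ball X₀ R).indicator ψ) X₀) (gradRatio g X₀)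
      (volumeTerm ((Metric.ball X₀ R).indicator ψ) g X₀)
      (vortexError f ((Metric.ball X₀ R).indicator ψ) X₀)) {q₀ : ℝ}
    (hq : Tendsto (FrequencySystem.qfun (massRatio ((Metric.ball X₀ R).indicator ψ) X₀)
      (weissDefect ((Metric.ball X₀ R).indicator ψ) g X₀)) (𝓝[>] 0) (𝓝 q₀)) :
    (∀ᶠ r in 𝓝[>] (0 : ℝ), 0 < bdryMass ψ X₀ r) ∧
      Tendsto (freqV ψ G X₀) (𝓝[>] 0) (𝓝 0) ∧
      Tendsto (freqD f ψ G X₀) (𝓝[>] 0) (𝓝 (3 / 2 + q₀)) ∧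
      Tendsto (freqH f ψ G X₀) (𝓝[>] 0) (𝓝 (3 / 2 + q₀)) := by
  have hIoo : Ioo 0 R' ∈ 𝓝[>] (0 : ℝ) := Ioo_mem_nhdsGT hF.R_pos
  have hmem : ∀ r ∈ Ioo 0 R', r ∈ Ioo 0 R := fun r hr => ⟨hr.1, hr.2.trans_le hR⟩
  have hV : Tendsto (freqV ψ G X₀) (𝓝[>] 0) (𝓝 0) := by
    refine hF.tendsto_v_div.congr' ?_
    filter_upwards [hIoo] with r hr
    exact (freqV_eq (hmem r hr) hG).symm
  have hD : Tendsto (freqD f ψ G X₀) (𝓝[>] 0) (𝓝 (3 / 2 + q₀)) := by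
    have h1 := ((hq.add (hF.tendsto_v_div.add hF.tendsto_κ_div)).const_add (3 / 2))
    rw [add_zero, add_zero] at h1
    refine h1.congr' ?_
    filter_upwards [hIoo] with r hr
    rw [freqD_eq h hm (hmem r hr) hG (hF.J_pos hr).ne', hF.L_div hr, add_div]
  refine ⟨?_, hV, hD, ?_⟩
  · filter_upwards [hIoo] with r hr
    have h1 := hF.J_pos hr
    rw [massRatio, bdryMass_indicator (hmem r hr)] at h1
    exact (div_pos_iff_of_pos_right (pow_pos hr.1 4)).1 h1
  · have := hD.sub hV
    rwa [sub_zero] at this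

/-- Near a degenerate point there is a local solution with a frequency system. -/
theorem IsVariationalSolution.exists_local (hψ : IsVariationalSolution Ω f ψ G)
    (hΩ : IsFlowDomain Ω) (hf : Continuous f) (hfg : VorticityGrowth f)
    (hg : GrowthAssumption Ω ψ G) (hX₀ : X₀ ∈ degeneratePoints Ω f ψ G) :
    ∃ R C R' C', R ≤ delta Ω X₀ ∧ R' ≤ R ∧
      LocalSolution X₀ R C f ((Metric.ball X₀ R).indicator ψ) (gradPos Ω ψ) ∧
      Measurable ((Metric.ball X₀ R).indicator ψ) ∧
      (∀ᵐ X, X ∈ Metric.ball X₀ R → G X = gradPos Ω ψ X) ∧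
      FrequencySystem R' C' (massRatio ((Metric.ball X₀ R).indicator ψ) X₀)
        (excess ((Metric.ball X₀ R).indicator ψ) (gradPos Ω ψ) X₀)
        (fun r => -(termJ₁ ((Metric.ball X₀ R).indicator ψ) X₀ r / r ^ 5))
        (weissDefect ((Metric.ball X₀ R).indicator ψ) (gradPos Ω ψ) X₀)
        (defectRatio ((Metric.ball X₀ R).indicator ψ) X₀) (gradRatio (gradPos Ω ψ) X₀)
        (volumeTerm ((Metric.ball X₀ R).indicator ψ) (gradPos Ω ψ) X₀)
        (vortexError f ((Metric.ball X₀ R).indicator ψ) X₀) := by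
  obtain ⟨R, C, h, hRδ⟩ := hψ.exists_localSolution hΩ hf hfg hg hX₀.1
  obtain ⟨h', hm⟩ := h.localize
  have hG : ∀ᵐ X, X ∈ Metric.ball X₀ R → G X = gradPos Ω ψ X := by
    filter_upwards [hψ.ae_grad_eq_ball hΩ hX₀.1.1 hX₀.1.2.2.2] with X hX hXB
    exact hX (Metric.ball_subset_closedBall (Metric.ball_subset_ball hRδ hXB))
  obtain ⟨R', C', hR', hF⟩ := h'.exists_frequencySystem hm (hX₀.2.congr' (by
    filter_upwards [Ioo_mem_nhdsGT h.R_pos] with r hr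
    exact (weissEnergy_indicator hr hG).symm))
  exact ⟨R, C, R', C', hRδ, hR', h', hm, hG, hF⟩

/-- The terms in the definition of `V` are well defined. -/
theorem IsVariationalSolution.intervalIntegrable_terms (hψ : IsVariationalSolution Ω f ψ G)
    (hΩ : IsFlowDomain Ω) (hX₀ : X₀ ∈ Ω) (hx : 0 < X₀ 0) {R C : ℝ}
    (h : LocalSolution X₀ R C f ((Metric.ball X₀ R).indicator ψ) g)
    (hm : Measurable ((Metric.ball X₀ R).indicator ψ))
    (hG : ∀ᵐ X, X ∈ Metric.ball X₀ R → G X = g X) {r : ℝ} (hr : r ∈ Ioo 0 (delta Ω X₀)) :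
    IntervalIntegrable (fun t => t ^ (-4 : ℤ) * termI₁ G X₀ t) volume 0 r ∧
      IntervalIntegrable (fun t => t ^ (-4 : ℤ) * termI₂ ψ X₀ t) volume 0 r ∧
      IntervalIntegrable (fun t => t ^ (-5 : ℤ) * termJ₁ ψ X₀ t) volume 0 r := by
  have hsub := closedBall_delta_subset hΩ hX₀ hx
  have hc := hψ.continuousOn.mono hsub
  have hz : ∀ (n : ℕ) (k : ℝ → ℝ),
      (fun t : ℝ => t ^ (-(n : ℤ)) * k t) = fun t => k t / t ^ n := fun n k => by
    ext t; rw [zpow_neg, zpow_natCast, div_eq_inv_mul]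
  refine ⟨?_, ?_, ?_⟩
  · refine (hz 4 (termI₁ G X₀)).symm ▸ intervalIntegrable_of_continuousOn_Ioo h.R_pos
      (h.integrableOn_termI₁.congr_fun (fun t ht => ?_) measurableSet_Ioo)
      (continuousOn_div_pow (hψ.continuousOn_termI₁ hΩ hX₀ hx) 4) hr
    simp only [termI₁_congr ht hG]
  · refine (hz 4 (termI₂ ψ X₀)).symm ▸ intervalIntegrable_of_continuousOn_Ioo h.R_pos
      ((h.integrableOn_termI₂ hm).congr_fun (fun t ht => ?_) measurableSet_Ioo)
      (continuousOn_div_pow (continuousOn_termI₂_of_continuousOn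
        (hc.mono Metric.ball_subset_closedBall)) 4) hr
    simp only [termI₂_indicator ht]
  · refine (hz 5 (termJ₁ ψ X₀)).symm ▸ intervalIntegrable_of_continuousOn_Ioo h.R_pos
      ((h.integrableOn_termJ₁ hm).congr_fun (fun t ht => ?_) measurableSet_Ioo)
      (continuousOn_div_pow (continuousOn_termJ₁_of_continuousOn hc fun X hX => by
        have := fst_ge_of_mem_closedBall_delta hX; linarith) 5) hr
    simp only [termJ₁_indicator ht]

variable {Ω : Set Plane} {f : ℝ → ℝ} {ψ : Plane → ℝ} {G g : Plane → Plane} {X₀ : Plane}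

/-! ### Blow-ups -/

/-- The dilation `X ↦ X₀ + r X`. -/
noncomputable def dilation (X₀ : Plane) {r : ℝ} (hr : r ≠ 0) : Plane ≃ₜ Plane :=
  (Homeomorph.smulOfNeZero r hr).trans (Homeomorph.addLeft X₀)

theorem dilation_apply {r : ℝ} (hr : r ≠ 0) (X : Plane) : dilation X₀ hr X = X₀ + r • X := rfl

theorem preimage_dilation_ball {r : ℝ} (hr : 0 < r) (s : ℝ) :
    dilation X₀ hr.ne' ⁻¹' Metric.ball X₀ (r * s) = Metric.ball 0 s := by
  ext X
  simp [dilation_apply, norm_smul, abs_of_pos hr, hr]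

theorem map_dilation {r : ℝ} (hr : 0 < r) :
    Measure.map (dilation X₀ hr.ne') (volume.restrict (Metric.ball 0 1)) =
      ENNReal.ofReal (r ^ 2)⁻¹ • volume.restrict (Metric.ball X₀ r) := by
  have e : (dilation X₀ hr.ne' : Plane → Plane) = (fun Y => X₀ + Y) ∘ fun X => r • X := rfl
  have h1 : Measure.map (dilation X₀ hr.ne') volume = ENNReal.ofReal (r ^ 2)⁻¹ • volume := by
    rw [e, ← Measure.map_map (by fun_prop) (by fun_prop),
      Measure.map_addHaar_smul _ hr.ne', Measure.map_smul, map_add_left_eq_self]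
    simp [abs_of_pos hr]
  have h2 := (dilation X₀ hr.ne').measurableEmbedding.restrict_map volume (Metric.ball X₀ r)
  have h3 := preimage_dilation_ball (X₀ := X₀) hr 1
  rw [mul_one] at h3
  rw [← h3, ← h2, h1, Measure.restrict_smul]

theorem integral_dilation {r : ℝ} (hr : 0 < r) (k : Plane → ℝ) :
    ∫ X in Metric.ball (0 : Plane) 1, k (X₀ + r • X) =
      (r ^ 2)⁻¹ * ∫ X in Metric.ball X₀ r, k X := by
  have h1 := (dilation X₀ hr.ne').measurableEmbedding.integral_map
    (μ := volume.restrict (Metric.ball 0 1)) k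
  rw [map_dilation hr, integral_smul_measure, ENNReal.toReal_ofReal (by positivity)] at h1
  exact h1.symm

theorem memLp_dilation {E : Type*} [NormedAddCommGroup E] {r : ℝ} (hr : 0 < r) {k : Plane → E}
    (hk : MemLp k 2 (volume.restrict (Metric.ball X₀ r))) :
    MemLp (fun X => k (X₀ + r • X)) 2 (volume.restrict (Metric.ball (0 : Plane) 1)) := by
  have h1 := (dilation X₀ hr.ne').measurableEmbedding.memLp_map_measure_iff (p := 2) (g := k)
    (μ := volume.restrict (Metric.ball 0 1))
  rw [map_dilation hr] at h1
  exact h1.1 (hk.smul_measure ENNReal.ofReal_ne_top)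

theorem HasWeakGradient.dilation {U : Set Plane} (h : HasWeakGradient ψ G U) {r : ℝ} (hr : 0 < r)
    (hU : Metric.ball X₀ r ⊆ U) (c : ℝ) {η : Plane → ℝ} (hη : ContDiff ℝ ∞ η)
    (hηc : HasCompactSupport η) (hηs : tsupport η ⊆ Metric.ball 0 1) (i : Fin 2) :
    ∫ X in Metric.ball (0 : Plane) 1, ψ (X₀ + r • X) * c * partialDeriv i η X =
      -∫ X in Metric.ball (0 : Plane) 1, ((r * c) • G (X₀ + r • X)) i * η X := by
  set T := StagnationFlow.dilation X₀ hr.ne' with hT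
  set ζ : Plane → ℝ := η ∘ T.symm with hζ
  have hTs : ContDiff ℝ ∞ T.symm := by
    have : (T.symm : Plane → Plane) = fun Y => r⁻¹ • (-X₀ + Y) := rfl
    rw [this]; fun_prop
  have hζT : ∀ X, ζ (X₀ + r • X) = η X := fun X => by
    rw [← dilation_apply hr.ne', hζ, Function.comp_apply, T.symm_apply_apply]
  have hd : ∀ X, partialDeriv i η X = r * partialDeriv i ζ (X₀ + r • X) := fun X => by
    have h1 : HasFDerivAt (fun X : Plane => X₀ + r • X) (r • ContinuousLinearMap.id ℝ Plane) X :=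
      ((hasFDerivAt_id X).const_smul r).const_add X₀
    have h2 := ((hη.comp hTs).differentiable (by simp) (X₀ + r • X)).hasFDerivAt.comp X h1
    have h3 : (η ∘ T.symm) ∘ (fun X : Plane => X₀ + r • X) = η := funext hζT
    rw [h3] at h2
    rw [partialDeriv, h2.fderiv, partialDeriv]
    simp [hζ]
  have hts : tsupport ζ ⊆ Metric.ball X₀ r := by
    have h1 : tsupport ζ = T.symm ⁻¹' tsupport η := tsupport_comp_eq_preimage η T.symm
    intro Y hY
    rw [h1] at hY
    have h3 := preimage_dilation_ball (X₀ := X₀) hr 1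
    have h2 := hηs hY
    rw [← h3, mem_preimage, T.apply_symm_apply, mul_one] at h2
    exact h2
  have hz : ∀ Y ∉ Metric.ball X₀ r, ζ Y = 0 ∧ partialDeriv i ζ Y = 0 := fun Y hY => by
    have h1 : Y ∉ tsupport ζ := fun h => hY (hts h)
    refine ⟨image_eq_zero_of_notMem_tsupport h1, ?_⟩
    rw [partialDeriv, fderiv_of_notMem_tsupport ℝ h1]; rfl
  have key := h.2.2 ζ (hη.comp hTs) (hηc.comp_homeomorph T.symm) (hts.trans hU) i
  have hUB : ∀ k : Plane → ℝ, (∀ Y ∉ Metric.ball X₀ r, k Y = 0) →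
      ∫ Y in U, k Y = ∫ Y in Metric.ball X₀ r, k Y := fun k hk => by
    rw [setIntegral_eq_integral_of_forall_compl_eq_zero fun Y hY => hk Y fun h => hY (hU h),
      setIntegral_eq_integral_of_forall_compl_eq_zero hk]
  rw [hUB _ fun Y hY => by rw [(hz Y hY).2, mul_zero],
    hUB _ fun Y hY => by rw [(hz Y hY).1, mul_zero]] at key
  have e1 := integral_dilation (X₀ := X₀) hr fun Y => r * c * (ψ Y * partialDeriv i ζ Y)
  have e2 := integral_dilation (X₀ := X₀) hr fun Y => r * c * (G Y i * ζ Y)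
  rw [integral_const_mul _ (fun Y => ψ Y * partialDeriv i ζ Y)] at e1
  rw [integral_const_mul _ (fun Y => G Y i * ζ Y)] at e2
  calc _ = ∫ X in Metric.ball (0 : Plane) 1,
        r * c * (ψ (X₀ + r • X) * partialDeriv i ζ (X₀ + r • X)) := by
        congr 1; ext X; rw [hd]; ring
    _ = -∫ X in Metric.ball (0 : Plane) 1, r * c * (G (X₀ + r • X) i * ζ (X₀ + r • X)) := by
        rw [e1, e2, key]; ring
    _ = _ := by
        congr 2; ext X; rw [hζT, PiLp.smul_apply, smul_eq_mul]; ring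

/-- Continuity on the closed δ-ball bounds ψ; for the gradient the weight 1/x is bounded below
there, so weighted square integrability suffices. -/
theorem IsVariationalSolution.memLp_ball (hψ : IsVariationalSolution Ω f ψ G)
    (hΩ : IsFlowDomain Ω) (hX₀ : X₀ ∈ Ω) (hx : 0 < X₀ 0) {r : ℝ} (hr : r ≤ delta Ω X₀) :
    MemLp ψ 2 (volume.restrict (Metric.ball X₀ r)) ∧
      MemLp G 2 (volume.restrict (Metric.ball X₀ r)) := by
  have hsub := closedBall_delta_subset hΩ hX₀ hx
  have hb : Metric.ball X₀ r ⊆ Metric.closedBall X₀ (delta Ω X₀) :=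
    (Metric.ball_subset_ball hr).trans Metric.ball_subset_closedBall
  constructor
  · have hc := hψ.continuousOn.mono hsub
    obtain ⟨B, hB⟩ := (isCompact_closedBall _ _).exists_bound_of_continuousOn hc
    have : IsFiniteMeasure (volume.restrict (Metric.ball X₀ r)) :=
      ⟨by rw [Measure.restrict_apply_univ]; exact measure_ball_lt_top⟩
    refine MemLp.of_bound ((hc.mono hb).aestronglyMeasurable Metric.isOpen_ball.measurableSet) B ?_
    filter_upwards [ae_restrict_mem Metric.isOpen_ball.measurableSet] with X hX using hB X (hb hX)
  · have hm : AEStronglyMeasurable G (volume.restrict (Metric.ball X₀ r)) :=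
      hψ.grad_meas.mono_measure (Measure.restrict_mono (hb.trans hsub) le_rfl)
    rw [memLp_two_iff_integrable_sq_norm hm]
    have hi := (hψ.weighted_grad_sq _ hsub (isCompact_closedBall _ _)).mono_set hb
    refine Integrable.mono' (hi.const_mul (X₀ 0 + delta Ω X₀)) (hm.norm.pow 2) ?_
    filter_upwards [ae_restrict_mem Metric.isOpen_ball.measurableSet] with X hX
    have h1 := fst_ge_of_mem_closedBall_delta (hb hX)
    have h2 := abs_le.1 (abs_sub_coord_le X X₀ 0)
    have h3 := hb hX
    rw [Metric.mem_closedBall, dist_eq_norm] at h3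
    have h4 : 0 < X 0 := by linarith
    rw [Real.norm_of_nonneg (by positivity), ← mul_div_assoc, le_div_iff₀ h4, mul_comm]
    gcongr; linarith

theorem locallyIntegrableOn_of_memLp {E : Type*} [NormedAddCommGroup E] {k : Plane → E}
    (h : MemLp k 2 (volume.restrict (Metric.ball (0 : Plane) 1))) :
    LocallyIntegrableOn k (Metric.ball (0 : Plane) 1) := by
  have : IsFiniteMeasure (volume.restrict (Metric.ball (0 : Plane) 1)) :=
    ⟨by rw [Measure.restrict_apply_univ]; exact measure_ball_lt_top⟩
  exact IntegrableOn.locallyIntegrableOn (h.integrable one_le_two)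

/-- No positivity of S(r) is needed: if the normalizing root is 0, division by zero makes both the
blow-up and its gradient vanish. -/
theorem IsVariationalSolution.memW12_blowUp (hψ : IsVariationalSolution Ω f ψ G)
    (hΩ : IsFlowDomain Ω) (hX₀ : X₀ ∈ Ω) (hx : 0 < X₀ 0) {r : ℝ} (hr : r ∈ Ioo 0 (delta Ω X₀)) :
    MemW12 (blowUp ψ X₀ r) (blowUpGrad ψ G X₀ r) (Metric.ball 0 1) := by
  obtain ⟨h1, h2⟩ := hψ.memLp_ball hΩ hX₀ hx hr.2.le
  have m1 : MemLp (blowUp ψ X₀ r) 2 (volume.restrict (Metric.ball (0 : Plane) 1)) := by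
    have := (memLp_dilation hr.1 h1).const_mul (Real.sqrt (r⁻¹ * bdryMass ψ X₀ r))⁻¹
    have e : blowUp ψ X₀ r = fun X => (Real.sqrt (r⁻¹ * bdryMass ψ X₀ r))⁻¹ * ψ (X₀ + r • X) := by
      ext X; rw [blowUp, div_eq_inv_mul]
    rwa [e]
  have m2 : MemLp (blowUpGrad ψ G X₀ r) 2 (volume.restrict (Metric.ball (0 : Plane) 1)) :=
    (memLp_dilation hr.1 h2).const_smul (r / Real.sqrt (r⁻¹ * bdryMass ψ X₀ r))
  refine ⟨m1, m2, locallyIntegrableOn_of_memLp m1, locallyIntegrableOn_of_memLp m2,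
    fun η hη hc hs i => ?_⟩
  refine hψ.hasWeakGradient.dilation hr.1 (fun X hX => ?_) _ hη hc hs i
  have hX' := Metric.ball_subset_closedBall (Metric.ball_subset_ball hr.2.le hX)
  refine ⟨closedBall_delta_subset hΩ hX₀ hx hX', ?_⟩
  have := fst_ge_of_mem_closedBall_delta hX'
  simp only [mem_ofPred_eq]; linarith

theorem w12NormSq_blowUp (ψ : Plane → ℝ) (G : Plane → Plane) {r : ℝ} (hr : 0 < r) :
    w12NormSq (blowUp ψ X₀ r) (blowUpGrad ψ G X₀ r) (Metric.ball 0 1) =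
      ((Real.sqrt (r⁻¹ * bdryMass ψ X₀ r))⁻¹) ^ 2 *
        ((r ^ 2)⁻¹ * (∫ X in Metric.ball X₀ r, ψ X ^ 2) + ∫ X in Metric.ball X₀ r, ‖G X‖ ^ 2) := by
  set c := (Real.sqrt (r⁻¹ * bdryMass ψ X₀ r))⁻¹ with hc
  have e1 := integral_dilation (X₀ := X₀) hr fun Y => c ^ 2 * ψ Y ^ 2
  have e2 := integral_dilation (X₀ := X₀) hr fun Y => (r * c) ^ 2 * ‖G Y‖ ^ 2
  rw [integral_const_mul _ (fun Y => ψ Y ^ 2)] at e1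
  rw [integral_const_mul _ (fun Y => ‖G Y‖ ^ 2)] at e2
  have h1 : ∀ X, blowUp ψ X₀ r X ^ 2 = c ^ 2 * ψ (X₀ + r • X) ^ 2 := fun X => by
    rw [blowUp, div_eq_mul_inv, ← hc]; ring
  have h2 : ∀ X, ‖blowUpGrad ψ G X₀ r X‖ ^ 2 = (r * c) ^ 2 * ‖G (X₀ + r • X)‖ ^ 2 := fun X => by
    rw [blowUpGrad, norm_smul, div_eq_mul_inv, ← hc, mul_pow, Real.norm_eq_abs, sq_abs]
  simp only [w12NormSq, h1, h2]
  rw [e1, e2]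
  field_simp

namespace LocalSolution

variable {R C : ℝ}

/-- The blow-ups are bounded in `W^{1,2}` as long as the gradient is controlled by the mass. -/
theorem w12NormSq_blowUp_le (h : LocalSolution X₀ R C f ((Metric.ball X₀ R).indicator ψ) g)
    (hm : Measurable ((Metric.ball X₀ R).indicator ψ))
    (hG : ∀ᵐ X, X ∈ Metric.ball X₀ R → G X = g X) {r M : ℝ} (hr : r ∈ Ioo 0 R)
    (hJ : 0 < massRatio ((Metric.ball X₀ R).indicator ψ) X₀ r)
    (hM : gradRatio g X₀ r ≤ M * massRatio ((Metric.ball X₀ R).indicator ψ) X₀ r) :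
    w12NormSq (blowUp ψ X₀ r) (blowUpGrad ψ G X₀ r) (Metric.ball 0 1) ≤
      2 * X₀ 0 * (1 + 3 * M) := by
  set u := (Metric.ball X₀ R).indicator ψ with hu
  have hr0 := hr.1
  have hx := h.center_pos
  have hle : r ≤ R := hr.2.le
  have bound : ∀ {k : Plane → ℝ}, MeasBdd X₀ R k → (∀ X, 0 ≤ k X) →
      ∫ X in Metric.ball X₀ r, k X ≤ 2 * X₀ 0 * ∫ X in Metric.ball X₀ r, k X / X 0 := by
    intro k hk h0
    rw [← integral_const_mul]
    refine hk.integral_mono ((h.measBdd_div hk).const_mul _) hle fun X hX => ?_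
    have hX' := Metric.ball_subset_ball hle hX
    rw [← mul_div_assoc, le_div_iff₀ (h.fst_pos hX'), mul_comm]
    exact mul_le_mul_of_nonneg_right (h.fst_mem hX').2 (h0 X)
  have i1 : ∫ X in Metric.ball X₀ r, ψ X ^ 2 = ∫ X in Metric.ball X₀ r, u X ^ 2 :=
    setIntegral_ball_congr hr hG fun X hX _ => by rw [hu, indicator_of_mem hX]
  have i2 : ∫ X in Metric.ball X₀ r, ‖G X‖ ^ 2 = ∫ X in Metric.ball X₀ r, ‖g X‖ ^ 2 :=
    setIntegral_ball_congr hr hG fun X _ e => by rw [e]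
  have b1 := bound ((h.measBdd_psi hm).pow 2) fun X => sq_nonneg _
  have b2 := bound h.measBdd_grad_sq fun X => sq_nonneg _
  have b3 := h.integral_mass_le hm hr
  rw [w12NormSq_blowUp ψ G hr0, i1, i2, ← bdryMass_indicator (ψ := ψ) hr, ← hu]
  set S := bdryMass u X₀ r with hS
  set A := ∫ X in Metric.ball X₀ r, ‖g X‖ ^ 2 / X 0 with hA
  have hSJ : massRatio u X₀ r = S / r ^ 4 := rfl
  have hαA : gradRatio g X₀ r = A / r ^ 3 := rfl
  have hSp : 0 < S := by rw [hSJ] at hJ; exact (div_pos_iff_of_pos_right (pow_pos hr0 4)).1 hJ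
  have hMA : r * A ≤ M * S := by
    rw [hSJ, hαA, div_le_iff₀ (by positivity)] at hM
    have : M * (S / r ^ 4) * r ^ 3 = M * S / r := by field_simp
    rw [this, le_div_iff₀ hr0] at hM
    linarith
  rw [inv_pow, Real.sq_sqrt (by positivity)]
  have e : (r⁻¹ * S)⁻¹ = r / S := by field_simp
  rw [e]
  -- Removing the weight costs 2x₀. The Poincaré inequality then contributes 1 + 2M through the
  -- function and the Dirichlet energy contributes another M.
  calc r / S * ((r ^ 2)⁻¹ * (∫ X in Metric.ball X₀ r, u X ^ 2) +
        ∫ X in Metric.ball X₀ r, ‖g X‖ ^ 2)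
      ≤ r / S * ((r ^ 2)⁻¹ * (2 * X₀ 0 * (r * S + 2 * r ^ 2 * A)) + 2 * X₀ 0 * A) := by
        gcongr
        exact b1.trans (by gcongr)
    _ = 2 * X₀ 0 * (1 + 3 * (r * A) / S) := by field_simp; ring
    _ ≤ _ := by
        have : r * A / S ≤ M := by rwa [div_le_iff₀ hSp]
        have e2 : 3 * (r * A) / S = 3 * (r * A / S) := by ring
        rw [e2]
        gcongr

end LocalSolution

/-- A sequence converging to `0` along which an eventually bounded quantity is bounded. -/
theorem exists_bound_of_eventually {B : ℝ → ℝ} {M : ℝ} (hB : ∀ᶠ r in 𝓝[>] 0, B r ≤ M) {ρ : ℕ → ℝ}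
    (hρ : ∀ m, 0 < ρ m) (h0 : Tendsto ρ atTop (𝓝 0)) : ∃ C, ∀ m, B (ρ m) ≤ C := by
  have h1 : Tendsto ρ atTop (𝓝[>] 0) :=
    tendsto_nhdsWithin_iff.2 ⟨h0, Eventually.of_forall hρ⟩
  obtain ⟨C, hC⟩ := (isBoundedUnder_of_eventually_le (h1.eventually hB)).bddAbove_range
  exact ⟨C, fun m => hC (mem_range_self m)⟩

/-! ### Polar kernels -/

/-- A measurable function of `(t, θ)` that is bounded for `t ∈ [a, 1]`. -/
def PolarBdd (a : ℝ) (K : ℝ → ℝ → ℝ) : Prop :=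
  Measurable (fun p : ℝ × ℝ => K p.1 p.2) ∧ ∃ B, ∀ t ∈ Icc a 1, ∀ θ, |K t θ| ≤ B

namespace PolarBdd

variable {a a' c d α β t : ℝ} {K L : ℝ → ℝ → ℝ}

theorem mono (h : PolarBdd a K) (ha : a ≤ a') : PolarBdd a' K :=
  ⟨h.1, h.2.imp fun _ hB t ht θ => hB t ⟨ha.trans ht.1, ht.2⟩ θ⟩

theorem mul (h : PolarBdd a K) (h' : PolarBdd a L) : PolarBdd a fun t θ => K t θ * L t θ := by
  obtain ⟨m, B, b⟩ := h
  obtain ⟨m', B', b'⟩ := h'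
  refine ⟨m.mul m', B * B', fun t ht θ => ?_⟩
  rw [abs_mul]
  exact mul_le_mul (b t ht θ) (b' t ht θ) (abs_nonneg _) ((abs_nonneg _).trans (b t ht θ))

theorem sub (h : PolarBdd a K) (h' : PolarBdd a L) : PolarBdd a fun t θ => K t θ - L t θ := by
  obtain ⟨m, B, b⟩ := h
  obtain ⟨m', B', b'⟩ := h'
  exact ⟨m.sub m', B + B', fun t ht θ => (abs_sub _ _).trans (add_le_add (b t ht θ) (b' t ht θ))⟩

theorem of_continuousOn {k : ℝ → ℝ} (hm : Measurable k) (hk : ContinuousOn k (Icc a 1)) :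
    PolarBdd a fun t _ => k t := by
  obtain ⟨B, hB⟩ := isCompact_Icc.exists_bound_of_continuousOn hk
  exact ⟨hm.comp measurable_fst, B, fun t ht _ => hB t ht⟩

theorem const (c : ℝ) : PolarBdd a fun _ _ => c := of_continuousOn measurable_const continuousOn_const

theorem const_mul (h : PolarBdd a K) (c : ℝ) : PolarBdd a fun t θ => c * K t θ := (const c).mul h

theorem sq (h : PolarBdd a K) : PolarBdd a fun t θ => K t θ ^ 2 := by
  simpa only [pow_two] using h.mul h

theorem abs (h : PolarBdd a K) : PolarBdd a fun t θ => |K t θ| :=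
  ⟨h.1.abs, h.2.imp fun B b t ht θ => by rw [abs_abs]; exact b t ht θ⟩

theorem rpow (ha : 0 < a) (y : ℝ) : PolarBdd a fun t _ => t ^ y :=
  of_continuousOn (by fun_prop) fun t ht =>
    (Real.continuousAt_rpow_const t y (Or.inl (ha.trans_le ht.1).ne')).continuousWithinAt

theorem intervalIntegrable_left (h : PolarBdd a K) (θ : ℝ) (hc : a ≤ c) (hcd : c ≤ d) (hd : d ≤ 1) :
    IntervalIntegrable (fun t => K t θ) volume c d := by
  obtain ⟨m, B, b⟩ := h
  refine (intervalIntegrable_const (c := B)).mono_fun'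
    (m.comp (measurable_id.prodMk measurable_const)).aestronglyMeasurable ?_
  rw [uIoc_of_le hcd]
  filter_upwards [ae_restrict_mem measurableSet_Ioc] with t ht
  exact b t ⟨hc.trans ht.1.le, ht.2.trans hd⟩ θ

theorem intervalIntegrable_right (h : PolarBdd a K) (ht : t ∈ Icc a 1) (α β : ℝ) :
    IntervalIntegrable (K t) volume α β := by
  obtain ⟨m, B, b⟩ := h
  exact (intervalIntegrable_const (c := B)).mono_fun'
    (m.comp (measurable_const.prodMk measurable_id)).aestronglyMeasurable
    (Eventually.of_forall fun θ => b t ht θ)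

theorem integrable_prod (h : PolarBdd a K) (hc : a ≤ c) (hd : d ≤ 1) (α β : ℝ) :
    Integrable (fun p : ℝ × ℝ => K p.1 p.2)
      ((volume.restrict (Ioc c d)).prod (volume.restrict (Ioc α β))) := by
  obtain ⟨m, B, b⟩ := h
  refine Integrable.mono' (integrable_const B) m.aestronglyMeasurable ?_
  rw [Measure.prod_restrict]
  filter_upwards [ae_restrict_mem (measurableSet_Ioc.prod measurableSet_Ioc)] with p hp
  exact b p.1 ⟨hc.trans hp.1.1.le, hp.1.2.trans hd⟩ p.2

theorem intervalIntegrable_integral_right (h : PolarBdd a K) (hc : a ≤ c) (hcd : c ≤ d)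
    (hd : d ≤ 1) (hαβ : α ≤ β) :
    IntervalIntegrable (fun t => ∫ θ in α..β, K t θ) volume c d := by
  simp only [intervalIntegral.integral_of_le hαβ]
  rw [intervalIntegrable_iff_integrableOn_Ioc_of_le hcd]
  exact (h.integrable_prod hc hd α β).integral_prod_left

theorem intervalIntegrable_integral_left (h : PolarBdd a K) (hc : a ≤ c) (hcd : c ≤ d)
    (hd : d ≤ 1) (hαβ : α ≤ β) :
    IntervalIntegrable (fun θ => ∫ t in c..d, K t θ) volume α β := by
  simp only [intervalIntegral.integral_of_le hcd]
  rw [intervalIntegrable_iff_integrableOn_Ioc_of_le hαβ]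
  exact (h.integrable_prod hc hd α β).integral_prod_right

theorem integral_swap (h : PolarBdd a K) (hc : a ≤ c) (hcd : c ≤ d) (hd : d ≤ 1) (hαβ : α ≤ β) :
    ∫ t in c..d, ∫ θ in α..β, K t θ = ∫ θ in α..β, ∫ t in c..d, K t θ := by
  simp only [intervalIntegral.integral_of_le hcd, intervalIntegral.integral_of_le hαβ]
  exact integral_integral_swap (h.integrable_prod hc hd α β)

end PolarBdd

/-- `(∫ |z|)² ≤ ∫ z²` on intervals of length at most one. -/
theorem sq_integral_abs_le {z : ℝ → ℝ} {a b : ℝ} (hab : a ≤ b) (hb : b - a ≤ 1)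
    (h1 : IntervalIntegrable (fun t => |z t|) volume a b)
    (h2 : IntervalIntegrable (fun t => z t ^ 2) volume a b) :
    (∫ t in a..b, |z t|) ^ 2 ≤ ∫ t in a..b, z t ^ 2 := by
  set c := ∫ t in a..b, |z t| with hc
  have h3 : ∫ t in a..b, (2 * c * |z t| - c ^ 2) ≤ ∫ t in a..b, z t ^ 2 := by
    refine intervalIntegral.integral_mono_on hab ((h1.const_mul _).sub intervalIntegrable_const) h2
      fun t _ => ?_
    have := sq_nonneg (|z t| - c)
    rw [← sq_abs (z t)]
    linarith
  rw [intervalIntegral.integral_sub (h1.const_mul _) intervalIntegrable_const,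
    intervalIntegral.integral_const_mul, ← hc, intervalIntegral.integral_const, smul_eq_mul] at h3
  nlinarith [mul_nonneg (sub_nonneg.2 hb) (sq_nonneg c)]

/-- A bound on circle functions that are Hölder continuous with exponent `1/2`. -/
theorem dist_le_of_sqrt_modulus {k : ℝ → ℝ} {K : ℝ}
    (hk : ∀ α β, α ≤ β → β ≤ α + 2 * Real.pi → |k β - k α| ≤ K * Real.sqrt (β - α)) {α β : ℝ}
    (h : |β - α| ≤ 2 * Real.pi) : dist (k β) (k α) ≤ K * Real.sqrt |β - α| := by
  rw [Real.dist_eq]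
  rcases le_total α β with hab | hab
  · rw [abs_of_nonneg (sub_nonneg.2 hab)] at h ⊢
    exact hk α β hab (by linarith)
  · rw [abs_sub_comm β α, abs_of_nonneg (sub_nonneg.2 hab)] at h ⊢
    rw [abs_sub_comm]
    exact hk β α hab (by linarith)

theorem continuous_of_sqrt_modulus {k : ℝ → ℝ} {K : ℝ}
    (hk : ∀ α β, α ≤ β → β ≤ α + 2 * Real.pi → |k β - k α| ≤ K * Real.sqrt (β - α)) :
    Continuous k := by
  refine continuous_iff_continuousAt.2 fun x => tendsto_iff_dist_tendsto_zero.2 ?_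
  have h1 : Tendsto (fun y => K * Real.sqrt |y - x|) (𝓝 x) (𝓝 0) := by
    have : Continuous fun y => K * Real.sqrt |y - x| := by fun_prop
    simpa using this.tendsto x
  refine squeeze_zero' (Eventually.of_forall fun _ => dist_nonneg) ?_ h1
  filter_upwards [Metric.ball_mem_nhds x Real.two_pi_pos] with y hy
  rw [Metric.mem_ball, Real.dist_eq] at hy
  exact dist_le_of_sqrt_modulus hk hy.le

/-! ### Compactness of fields in polar coordinates -/

/-- A nonnegative function `U` in polar coordinates of the unit disc that vanishes in the lower
half, with radial derivative `V` and angular derivative `W`. -/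
structure PolarField (H M : ℝ) (U V W : ℝ → ℝ → ℝ) : Prop where
  bddU : PolarBdd 0 U
  bddV : PolarBdd 0 V
  bddW : PolarBdd 0 W
  periodic : ∀ t, Function.Periodic (U t) (2 * Real.pi)
  periodicW : ∀ t, Function.Periodic (W t) (2 * Real.pi)
  nonneg : ∀ t ∈ Icc (0 : ℝ) 1, ∀ θ, 0 ≤ U t θ
  zero : ∀ t ∈ Icc (0 : ℝ) 1, ∀ θ, Real.sin θ ≤ 0 → U t θ = 0
  radial : ∀ θ, ∀ a ∈ Ioc (0 : ℝ) 1, ∀ b ∈ Icc a 1,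
    ∫ s in a..b, s ^ (-H - 1) * (s * V s θ - H * U s θ) = b ^ (-H) * U b θ - a ^ (-H) * U a θ
  angular : ∀ t ∈ Icc (0 : ℝ) 1, ∀ α β, α ≤ β → ∫ θ in α..β, W t θ = U t β - U t α
  energy : ∫ s in (1 / 2 : ℝ)..1, ∫ θ in (0 : ℝ)..(2 * Real.pi), W s θ ^ 2 ≤ M

/-- The radial average of the homogeneous profiles. -/
noncomputable def profile (H : ℝ) (U : ℝ → ℝ → ℝ) (θ : ℝ) : ℝ :=
  2 * ∫ s in (1 / 2 : ℝ)..1, s ^ (-H) * U s θ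

namespace PolarField

variable {H M : ℝ} {U V W : ℝ → ℝ → ℝ}

theorem bddProfile (h : PolarField H M U V W) {a : ℝ} (ha : 0 < a) :
    PolarBdd a fun s θ => s ^ (-H) * U s θ := (PolarBdd.rpow ha _).mul (h.bddU.mono ha.le)

theorem bddDefect (h : PolarField H M U V W) : PolarBdd 0 fun s θ => s * V s θ - H * U s θ :=
  ((PolarBdd.of_continuousOn measurable_id continuousOn_id).mul h.bddV).sub (h.bddU.const_mul H)

theorem rpow_le {a s y : ℝ} (ha : 0 < a) (hs : a ≤ s) (hy : y ≤ 0) : s ^ y ≤ a ^ y :=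
  Real.rpow_le_rpow_of_nonpos ha hs hy

/-- On each circle the increment is the integral of W over an arc, hence Hölder with exponent 1/2 in
terms of ∫W². The energy is controlled only after integration over the radius, which is why the
radial average is used rather than a single circle. -/
theorem abs_profile_sub_le (h : PolarField H M U V W) (hH : 0 ≤ H) {α β : ℝ} (hαβ : α ≤ β)
    (hβ : β ≤ α + 2 * Real.pi) :
    |profile H U β - profile H U α| ≤ (1 / 2 : ℝ) ^ (-H) * (M + 1) * Real.sqrt (β - α) := by
  rcases hαβ.eq_or_lt with rfl | hlt
  · simp
  -- The parameter in Young's inequality |W| ≤ (η/2)W² + 1/(2η), chosen so that both terms integrate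
  -- to order η over an arc of length η².
  set η := Real.sqrt (β - α) with hη
  have hη0 : 0 < η := Real.sqrt_pos.2 (sub_pos.2 hlt)
  have hη2 : η ^ 2 = β - α := Real.sq_sqrt (sub_nonneg.2 hαβ)
  have bW : PolarBdd (1 / 2) W := h.bddW.mono (by norm_num)
  have bp := h.bddProfile (a := 1 / 2) (by norm_num)
  have iW := bW.sq.intervalIntegrable_integral_right (c := 1 / 2) (d := 1) le_rfl (by norm_num)
    le_rfl (show (0 : ℝ) ≤ 2 * Real.pi by positivity)
  have hper : ∀ s, ∫ θ in α..(α + 2 * Real.pi), W s θ ^ 2 = ∫ θ in (0 : ℝ)..(2 * Real.pi), W s θ ^ 2 :=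
    fun s => by
      have hp : Function.Periodic (fun θ => W s θ ^ 2) (2 * Real.pi) := fun θ => by
        simp only [h.periodicW s θ]
      have := hp.intervalIntegral_add_eq α 0
      rwa [zero_add] at this
  have key : ∀ s ∈ Icc (1 / 2 : ℝ) 1, |s ^ (-H) * U s β - s ^ (-H) * U s α| ≤
      (1 / 2 : ℝ) ^ (-H) * (η / 2 * (∫ θ in (0 : ℝ)..(2 * Real.pi), W s θ ^ 2) + η / 2) := by
    intro s hs
    have hs0 : 0 < s := by linarith [hs.1]
    rw [← mul_sub, abs_mul, abs_of_pos (Real.rpow_pos_of_pos hs0 _),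
      ← h.angular s ⟨hs0.le, hs.2⟩ α β hαβ]
    have i2 := bW.sq.intervalIntegrable_right hs α β
    refine mul_le_mul (rpow_le (by norm_num) hs.1 (by linarith)) ?_ (abs_nonneg _) (by positivity)
    calc |∫ θ in α..β, W s θ| ≤ ∫ θ in α..β, |W s θ| :=
            intervalIntegral.abs_integral_le_integral_abs hαβ
        _ ≤ ∫ θ in α..β, (η / 2 * W s θ ^ 2 + 1 / (2 * η)) := by
            refine intervalIntegral.integral_mono_on hαβ
              (bW.abs.intervalIntegrable_right hs α β)
              ((i2.const_mul _).add intervalIntegrable_const) fun θ _ => ?_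
            have e : η / 2 * W s θ ^ 2 + 1 / (2 * η) = |W s θ| +
                (η * |W s θ| - 1) ^ 2 / (2 * η) := by
              rw [← sq_abs]; field_simp; ring
            rw [e]
            have : 0 ≤ (η * |W s θ| - 1) ^ 2 / (2 * η) := by positivity
            linarith
        _ = η / 2 * (∫ θ in α..β, W s θ ^ 2) + η / 2 := by
            rw [intervalIntegral.integral_add (i2.const_mul _) intervalIntegrable_const,
              intervalIntegral.integral_const_mul, intervalIntegral.integral_const, smul_eq_mul,
              ← hη2]
            field_simp
        _ ≤ η / 2 * (∫ θ in (0 : ℝ)..(2 * Real.pi), W s θ ^ 2) + η / 2 := by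
            rw [← hper s]
            gcongr
            exact intervalIntegral.integral_mono_interval le_rfl hαβ hβ
              (Eventually.of_forall fun θ => sq_nonneg _) (bW.sq.intervalIntegrable_right hs _ _)
  have i1 := bp.intervalIntegrable_left β le_rfl (by norm_num : (1 / 2 : ℝ) ≤ 1) le_rfl
  have i2 := bp.intervalIntegrable_left α le_rfl (by norm_num : (1 / 2 : ℝ) ≤ 1) le_rfl
  rw [profile, profile, ← mul_sub, ← intervalIntegral.integral_sub i1 i2, abs_mul, abs_two]
  calc _ ≤ 2 * ∫ s in (1 / 2 : ℝ)..1, |s ^ (-H) * U s β - s ^ (-H) * U s α| := by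
        gcongr
        exact intervalIntegral.abs_integral_le_integral_abs (by norm_num)
    _ ≤ 2 * ∫ s in (1 / 2 : ℝ)..1, (1 / 2 : ℝ) ^ (-H) *
          (η / 2 * (∫ θ in (0 : ℝ)..(2 * Real.pi), W s θ ^ 2) + η / 2) := by
        gcongr
        exact intervalIntegral.integral_mono_on (by norm_num) (i1.sub i2).abs
          (((iW.const_mul _).add intervalIntegrable_const).const_mul _) key
    _ = (1 / 2 : ℝ) ^ (-H) * ((∫ s in (1 / 2 : ℝ)..1, ∫ θ in (0 : ℝ)..(2 * Real.pi), W s θ ^ 2)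
          + 1 / 2) * η := by
        rw [intervalIntegral.integral_const_mul, intervalIntegral.integral_add (iW.const_mul _)
          intervalIntegrable_const, intervalIntegral.integral_const_mul,
          intervalIntegral.integral_const, smul_eq_mul]
        ring
    _ ≤ _ := by
        have := h.energy
        gcongr
        linarith

theorem periodic_profile (h : PolarField H M U V W) :
    Function.Periodic (profile H U) (2 * Real.pi) := fun θ => by
  simp only [profile, h.periodic _ θ]

theorem profile_nonneg (h : PolarField H M U V W) (θ : ℝ) : 0 ≤ profile H U θ := by
  refine mul_nonneg zero_le_two (intervalIntegral.integral_nonneg (by norm_num) fun s hs => ?_)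
  have hs0 : 0 < s := by linarith [hs.1]
  exact mul_nonneg (Real.rpow_pos_of_pos hs0 _).le (h.nonneg s ⟨hs0.le, hs.2⟩ θ)

theorem profile_zero (h : PolarField H M U V W) {θ : ℝ} (hθ : Real.sin θ ≤ 0) :
    profile H U θ = 0 := by
  rw [profile, intervalIntegral.integral_congr (g := fun _ => 0), intervalIntegral.integral_zero,
    mul_zero]
  intro s hs
  rw [uIcc_of_le (by norm_num)] at hs
  simp only [h.zero s ⟨by linarith [hs.1], hs.2⟩ θ hθ, mul_zero]

theorem energy_nonneg (h : PolarField H M U V W) : 0 ≤ M :=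
  (intervalIntegral.integral_nonneg (by norm_num) fun _ _ =>
    intervalIntegral.integral_nonneg (by positivity) fun _ _ => sq_nonneg _).trans h.energy

theorem continuous_profile (h : PolarField H M U V W) (hH : 0 ≤ H) : Continuous (profile H U) :=
  continuous_of_sqrt_modulus fun _ _ => h.abs_profile_sub_le hH

/-- The profile vanishes at −π/2, and every angle lies within one period of it, so the Hölder bound
controls the size. -/
theorem abs_profile_le (h : PolarField H M U V W) (hH : 0 ≤ H) (θ : ℝ) :
    |profile H U θ| ≤ (1 / 2 : ℝ) ^ (-H) * (M + 1) * Real.sqrt (2 * Real.pi) := by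
  obtain ⟨y, hy, e⟩ := h.periodic_profile.exists_mem_Ico (by positivity) θ (-(Real.pi / 2))
  have h0 : profile H U (-(Real.pi / 2)) = 0 := h.profile_zero (by simp)
  have h1 := h.abs_profile_sub_le hH hy.1 hy.2.le
  rw [h0, sub_zero, ← e] at h1
  have := h.energy_nonneg
  refine h1.trans ?_
  gcongr
  linarith [hy.2]

/-- The distance to the profile is controlled by the deviation from homogeneity. -/
theorem integral_sq_sub_profile_le (h : PolarField H M U V W) (hH : 0 ≤ H) {a t : ℝ} (ha : 0 < a)
    (ha2 : a ≤ 1 / 2) (ht : t ∈ Icc a 1) :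
    ∫ θ in (0 : ℝ)..(2 * Real.pi), (t ^ (-H) * U t θ - profile H U θ) ^ 2 ≤
      (a ^ (-H - 1)) ^ 2 *
        ∫ s in a..1, ∫ θ in (0 : ℝ)..(2 * Real.pi), (s * V s θ - H * U s θ) ^ 2 := by
  have hpi : (0 : ℝ) ≤ 2 * Real.pi := by positivity
  have ha1 : a ≤ 1 := by linarith
  have bp := h.bddProfile ha
  have bd := h.bddDefect.mono ha.le
  have bc : PolarBdd a fun s θ => s ^ (-H - 1) * (s * V s θ - H * U s θ) :=
    (PolarBdd.rpow ha _).mul bd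
  -- The radial derivative of s^{−H}U is s^{−H−1}(sV − HU), so its variation along a ray measures
  -- the failure of homogeneity. The power of a is why the estimate is confined to annuli.
  have h1 : ∀ θ, ∀ s ∈ Icc a 1, ∀ b ∈ Icc s 1, |b ^ (-H) * U b θ - s ^ (-H) * U s θ| ≤
      a ^ (-H - 1) * ∫ τ in a..1, |τ * V τ θ - H * U τ θ| := by
    intro θ s hs b hb
    rw [← h.radial θ s ⟨ha.trans_le hs.1, hs.2⟩ b hb]
    calc _ ≤ ∫ τ in s..b, |τ ^ (-H - 1) * (τ * V τ θ - H * U τ θ)| :=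
          intervalIntegral.abs_integral_le_integral_abs hb.1
      _ ≤ ∫ τ in s..b, a ^ (-H - 1) * |τ * V τ θ - H * U τ θ| := by
          refine intervalIntegral.integral_mono_on hb.1
            (bc.abs.intervalIntegrable_left θ hs.1 hb.1 hb.2)
            ((bd.abs.intervalIntegrable_left θ hs.1 hb.1 hb.2).const_mul _) fun τ hτ => ?_
          have hτ0 : a ≤ τ := hs.1.trans hτ.1
          rw [abs_mul, abs_of_pos (Real.rpow_pos_of_pos (ha.trans_le hτ0) _)]
          exact mul_le_mul_of_nonneg_right (rpow_le ha hτ0 (by linarith)) (abs_nonneg _)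
      _ ≤ _ := by
          rw [intervalIntegral.integral_const_mul]
          gcongr
          exact intervalIntegral.integral_mono_interval hs.1 hb.1 hb.2
            (Eventually.of_forall fun _ => abs_nonneg _)
            (bd.abs.intervalIntegrable_left θ le_rfl ha1 le_rfl)
  have h2 : ∀ θ, |t ^ (-H) * U t θ - profile H U θ| ≤
      a ^ (-H - 1) * ∫ τ in a..1, |τ * V τ θ - H * U τ θ| := by
    intro θ
    have i1 := bp.intervalIntegrable_left θ ha2 (by norm_num : (1 / 2 : ℝ) ≤ 1) le_rfl
    -- The factor 2 in the profile normalizes the average over [1/2, 1], so the difference is an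
    -- average of differences along the ray.
    have e : t ^ (-H) * U t θ - profile H U θ =
        2 * ∫ s in (1 / 2 : ℝ)..1, (t ^ (-H) * U t θ - s ^ (-H) * U s θ) := by
      rw [intervalIntegral.integral_sub intervalIntegrable_const i1,
        intervalIntegral.integral_const, profile, smul_eq_mul]
      ring
    rw [e, abs_mul, abs_two]
    have := intervalIntegral.norm_integral_le_of_norm_le_const (a := 1 / 2) (b := 1)
      (f := fun s => t ^ (-H) * U t θ - s ^ (-H) * U s θ)
      (C := a ^ (-H - 1) * ∫ τ in a..1, |τ * V τ θ - H * U τ θ|) fun s hs => by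
        rw [uIoc_of_le (by norm_num)] at hs
        have hs' : s ∈ Icc a 1 := ⟨ha2.trans hs.1.le, hs.2⟩
        rw [Real.norm_eq_abs]
        rcases le_total s t with hst | hst
        · exact h1 θ s hs' t ⟨hst, ht.2⟩
        · rw [abs_sub_comm]; exact h1 θ t ht s ⟨hst, hs.2⟩
    rw [Real.norm_eq_abs] at this
    norm_num at this ⊢
    linarith
  have hc := h.continuous_profile hH
  have i3 : IntervalIntegrable (fun θ => (t ^ (-H) * U t θ - profile H U θ) ^ 2) volume 0
      (2 * Real.pi) := by
    have hb : PolarBdd a fun s θ => s ^ (-H) * U s θ - profile H U θ :=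
      bp.sub ⟨hc.measurable.comp measurable_snd, _, fun _ _ θ => h.abs_profile_le hH θ⟩
    exact hb.sq.intervalIntegrable_right ht _ _
  rw [bd.sq.integral_swap le_rfl ha1 le_rfl hpi, ← intervalIntegral.integral_const_mul]
  refine intervalIntegral.integral_mono_on hpi i3
    ((bd.sq.intervalIntegrable_integral_left le_rfl ha1 le_rfl hpi).const_mul _) fun θ _ => ?_
  rw [← sq_abs]
  refine (pow_le_pow_left₀ (abs_nonneg _) (h2 θ) 2).trans ?_
  rw [mul_pow]
  gcongr
  exact sq_integral_abs_le ha1 (by linarith) (bd.abs.intervalIntegrable_left θ le_rfl ha1 le_rfl)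
    (bd.sq.intervalIntegrable_left θ le_rfl ha1 le_rfl)

end PolarField

/-- Polar fields that are asymptotically homogeneous have a homogeneous limit. -/
theorem exists_profile_limit {H M : ℝ} (hH : 0 ≤ H) {U V W : ℕ → ℝ → ℝ → ℝ}
    (h : ∀ m, PolarField H M (U m) (V m) (W m))
    (hE : ∀ a ∈ Ioc (0 : ℝ) (1 / 2), Tendsto (fun m => ∫ s in a..1,
      ∫ θ in (0 : ℝ)..(2 * Real.pi), (s * V m s θ - H * U m s θ) ^ 2) atTop (𝓝 0)) :
    ∃ (𝒰 : Filter ℕ) (k : ℝ → ℝ), 𝒰.NeBot ∧ 𝒰 ≤ atTop ∧ Continuous k ∧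
      Function.Periodic k (2 * Real.pi) ∧ (∀ θ, 0 ≤ k θ) ∧ (∀ θ, Real.sin θ ≤ 0 → k θ = 0) ∧
      ∀ a ∈ Ioc (0 : ℝ) (1 / 2), ∀ ε > 0, ∀ᶠ m in 𝒰, ∀ t ∈ Icc a 1,
        ∫ θ in (0 : ℝ)..(2 * Real.pi), (t ^ (-H) * U m t θ - k θ) ^ 2 ≤ ε := by
  have hpi : (0 : ℝ) ≤ 2 * Real.pi := by positivity
  -- Along an ultrafilter the bounded profiles converge at all angles simultaneously, without
  -- extracting a diagonal subsequence.
  set 𝒰 : Ultrafilter ℕ := hyperfilter ℕ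
  have h𝒰 : (𝒰 : Filter ℕ) ≤ atTop := Nat.hyperfilter_le_atTop
  set K := (1 / 2 : ℝ) ^ (-H) * (M + 1) with hK
  have hex : ∀ θ, ∃ x, Tendsto (fun m => profile H (U m) θ) 𝒰 (𝓝 x) := fun θ => by
    obtain ⟨x, -, hx⟩ := (isCompact_Icc (a := -(K * Real.sqrt (2 * Real.pi)))
      (b := K * Real.sqrt (2 * Real.pi))).ultrafilter_le_nhds'
      (𝒰.map fun m => profile H (U m) θ) (by
        rw [Ultrafilter.mem_map]
        exact univ_mem' fun m => abs_le.1 ((h m).abs_profile_le hH θ))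
    exact ⟨x, hx⟩
  choose k hk using hex
  have hmod : ∀ α β, α ≤ β → β ≤ α + 2 * Real.pi → |k β - k α| ≤ K * Real.sqrt (β - α) :=
    fun α β h1 h2 => le_of_tendsto' ((hk β).sub (hk α)).abs
      fun m => (h m).abs_profile_sub_le hH h1 h2
  have hkc := continuous_of_sqrt_modulus hmod
  -- The common Hölder modulus gives equicontinuity, and on the compact interval pointwise
  -- convergence becomes uniform.
  have hunif : ∀ δ > 0, ∀ᶠ m in (𝒰 : Filter ℕ), ∀ θ ∈ Icc 0 (2 * Real.pi),
      |profile H (U m) θ - k θ| ≤ δ := by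
    have heq : Equicontinuous fun (m : ℕ) (θ : Icc 0 (2 * Real.pi)) => profile H (U m) θ := by
      refine Metric.equicontinuous_of_continuity_modulus (fun s => K * Real.sqrt |s|) ?_ _
        fun x y m => ?_
      · have : Continuous fun s : ℝ => K * Real.sqrt |s| := by fun_prop
        simpa using this.tendsto 0
      · have h1 : |(x : ℝ) - y| ≤ 2 * Real.pi := by
          have := x.2; have := y.2
          simp only [mem_Icc] at *
          rw [abs_le]; constructor <;> linarith
        refine (dist_le_of_sqrt_modulus (fun _ _ => (h m).abs_profile_sub_le hH) h1).trans_eq ?_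
        rw [abs_of_nonneg dist_nonneg]; rfl
    have h1 := (heq.tendsto_uniformFun_iff_pi 𝒰 fun θ : Icc 0 (2 * Real.pi) => k θ).2
      (tendsto_pi_nhds.2 fun θ => hk θ)
    rw [UniformFun.tendsto_iff_tendstoUniformly, Metric.tendstoUniformly_iff] at h1
    intro δ hδ
    filter_upwards [h1 δ hδ] with m hm θ hθ
    rw [abs_sub_comm]
    exact (hm ⟨θ, hθ⟩).le
  refine ⟨𝒰, k, inferInstance, h𝒰, hkc, fun θ => tendsto_nhds_unique (hk _) ?_,
    fun θ => ge_of_tendsto' (hk θ) fun m => (h m).profile_nonneg θ,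
    fun θ hθ => tendsto_nhds_unique (hk θ) ?_, fun a ha ε hε => ?_⟩
  · simp only [fun m => (h m).periodic_profile θ]; exact hk θ
  · simp only [fun m => (h m).profile_zero hθ]; exact tendsto_const_nhds
  -- With (a + b)² ≤ 2a² + 2b² and circumference 2π, this share and the share ε/4 each contribute
  -- ε/2.
  have hε' : 0 < ε / (8 * Real.pi) := by positivity
  have h1 := ((hE a ha).const_mul ((a ^ (-H - 1)) ^ 2)).mono_left h𝒰
  rw [mul_zero] at h1
  filter_upwards [hunif _ (Real.sqrt_pos.2 hε'), h1.eventually_le_const (show 0 < ε / 4 by positivity)]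
    with m hm1 hm2 t ht
  have hc := (h m).continuous_profile hH
  have hb : PolarBdd a fun s θ => s ^ (-H) * U m s θ - profile H (U m) θ :=
    ((h m).bddProfile ha.1).sub
      ⟨hc.measurable.comp measurable_snd, _, fun _ _ θ => (h m).abs_profile_le hH θ⟩
  have i1 := hb.sq.intervalIntegrable_right ht 0 (2 * Real.pi)
  have hb' : IntervalIntegrable (fun θ => (t ^ (-H) * U m t θ - k θ) ^ 2) volume 0 (2 * Real.pi) := by
    obtain ⟨B, hB⟩ := isCompact_Icc.exists_bound_of_continuousOn (s := Icc 0 (2 * Real.pi))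
      (f := fun θ => profile H (U m) θ - k θ) (hc.sub hkc).continuousOn
    refine (((i1.const_mul 2).add ((hc.sub hkc).pow 2 |>.intervalIntegrable 0 (2 * Real.pi)
      |>.const_mul 2))).mono_fun' ?_ (Eventually.of_forall fun θ => ?_)
    · have := ((h m).bddU.1.comp (measurable_const.prodMk measurable_id) : Measurable (U m t))
      exact (((this.const_mul _).sub hkc.measurable).pow_const 2).aestronglyMeasurable
    · simp only [Pi.sub_apply, Pi.pow_apply]
      rw [Real.norm_of_nonneg (sq_nonneg _)]
      nlinarith [sq_nonneg (t ^ (-H) * U m t θ - profile H (U m) θ - (profile H (U m) θ - k θ))]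
  calc ∫ θ in (0 : ℝ)..(2 * Real.pi), (t ^ (-H) * U m t θ - k θ) ^ 2
      ≤ ∫ θ in (0 : ℝ)..(2 * Real.pi),
          (2 * (t ^ (-H) * U m t θ - profile H (U m) θ) ^ 2 + 2 * (ε / (8 * Real.pi))) := by
        refine intervalIntegral.integral_mono_on hpi hb'
          ((i1.const_mul 2).add intervalIntegrable_const) fun θ hθ => ?_
        have h2 : (profile H (U m) θ - k θ) ^ 2 ≤ ε / (8 * Real.pi) := by
          rw [← sq_abs, ← Real.sq_sqrt hε'.le]
          exact pow_le_pow_left₀ (abs_nonneg _) (hm1 θ hθ) 2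
        nlinarith [sq_nonneg (t ^ (-H) * U m t θ - profile H (U m) θ - (profile H (U m) θ - k θ))]
    _ = 2 * (∫ θ in (0 : ℝ)..(2 * Real.pi), (t ^ (-H) * U m t θ - profile H (U m) θ) ^ 2) + ε / 2 := by
        rw [intervalIntegral.integral_add (i1.const_mul 2) intervalIntegrable_const,
          intervalIntegral.integral_const_mul, intervalIntegral.integral_const, smul_eq_mul]
        have := Real.pi_pos
        field_simp
        ring
    _ ≤ 2 * (ε / 4) + ε / 2 := by
        gcongr
        exact ((h m).integral_sq_sub_profile_le hH ha.1 ha.2 ht).trans hm2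
    _ = ε := by ring

/-- Strong convergence in `L²` preserves the limits of norms. -/
theorem integral_sq_eq_of_tendsto {ι : Type*} {𝒰 : Filter ι} [𝒰.NeBot] {u : ι → ℝ → ℝ}
    {k : ℝ → ℝ} {a b x : ℝ} (hab : a ≤ b)
    (hu : ∀ m, IntervalIntegrable (fun θ => u m θ ^ 2) volume a b)
    (hk : IntervalIntegrable (fun θ => k θ ^ 2) volume a b)
    (hd : ∀ m, IntervalIntegrable (fun θ => (u m θ - k θ) ^ 2) volume a b)
    (h1 : Tendsto (fun m => ∫ θ in a..b, (u m θ - k θ) ^ 2) 𝒰 (𝓝 0))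
    (h2 : Tendsto (fun m => ∫ θ in a..b, u m θ ^ 2) 𝒰 (𝓝 x)) : ∫ θ in a..b, k θ ^ 2 = x := by
  -- This form of the triangle inequality lets the distance tend to 0 first, with η fixed, and η
  -- tend to 0 afterwards.
  have key : ∀ p q η : ℝ, 0 < η → p ^ 2 ≤ (1 + η) * q ^ 2 + (1 + 1 / η) * (p - q) ^ 2 := by
    intro p q η hη
    have e : (1 + η) * q ^ 2 + (1 + 1 / η) * (p - q) ^ 2 - p ^ 2 = (η * q - (p - q)) ^ 2 / η := by
      field_simp; ring
    have : 0 ≤ (η * q - (p - q)) ^ 2 / η := by positivity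
    linarith
  have lim : ∀ η > 0, (∫ θ in a..b, k θ ^ 2) ≤ (1 + η) * x ∧ x ≤ (1 + η) * ∫ θ in a..b, k θ ^ 2 := by
    intro η hη
    have h3 := (h2.const_mul (1 + η)).add (h1.const_mul (1 + 1 / η))
    have h4 := (tendsto_const_nhds (x := (1 + η) * ∫ θ in a..b, k θ ^ 2) (f := 𝒰)).add
      (h1.const_mul (1 + 1 / η))
    rw [mul_zero, add_zero] at h3 h4
    constructor
    · refine ge_of_tendsto' h3 fun m => ?_
      rw [← intervalIntegral.integral_const_mul, ← intervalIntegral.integral_const_mul,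
        ← intervalIntegral.integral_add ((hu m).const_mul _) ((hd m).const_mul _)]
      refine intervalIntegral.integral_mono_on hab hk (((hu m).const_mul _).add
        ((hd m).const_mul _)) fun θ _ => ?_
      have := key (k θ) (u m θ) η hη
      rwa [← neg_sub, neg_sq] at this
    · refine le_of_tendsto_of_tendsto' h2 h4 fun m => ?_
      rw [← intervalIntegral.integral_const_mul, ← intervalIntegral.integral_const_mul,
        ← intervalIntegral.integral_add (hk.const_mul _) ((hd m).const_mul _)]
      exact intervalIntegral.integral_mono_on hab (hu m) ((hk.const_mul _).add
        ((hd m).const_mul _)) fun θ _ => key _ _ η hη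
  have hlim : ∀ y : ℝ, Tendsto (fun η : ℝ => (1 + η) * y) (𝓝[>] 0) (𝓝 y) := fun y => by
    have : Continuous fun η : ℝ => (1 + η) * y := by fun_prop
    have h3 := this.tendsto 0
    rw [add_zero, one_mul] at h3
    exact h3.mono_left nhdsWithin_le_nhds
  refine le_antisymm (ge_of_tendsto (hlim x) ?_) (ge_of_tendsto (hlim _) ?_)
  · filter_upwards [self_mem_nhdsWithin] with η hη using (lim η hη).1
  · filter_upwards [self_mem_nhdsWithin] with η hη using (lim η hη).2

/-- Weak and strong limits in `L²` agree. -/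
theorem ae_eq_of_weak_of_strong {α ι : Type*} [MeasurableSpace α] {μ : Measure α} {𝒰 : Filter ι}
    [𝒰.NeBot] {u : ι → α → ℝ} {u₀ φ : α → ℝ} (hu : ∀ m, MemLp (u m) 2 μ) (hu₀ : MemLp u₀ 2 μ)
    (hφ : MemLp φ 2 μ)
    (hw : ∀ h : α → ℝ, MemLp h 2 μ → Tendsto (fun m => ∫ x, u m x * h x ∂μ) 𝒰
      (𝓝 (∫ x, u₀ x * h x ∂μ)))
    (hs : Tendsto (fun m => ∫ x, (u m x - φ x) ^ 2 ∂μ) 𝒰 (𝓝 0)) : u₀ =ᵐ[μ] φ := by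
  -- Testing the weak convergence with the difference of the two limits shows that its L² norm is 0.
  set h : α → ℝ := fun x => u₀ x - φ x with hh
  have hL : MemLp h 2 μ := hu₀.sub hφ
  have i1 : ∀ m, Integrable (fun x => (u m x - φ x) ^ 2) μ := fun m => ((hu m).sub hφ).integrable_sq
  have i2 : Integrable (fun x => h x ^ 2) μ := hL.integrable_sq
  have i3 : ∀ m, Integrable (fun x => u m x * h x) μ := fun m => (hu m).integrable_mul hL
  have i4 : Integrable (fun x => φ x * h x) μ := hφ.integrable_mul hL
  have i5 : Integrable (fun x => u₀ x * h x) μ := hu₀.integrable_mul hL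
  have hlim : Tendsto (fun m => ∫ x, u m x * h x ∂μ) 𝒰 (𝓝 (∫ x, φ x * h x ∂μ)) := by
    rw [tendsto_iff_dist_tendsto_zero]
    have hb : ∀ m, ∀ η > 0, dist (∫ x, u m x * h x ∂μ) (∫ x, φ x * h x ∂μ) ≤
        (1 / η) * (∫ x, (u m x - φ x) ^ 2 ∂μ) + η * ∫ x, h x ^ 2 ∂μ := by
      intro m η hη
      rw [Real.dist_eq, ← integral_sub (i3 m) i4, ← integral_const_mul, ← integral_const_mul,
        ← integral_add ((i1 m).const_mul _) (i2.const_mul _)]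
      refine (norm_integral_le_integral_norm _).trans (integral_mono ((i3 m).sub i4).norm
        (((i1 m).const_mul _).add (i2.const_mul _)) fun x => ?_)
      change |u m x * h x - φ x * h x| ≤ 1 / η * (u m x - φ x) ^ 2 + η * h x ^ 2
      rw [← sub_mul, abs_mul]
      have e : 1 / η * (u m x - φ x) ^ 2 + η * h x ^ 2 - |u m x - φ x| * |h x| =
          ((|u m x - φ x| - η * |h x| / 2) ^ 2 + 3 / 4 * (η * |h x|) ^ 2) / η := by
        rw [← sq_abs (u m x - φ x), ← sq_abs (h x)]; field_simp; ring
      have : 0 ≤ ((|u m x - φ x| - η * |h x| / 2) ^ 2 + 3 / 4 * (η * |h x|) ^ 2) / η := by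
        positivity
      linarith
    set A := ∫ x, h x ^ 2 ∂μ
    have hA : 0 ≤ A := integral_nonneg fun x => sq_nonneg _
    refine tendsto_order.2 ⟨fun y hy => Eventually.of_forall fun m => hy.trans_le dist_nonneg,
      fun ε hε => ?_⟩
    set η := ε / (2 * (A + 1)) with hη
    have hη0 : 0 < η := by positivity
    have h3 := (hs.const_mul (1 / η)).eventually_lt_const (show 1 / η * 0 < ε / 2 by
      rw [mul_zero]; positivity)
    filter_upwards [h3] with m hm
    have h4 : η * A ≤ ε / 2 := by
      rw [hη, div_mul_eq_mul_div, div_le_div_iff₀ (by positivity) two_pos]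
      nlinarith
    linarith [hb m η hη0]
  have h5 : ∫ x, h x ^ 2 ∂μ = 0 := by
    have h6 := tendsto_nhds_unique (hw h hL) hlim
    rw [← sub_eq_zero, ← integral_sub i5 i4] at h6
    rw [← h6]
    congr 1; ext x; simp only [hh]; ring
  filter_upwards [(integral_eq_zero_iff_of_nonneg (fun x => sq_nonneg (h x)) i2).1 h5] with x hx
  have := pow_eq_zero_iff two_ne_zero |>.1 hx
  simp only [hh] at this
  linarith

/-! ### Homogeneous functions -/

/-- The function that is homogeneous of degree `H` and equals `k` on the unit circle. -/
noncomputable def homogExt (H : ℝ) {k : ℝ → ℝ} (hk : Function.Periodic k (2 * Real.pi))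
    (X : Plane) : ℝ :=
  ‖X‖ ^ H * hk.lift ((Complex.arg ⟨X 0, X 1⟩ : ℝ) : Real.Angle)

section homogExt

variable {H : ℝ} {k : ℝ → ℝ} (hk : Function.Periodic k (2 * Real.pi))

theorem homogExt_polar {t : ℝ} (ht : 0 < t) (θ : ℝ) : homogExt H hk (t • dir θ) = t ^ H * k θ := by
  have h1 : (⟨(t • dir θ) 0, (t • dir θ) 1⟩ : ℂ) =
      t * (Real.Angle.cos θ + Real.Angle.sin θ * Complex.I) := by
    apply Complex.ext
    · simp [-Complex.ofReal_cos]
    · simp [-Complex.ofReal_sin]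
  rw [homogExt, h1, Complex.arg_mul_cos_add_sin_mul_I_coe_angle ht, norm_smul, norm_dir, mul_one,
    Real.norm_of_nonneg ht.le]
  rfl

theorem homogExt_zero (hH : H ≠ 0) : homogExt H hk 0 = 0 := by
  rw [homogExt, norm_zero, Real.zero_rpow hH, zero_mul]

theorem exists_eq_norm_smul_dir (X : Plane) : ∃ θ, X = ‖X‖ • dir θ := by
  obtain ⟨θ, hθ⟩ := LocalSolution.exists_polar (X₀ := 0) (X := X)
  rw [zero_add, sub_zero] at hθ
  exact ⟨θ, hθ⟩

theorem homogExt_smul (hH : H ≠ 0) {t : ℝ} (ht : 0 < t) (X : Plane) :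
    homogExt H hk (t • X) = t ^ H * homogExt H hk X := by
  rcases eq_or_ne X 0 with rfl | hX
  · rw [smul_zero, homogExt_zero hk hH, mul_zero]
  · obtain ⟨θ, hθ⟩ := exists_eq_norm_smul_dir X
    have hn := norm_pos_iff.2 hX
    rw [hθ, smul_smul, homogExt_polar hk (by positivity), homogExt_polar hk hn,
      Real.mul_rpow ht.le hn.le, mul_assoc]

theorem homogExt_nonneg (h0 : ∀ θ, 0 ≤ k θ) (hH : H ≠ 0) (X : Plane) : 0 ≤ homogExt H hk X := by
  rcases eq_or_ne X 0 with rfl | hX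
  · rw [homogExt_zero hk hH]
  · obtain ⟨θ, hθ⟩ := exists_eq_norm_smul_dir X
    rw [hθ, homogExt_polar hk (norm_pos_iff.2 hX)]
    exact mul_nonneg (Real.rpow_nonneg (norm_nonneg _) _) (h0 θ)

theorem homogExt_eq_zero (h0 : ∀ θ, Real.sin θ ≤ 0 → k θ = 0) (hH : H ≠ 0) {X : Plane}
    (hX1 : X 1 ≤ 0) : homogExt H hk X = 0 := by
  rcases eq_or_ne X 0 with rfl | hX
  · exact homogExt_zero hk hH
  · obtain ⟨θ, hθ⟩ := exists_eq_norm_smul_dir X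
    have hn := norm_pos_iff.2 hX
    rw [hθ, PiLp.smul_apply, dir_one, smul_eq_mul] at hX1
    rw [hθ, homogExt_polar hk hn, h0 θ (nonpos_of_mul_nonpos_right hX1 hn), mul_zero]

/-- The argument jumps on the negative axis but is continuous as an angle modulo 2π, where a
periodic k descends. At the origin the bounded angular factor is multiplied by |X|^H with H > 0. -/
theorem continuous_homogExt (hc : Continuous k) (hH : 0 < H) : Continuous (homogExt H hk) := by
  have hl : Continuous (hk.lift : Real.Angle → ℝ) := hc.quotient_liftOn' _
  refine continuous_iff_continuousAt.2 fun X => ?_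
  rcases eq_or_ne X 0 with rfl | hX
  · have : Fact (0 < 2 * Real.pi) := ⟨Real.two_pi_pos⟩
    obtain ⟨B, hB⟩ := (isCompact_univ (X := AddCircle (2 * Real.pi))).exists_bound_of_continuousOn
      hl.continuousOn
    rw [ContinuousAt, homogExt_zero hk hH.ne']
    have h1 : Tendsto (fun X : Plane => ‖X‖ ^ H * B) (𝓝 0) (𝓝 0) := by
      have : Continuous fun X : Plane => ‖X‖ ^ H * B :=
        (continuous_norm.rpow_const fun _ => Or.inr hH.le).mul continuous_const
      simpa [Real.zero_rpow hH.ne'] using this.tendsto 0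
    refine squeeze_zero_norm (fun X => ?_) h1
    rw [homogExt, norm_mul, Real.norm_of_nonneg (Real.rpow_nonneg (norm_nonneg _) _)]
    exact mul_le_mul_of_nonneg_left (hB _ (mem_univ _)) (Real.rpow_nonneg (norm_nonneg _) _)
  · have hz : (⟨X 0, X 1⟩ : ℂ) ≠ 0 := fun h => hX (by
      ext i; fin_cases i
      · exact congrArg Complex.re h
      · exact congrArg Complex.im h)
    have h1 : ContinuousAt (fun X : Plane => (⟨X 0, X 1⟩ : ℂ)) X := by
      have : (fun X : Plane => (⟨X 0, X 1⟩ : ℂ)) = fun X => (X 0 : ℂ) + X 1 * Complex.I := by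
        ext Y; exact Complex.mk_eq_add_mul_I _ _
      rw [this]; fun_prop
    have h2 := ContinuousAt.comp (f := fun X : Plane => (⟨X 0, X 1⟩ : ℂ)) (x := X)
      (Complex.continuousAt_arg_coe_angle hz) h1
    exact (continuous_norm.continuousAt.rpow_const (Or.inr hH.le)).mul (ContinuousAt.comp (x := X)
      hl.continuousAt h2)

end homogExt

/-! ### Blow-ups in polar coordinates -/

/-- The normalized blow-up in polar coordinates. -/
noncomputable def polarValue (ψ : Plane → ℝ) (X₀ : Plane) (r t θ : ℝ) : ℝ :=
  ψ (X₀ + (r * t) • dir θ) / Real.sqrt (r⁻¹ * bdryMass ψ X₀ r)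

/-- The radial derivative of the normalized blow-up. -/
noncomputable def polarRadial (ψ : Plane → ℝ) (g : Plane → Plane) (X₀ : Plane) (r t θ : ℝ) : ℝ :=
  r * inner ℝ (dir θ) (g (X₀ + (r * t) • dir θ)) / Real.sqrt (r⁻¹ * bdryMass ψ X₀ r)

/-- The angular derivative of the normalized blow-up. -/
noncomputable def polarAngular (ψ : Plane → ℝ) (g : Plane → Plane) (X₀ : Plane) (r t θ : ℝ) : ℝ :=
  r * t * inner ℝ (dir (θ + Real.pi / 2)) (g (X₀ + (r * t) • dir θ)) /
    Real.sqrt (r⁻¹ * bdryMass ψ X₀ r)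

theorem hasDerivAt_dir (θ : ℝ) : HasDerivAt dir (dir (θ + Real.pi / 2)) θ := by
  have h1 : HasDerivAt (fun θ => ![Real.cos θ, Real.sin θ]) ![-Real.sin θ, Real.cos θ] θ :=
    hasDerivAt_pi.2 fun i => by
      fin_cases i
      · exact Real.hasDerivAt_cos θ
      · exact Real.hasDerivAt_sin θ
  refine ((PiLp.hasFDerivAt_toLp (𝕜 := ℝ) 2 ![Real.cos θ, Real.sin θ]).comp_hasDerivAt θ h1).congr_deriv ?_
  ext i
  fin_cases i
  · simp [Real.cos_add_pi_div_two]
  · simp [Real.sin_add_pi_div_two]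

theorem blowUp_polar (ψ : Plane → ℝ) (X₀ : Plane) (r t θ : ℝ) :
    blowUp ψ X₀ r (t • dir θ) = polarValue ψ X₀ r t θ := by
  rw [blowUp, polarValue, smul_smul]

namespace LocalSolution

variable {X₀ : Plane} {R C R' C' : ℝ} {f : ℝ → ℝ} {ψ : Plane → ℝ} {g : Plane → Plane}
  {j p v κ : ℝ → ℝ}

theorem _root_.StagnationFlow.PolarBdd.div_const {a : ℝ} {K : ℝ → ℝ → ℝ} (h : PolarBdd a K) (c : ℝ) :
    PolarBdd a fun t θ => K t θ / c := by
  simpa only [div_eq_inv_mul] using h.const_mul c⁻¹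

theorem mul_mem {r t : ℝ} (hr : r ∈ Ioo 0 R) (ht : t ∈ Icc (0 : ℝ) 1) : r * t ∈ Ico 0 R :=
  ⟨mul_nonneg hr.1.le ht.1, (mul_le_of_le_one_right hr.1.le ht.2).trans_lt hr.2⟩

theorem polar_mem {r t : ℝ} (hr : r ∈ Ioo 0 R) (ht : t ∈ Icc (0 : ℝ) 1) (θ : ℝ) :
    X₀ + (r * t) • dir θ ∈ Metric.ball X₀ R :=
  (mem_ball_polar (mul_mem hr ht).1).2 (mul_mem hr ht).2

theorem polarBdd_of_ball {k : Plane → ℝ} (hk : MeasBdd X₀ R k) {r : ℝ} (hr : r ∈ Ioo 0 R) :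
    PolarBdd 0 fun t θ => k (X₀ + (r * t) • dir θ) := by
  obtain ⟨m, B, hB⟩ := hk
  refine ⟨m.comp ?_, B, fun t ht θ => hB _ (polar_mem hr ht θ)⟩
  have := continuous_dir
  exact Continuous.measurable (by fun_prop)

theorem polarBdd_inner (h : LocalSolution X₀ R C f ψ g) {r : ℝ} (hr : r ∈ Ioo 0 R) (c : ℝ) :
    PolarBdd 0 fun t θ => inner ℝ (dir (θ + c)) (g (X₀ + (r * t) • dir θ)) := by
  obtain ⟨-, B, hB⟩ := h.measBdd_grad_sq
  have hd := continuous_dir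
  refine ⟨Measurable.inner (Continuous.measurable (by fun_prop))
    (h.grad_meas.comp (Continuous.measurable (by fun_prop))), Real.sqrt B, fun t ht θ => ?_⟩
  refine (abs_real_inner_le_norm _ _).trans ?_
  rw [norm_dir, one_mul]
  exact Real.le_sqrt_of_sq_le ((le_abs_self _).trans (hB _ (polar_mem hr ht θ)))

theorem polarBdd_angular (h : LocalSolution X₀ R C f ψ g) {r : ℝ} (hr : r ∈ Ioo 0 R) :
    PolarBdd 0 (polarAngular ψ g X₀ r) :=
  (((PolarBdd.of_continuousOn (a := 0) (k := fun t => r * t) (by fun_prop)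
    (by fun_prop)).mul (h.polarBdd_inner hr (Real.pi / 2)))).div_const _

/-- The blow-ups are polar fields. -/
theorem polarField (h : LocalSolution X₀ R C f ψ g) (hm : Measurable ψ) {r : ℝ}
    (hr : r ∈ Ioo 0 R) (hS : 0 < bdryMass ψ X₀ r) (H : ℝ) {M : ℝ}
    (hM : ∫ s in (1 / 2 : ℝ)..1, ∫ θ in (0 : ℝ)..(2 * Real.pi), polarAngular ψ g X₀ r s θ ^ 2 ≤ M) :
    PolarField H M (polarValue ψ X₀ r) (polarRadial ψ g X₀ r) (polarAngular ψ g X₀ r) := by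
  have hr0 := hr.1
  have hσ : 0 < Real.sqrt (r⁻¹ * bdryMass ψ X₀ r) := Real.sqrt_pos.2 (by positivity)
  have bU : PolarBdd 0 (polarValue ψ X₀ r) := (polarBdd_of_ball (h.measBdd_psi hm) hr).div_const _
  have bV : PolarBdd 0 (polarRadial ψ g X₀ r) := by
    have := ((h.polarBdd_inner hr 0).const_mul r).div_const (Real.sqrt (r⁻¹ * bdryMass ψ X₀ r))
    simp only [add_zero] at this
    exact this
  have bW := h.polarBdd_angular (ψ := ψ) hr
  have hpos : ∀ t θ, 0 < polarValue ψ X₀ r t θ → 0 < ψ (X₀ + (r * t) • dir θ) := fun t θ hp =>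
    (div_pos_iff_of_pos_right hσ).1 hp
  have hzero : ∀ t ∈ Icc (0 : ℝ) 1, ∀ θ, polarValue ψ X₀ r t θ = 0 →
      g (X₀ + (r * t) • dir θ) = 0 := fun t ht θ hp =>
    h.grad_zero _ (polar_mem hr ht θ) ((div_eq_zero_iff.1 hp).resolve_right hσ.ne')
  have hnn : ∀ t ∈ Icc (0 : ℝ) 1, ∀ θ, 0 ≤ polarValue ψ X₀ r t θ := fun t ht θ =>
    div_nonneg (h.nonneg _ (polar_mem hr ht θ)) hσ.le
  refine ⟨bU, bV, bW, fun t θ => by simp only [polarValue, dir_periodic θ], fun t θ => ?_, hnn,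
    fun t ht θ hθ => ?_, fun θ a ha b hb => ?_, fun t ht α β hαβ => ?_, hM⟩
  · rw [polarAngular, polarAngular, dir_periodic θ, add_right_comm, dir_periodic]
  · rw [polarValue, h.zero_below _ (polar_mem hr ht θ), zero_div]
    rw [PiLp.add_apply, h.center, zero_add, PiLp.smul_apply, dir_one, smul_eq_mul]
    exact mul_nonpos_of_nonneg_of_nonpos (mul_mem hr ht).1 hθ
  · have hI : ∀ s ∈ Icc a b, s ∈ Icc (0 : ℝ) 1 ∧ 0 < s := fun s hs =>
      ⟨⟨ha.1.le.trans hs.1, hs.2.trans hb.2⟩, ha.1.trans_le hs.1⟩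
    have hray : ContinuousOn (fun s => polarValue ψ X₀ r s θ) (Icc a b) := by
      refine ContinuousOn.div_const ?_ _
      exact (h.continuousOn_ray θ).comp (f := fun s => r * s) (by fun_prop)
        fun s hs => mul_mem hr (hI s hs).1
    -- Nonnegativity of the rescaled value allows the ray to cross the free boundary; the derivative
    -- vanishes at zeros because both the value and the gradient do.
    refine integral_eq_sub_of_hasDerivAt_of_pos (u := fun s => s ^ (-H) * polarValue ψ X₀ r s θ)
      hb.1 (ContinuousOn.mul (fun s hs => (Real.continuousAt_rpow_const s _
        (Or.inl (hI s hs).2.ne')).continuousWithinAt) hray)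
      (fun s hs => mul_nonneg (Real.rpow_nonneg (hI s hs).2.le _) (hnn s (hI s hs).1 θ))
      (fun s hs hp => ?_) (fun s hs h0 => ?_) ?_
    · have hs' := hI s (Ioo_subset_Icc_self hs)
      have h1 := h.hasDerivAt_ray θ (mul_mem hr hs'.1)
        (hpos s θ (pos_of_mul_pos_right hp (Real.rpow_nonneg hs'.2.le _)))
      have h2 := (HasDerivAt.comp (h₂ := fun τ => ψ (X₀ + τ • dir θ)) (h := fun s => r * s) s h1
        ((hasDerivAt_id s).const_mul r)).div_const (Real.sqrt (r⁻¹ * bdryMass ψ X₀ r))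
      have h3 := (Real.hasDerivAt_rpow_const (p := -H) (Or.inl hs'.2.ne')).mul h2
      refine h3.congr_deriv ?_
      have e : s ^ (-H) = s ^ (-H - 1) * s := by
        rw [← Real.rpow_add_one hs'.2.ne', sub_add_cancel]
      simp only [Function.comp_apply, polarRadial, polarValue]
      rw [e]; ring
    · have hs' := hI s hs
      have hU : polarValue ψ X₀ r s θ = 0 :=
        (mul_eq_zero.1 h0).resolve_left (Real.rpow_pos_of_pos hs'.2 _).ne'
      rw [hU, polarRadial, hzero s hs'.1 θ hU, inner_zero_right]
      simp
    · exact (((PolarBdd.rpow ha.1 _).mul (((PolarBdd.of_continuousOn measurable_id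
        continuousOn_id).mul bV).sub (bU.const_mul H) |>.mono ha.1.le))).intervalIntegrable_left θ
        le_rfl hb.1 hb.2
  · have hd := continuous_dir
    refine integral_eq_sub_of_hasDerivAt_of_pos hαβ ?_ (fun θ _ => hnn t ht θ)
      (fun θ _ hp => ?_) (fun θ _ h0 => ?_) (bW.intervalIntegrable_right ht α β)
    · exact (h.contOn.comp (by fun_prop) fun θ _ => polar_mem hr ht θ).div_const _
    · have h1 := h.hasFDerivAt _ (polar_mem hr ht θ) (hpos t θ hp)
      have h2 := ((hasDerivAt_dir θ).const_smul (r * t)).const_add X₀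
      have h3 := (h1.comp_hasDerivAt θ h2).div_const (Real.sqrt (r⁻¹ * bdryMass ψ X₀ r))
      refine h3.congr_deriv ?_
      rw [innerSL_apply_apply, inner_smul_right, real_inner_comm, polarAngular]
    · rw [polarAngular, hzero t ht θ h0, inner_zero_right, mul_zero, zero_div]

/-- Passing to the circle integral inserts arc length τ and weight 1/x, and x ≤ 2x₀ in the ball. -/
theorem integral_sq_le_circleInt (h : LocalSolution X₀ R C f ψ g) {k : Plane → ℝ}
    (hk : MeasBdd X₀ R k) (hk0 : ∀ X, 0 ≤ k X) {τ : ℝ} (hτ : τ ∈ Ioo 0 R) :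
    ∫ θ in (0 : ℝ)..(2 * Real.pi), k (X₀ + τ • dir θ) ≤
      2 * X₀ 0 / τ * circleInt X₀ τ fun X => k X / X 0 := by
  have hτ0 := hτ.1
  have i1 := (hk.intervalIntegrable_circle hτ0.le hτ.2).mul_const τ⁻¹
  simp only [mul_inv_cancel_right₀ hτ0.ne'] at i1
  rw [circleInt_eq, ← intervalIntegral.integral_const_mul]
  refine intervalIntegral.integral_mono_on (by positivity) i1
    (((h.measBdd_div hk).intervalIntegrable_circle hτ0.le hτ.2).const_mul _) fun θ _ => ?_
  have hX := (mem_ball_polar (X₀ := X₀) (θ := θ) hτ0.le).2 hτ.2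
  have h1 := h.fst_pos hX
  have h2 := (h.fst_mem hX).2
  set Y := X₀ + τ • dir θ
  have e : 2 * X₀ 0 / τ * (k Y / Y 0 * τ) = k Y * (2 * X₀ 0 / Y 0) := by field_simp
  rw [e]
  exact le_mul_of_one_le_right (hk0 Y) ((one_le_div h1).2 h2)

theorem massRatio_eq (ψ : Plane → ℝ) (X₀ : Plane) {r : ℝ} (hr : 0 < r) :
    r⁻¹ * bdryMass ψ X₀ r = r ^ 3 * massRatio ψ X₀ r := by
  rw [massRatio]; field_simp

/-- The angular energy of the blow-ups is bounded by the normalized Dirichlet energy. -/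
theorem integral_polarAngular_le (h : LocalSolution X₀ R C f ψ g) {r : ℝ} (hr : r ∈ Ioo 0 R) {M : ℝ}
    (hJ : 0 < massRatio ψ X₀ r) (hM : gradRatio g X₀ r ≤ M * massRatio ψ X₀ r) :
    ∫ s in (1 / 2 : ℝ)..1, ∫ θ in (0 : ℝ)..(2 * Real.pi), polarAngular ψ g X₀ r s θ ^ 2 ≤
      4 * X₀ 0 * M := by
  have hr0 := hr.1
  have hx := h.center_pos
  have hpi : (0 : ℝ) ≤ 2 * Real.pi := by positivity
  have bg := h.measBdd_grad_sq
  have ba := h.measBdd_div bg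
  set J := massRatio ψ X₀ r with hJd
  have hσ : Real.sqrt (r⁻¹ * bdryMass ψ X₀ r) ^ 2 = r ^ 3 * J := by
    rw [massRatio_eq ψ X₀ hr0, Real.sq_sqrt (by positivity)]
  have bW := (h.polarBdd_angular (ψ := ψ) hr).mono (show (0 : ℝ) ≤ 1 / 2 by norm_num)
  have ic := (ba.intervalIntegrable (a := r * (1 / 2)) (b := r * 1) (by positivity)
    (by nlinarith) (by linarith [hr.2])).comp_mul_left (c := r)
  rw [mul_div_cancel_left₀ _ hr0.ne', mul_div_cancel_left₀ _ hr0.ne'] at ic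
  calc _ ≤ ∫ s in (1 / 2 : ℝ)..1, 4 * X₀ 0 / (r ^ 2 * J) *
          circleInt X₀ (r * s) fun X => ‖g X‖ ^ 2 / X 0 := by
        refine intervalIntegral.integral_mono_on (by norm_num)
          (bW.sq.intervalIntegrable_integral_right le_rfl (by norm_num) le_rfl hpi)
          (ic.const_mul _) fun s hs => ?_
        have hs0 : 0 < s := by linarith [hs.1]
        have hs1 : s ∈ Icc (0 : ℝ) 1 := ⟨hs0.le, hs.2⟩
        have hτ : r * s ∈ Ioo 0 R := ⟨by positivity, (mul_mem hr hs1).2⟩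
        have hc : 0 ≤ circleInt X₀ (r * s) fun X => ‖g X‖ ^ 2 / X 0 :=
          circleInt_nonneg hτ.1.le hτ.2 fun X hX => div_nonneg (sq_nonneg _) (h.fst_pos hX).le
        have i1 := ((bg.intervalIntegrable_circle hτ.1.le hτ.2).mul_const (r * s)⁻¹)
        simp only [mul_inv_cancel_right₀ hτ.1.ne'] at i1
        calc _ ≤ ∫ θ in (0 : ℝ)..(2 * Real.pi),
              (r * s) ^ 2 / (r ^ 3 * J) * ‖g (X₀ + (r * s) • dir θ)‖ ^ 2 := by
              refine intervalIntegral.integral_mono_on hpi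
                (bW.sq.intervalIntegrable_right hs _ _) (i1.const_mul _) fun θ _ => ?_
              rw [polarAngular, div_pow, hσ, mul_pow, mul_div_right_comm]
              have := abs_real_inner_le_norm (dir (θ + Real.pi / 2)) (g (X₀ + (r * s) • dir θ))
              rw [norm_dir, one_mul] at this
              refine mul_le_mul_of_nonneg_left ?_ (by positivity)
              rw [← sq_abs]
              exact pow_le_pow_left₀ (abs_nonneg _) this 2
          _ ≤ (r * s) ^ 2 / (r ^ 3 * J) * (2 * X₀ 0 / (r * s) *
                circleInt X₀ (r * s) fun X => ‖g X‖ ^ 2 / X 0) := by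
              rw [intervalIntegral.integral_const_mul]
              gcongr
              exact h.integral_sq_le_circleInt bg (fun X => sq_nonneg _) hτ
          _ = s * (2 * X₀ 0 / (r ^ 2 * J) * circleInt X₀ (r * s) fun X => ‖g X‖ ^ 2 / X 0) := by
              field_simp
          _ ≤ 1 * (2 * X₀ 0 / (r ^ 2 * J) * circleInt X₀ (r * s) fun X => ‖g X‖ ^ 2 / X 0) := by
              gcongr
              exact hs.2
          _ ≤ _ := by
              rw [one_mul]
              gcongr
              norm_num
    -- The substitution τ = rs returns to the original scale, where the circle integrals add up to
    -- the Dirichlet integral over the ball.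
    _ = 4 * X₀ 0 / (r ^ 3 * J) * ∫ τ in (r * (1 / 2))..(r * 1),
          circleInt X₀ τ fun X => ‖g X‖ ^ 2 / X 0 := by
        rw [intervalIntegral.integral_const_mul, intervalIntegral.integral_comp_mul_left
          (fun τ => circleInt X₀ τ fun X => ‖g X‖ ^ 2 / X 0) hr0.ne', smul_eq_mul]
        field_simp
    _ ≤ 4 * X₀ 0 / (r ^ 3 * J) * ∫ τ in (0 : ℝ)..r, circleInt X₀ τ fun X => ‖g X‖ ^ 2 / X 0 := by
        rw [mul_one]
        gcongr
        refine intervalIntegral.integral_mono_interval (by positivity) (by linarith) le_rfl ?_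
          (ba.intervalIntegrable le_rfl hr0.le hr.2.le)
        filter_upwards [ae_restrict_mem measurableSet_Ioc] with τ hτ
        exact circleInt_nonneg hτ.1.le (hτ.2.trans_lt hr.2)
          fun X hX => div_nonneg (sq_nonneg _) (h.fst_pos hX).le
    _ = 4 * X₀ 0 / J * gradRatio g X₀ r := by
        rw [← ba.integral_ball hr0.le hr.2.le, gradRatio]
        field_simp
    _ ≤ 4 * X₀ 0 / J * (M * J) := by gcongr
    _ = _ := by field_simp

/-- As a quadratic polynomial in q the left side is minimal at q = L/J, and its minimum is the
Cauchy–Schwarz defect. This links the integrable quantity of the frequency formula with the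
deviation from homogeneity of any given degree. -/
theorem circleInt_defect_eq (h : LocalSolution X₀ R C f ψ g) (hm : Measurable ψ) {τ : ℝ}
    (hτ : τ ∈ Ioo 0 R) (hJ : massRatio ψ X₀ τ ≠ 0) (q : ℝ) :
    circleInt X₀ τ (fun X => (τ * normalDeriv X₀ g X - (3 / 2 + q) * ψ X) ^ 2 / X 0) =
      τ ^ 4 * massRatio ψ X₀ τ * (FrequencySystem.defect (massRatio ψ X₀) (excess ψ g X₀)
        (weissDefect ψ g X₀) τ + (excess ψ g X₀ τ / massRatio ψ X₀ τ - q) ^ 2) := by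
  have hτ0 := hτ.1.ne'
  have hS : bdryMass ψ X₀ τ ≠ 0 := fun h0 => hJ (by rw [massRatio, h0, zero_div])
  rw [h.circleInt_sq_eq hm hτ, FrequencySystem.defect, h.weissDefect_eq hm hτ, excess, massRatio]
  field_simp
  ring

/-- The deviation of the blow-ups from homogeneity. -/
theorem integral_polarDefect_le (h : LocalSolution X₀ R C f ψ g) (hm : Measurable ψ)
    (hF : FrequencySystem R' C' (massRatio ψ X₀) (excess ψ g X₀) j (weissDefect ψ g X₀) p
      (gradRatio g X₀) v κ) (hR : R' ≤ R) {r q δ a : ℝ} (hr : r ∈ Ioo 0 R') (ha : a ∈ Ioc (0 : ℝ) (1 / 2))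
    (hδ : ∀ τ ∈ Ioc 0 r, (excess ψ g X₀ τ / massRatio ψ X₀ τ - q) ^ 2 ≤ δ) :
    ∫ s in a..1, ∫ θ in (0 : ℝ)..(2 * Real.pi), (s * polarRadial ψ g X₀ r s θ -
        (3 / 2 + q) * polarValue ψ X₀ r s θ) ^ 2 ≤ 2 * X₀ 0 * Real.exp 1 *
      ((∫ t in (0 : ℝ)..r, 2 / t * (FrequencySystem.defect (massRatio ψ X₀) (excess ψ g X₀)
        (weissDefect ψ g X₀) t + ((v t + κ t) / massRatio ψ X₀ t) ^ 2)) / 2 + δ) := by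
  have hrR : r ∈ Ioo 0 R := ⟨hr.1, hr.2.trans_le hR⟩
  have hr0 := hr.1
  have ha0 := ha.1
  have ha1 : a ≤ 1 := by linarith [ha.2]
  have hx := h.center_pos
  have hpi : (0 : ℝ) ≤ 2 * Real.pi := by positivity
  set J := massRatio ψ X₀ with hJd
  set D := FrequencySystem.defect J (excess ψ g X₀) (weissDefect ψ g X₀) with hD
  set F : ℝ → ℝ := fun t => 2 / t * (D t + ((v t + κ t) / J t) ^ 2) with hFd
  have hJr := hF.J_pos hr
  have hS : 0 < bdryMass ψ X₀ r := (div_pos_iff_of_pos_right (pow_pos hr0 4)).1 hJr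
  have hσ : Real.sqrt (r⁻¹ * bdryMass ψ X₀ r) ^ 2 = r ^ 3 * J r := by
    rw [massRatio_eq ψ X₀ hr0, Real.sq_sqrt (by positivity)]
  have hPF := h.polarField hm hrR hS (3 / 2 + q) le_rfl
  have bd := hPF.bddDefect.mono ha0.le
  have hδ0 : 0 ≤ δ := (sq_nonneg _).trans (hδ r ⟨hr0, le_rfl⟩)
  have hFi : IntervalIntegrable F volume 0 r := by
    rw [intervalIntegrable_iff_integrableOn_Ioc_of_le hr0.le]
    exact hF.integrableOn_defect hr
  -- The defect is recovered from the integrable quantity by dropping the nonnegative square of e.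
  have hF0 : ∀ t ∈ Ioc 0 r, D t ≤ t / 2 * F t := fun t ht => by
    have e : t / 2 * F t = D t + ((v t + κ t) / J t) ^ 2 := by
      have := ht.1.ne'
      simp only [hFd]; field_simp
    rw [e]; linarith [sq_nonneg ((v t + κ t) / J t)]
  have hFn : ∀ t ∈ Ioc 0 r, 0 ≤ F t := fun t ht =>
    mul_nonneg (div_nonneg zero_le_two ht.1.le)
      (add_nonneg (hF.defect_nonneg ⟨ht.1, ht.2.trans_lt hr.2⟩) (sq_nonneg _))
  have hFia : IntervalIntegrable F volume (r * a) (r * 1) := by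
    refine hFi.mono_set ?_
    rw [uIcc_of_le (by nlinarith), uIcc_of_le hr0.le, mul_one]
    exact Icc_subset_Icc_left (by positivity)
  have ic := hFia.comp_mul_left (c := r)
  rw [mul_div_cancel_left₀ _ hr0.ne', mul_div_cancel_left₀ _ hr0.ne'] at ic
  calc _ ≤ ∫ s in a..1, 2 * X₀ 0 * Real.exp 1 * (r / 2 * F (r * s) + δ) := by
        refine intervalIntegral.integral_mono_on ha1
          (bd.sq.intervalIntegrable_integral_right le_rfl ha1 le_rfl hpi)
          (((ic.const_mul _).add intervalIntegrable_const).const_mul _) fun s hs => ?_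
        have hs0 : 0 < s := ha0.trans_le hs.1
        have hsr : r * s ≤ r := mul_le_of_le_one_right hr0.le hs.2
        have hτ : r * s ∈ Ioo 0 R' := ⟨by positivity, hsr.trans_lt hr.2⟩
        have hτR : r * s ∈ Ioo 0 R := ⟨hτ.1, hτ.2.trans_le hR⟩
        have hJτ := hF.J_pos hτ
        have hdn := hF.defect_nonneg hτ
        have bk : MeasBdd X₀ R fun X =>
            (r * s * normalDeriv X₀ g X - (3 / 2 + q) * ψ X) ^ 2 :=
          ((h.measBdd_normalDeriv.const_mul _).sub ((h.measBdd_psi hm).const_mul _)).pow 2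
        have e1 : ∀ θ, (s * polarRadial ψ g X₀ r s θ - (3 / 2 + q) * polarValue ψ X₀ r s θ) ^ 2 =
            (r ^ 3 * J r)⁻¹ * (r * s * normalDeriv X₀ g (X₀ + (r * s) • dir θ) -
              (3 / 2 + q) * ψ (X₀ + (r * s) • dir θ)) ^ 2 := fun θ => by
          rw [← hσ, normalDeriv, normal_polar hτ.1, polarRadial, polarValue]
          ring
        simp only [e1]
        rw [intervalIntegral.integral_const_mul]
        calc _ ≤ (r ^ 3 * J r)⁻¹ * (2 * X₀ 0 / (r * s) * ((r * s) ^ 4 * J (r * s) *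
              (D (r * s) + (excess ψ g X₀ (r * s) / J (r * s) - q) ^ 2))) := by
              rw [← h.circleInt_defect_eq hm hτR hJτ.ne']
              gcongr
              exact h.integral_sq_le_circleInt bk (fun X => sq_nonneg _) hτR
          _ = s ^ 3 * (2 * X₀ 0 * (J (r * s) / J r) *
                (D (r * s) + (excess ψ g X₀ (r * s) / J (r * s) - q) ^ 2)) := by
              field_simp
          _ ≤ 1 * (2 * X₀ 0 * Real.exp 1 * (r / 2 * F (r * s) + δ)) := by
              -- Normalization is at radius r but the circle has radius rs; almost monotonicity of J
              -- bounds the mismatch.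
              have h1 : J (r * s) / J r ≤ Real.exp 1 :=
                (div_le_iff₀ hJr).2 (hF.J_le_mul hτ hr hsr)
              have h2 : D (r * s) ≤ r / 2 * F (r * s) :=
                (hF0 _ ⟨hτ.1, hsr⟩).trans (by
                  have := hFn _ ⟨hτ.1, hsr⟩
                  gcongr)
              have h3 := hδ _ ⟨hτ.1, hsr⟩
              have h4 : s ^ 3 ≤ 1 := pow_le_one₀ hs0.le hs.2
              have : 0 ≤ r / 2 * F (r * s) := hdn.trans h2
              gcongr
          _ = _ := one_mul _
    _ = 2 * X₀ 0 * Real.exp 1 * ((∫ t in (r * a)..(r * 1), F t) / 2 + (1 - a) * δ) := by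
        rw [intervalIntegral.integral_const_mul, intervalIntegral.integral_add (ic.const_mul _)
          intervalIntegrable_const, intervalIntegral.integral_const_mul,
          intervalIntegral.integral_comp_mul_left _ hr0.ne', intervalIntegral.integral_const,
          smul_eq_mul, smul_eq_mul]
        field_simp
    _ ≤ _ := by
        gcongr
        · rw [mul_one]
          refine intervalIntegral.integral_mono_interval (by positivity) (by nlinarith) le_rfl ?_ hFi
          filter_upwards [ae_restrict_mem measurableSet_Ioc] with t ht using hFn t ht
        · nlinarith

/-- One contribution is the tail of a convergent integral, the other the distance of L/J from its
limit over all radii below r; both vanish as r → 0. -/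
theorem tendsto_polarDefect (h : LocalSolution X₀ R C f ψ g) (hm : Measurable ψ)
    (hF : FrequencySystem R' C' (massRatio ψ X₀) (excess ψ g X₀) j (weissDefect ψ g X₀) p
      (gradRatio g X₀) v κ) (hR : R' ≤ R) {q a : ℝ} (ha : a ∈ Ioc (0 : ℝ) (1 / 2))
    (hq : Tendsto (fun r => excess ψ g X₀ r / massRatio ψ X₀ r) (𝓝[>] 0) (𝓝 q)) :
    Tendsto (fun r => ∫ s in a..1, ∫ θ in (0 : ℝ)..(2 * Real.pi), (s * polarRadial ψ g X₀ r s θ -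
      (3 / 2 + q) * polarValue ψ X₀ r s θ) ^ 2) (𝓝[>] 0) (𝓝 0) := by
  have hx := h.center_pos
  have hpi : (0 : ℝ) ≤ 2 * Real.pi := by positivity
  set A := 2 * X₀ 0 * Real.exp 1 with hA
  have hA0 : 0 < A := by positivity
  have ha1 : a ≤ 1 := by linarith [ha.2]
  refine tendsto_order.2 ⟨fun y hy => Eventually.of_forall fun r => hy.trans_le ?_, fun ε hε => ?_⟩
  · exact intervalIntegral.integral_nonneg ha1 fun s _ =>
      intervalIntegral.integral_nonneg hpi fun θ _ => sq_nonneg _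
  have h1 : ∀ᶠ r in 𝓝[>] (0 : ℝ), (excess ψ g X₀ r / massRatio ψ X₀ r - q) ^ 2 ≤ ε / (4 * A) := by
    have := (hq.sub_const q).pow 2
    rw [sub_self, zero_pow two_ne_zero] at this
    exact this.eventually_le_const (by positivity)
  obtain ⟨η, hη, hsub⟩ := mem_nhdsGT_iff_exists_Ioo_subset.1 h1
  filter_upwards [Ioo_mem_nhdsGT hη, Ioo_mem_nhdsGT hF.R_pos,
    hF.tendsto_integral_defect.eventually_lt_const (show 0 < ε / A by positivity)] with r hr1 hr2 hr3
  refine (h.integral_polarDefect_le hm hF hR hr2 ha (δ := ε / (4 * A))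
    fun τ hτ => hsub ⟨hτ.1, hτ.2.trans_lt hr1.2⟩).trans_lt ?_
  rw [← hA]
  calc _ < A * (ε / A / 2 + ε / (4 * A)) := by gcongr
    _ ≤ ε := by field_simp; norm_num

/-- The boundary values of the blow-ups are normalized. -/
theorem integral_polarValue_sq_mem (h : LocalSolution X₀ R C f ψ g) (hm : Measurable ψ) {r : ℝ}
    (hr : r ∈ Ioo 0 R) (hS : 0 < bdryMass ψ X₀ r) :
    ∫ θ in (0 : ℝ)..(2 * Real.pi), polarValue ψ X₀ r 1 θ ^ 2 ∈ Icc (X₀ 0 - r) (X₀ 0 + r) := by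
  have hr0 := hr.1
  have hpi : (0 : ℝ) ≤ 2 * Real.pi := by positivity
  have h1 : (1 : ℝ) ∈ Icc (0 : ℝ) 1 := ⟨zero_le_one, le_rfl⟩
  have hσ : Real.sqrt (r⁻¹ * bdryMass ψ X₀ r) ^ 2 = r⁻¹ * bdryMass ψ X₀ r :=
    Real.sq_sqrt (by positivity)
  have bU := (h.polarField hm hr hS 0 le_rfl).bddU
  have i1 := bU.sq.intervalIntegrable_right h1 0 (2 * Real.pi)
  have i2 := ((h.measBdd_mass hm).intervalIntegrable_circle hr0.le hr.2).mul_const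
    (bdryMass ψ X₀ r)⁻¹
  have hn : ∫ θ in (0 : ℝ)..(2 * Real.pi),
      ψ (X₀ + r • dir θ) ^ 2 / (X₀ + r • dir θ) 0 * r * (bdryMass ψ X₀ r)⁻¹ = 1 := by
    rw [intervalIntegral.integral_mul_const]
    exact mul_inv_cancel₀ hS.ne'
  -- The squared boundary value is x times an angular density of total mass one, and x differs from
  -- x₀ by at most r on the circle.
  have e : ∀ θ, polarValue ψ X₀ r 1 θ ^ 2 = (X₀ + r • dir θ) 0 *
      (ψ (X₀ + r • dir θ) ^ 2 / (X₀ + r • dir θ) 0 * r * (bdryMass ψ X₀ r)⁻¹) := fun θ => by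
    have := (h.fst_pos ((mem_ball_polar (X₀ := X₀) (θ := θ) hr0.le).2 hr.2)).ne'
    rw [polarValue, div_pow, hσ, mul_one]
    field_simp
  have hnn : ∀ θ, 0 ≤ ψ (X₀ + r • dir θ) ^ 2 / (X₀ + r • dir θ) 0 * r * (bdryMass ψ X₀ r)⁻¹ :=
    fun θ => by
      have := h.fst_pos ((mem_ball_polar (X₀ := X₀) (θ := θ) hr0.le).2 hr.2)
      positivity
  have hc : ∀ θ, |(X₀ + r • dir θ) 0 - X₀ 0| ≤ r := fun θ => by
    refine (abs_sub_coord_le _ _ 0).trans ?_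
    rw [add_sub_cancel_left, norm_smul, norm_dir, mul_one, Real.norm_of_nonneg hr0.le]
  have he : ∀ c, ∫ θ in (0 : ℝ)..(2 * Real.pi), c * (ψ (X₀ + r • dir θ) ^ 2 / (X₀ + r • dir θ) 0 * r *
      (bdryMass ψ X₀ r)⁻¹) = c := fun c => by rw [intervalIntegral.integral_const_mul, hn, mul_one]
  constructor
  · refine (he _).ge.trans (intervalIntegral.integral_mono_on hpi (i2.const_mul _) i1 fun θ _ => ?_)
    rw [e]
    exact mul_le_mul_of_nonneg_right (by linarith [(abs_le.1 (hc θ)).1]) (hnn θ)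
  · refine (intervalIntegral.integral_mono_on hpi i1 (i2.const_mul _) fun θ _ => ?_).trans (he _).le
    rw [e]
    exact mul_le_mul_of_nonneg_right (by linarith [(abs_le.1 (hc θ)).2]) (hnn θ)

end LocalSolution

/-! ### The limit of the blow-ups -/

theorem MeasBdd.indicator {X₀ : Plane} {R : ℝ} {k : Plane → ℝ} (hk : MeasBdd X₀ R k) {A : Set Plane}
    (hA : MeasurableSet A) : MeasBdd X₀ R (A.indicator k) := by
  obtain ⟨m, B, hB⟩ := hk
  refine ⟨m.indicator hA, B, fun X hX => ?_⟩
  have h1 := hB X hX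
  by_cases hXA : X ∈ A
  · rwa [indicator_of_mem hXA]
  · rw [indicator_of_notMem hXA, abs_zero]; exact (abs_nonneg _).trans h1

theorem MeasBdd.memLp {X₀ : Plane} {R : ℝ} {k : Plane → ℝ} (hk : MeasBdd X₀ R k) :
    MemLp k 2 (volume.restrict (Metric.ball X₀ R)) := by
  obtain ⟨m, B, hB⟩ := hk
  have : IsFiniteMeasure (volume.restrict (Metric.ball X₀ R)) :=
    ⟨by rw [Measure.restrict_apply_univ]; exact measure_ball_lt_top⟩
  refine MemLp.of_bound m.aestronglyMeasurable B ?_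
  filter_upwards [ae_restrict_mem Metric.isOpen_ball.measurableSet] with X hX using hB X hX

theorem polarBdd_of_periodic {k : ℝ → ℝ} (hc : Continuous k)
    (hk : Function.Periodic k (2 * Real.pi)) (a : ℝ) : PolarBdd a fun _ θ => k θ := by
  obtain ⟨B, hB⟩ := (isCompact_Icc (a := 0) (b := 2 * Real.pi)).exists_bound_of_continuousOn
    hc.continuousOn
  refine ⟨hc.measurable.comp measurable_snd, B, fun _ _ θ => ?_⟩
  obtain ⟨y, hy, e⟩ := hk.exists_mem_Ico₀ Real.two_pi_pos θ
  change |k θ| ≤ B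
  rw [e]
  exact hB y (Ico_subset_Icc_self hy)

/-- Two functions that agree outside all small balls around the origin agree. -/
theorem ae_eq_of_annuli {u v : Plane → ℝ} {μ : Measure Plane} [NullSingletonClass μ]
    (h : ∀ a ∈ Ioc (0 : ℝ) (1 / 2), u =ᵐ[μ.restrict {X | a ≤ ‖X‖}] v) : u =ᵐ[μ] v := by
  have hA : ∀ a : ℝ, MeasurableSet {X : Plane | a ≤ ‖X‖} := fun a =>
    measurableSet_le measurable_const measurable_norm
  have h1 : ∀ᵐ X ∂μ, ∀ n : ℕ, 1 / ((n : ℝ) + 2) ≤ ‖X‖ → u X = v X := ae_all_iff.2 fun n =>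
    (ae_restrict_iff' (hA _)).1 (h _ ⟨by positivity, by
      gcongr; linarith [Nat.cast_nonneg (α := ℝ) n]⟩)
  have h2 : ∀ᵐ X ∂μ, X ≠ 0 := compl_mem_ae_iff.2 (measure_singleton 0)
  filter_upwards [h1, h2] with X hX h0
  obtain ⟨n, hn⟩ := exists_nat_one_div_lt (norm_pos_iff.2 h0)
  refine hX n (le_trans ?_ hn.le)
  gcongr; norm_num

namespace LocalSolution

variable {X₀ : Plane} {R C R' C' : ℝ} {f : ℝ → ℝ} {ψ : Plane → ℝ} {g : Plane → Plane}
  {j p v κ : ℝ → ℝ}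

theorem measBdd_blowUp (h : LocalSolution X₀ R C f ψ g) (hm : Measurable ψ) {r : ℝ}
    (hr : r ∈ Ioo 0 R) : MeasBdd 0 1 (blowUp ψ X₀ r) := by
  obtain ⟨-, B, hB⟩ := h.measBdd_psi hm
  refine ⟨(hm.comp (Continuous.measurable (by fun_prop))).div_const _,
    B / |Real.sqrt (r⁻¹ * bdryMass ψ X₀ r)|, fun X hX => ?_⟩
  rw [blowUp, abs_div]
  gcongr
  refine hB _ ?_
  rw [Metric.mem_ball, dist_eq_norm] at hX ⊢
  rw [add_sub_cancel_left, norm_smul, Real.norm_of_nonneg hr.1.le]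
  rw [sub_zero] at hX
  exact (mul_le_of_le_one_right hr.1.le hX.le).trans_lt hr.2

/-- The `L²` distance to a homogeneous function in an annulus. -/
theorem integral_annulus_le (h : LocalSolution X₀ R C f ψ g) (hm : Measurable ψ) {H r a ε : ℝ}
    (hH : 0 < H) (hr : r ∈ Ioo 0 R) {k : ℝ → ℝ} (hc : Continuous k)
    (hk : Function.Periodic k (2 * Real.pi)) (ha : 0 < a) (hε : 0 ≤ ε)
    (hd : ∀ t ∈ Icc a 1, ∫ θ in (0 : ℝ)..(2 * Real.pi),
      (t ^ (-H) * polarValue ψ X₀ r t θ - k θ) ^ 2 ≤ ε) :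
    ∫ X in {X | a ≤ ‖X‖}, (blowUp ψ X₀ r X - homogExt H hk X) ^ 2
      ∂(volume.restrict (Metric.ball 0 1)) ≤ ε := by
  have hA : MeasurableSet {X : Plane | a ≤ ‖X‖} := measurableSet_le measurable_const measurable_norm
  have hφ : MeasBdd 0 1 (homogExt H hk) := by
    have hφc := continuous_homogExt hk hc hH
    obtain ⟨B, hB⟩ := (isCompact_closedBall (0 : Plane) 1).exists_bound_of_continuousOn hφc.continuousOn
    exact ⟨hφc.measurable, B, fun X hX => hB X (Metric.ball_subset_closedBall hX)⟩
  have hb := (((h.measBdd_blowUp hm hr).sub hφ).pow 2).indicator hA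
  rw [← integral_indicator hA, hb.integral_ball zero_le_one le_rfl]
  calc _ ≤ ∫ t in (0 : ℝ)..1, ε := by
        refine intervalIntegral.integral_mono_on zero_le_one
          (hb.intervalIntegrable le_rfl zero_le_one le_rfl) intervalIntegrable_const fun t ht => ?_
        rw [circleInt_eq]
        rcases lt_or_ge t a with hta | hta
        · rw [intervalIntegral.integral_congr (g := fun _ => 0), intervalIntegral.integral_zero]
          · exact hε
          · intro θ _
            simp only
            rw [indicator_of_notMem, zero_mul]
            simp [norm_smul, abs_of_nonneg ht.1, hta]
        · have ht0 : 0 < t := ha.trans_le hta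
          -- Factoring out t^H reduces the squared distance to the angular one; the remaining factor
          -- t^{2H}·t is at most 1.
          have e : ∀ θ, ({X : Plane | a ≤ ‖X‖}.indicator (fun X =>
              (blowUp ψ X₀ r X - homogExt H hk X) ^ 2) (0 + t • dir θ)) * t =
              (t ^ H) ^ 2 * t * (t ^ (-H) * polarValue ψ X₀ r t θ - k θ) ^ 2 := fun θ => by
            rw [indicator_of_mem (by simp [norm_smul, abs_of_nonneg ht.1, hta]), zero_add,
              blowUp_polar, homogExt_polar hk ht0, Real.rpow_neg ht.1]
            have := (Real.rpow_pos_of_pos ht0 H).ne'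
            field_simp
          simp only [e]
          rw [intervalIntegral.integral_const_mul]
          have h1 : (t ^ H) ^ 2 * t ≤ 1 :=
            mul_le_one₀ (pow_le_one₀ (Real.rpow_nonneg ht.1 _) (Real.rpow_le_one ht.1 ht.2 hH.le))
              ht.1 ht.2
          exact (mul_le_of_le_one_left (intervalIntegral.integral_nonneg (by positivity)
            fun _ _ => sq_nonneg _) h1).trans (hd t ⟨hta, ht.2⟩)
    _ = ε := by simp

/-- Weak limits of the blow-ups are homogeneous. -/
theorem exists_homogeneous_limit (h : LocalSolution X₀ R C f ψ g) (hm : Measurable ψ)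
    (hF : FrequencySystem R' C' (massRatio ψ X₀) (excess ψ g X₀) j (weissDefect ψ g X₀) p
      (gradRatio g X₀) v κ) (hR : R' ≤ R) {q M : ℝ} (hq0 : 0 ≤ q)
    (hq : Tendsto (fun r => excess ψ g X₀ r / massRatio ψ X₀ r) (𝓝[>] 0) (𝓝 q)) {ρ : ℕ → ℝ}
    (hρ : ∀ m, ρ m ∈ Ioo 0 R') (h0 : Tendsto ρ atTop (𝓝 0))
    (hM : ∀ m, gradRatio g X₀ (ρ m) ≤ M * massRatio ψ X₀ (ρ m)) {u₀ : Plane → ℝ}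
    (hu₀ : MemLp u₀ 2 (volume.restrict (Metric.ball (0 : Plane) 1)))
    (hw : ∀ l : Plane → ℝ, MemLp l 2 (volume.restrict (Metric.ball (0 : Plane) 1)) →
      Tendsto (fun m => ∫ X in Metric.ball (0 : Plane) 1, blowUp ψ X₀ (ρ m) X * l X) atTop
        (𝓝 (∫ X in Metric.ball (0 : Plane) 1, u₀ X * l X))) :
    ∃ φ₀ : Plane → ℝ, φ₀ =ᵐ[volume.restrict (Metric.ball (0 : Plane) 1)] u₀ ∧ Continuous φ₀ ∧
      (∀ X, ∀ t > 0, φ₀ (t • X) = t ^ (3 / 2 + q) * φ₀ X) ∧ (∀ X, 0 ≤ φ₀ X) ∧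
      (∀ X, X 1 ≤ 0 → φ₀ X = 0) ∧ circleInt 0 1 (fun X => φ₀ X ^ 2 / X₀ 0) = 1 := by
  have hH : 0 < 3 / 2 + q := by positivity
  have hpi : (0 : ℝ) ≤ 2 * Real.pi := by positivity
  have h1m : (1 : ℝ) ∈ Icc (1 / 2 : ℝ) 1 := ⟨by norm_num, le_rfl⟩
  have h1m' : (1 : ℝ) ∈ Icc (0 : ℝ) 1 := ⟨by norm_num, le_rfl⟩
  have hρR : ∀ m, ρ m ∈ Ioo 0 R := fun m => ⟨(hρ m).1, (hρ m).2.trans_le hR⟩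
  have hS : ∀ m, 0 < bdryMass ψ X₀ (ρ m) := fun m =>
    (div_pos_iff_of_pos_right (pow_pos (hρ m).1 4)).1 (hF.J_pos (hρ m))
  have hP := fun m => h.polarField hm (hρR m) (hS m) (3 / 2 + q)
    (h.integral_polarAngular_le (hρR m) (hF.J_pos (hρ m)) (hM m))
  have hρt : Tendsto ρ atTop (𝓝[>] 0) :=
    tendsto_nhdsWithin_iff.2 ⟨h0, Eventually.of_forall fun m => (hρ m).1⟩
  -- The limit k is taken along an ultrafilter finer than `atTop`, which is enough: the weak limit
  -- along the whole sequence is given, and it is only being identified.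
  obtain ⟨𝒰, k, hne, h𝒰, hkc, hkp, hk0, hkz, hlim⟩ := exists_profile_limit hH.le hP
    fun a ha => (h.tendsto_polarDefect hm hF hR ha hq).comp hρt
  have bk := polarBdd_of_periodic hkc hkp 0
  -- The convergence to k includes the circle t = 1 itself, so the normalization of the boundary
  -- values passes to the limit without a trace theorem.
  have hnorm : ∫ θ in (0 : ℝ)..(2 * Real.pi), k θ ^ 2 = X₀ 0 := by
    have hd : ∀ m, IntervalIntegrable (fun θ => (polarValue ψ X₀ (ρ m) 1 θ - k θ) ^ 2) volume 0
        (2 * Real.pi) := fun m => ((hP m).bddU.sub bk).sq.intervalIntegrable_right h1m' _ _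
    refine integral_sq_eq_of_tendsto hpi (𝒰 := 𝒰)
      (fun m => (hP m).bddU.sq.intervalIntegrable_right h1m' _ _)
      (bk.sq.intervalIntegrable_right h1m' _ _) hd ?_ ?_
    · refine tendsto_order.2 ⟨fun y hy => Eventually.of_forall fun m =>
        hy.trans_le (intervalIntegral.integral_nonneg hpi fun _ _ => sq_nonneg _), fun ε hε => ?_⟩
      filter_upwards [hlim (1 / 2) ⟨by norm_num, le_rfl⟩ (ε / 2) (by positivity)] with m hm'
      have h1 := hm' 1 h1m
      simp only [Real.one_rpow, one_mul] at h1
      linarith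
    · have h1 := (h0.mono_left h𝒰).const_sub (X₀ 0)
      have h2 := (h0.mono_left h𝒰).const_add (X₀ 0)
      rw [sub_zero] at h1
      rw [add_zero] at h2
      exact tendsto_of_tendsto_of_tendsto_of_le_of_le h1 h2
        (fun m => (h.integral_polarValue_sq_mem hm (hρR m) (hS m)).1)
        (fun m => (h.integral_polarValue_sq_mem hm (hρR m) (hS m)).2)
  have hφc := continuous_homogExt hkp hkc hH
  have hφL : MemLp (homogExt (3 / 2 + q) hkp) 2 (volume.restrict (Metric.ball (0 : Plane) 1)) := by
    obtain ⟨B, hB⟩ := (isCompact_closedBall (0 : Plane) 1).exists_bound_of_continuousOn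
      hφc.continuousOn
    exact MeasBdd.memLp ⟨hφc.measurable, B, fun X hX => hB X (Metric.ball_subset_closedBall hX)⟩
  refine ⟨homogExt (3 / 2 + q) hkp, (ae_eq_of_annuli fun a ha => ?_).symm, hφc,
    fun X t ht => homogExt_smul hkp hH.ne' ht X, homogExt_nonneg hkp hk0 hH.ne',
    fun X hX => homogExt_eq_zero hkp hkz hH.ne' hX, ?_⟩
  · have hA : MeasurableSet {X : Plane | a ≤ ‖X‖} :=
      measurableSet_le measurable_const measurable_norm
    -- On each annulus the blow-ups converge strongly to the homogeneous extension, so it coincides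
    -- there with the weak limit.
    refine ae_eq_of_weak_of_strong (𝒰 := 𝒰) (u := fun m => blowUp ψ X₀ (ρ m))
      (fun m => (h.measBdd_blowUp hm (hρR m)).memLp.restrict _) (hu₀.restrict _) (hφL.restrict _)
      (fun l hl => ?_) ?_
    · have h1 := (hw _ ((memLp_indicator_iff_restrict hA).2 hl)).mono_left h𝒰
      have e : ∀ w : Plane → ℝ, ∫ X in Metric.ball (0 : Plane) 1,
          w X * {X : Plane | a ≤ ‖X‖}.indicator l X = ∫ X in {X : Plane | a ≤ ‖X‖}, w X * l X
            ∂(volume.restrict (Metric.ball 0 1)) := fun w => by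
        rw [← integral_indicator hA]
        congr 1; ext X; rw [indicator_mul_right]
      simpa only [e] using h1
    · refine tendsto_order.2 ⟨fun y hy => Eventually.of_forall fun m =>
        hy.trans_le (integral_nonneg fun _ => sq_nonneg _), fun ε hε => ?_⟩
      filter_upwards [hlim a ha (ε / 2) (by positivity)] with m hm'
      exact (h.integral_annulus_le hm hH (hρR m) hkc hkp ha.1 (by positivity) hm').trans_lt
        (by linarith)
  · have hx := h.center_pos.ne'
    rw [circleInt_eq]
    have e : ∀ θ, homogExt (3 / 2 + q) hkp (0 + (1 : ℝ) • dir θ) ^ 2 / X₀ 0 * 1 =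
        (X₀ 0)⁻¹ * k θ ^ 2 := fun θ => by
      rw [zero_add, homogExt_polar hkp one_pos, Real.one_rpow, one_mul]
      field_simp
    simp only [e]
    rw [intervalIntegral.integral_const_mul, hnorm, inv_mul_cancel₀ hx]

end LocalSolution

end StagnationFlow

/-! ### The theorem on the frequency limit and the blow-ups -/

theorem mainTheorem7
    (Ω : Set Plane) (f : ℝ → ℝ) (ψ : Plane → ℝ) (G : Plane → Plane)
    (hΩ : IsFlowDomain Ω) (hf : Continuous f) (hf_growth : VorticityGrowth f)
    (hψ : IsVariationalSolution Ω f ψ G) (hψ_growth : GrowthAssumption Ω ψ G)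
    (X₀ : Plane) (hX₀ : X₀ ∈ degeneratePoints Ω f ψ G) :
    -- the quantities below are well defined
    (∀ᶠ r in 𝓝[>] (0 : ℝ), 0 < bdryMass ψ X₀ r) ∧
    (∀ r ∈ Ioo 0 (delta Ω X₀),
      IntervalIntegrable (fun t => t ^ (-4 : ℤ) * termI₁ G X₀ t) volume 0 r ∧
      IntervalIntegrable (fun t => t ^ (-4 : ℤ) * termI₂ ψ X₀ t) volume 0 r ∧
      IntervalIntegrable (fun t => t ^ (-5 : ℤ) * termJ₁ ψ X₀ t) volume 0 r) ∧
    -- `H₀` is the limit `H(0+)`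
    ∃ H₀ : ℝ, Tendsto (freqH f ψ G X₀) (𝓝[>] 0) (𝓝 H₀) ∧
      -- (1)
      Tendsto (freqV ψ G X₀) (𝓝[>] 0) (𝓝 0) ∧
      Tendsto (freqD f ψ G X₀) (𝓝[>] 0) (𝓝 H₀) ∧
      -- (2)
      (∀ ρ : ℕ → ℝ, (∀ m, ρ m ∈ Ioo 0 (delta Ω X₀)) → Tendsto ρ atTop (𝓝 0) →
        ∃ C : ℝ, ∀ m,
          MemW12 (blowUp ψ X₀ (ρ m)) (blowUpGrad ψ G X₀ (ρ m)) (Metric.ball 0 1) ∧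
          w12NormSq (blowUp ψ X₀ (ρ m)) (blowUpGrad ψ G X₀ (ρ m)) (Metric.ball 0 1) ≤ C) ∧
      -- (3)
      (∀ ρ : ℕ → ℝ, (∀ m, ρ m ∈ Ioo 0 (delta Ω X₀)) → Tendsto ρ atTop (𝓝 0) →
        ∀ (u₀ : Plane → ℝ) (g₀ : Plane → Plane), MemW12 u₀ g₀ (Metric.ball 0 1) →
          WeakConvW12 (fun m => blowUp ψ X₀ (ρ m)) (fun m => blowUpGrad ψ G X₀ (ρ m))
            u₀ g₀ (Metric.ball 0 1) →
          -- `φ₀` is the representative of the limit that is continuous up to the boundary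
          ∃ φ₀ : Plane → ℝ,
            (∀ᵐ X ∂(volume.restrict (Metric.ball (0 : Plane) 1)), φ₀ X = u₀ X) ∧
            ContinuousOn φ₀ (Metric.closedBall 0 1) ∧
            (∀ X ∈ Metric.closedBall (0 : Plane) 1, ∀ t ∈ Ioc (0 : ℝ) 1,
              φ₀ (t • X) = t ^ H₀ * φ₀ X) ∧
            (∀ X ∈ Metric.ball (0 : Plane) 1, 0 ≤ φ₀ X) ∧
            (∀ X ∈ Metric.ball (0 : Plane) 1, X 1 ≤ 0 → φ₀ X = 0) ∧
            circleInt 0 1 (fun X => φ₀ X ^ 2 / X₀ 0) = 1) := by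
  have hx : 0 < X₀ 0 := hX₀.1.2.2.2
  have hXΩ : X₀ ∈ Ω := hX₀.1.1
  obtain ⟨R, C, R', C', hRδ, hR'R, h, hm, hG, hF⟩ :=
    hψ.exists_local hΩ hf hf_growth hψ_growth hX₀
  obtain ⟨q, hq0, hq⟩ := hF.exists_tendsto_qfun
  obtain ⟨hS, hV, hD, hH⟩ := tendsto_freq h hm hG hR'R hF hq
  have hL := hq.add (hF.tendsto_v_div.add hF.tendsto_κ_div)
  rw [add_zero, add_zero] at hL
  have hIoo : Ioo 0 R' ∈ 𝓝[>] (0 : ℝ) := Ioo_mem_nhdsGT hF.R_pos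
  obtain ⟨M, hM⟩ := hF.exists_α_le
  refine ⟨hS, fun r hr => hψ.intervalIntegrable_terms hΩ hXΩ hx h hm hG hr,
    3 / 2 + q, hH, hV, hD, fun ρ hρ h0 => ?_, fun ρ hρ h0 u₀ g₀ hu₀ hw => ?_⟩
  -- The estimate holds for small radii only; the finitely many remaining terms of the sequence
  -- enlarge the constant.
  · obtain ⟨B, hB⟩ := exists_bound_of_eventually (M := 2 * X₀ 0 * (1 + 3 * M))
      (B := fun r => w12NormSq (blowUp ψ X₀ r) (blowUpGrad ψ G X₀ r) (Metric.ball 0 1))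
      (by
        filter_upwards [hIoo, hM] with r hr hMr
        exact h.w12NormSq_blowUp_le hm hG ⟨hr.1, hr.2.trans_le hR'R⟩ (hF.J_pos hr) hMr)
      (fun m => (hρ m).1) h0
    exact ⟨B, fun m => ⟨hψ.memW12_blowUp hΩ hXΩ hx (hρ m), hB m⟩⟩
  · have hρt : Tendsto ρ atTop (𝓝[>] 0) :=
      tendsto_nhdsWithin_iff.2 ⟨h0, Eventually.of_forall fun m => (hρ m).1⟩
    -- Only a tail of the sequence lies in the range of the frequency system; discarding finitely
    -- many terms does not change the weak limit.
    obtain ⟨N, hN⟩ := eventually_atTop.1 (hρt.eventually (hM.and hIoo))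
    have hN' : ∀ m, ρ (m + N) ∈ Ioo 0 R' := fun m => (hN _ (Nat.le_add_left N m)).2
    obtain ⟨φ₀, h1, h2, h3, h4, h5, h6⟩ := h.exists_homogeneous_limit hm hF hR'R hq0
      (hL.congr' (by filter_upwards [hIoo] with r hr; rw [hF.L_div hr, add_div]))
      (ρ := fun m => ρ (m + N)) hN' ((tendsto_add_atTop_iff_nat N).2 h0)
      (fun m => (hN _ (Nat.le_add_left N m)).1) hu₀.1 fun l hl => by
        refine ((tendsto_add_atTop_iff_nat N).2 (hw l hl).1).congr fun m => ?_
        refine setIntegral_congr_fun Metric.isOpen_ball.measurableSet fun X hX => ?_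
        have hr : ρ (m + N) ∈ Ioo 0 R := ⟨(hN' m).1, (hN' m).2.trans_le hR'R⟩
        have hXR : X₀ + ρ (m + N) • X ∈ Metric.ball X₀ R := by
          rw [Metric.mem_ball, dist_eq_norm] at hX ⊢
          rw [add_sub_cancel_left, norm_smul, Real.norm_of_nonneg hr.1.le]
          rw [sub_zero] at hX
          exact (mul_le_of_le_one_right hr.1.le hX.le).trans_lt hr.2
        simp only [blowUp, bdryMass_indicator hr, indicator_of_mem hXR]
    exact ⟨φ₀, h1, h2.continuousOn, fun X _ t ht => h3 X t ht.1, fun X _ => h4 X,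
      fun X _ => h5 X, h6⟩
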